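/- Write $\log$ for logarithms to base 2. Let $G$ be a finite group. For $H\le G$ let $H\backslash G$ be the set of right cosets $Hg$; for $H\le H'\le G$ let $\pi_{H,H'}:H\backslash G\to H'\backslash G$, $Hg\mapsto H'g$; for $g\in G$ let $c_{H,g}:H\backslash G\to gHg^{-1}\backslash G$, $Hh\mapsto (gHg^{-1})gh$. Let $\mathcal P$ be a set of subgroups of $G$ closed under conjugation. A $\mathcal P$-scheme is a family $\mathcal C=\{C_H:H\in\mathcal P\}$, where $C_H$ is a partition of $H\backslash G$, such that for all $H,H'\in\mathcal P$ and $g\in G$: (compatibility) if $H\le H'$, then $\pi_{H,H'}$ maps any two elements of the same block of $C_H$ into the same block of $C_{H'}$; (invariance) $c_{H,g}$ maps each block of $C_H$ bijectively onto a block of $C_{gHg^{-1}}$; (regularity) if $H\le H'$, $B\in C_H$ and $B'\in C_{H'}$, then $\#\{x\in B:\pi_{H,H'}(x)=y\}$ is the same for all $y\in B'$. $\mathcal C$ is discrete on $H$ if all blocks of $C_H$ are singletons. $\mathcal C$ is strongly antisymmetric if no nontrivial permutation of a block of any $C_H$ is a composition of bijections between blocks, each of the form $c_{H,g}|_B$,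 $\pi_{H,H'}|_B$ or $(\pi_{H,H'}|_B)^{-1}$ with $H,H'\in\mathcal P$ and $B$ a block of $C_H$. For a permutation group $G$ on a finite set $S$ and $m\in\mathbb N^+$, let $\mathcal P_m$ be the set of the pointwise stabilizers $G_{x_1,\dots,x_k}$ with $1\le k\le m$ and $x_1,\dots,x_k\in S$, and let $d(G)$ be the least $m\in\mathbb N^+$ such that every strongly antisymmetric $\mathcal P_m$-scheme is discrete on $G_x$ for all $x\in S$. A permutation group $G$ on a subset $S$ of a vector space $V$ acts linearly on $S$ if $G$ can be identified with a subgroup of $\mathrm{GL}(V)$ whose natural action on $V$ induces the action of $G$ on $S$. For $m\in\mathbb N^+$ and a prime power $q$, let $d_{\mathrm{Lin}}(m,q)$ be the maximum of $d(G)$ over all $G\le\mathrm{GL}_{m'}(q')$ acting linearly on a set $S\subseteq\mathbb F_{q'}^{m'}$, where $m'\in\mathbb N^+$ and the prime power $q'$ satisfy $m'\le m$, $q'^{m'}\le q^m$ and $\gcd(q,q')\ne 1$. **Theorem.** $d_{\mathrm{Lin}}(m,q)=O\left(\frac{m\log q}{(\log\log\log(m\log q))^{1/3}}\right)$. That is,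 there is an absolute constant $c>0$ such that for all $m\in\mathbb N^+$ and all prime powers $q$ with $m\log q>4$ (equivalently, $\log\log\log(m\log q)$ is defined and positive), $$d_{\mathrm{Lin}}(m,q)\le c\cdot\frac{m\log q}{(\log\log\log(m\log q))^{1/3}}.$$ -/

import Mathlib

namespace PScheme

section General

variable {G : Type*} [Group G]

/-- The space `H \ G` of right cosets `Hg` of a subgroup `H` of `G`. -/
abbrev RightCosets (H : Subgroup G) : Type _ := Quotient (QuotientGroup.rightRel H)

/-- The right coset `Hg`. -/
abbrev coset (H : Subgroup G) (g : G) : RightCosets H := Quotient.mk (QuotientGroup.rightRel H) g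

/-- The conjugate subgroup `g H g⁻¹`. -/
def conj (g : G) (H : Subgroup G) : Subgroup G := H.map (MulAut.conj g).toMonoidHom

/-- The projection `π_{H,H'} : H \ G → H' \ G`, `Hg ↦ H'g`, for `H ≤ H'`. -/
def projMap {H H' : Subgroup G} (h : H ≤ H') : RightCosets H → RightCosets H' :=
  Quotient.map id fun a b hab => by
    rw [← Quotient.eq_iff_equiv, Quotient.eq, QuotientGroup.rightRel_apply] at hab ⊢
    exact h hab

/-- The conjugation `c_{H,g} : H \ G → gHg⁻¹ \ G`, `Hh ↦ (gHg⁻¹)gh`.  The target is a subgroup `H'`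
equal to `gHg⁻¹`, so that no transport along equalities of subgroups is ever needed. -/
def conjMap {H H' : Subgroup G} (g : G) (h : H' = conj g H) : RightCosets H → RightCosets H' :=
  Quotient.map (fun a => g * a) fun a b hab => by
    rw [← Quotient.eq_iff_equiv, Quotient.eq, QuotientGroup.rightRel_apply] at hab ⊢
    subst h
    exact ⟨b * a⁻¹, hab, by simp [mul_assoc]⟩

end General

/-- A subgroup system over `G`: a set of subgroups that is closed under conjugation. -/
structure SubgroupSystem (G : Type*) [Group G] where
  carrier : Set (Subgroup G)
  conj_mem : ∀ H ∈ carrier, ∀ g : G, conj g H ∈ carrier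

section Scheme

variable {G : Type*} [Group G]

/-- A `𝒫`-collection: a partition `C_H` of `H \ G` for every `H ∈ 𝒫`.  A partition is encoded by its
equivalence relation; its blocks are the equivalence classes, `(C H).classes`. -/
abbrev Collection (P : SubgroupSystem G) : Type _ := (H : P.carrier) → Setoid (RightCosets H.1)

/-- A `𝒫`-scheme over a finite group `G`: a `𝒫`-collection with compatibility, invariance and
regularity. -/
structure IsScheme [Finite G] {P : SubgroupSystem G} (C : Collection P) : Prop where
  compatibility : ∀ (H H' : P.carrier) (h : H.1 ≤ H'.1) (x x' : RightCosets H.1),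
    (C H) x x' → (C H') (projMap h x) (projMap h x')
  invariance : ∀ (H H' : P.carrier) (g : G) (h : H'.1 = conj g H.1), ∀ B ∈ (C H).classes,
    ∃ B' ∈ (C H').classes, Set.BijOn (conjMap g h) B B'
  regularity : ∀ (H H' : P.carrier) (h : H.1 ≤ H'.1), ∀ B ∈ (C H).classes, ∀ B' ∈ (C H').classes,
    ∀ y ∈ B', ∀ y' ∈ B',
      {x | x ∈ B ∧ projMap h x = y}.ncard = {x | x ∈ B ∧ projMap h x = y'}.ncard

/-- `C` is discrete on `H` if `C_H` is the finest partition of `H \ G`. -/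
def Discrete {P : SubgroupSystem G} (C : Collection P) (H : P.carrier) : Prop := C H = ⊥

/-- The bijections between blocks of `C` that are compositions of bijections between blocks of one
of the three forms: a restriction of a conjugation, a restriction of a projection, the inverse of a
restriction of a projection. -/
inductive BlockMap {P : SubgroupSystem G} (C : Collection P) :
    (H : P.carrier) → (B : Set (RightCosets H.1)) →
    (H' : P.carrier) → (B' : Set (RightCosets H'.1)) → (B ≃ B') → Prop
  | conj (H H' : P.carrier) (g : G) (h : H'.1 = conj g H.1)
      (B : Set (RightCosets H.1)) (hB : B ∈ (C H).classes)
      (B' : Set (RightCosets H'.1)) (hB' : B' ∈ (C H').classes)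
      (f : B ≃ B') (hf : ∀ x : B, (f x : RightCosets H'.1) = conjMap g h x) :
      BlockMap C H B H' B' f
  | proj (H H' : P.carrier) (h : H.1 ≤ H'.1)
      (B : Set (RightCosets H.1)) (hB : B ∈ (C H).classes)
      (B' : Set (RightCosets H'.1)) (hB' : B' ∈ (C H').classes)
      (f : B ≃ B') (hf : ∀ x : B, (f x : RightCosets H'.1) = projMap h x) :
      BlockMap C H B H' B' f
  | projInv (H H' : P.carrier) (h : H'.1 ≤ H.1)
      (B : Set (RightCosets H.1)) (hB : B ∈ (C H).classes)
      (B' : Set (RightCosets H'.1)) (hB' : B' ∈ (C H').classes)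
      (f : B ≃ B') (hf : ∀ y : B', (f.symm y : RightCosets H.1) = projMap h y) :
      BlockMap C H B H' B' f
  | comp (H H' H'' : P.carrier) (B : Set (RightCosets H.1)) (B' : Set (RightCosets H'.1))
      (B'' : Set (RightCosets H''.1)) (f : B ≃ B') (f' : B' ≃ B'')
      (hf : BlockMap C H B H' B' f) (hf' : BlockMap C H' B' H'' B'' f') :
      BlockMap C H B H'' B'' (f.trans f')

/-- Strong antisymmetry: no nontrivial permutation of a block is such a composition. -/
def StronglyAntisymmetric {P : SubgroupSystem G} (C : Collection P) : Prop :=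
  ∀ (H : P.carrier), ∀ B ∈ (C H).classes, ∀ f : B ≃ B, BlockMap C H B H B f → f = Equiv.refl B

end Scheme

section Depth

variable {S : Type*}

/-- The pointwise stabilizer `G_{x_1,…,x_k}`. -/
def tupleStabilizer (G : Subgroup (Equiv.Perm S)) {k : ℕ} (x : Fin k → S) : Subgroup G :=
  fixingSubgroup G (Set.range x)

theorem mem_tupleStabilizer (G : Subgroup (Equiv.Perm S)) {k : ℕ} (x : Fin k → S) (g : G) :
    g ∈ tupleStabilizer G x ↔ ∀ i, g • x i = x i := by
  simp [tupleStabilizer, mem_fixingSubgroup_iff]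

theorem conj_tupleStabilizer (G : Subgroup (Equiv.Perm S)) {k : ℕ} (x : Fin k → S) (g : G) :
    conj g (tupleStabilizer G x) = tupleStabilizer G (fun i => g • x i) := by
  ext a
  rw [mem_tupleStabilizer, conj, Subgroup.mem_map]
  constructor
  · rintro ⟨b, hb, rfl⟩ i
    rw [mem_tupleStabilizer] at hb
    simp [mul_smul, hb i]
  · intro h
    refine ⟨g⁻¹ * a * g, ?_, by simp [mul_assoc]⟩
    rw [mem_tupleStabilizer]
    intro i
    rw [mul_smul, mul_smul, h i, inv_smul_smul]

/-- The system of stabilizers of depth `m` of a permutation group `G` on `S`: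
`𝒫_m = {G_{x_1,…,x_k} : 1 ≤ k ≤ m, x_1,…,x_k ∈ S}`. -/
def stabilizerSystem (G : Subgroup (Equiv.Perm S)) (m : ℕ) : SubgroupSystem G where
  carrier := {H | ∃ k : ℕ, 1 ≤ k ∧ k ≤ m ∧ ∃ x : Fin k → S, H = tupleStabilizer G x}
  conj_mem := by
    rintro _ ⟨k, h1, hm, x, rfl⟩ g
    exact ⟨k, h1, hm, fun i => g • x i, conj_tupleStabilizer G x g⟩

/-- The point stabilizer `G_x` is a member of `𝒫_m` for `m ≥ 1`. -/
theorem stabilizer_mem (G : Subgroup (Equiv.Perm S)) {m : ℕ} (hm : 1 ≤ m) (x : S) :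
    MulAction.stabilizer G x ∈ (stabilizerSystem G m).carrier :=
  ⟨1, le_rfl, hm, fun _ => x, by ext g; simp [mem_tupleStabilizer]⟩

/-- The positive integers `m` such that every strongly antisymmetric `𝒫_m`-scheme is discrete on
`G_x` for all `x ∈ S`. -/
def depthSet [Finite S] (G : Subgroup (Equiv.Perm S)) : Set ℕ :=
  {m | ∃ hm : 1 ≤ m, ∀ C : Collection (stabilizerSystem G m),
    IsScheme C → StronglyAntisymmetric C →
      ∀ x : S, Discrete C ⟨MulAction.stabilizer G x, stabilizer_mem G hm x⟩}

/-- `d(G)`: the least element of `depthSet G`, which is nonempty by `d_isLeast` below. -/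
noncomputable def d [Finite S] (G : Subgroup (Equiv.Perm S)) : ℕ := sInf (depthSet G)

theorem card_mem_depthSet [Finite S] (G : Subgroup (Equiv.Perm S)) :
    max 1 (Nat.card S) ∈ depthSet G := by
  refine ⟨le_max_left _ _, fun C hC hA x => ?_⟩
  have hpos : 1 ≤ Nat.card S := Nat.card_pos_iff.2 ⟨⟨x⟩, inferInstance⟩
  have hbot : (⊥ : Subgroup G) ∈ (stabilizerSystem G (max 1 (Nat.card S))).carrier := by
    refine ⟨Nat.card S, hpos, le_max_right _ _, (Finite.equivFin S).symm, ?_⟩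
    ext g
    rw [mem_tupleStabilizer, Subgroup.mem_bot]
    constructor
    · rintro rfl i
      simp
    · intro h
      ext s
      simpa [Subgroup.smul_def] using h (Finite.equivFin S s)
  set H₀ : (stabilizerSystem G (max 1 (Nat.card S))).carrier := ⟨⊥, hbot⟩ with hH₀
  have hinj : ∀ a b : G, coset (⊥ : Subgroup G) a = coset ⊥ b → a = b := by
    intro a b hab
    rw [coset, coset, Quotient.eq, QuotientGroup.rightRel_apply, Subgroup.mem_bot,
      mul_inv_eq_one] at hab
    exact hab.symm
  have hdisc : ∀ a b : G, (C H₀) (coset ⊥ a) (coset ⊥ b) → a = b := by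
    intro a b hab
    have hc : H₀.1 = conj (b * a⁻¹) H₀.1 := by simp [hH₀, conj]
    have hB : {z | (C H₀) z (coset ⊥ a)} ∈ (C H₀).classes := ⟨_, rfl⟩
    obtain ⟨B', hB', hbij⟩ := hC.invariance H₀ H₀ (b * a⁻¹) hc _ hB
    have himg : conjMap (b * a⁻¹) hc (coset ⊥ a) = coset ⊥ b := by
      show coset ⊥ (b * a⁻¹ * a) = coset ⊥ b
      rw [inv_mul_cancel_right]
    have hbB' : coset ⊥ b ∈ B' := himg ▸ hbij.mapsTo ((C H₀).refl _)
    have hEq : B' = {z | (C H₀) z (coset ⊥ a)} :=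
      Setoid.eq_of_mem_classes hB' hbB' hB ((C H₀).symm hab)
    subst hEq
    have := hA H₀ _ hB hbij.equiv
      (BlockMap.conj H₀ H₀ (b * a⁻¹) hc _ hB _ hB _ (fun _ => rfl))
    have h2 := congrArg Subtype.val (DFunLike.congr_fun this ⟨coset ⊥ a, (C H₀).refl _⟩)
    have h3 : conjMap (b * a⁻¹) hc (coset ⊥ a) = coset ⊥ a := h2
    exact hinj _ _ (h3.symm.trans himg)
  set H₁ : (stabilizerSystem G (max 1 (Nat.card S))).carrier :=
    ⟨MulAction.stabilizer G x, stabilizer_mem G (le_max_left _ _) x⟩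
  show C H₁ = ⊥
  refine eq_bot_iff.2 fun u v huv => ?_
  show u = v
  induction u using Quotient.inductionOn with | _ a
  have hle : H₀.1 ≤ H₁.1 := bot_le
  have hreg := hC.regularity H₀ H₁ hle {z | (C H₀) z (coset ⊥ a)} ⟨_, rfl⟩
    {z | (C H₁) z (coset _ a)} ⟨_, rfl⟩ (coset _ a) ((C H₁).refl _) v ((C H₁).symm huv)
  have hpa : projMap hle (coset ⊥ a) = coset H₁.1 a := rfl
  have hne : {z | z ∈ {z | (C H₀) z (coset ⊥ a)} ∧ projMap hle z = coset H₁.1 a}.ncard ≠ 0 := by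
    exact Set.ncard_ne_zero_of_mem (a := coset ⊥ a) ⟨(C H₀).refl _, hpa⟩
  rw [hreg] at hne
  obtain ⟨z, hz, hzv⟩ := Set.nonempty_of_ncard_ne_zero hne
  induction z using Quotient.inductionOn with | _ b
  have : b = a := hdisc _ _ hz
  subst this
  exact hzv

theorem d_isLeast [Finite S] (G : Subgroup (Equiv.Perm S)) : IsLeast (depthSet G) (d G) :=
  ⟨Nat.sInf_mem ⟨_, card_mem_depthSet G⟩, fun _ h => Nat.sInf_le h⟩

end Depth

section Linear

/-- A permutation group `G` on a subset `S` of a vector space `V` over `F` acts linearly on `S` if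
`G` can be identified with a subgroup of `GL(V)` whose natural action on `V` induces the action of
`G` on `S`. -/
def ActsLinearly (F : Type*) {V : Type*} [Field F] [AddCommGroup V] [Module F V] (S : Set V)
    (G : Subgroup (Equiv.Perm S)) : Prop :=
  ∃ φ : G →* (V ≃ₗ[F] V), Function.Injective φ ∧
    ∀ (g : G) (x : S), φ g (x : V) = ((g : Equiv.Perm S) x : V)

/-- The values `d(G)`, where `G` acts linearly on a subset `S` of `F^m'`, `F` is a finite field of
order `q'`, and `1 ≤ m' ≤ m`, `q'^m' ≤ q^m`, `gcd(q, q') ≠ 1`. -/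
def dLinSet (m q : ℕ) : Set ℕ :=
  {n | ∃ (m' : ℕ) (F : Type) (_ : Field F) (_ : Finite F),
    1 ≤ m' ∧ m' ≤ m ∧ Nat.card F ^ m' ≤ q ^ m ∧ Nat.gcd q (Nat.card F) ≠ 1 ∧
    ∃ (S : Set (Fin m' → F)) (G : Subgroup (Equiv.Perm S)), ActsLinearly F S G ∧ n = d G}

/-- `d_Lin(m, q)`: the maximum of `dLinSet m q`, which is attained by `dLin_isGreatest` below. -/
noncomputable def dLin (m q : ℕ) : ℕ := sSup (dLinSet m q)

theorem dLinSet_bddAbove (m q : ℕ) : BddAbove (dLinSet m q) := by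
  refine ⟨max 1 (q ^ m), ?_⟩
  rintro _ ⟨m', F, _, _, -, -, hc, -, S, G, -, rfl⟩
  refine ((d_isLeast G).2 (card_mem_depthSet G)).trans (max_le_max le_rfl ?_)
  refine (Finite.card_subtype_le _).trans ?_
  simpa [Nat.card_fun] using hc

theorem dLin_isGreatest {m q : ℕ} (hm : 1 ≤ m) (hq : IsPrimePow q) :
    IsGreatest (dLinSet m q) (dLin m q) := by
  refine ⟨Nat.sSup_mem ?_ (dLinSet_bddAbove m q), fun _ h => le_csSup (dLinSet_bddAbove m q) h⟩
  have hq0 : 0 < q := hq.pos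
  have : Fact q.minFac.Prime := ⟨Nat.minFac_prime hq.ne_one⟩
  refine ⟨_, 1, ZMod q.minFac, inferInstance, inferInstance, le_rfl, hm, ?_, ?_, ∅, ⊥, ?_, rfl⟩
  · rw [Nat.card_zmod, pow_one]
    exact (Nat.minFac_le hq0).trans (Nat.le_self_pow (by omega) q)
  · rw [Nat.card_zmod, Nat.gcd_eq_right (Nat.minFac_dvd q)]
    exact (Nat.minFac_prime hq.ne_one).ne_one
  · exact ⟨1, Function.injective_of_subsingleton _, fun _ x => x.2.elim⟩

end Linear

end PScheme

/-! Put N = m log q and let V be the ambient space, so |V| ≤ 2^N. Elements of S spanning the same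
subspace as S have trivial pointwise stabilizer, and strong antisymmetry then gives d(G) ≤ 2 dim V +
2. This settles fields with more than 2^Λ elements. For smaller fields the characteristic p is at
most 2^Λ, and `false_of_rel` shows that a strongly antisymmetric scheme of depth 16M has no two
distinct points in one block if |V| ≤ 2^(ΛM) and M is at least a triple exponential in Λ. Taking M =
⌈N/Λ⌉ bounds d(G) by O(N/Λ).

A scheme is read as a system of types of tuples (`TupleScheme`). Regularity says that the number of
extensions of a tuple of given type depends only on its type. Linearity says that related tuples are
conjugate under an additive automorphism of V. Antisymmetry says that related tuples definable from
each other are equal. Below, n is the number of points, and `cls` and `dcl` play the roles of orbit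
and definable closure over constants.

Homogeneity. Minimizing a weighted class size gives a local scheme in which every nontrivial class
over a small set A has at least n/K^(|A|+1) elements (`exists_homogeneous`). There the exchange
property holds and definable closures have bounded size, so there is a good notion of independence.

Small doubling. There are more short sums of vectors than elements of V. The pigeonhole principle
gives a short dependence, then large families of interdefinable elements, then a nonzero difference
of two points that lies in the group generated by a set of constants over which the first point is
not definable (`exists_definable_difference`). Its conjugates are popular differences, so some class
has small doubling (`exists_small_doubling`), and by Ruzsa's theorem its differences generate a
group U with |U| ≤ Mn for a new, moderate M.

Contradiction. Let h(k) be the mean of log(n/|class of v over x|) over points v and k-tuples x.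
Antisymmetry makes h grow at least linearly (`le_height`), homogeneity at most linearly. Where
h(R+2) - h(R) is bounded, most classes of points over R-tuples have small doubling, hence occupy a
definite share of a coset of the group they generate. Counting the characters of U that are trivial
on these groups shows that for most x and v there are at least n/|class of v over x| elements
definable over x and v, up to a constant (`mul_ncard_lt_le`). Changing one coordinate of an
(R+2)-tuple by a difference of elements definable over the other coordinates gives an interdefinable
tuple. Antisymmetry bounds the number of interdefinable tuples by n^(R+2) over the number of
conjugates, and an entropy inequality turns this into (R+2)(h(R) - loss) ≤ h(0) + ... + h(R+1)
(`mul_height_le`). So h(R) is at most an average of mostly earlier values plus a loss that depends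
only logarithmically on the range of R, which contradicts linear growth at a suitably chosen R
(`exists_index_of_growth`). -/

namespace PScheme

/-! ### From schemes of stabilizers to types of tuples. -/

/-- A system of equivalence relations on the tuples of elements of `S`, regular for tuples of length
at most `m`, whose related tuples are related by automorphisms of the additive group `V`. -/
structure TupleScheme {S V : Type} [AddCommGroup V] (vec : S → V) (m : ℕ) where
  inj : Function.Injective vec
  rel : ∀ {ι : Type}, (ι → S) → (ι → S) → Prop
  refl : ∀ {ι : Type} (x : ι → S), rel x x
  symm : ∀ {ι : Type} {x y : ι → S}, rel x y → rel y x
  trans : ∀ {ι : Type} {x y z : ι → S}, rel x y → rel y z → rel x z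
  pull : ∀ {ι κ : Type} (f : κ → ι) {x y : ι → S}, rel x y → rel (x ∘ f) (y ∘ f)
  ext : ∀ {ι κ : Type} [Finite ι] [Finite κ] {x y : ι → S} (a : κ → S),
    Nat.card ι + Nat.card κ ≤ m → rel x y →
    Nat.card {b // rel (Sum.elim x a) (Sum.elim y b)} =
      Nat.card {b // rel (Sum.elim x a) (Sum.elim x b)}
  lin : ∀ {ι : Type} {x y : ι → S}, rel x y → ∃ φ : V ≃+ V, ∀ i, φ (vec (x i)) = vec (y i)
  antisymm : ∀ {ι : Type} [Finite ι] {x y : ι → S}, 2 * Nat.card ι ≤ m → rel x y →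
    (∀ y', rel (Sum.elim x y) (Sum.elim x y') → y' = y) → y = x

section OfScheme

variable {S : Type} {G : Subgroup (Equiv.Perm S)} {m : ℕ}

/-- Depth is measured by the number of distinct entries, so that tuples may be reindexed and
repeated freely, over any index type. -/
theorem fixingSubgroup_mem_stabilizerSystem [Finite S] {ι : Type} [Nonempty ι] (w : ι → S)
    (hw : (Set.range w).ncard ≤ m) :
    fixingSubgroup G (Set.range w) ∈ (stabilizerSystem G m).carrier := by
  refine ⟨(Set.range w).ncard, ?_, hw,
    fun i => ((Finite.equivFinOfCardEq (Nat.card_coe_set_eq _)).symm i : Set.range w), ?_⟩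
  · exact (Set.ncard_pos (Set.toFinite _)).2 (Set.range_nonempty w)
  · unfold tupleStabilizer
    congr 1
    ext s
    constructor
    · intro hs
      exact ⟨Finite.equivFinOfCardEq (Nat.card_coe_set_eq _) ⟨s, hs⟩, by simp⟩
    · rintro ⟨i, rfl⟩
      exact Subtype.coe_prop _

/-- The stabilizer of a tuple as a member of the stabilizer system. -/
def tupleMember [Finite S] (G : Subgroup (Equiv.Perm S)) {ι : Type} [Nonempty ι] (w : ι → S)
    (hw : (Set.range w).ncard ≤ m) : (stabilizerSystem G m).carrier :=
  ⟨fixingSubgroup G (Set.range w), fixingSubgroup_mem_stabilizerSystem w hw⟩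

theorem mem_tupleMember [Finite S] {ι : Type} [Nonempty ι] {w : ι → S}
    {hw : (Set.range w).ncard ≤ m} {g : G} :
    g ∈ (tupleMember G w hw).1 ↔ ∀ i, g • w i = w i := by
  simp [tupleMember, mem_fixingSubgroup_iff]

theorem tupleMember_conj [Finite S] {ι : Type} [Nonempty ι] {w w' : ι → S}
    {hw : (Set.range w).ncard ≤ m} {hw' : (Set.range w').ncard ≤ m} {g : G}
    (h : ∀ i, w' i = g • w i) :
    (tupleMember G w' hw').1 = conj g (tupleMember G w hw).1 := by
  ext a
  rw [mem_tupleMember, conj, Subgroup.mem_map]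
  constructor
  · intro ha
    refine ⟨g⁻¹ * a * g, ?_, by simp [mul_assoc]⟩
    rw [mem_tupleMember]
    intro i
    rw [mul_smul, mul_smul, ← h i, ha i, h i, inv_smul_smul]
  · rintro ⟨b, hb, rfl⟩ i
    rw [mem_tupleMember] at hb
    simp [mul_smul, hb i, h i]

theorem tupleMember_le [Finite S] {ι κ : Type} [Nonempty ι] [Nonempty κ] {w : ι → S} {v : κ → S}
    {hw : (Set.range w).ncard ≤ m} {hv : (Set.range v).ncard ≤ m} (f : κ → ι)
    (h : ∀ i, v i = w (f i)) : (tupleMember G w hw).1 ≤ (tupleMember G v hv).1 := by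
  intro a ha
  rw [mem_tupleMember] at ha ⊢
  intro i
  rw [h i, ha]

theorem coset_eq_iff {H : Subgroup G} {a b : G} : coset H a = coset H b ↔ b * a⁻¹ ∈ H := by
  rw [coset, coset, Quotient.eq, QuotientGroup.rightRel_apply]

/-- Two tuples are related if they are equal, or short and conjugate by an element `g` such that the
cosets of `1` and `g⁻¹` lie in the same block. -/
def tupleRel [Finite S] (C : Collection (stabilizerSystem G m)) {ι : Type} (x y : ι → S) : Prop :=
  x = y ∨ ∃ (_ : Nonempty ι) (hx : (Set.range x).ncard ≤ m) (g : G), (∀ i, y i = g • x i) ∧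
    (C (tupleMember G x hx)) (coset _ 1) (coset _ g⁻¹)

/-- The equality clause of `tupleRel` matters only for empty tuples and for tuples with too many
entries, whose stabilizers need not lie in the system. For the others it is the case g = 1. The
inverse of g appears because a right coset Hh corresponds to the tuple h⁻¹ • x. -/
theorem tupleRel_iff [Finite S] (C : Collection (stabilizerSystem G m)) {ι : Type} [Nonempty ι]
    {x y : ι → S} (hx : (Set.range x).ncard ≤ m) :
    tupleRel C x y ↔ ∃ g : G, (∀ i, y i = g • x i) ∧
      (C (tupleMember G x hx)) (coset _ 1) (coset _ g⁻¹) := by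
  constructor
  · rintro (rfl | ⟨_, _, g, h1, h2⟩)
    · exact ⟨1, by simp, by simp⟩
    · exact ⟨g, h1, h2⟩
  · rintro ⟨g, h1, h2⟩
    exact Or.inr ⟨inferInstance, hx, g, h1, h2⟩

theorem IsScheme.conj_rel [Finite G] {C : Collection (stabilizerSystem G m)} (hC : IsScheme C)
    {H H' : (stabilizerSystem G m).carrier} (g : G) (h : H'.1 = conj g H.1) {a b : G}
    (hab : (C H) (coset _ a) (coset _ b)) : (C H') (coset _ (g * a)) (coset _ (g * b)) := by
  obtain ⟨B', hB', hbij⟩ := hC.invariance H H' g h {z | (C H) z (coset _ b)} ⟨_, rfl⟩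
  have h1 : conjMap g h (coset _ a) ∈ B' := hbij.mapsTo hab
  have h2 : conjMap g h (coset _ b) ∈ B' := hbij.mapsTo ((C H).refl _)
  exact Setoid.rel_iff_exists_classes (C H') |>.2 ⟨B', hB', h1, h2⟩

theorem IsScheme.proj_rel [Finite G] {C : Collection (stabilizerSystem G m)} (hC : IsScheme C)
    {H H' : (stabilizerSystem G m).carrier} (h : H.1 ≤ H'.1) {a b : G}
    (hab : (C H) (coset _ a) (coset _ b)) : (C H') (coset _ a) (coset _ b) :=
  hC.compatibility H H' h _ _ hab

theorem ncard_range_comp_le [Finite S] {ι κ : Type} (f : κ → ι) {x : ι → S}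
    (h : (Set.range x).ncard ≤ m) : (Set.range (x ∘ f)).ncard ≤ m :=
  (Set.ncard_le_ncard (Set.range_comp_subset_range f x) (Set.toFinite _)).trans h

theorem ncard_range_smul [Finite S] {ι : Type} {x y : ι → S} {g : G} (h : ∀ i, y i = g • x i) :
    (Set.range y).ncard = (Set.range x).ncard := by
  have : Set.range y = (fun s => g • s) '' Set.range x := by
    ext s
    simp [h]
  rw [this]
  exact Set.ncard_image_of_injective _ (MulAction.injective g)

theorem ncard_range_le [Finite S] {ι : Type} [Finite ι] (x : ι → S) (h : Nat.card ι ≤ m) :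
    (Set.range x).ncard ≤ m := by
  refine le_trans ?_ h
  rw [← Nat.card_coe_set_eq]
  exact Finite.card_range_le x

/-- The tuple that corresponds to a coset of the stabilizer of `w`. -/
noncomputable def cosetTuple {ι : Type} (w : ι → S) (H : Subgroup G)
    (hH : ∀ g ∈ H, ∀ i, g • w i = w i) : RightCosets H → ι → S :=
  Quotient.lift (fun h i => h⁻¹ • w i) fun a b hab => by
    rw [← Quotient.eq_iff_equiv, Quotient.eq, QuotientGroup.rightRel_apply] at hab
    funext i
    have := hH _ hab i
    rw [mul_smul] at this
    rw [eq_inv_smul_iff, this]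

theorem cosetTuple_injective [Finite S] {ι : Type} [Nonempty ι] (w : ι → S)
    (hw : (Set.range w).ncard ≤ m) :
    Function.Injective (cosetTuple (G := G) w (tupleMember G w hw).1
      fun _ hg => mem_tupleMember.1 hg) := by
  intro u v huv
  induction u using Quotient.inductionOn with | _ a
  induction v using Quotient.inductionOn with | _ b
  refine coset_eq_iff.2 (mem_tupleMember.2 fun i => ?_)
  have := congrFun huv i
  change a⁻¹ • w i = b⁻¹ • w i at this
  rw [mul_smul, this, smul_inv_smul]

/-- The tuples related to x are the image of one block under an injective map from cosets to tuples,
so counting tuples amounts to counting cosets. -/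
theorem tupleRel_iff_coset [Finite S] (C : Collection (stabilizerSystem G m)) {ι : Type}
    [Nonempty ι] {x y : ι → S} (hx : (Set.range x).ncard ≤ m) :
    tupleRel C x y ↔ ∃ z, (C (tupleMember G x hx)) z (coset _ 1) ∧
      cosetTuple x (tupleMember G x hx).1 (fun _ hg => mem_tupleMember.1 hg) z = y := by
  rw [tupleRel_iff C hx]
  constructor
  · rintro ⟨g, h1, h2⟩
    refine ⟨coset _ g⁻¹, (C _).symm h2, ?_⟩
    funext i
    change g⁻¹⁻¹ • x i = y i
    rw [h1, inv_inv]
  · rintro ⟨z, h1, h2⟩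
    induction z using Quotient.inductionOn with | _ b
    refine ⟨b⁻¹, fun i => (congrFun h2 i).symm, (C _).symm ?_⟩
    rw [inv_inv]
    exact h1

section Laws

variable [Finite S] {C : Collection (stabilizerSystem G m)}

theorem tupleRel_symm (hC : IsScheme C) {ι : Type} {x y : ι → S} (h : tupleRel C x y) :
    tupleRel C y x := by
  rcases h with rfl | ⟨_, hx, g, h1, h2⟩
  · exact Or.inl rfl
  · have hy : (Set.range y).ncard ≤ m := (ncard_range_smul h1).trans_le hx
    refine (tupleRel_iff C hy).2 ⟨g⁻¹, fun i => by rw [h1, inv_smul_smul], ?_⟩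
    have := (C _).symm (hC.conj_rel (H' := tupleMember G y hy) g (tupleMember_conj h1) h2)
    simpa using this

theorem tupleRel_trans (hC : IsScheme C) {ι : Type} {x y z : ι → S} (h : tupleRel C x y)
    (h' : tupleRel C y z) : tupleRel C x z := by
  rcases h with rfl | ⟨_, hx, g, h1, h2⟩
  · exact h'
  · have hy : (Set.range y).ncard ≤ m := (ncard_range_smul h1).trans_le hx
    obtain ⟨k, h3, h4⟩ := (tupleRel_iff C hy).1 h'
    refine (tupleRel_iff C hx).2 ⟨k * g, fun i => by rw [h3, h1, mul_smul], ?_⟩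
    have := hC.conj_rel (H' := tupleMember G x hx) g⁻¹
      (tupleMember_conj fun i => by rw [h1, inv_smul_smul]) h4
    rw [mul_one] at this
    rw [mul_inv_rev]
    exact (C _).trans h2 this

theorem tupleRel_pull (hC : IsScheme C) {ι κ : Type} (f : κ → ι) {x y : ι → S}
    (h : tupleRel C x y) : tupleRel C (x ∘ f) (y ∘ f) := by
  rcases h with rfl | ⟨_, hx, g, h1, h2⟩
  · exact Or.inl rfl
  · rcases isEmpty_or_nonempty κ with hκ | hκ
    · exact Or.inl (Subsingleton.elim _ _)
    · refine (tupleRel_iff C (ncard_range_comp_le f hx)).2 ⟨g, fun i => h1 _, ?_⟩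
      exact hC.proj_rel (tupleMember_le f fun _ => rfl) h2

/-- Regularity of the projection from cosets of the stabilizer of (x, a) to cosets of the stabilizer
of x: the extensions of y correspond to the fibre over the coset of y, and y lies in the block of x.
-/
theorem tupleRel_ext (hC : IsScheme C) {ι κ : Type} [Finite ι] [Finite κ] {x y : ι → S}
    (a : κ → S) (hm : Nat.card ι + Nat.card κ ≤ m) (h : tupleRel C x y) :
    Nat.card {b // tupleRel C (Sum.elim x a) (Sum.elim y b)} =
      Nat.card {b // tupleRel C (Sum.elim x a) (Sum.elim x b)} := by
  rcases isEmpty_or_nonempty ι with hι | hι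
  · rw [Subsingleton.elim x y]
  have hw : (Set.range (Sum.elim x a)).ncard ≤ m :=
    ncard_range_le _ (by rw [Nat.card_sum]; exact hm)
  have hx : (Set.range x).ncard ≤ m := ncard_range_le _ (by omega)
  have hle : (tupleMember G (Sum.elim x a) hw).1 ≤ (tupleMember G x hx).1 :=
    tupleMember_le (v := x) (w := Sum.elim x a) Sum.inl fun _ => rfl
  set T := cosetTuple (Sum.elim x a) (tupleMember G (Sum.elim x a) hw).1
    (fun _ hg => mem_tupleMember.1 hg) with hT
  have key : ∀ g : G, ∀ y' : ι → S, (∀ i, y' i = g • x i) →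
      Nat.card {b // tupleRel C (Sum.elim x a) (Sum.elim y' b)} =
        {z | z ∈ {z | (C (tupleMember G (Sum.elim x a) hw)) z (coset _ 1)} ∧
          projMap hle z = coset _ g⁻¹}.ncard := by
    intro g y' hy'
    change Nat.card ↥{b | tupleRel C (Sum.elim x a) (Sum.elim y' b)} = _
    rw [Nat.card_coe_set_eq]
    have : {b | tupleRel C (Sum.elim x a) (Sum.elim y' b)} = (fun z => T z ∘ Sum.inr) ''
        {z | z ∈ {z | (C (tupleMember G (Sum.elim x a) hw)) z (coset _ 1)} ∧
          projMap hle z = coset _ g⁻¹} := by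
      ext b
      rw [Set.mem_ofPred_eq, tupleRel_iff_coset C hw]
      constructor
      · rintro ⟨z, hz, hz2⟩
        refine ⟨z, ⟨hz, ?_⟩, ?_⟩
        · induction z using Quotient.inductionOn with | _ k
          refine coset_eq_iff.2 (mem_tupleMember.2 fun i => ?_)
          have := congrFun hz2 (Sum.inl i)
          change k⁻¹ • x i = y' i at this
          simp [mul_smul, this, hy']
        · change T z ∘ Sum.inr = b
          rw [hT, hz2]
          rfl
      · rintro ⟨z, ⟨hz, hz2⟩, rfl⟩
        refine ⟨z, hz, ?_⟩
        funext i
        rcases i with i | i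
        · induction z using Quotient.inductionOn with | _ k
          have := mem_tupleMember.1 (coset_eq_iff.1 hz2) i
          change k⁻¹ • x i = y' i
          rw [hy' i]
          simp only [id, mul_smul] at this
          rwa [inv_smul_eq_iff] at this
        · rfl
    rw [this]
    refine Set.InjOn.ncard_image ?_
    rintro z ⟨-, hz⟩ z' ⟨-, hz'⟩ hzz
    refine cosetTuple_injective _ hw ?_
    funext i
    rcases i with i | i
    · induction z using Quotient.inductionOn with | _ k
      induction z' using Quotient.inductionOn with | _ k'
      have h1 := mem_tupleMember.1 (coset_eq_iff.1 (hz.trans hz'.symm)) i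
      change k⁻¹ • x i = k'⁻¹ • x i
      simp only [id, mul_smul] at h1
      rw [← h1, inv_smul_smul, h1]
    · exact congrFun hzz i
  obtain ⟨g, h1, h2⟩ := (tupleRel_iff C hx).1 h
  rw [key g y h1, key 1 x (by simp)]
  exact hC.regularity _ (tupleMember G x hx) hle _ ⟨_, rfl⟩
    {z | (C (tupleMember G x hx)) z (coset _ 1)} ⟨_, rfl⟩ _ ((C _).symm h2) _
    (by simp)

/-- Let B, B1, B2 be the blocks of the trivial coset for (x, y), x and y. Uniqueness of y makes B →
B1 a bijection, conjugation carries B2 onto B1, and hence B → B2 is a bijection too. The resulting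
permutation B1 → B → B2 → B1 is of the forbidden kind unless it is the identity, and it sends the
coset of 1 to that of g⁻¹. -/
theorem tupleRel_antisymm [Finite G] (hC : IsScheme C) (hA : StronglyAntisymmetric C) {ι : Type}
    [Finite ι] {x y : ι → S} (hm : 2 * Nat.card ι ≤ m) (h : tupleRel C x y)
    (huniq : ∀ y', tupleRel C (Sum.elim x y) (Sum.elim x y') → y' = y) : y = x := by
  rcases isEmpty_or_nonempty ι with hι | hι
  · exact Subsingleton.elim _ _
  have hw : (Set.range (Sum.elim x y)).ncard ≤ m :=
    ncard_range_le _ (by rw [Nat.card_sum]; omega)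
  have hx : (Set.range x).ncard ≤ m := ncard_range_le _ (by omega)
  have hy : (Set.range y).ncard ≤ m := ncard_range_le _ (by omega)
  have hle1 : (tupleMember G (Sum.elim x y) hw).1 ≤ (tupleMember G x hx).1 :=
    tupleMember_le (v := x) (w := Sum.elim x y) Sum.inl fun _ => rfl
  have hle2 : (tupleMember G (Sum.elim x y) hw).1 ≤ (tupleMember G y hy).1 :=
    tupleMember_le (v := y) (w := Sum.elim x y) Sum.inr fun _ => rfl
  obtain ⟨g, h1, h2⟩ := (tupleRel_iff C hx).1 h
  have hfin : ∀ H : Subgroup G, Finite (RightCosets H) := fun H => inferInstance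
  let H := tupleMember G (Sum.elim x y) hw
  let H1 := tupleMember G x hx
  let H2 := tupleMember G y hy
  let B : Set (RightCosets H.1) := {z | (C H) z (coset _ 1)}
  let B1 : Set (RightCosets H1.1) := {z | (C H1) z (coset _ 1)}
  let B2 : Set (RightCosets H2.1) := {z | (C H2) z (coset _ 1)}
  have hB : B ∈ (C H).classes := ⟨_, rfl⟩
  have hB1 : B1 ∈ (C H1).classes := ⟨_, rfl⟩
  have hB2 : B2 ∈ (C H2).classes := ⟨_, rfl⟩
  have one_mem : coset H.1 1 ∈ B := (C H).refl _
  have surj : ∀ (H' : (stabilizerSystem G m).carrier) (hle : H.1 ≤ H'.1),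
      Set.SurjOn (projMap hle) B {z | (C H') z (coset _ 1)} := by
    intro H' hle z hz
    have := hC.regularity H H' hle B hB _ ⟨coset _ 1, rfl⟩ _ ((C H').refl _) z hz
    have hne : {x | x ∈ B ∧ projMap hle x = coset _ 1}.ncard ≠ 0 :=
      Set.ncard_ne_zero_of_mem (a := coset _ 1) ⟨one_mem, rfl⟩
    rw [this] at hne
    exact Set.nonempty_of_ncard_ne_zero hne
  have maps : ∀ (H' : (stabilizerSystem G m).carrier) (hle : H.1 ≤ H'.1),
      Set.MapsTo (projMap hle) B {z | (C H') z (coset _ 1)} :=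
    fun H' hle z hz => hC.compatibility H H' hle z (coset _ 1) hz
  have fib : {x | x ∈ B ∧ projMap hle1 x = coset H1.1 1} ⊆ {coset H.1 1} := by
    rintro z ⟨hz, hz1⟩
    induction z using Quotient.inductionOn with | _ k
    have hk := mem_tupleMember.1 (coset_eq_iff.1 hz1)
    have h3 : tupleRel C (Sum.elim x y) (Sum.elim x fun i => k⁻¹ • y i) := by
      refine (tupleRel_iff C hw).2 ⟨k⁻¹, ?_, (C H).symm ?_⟩
      · rintro (i | i)
        · have := hk i
          simp only [id, one_mul] at this
          exact this.symm
        · rfl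
      · rw [inv_inv]
        exact hz
    have h4 := huniq _ h3
    refine coset_eq_iff.2 (mem_tupleMember.2 ?_)
    rintro (i | i)
    · exact hk i
    · have := congrFun h4 i
      simpa using this
  have bij1 : Set.BijOn (projMap hle1) B B1 := by
    refine ⟨maps H1 hle1, ?_, surj H1 hle1⟩
    intro u hu v hv huv
    have hc : {x | x ∈ B ∧ projMap hle1 x = projMap hle1 u}.ncard ≤ 1 := by
      rw [← hC.regularity H H1 hle1 B hB B1 hB1 (coset _ 1) ((C H1).refl _) _ (maps H1 hle1 hu)]
      exact (Set.ncard_le_ncard fib).trans (by simp)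
    exact (Set.ncard_le_one (Set.toFinite _)).1 hc u ⟨hu, rfl⟩ v ⟨hv, huv.symm⟩
  obtain ⟨B3, hB3, bij3⟩ := hC.invariance H2 H1 g⁻¹
    (tupleMember_conj fun i => by rw [h1, inv_smul_smul]) B2 hB2
  have hg : conjMap g⁻¹ (tupleMember_conj fun i => by rw [h1, inv_smul_smul]) (coset H2.1 1) =
      coset H1.1 g⁻¹ := by
    change coset _ (g⁻¹ * 1) = _
    rw [mul_one]
  have hB31 : B3 = B1 := by
    refine Setoid.eq_of_mem_classes hB3 (x := coset H1.1 g⁻¹) ?_ hB1 ((C H1).symm h2)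
    rw [← hg]
    exact bij3.mapsTo ((C H2).refl _)
  rw [hB31] at bij3
  have bij2 : Set.BijOn (projMap hle2) B B2 := by
    refine ⟨maps H2 hle2, ?_, surj H2 hle2⟩
    -- A surjection between finite sets of equal size is injective; conjugation gives |B2| = |B1| =
    -- |B|.
    refine Set.injOn_of_ncard_image_eq ?_ (Set.toFinite _)
    rw [(surj H2 hle2).image_eq_of_mapsTo (maps H2 hle2)]
    change B2.ncard = B.ncard
    rw [← bij3.injOn.ncard_image, bij3.image_eq, ← bij1.image_eq, bij1.injOn.ncard_image]
  have hmap : BlockMap C H1 B1 H1 B1 ((bij1.equiv.symm.trans bij2.equiv).trans bij3.equiv) := by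
    refine BlockMap.comp H1 H2 H1 B1 B2 B1 _ _ (BlockMap.comp H1 H H2 B1 B B2 _ _ ?_ ?_) ?_
    · exact BlockMap.projInv H1 H hle1 B1 hB1 B hB _ fun _ => rfl
    · exact BlockMap.proj H H2 hle2 B hB B2 hB2 _ fun _ => rfl
    · exact BlockMap.conj H2 H1 g⁻¹
        (tupleMember_conj fun i => by rw [h1, inv_smul_smul]) B2 hB2 B1 hB1 _ fun _ => rfl
  have hid := hA H1 B1 hB1 _ hmap
  have h5 : bij1.equiv.symm ⟨coset H1.1 1, (C H1).refl _⟩ = ⟨coset H.1 1, one_mem⟩ := by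
    rw [Equiv.symm_apply_eq]
    rfl
  have h6 := congrArg Subtype.val (DFunLike.congr_fun hid ⟨coset H1.1 1, (C H1).refl _⟩)
  rw [Equiv.trans_apply, Equiv.trans_apply, h5] at h6
  have h7 : coset H1.1 g⁻¹ = coset H1.1 1 := hg.symm.trans h6
  have h8 := mem_tupleMember.1 (coset_eq_iff.1 h7)
  funext i
  have := h8 i
  rw [inv_inv, one_mul] at this
  rw [h1, this]

end Laws

/-- The tuple scheme of a strongly antisymmetric scheme of stabilizers of a group acting linearly. -/
def TupleScheme.ofScheme [Finite S] [Finite G] {V : Type} [AddCommGroup V] {vec : S → V}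
    (hinj : Function.Injective vec)
    (hvec : ∀ g : G, ∃ φ : V ≃+ V, ∀ s, φ (vec s) = vec (g • s))
    {C : Collection (stabilizerSystem G m)} (hC : IsScheme C) (hA : StronglyAntisymmetric C) :
    TupleScheme vec m where
  inj := hinj
  rel := tupleRel C
  refl _ := Or.inl rfl
  symm := tupleRel_symm hC
  trans := tupleRel_trans hC
  pull := tupleRel_pull hC
  ext := tupleRel_ext hC
  lin := by
    rintro ι x y (rfl | ⟨_, -, g, h1, -⟩)
    · exact ⟨AddEquiv.refl V, fun _ => rfl⟩
    · obtain ⟨φ, hφ⟩ := hvec g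
      exact ⟨φ, fun i => by rw [hφ, h1]⟩
  antisymm := tupleRel_antisymm hC hA

theorem exists_tupleRel_of_not_discrete [Finite S] [Finite G]
    {C : Collection (stabilizerSystem G m)} (hC : IsScheme C) (hm : 1 ≤ m) (x : S)
    (h : ¬ Discrete C ⟨MulAction.stabilizer G x, stabilizer_mem G hm x⟩) :
    ∃ s s' : S, s ≠ s' ∧ tupleRel C (fun _ : Unit => s) (fun _ => s') := by
  have : ∃ u v, (C ⟨MulAction.stabilizer G x, stabilizer_mem G hm x⟩) u v ∧ u ≠ v := by
    by_contra! hcon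
    exact h (eq_bot_iff.2 fun u v huv => hcon u v huv)
  obtain ⟨u, v, huv, hne⟩ := this
  induction u using Quotient.inductionOn with | _ a
  induction v using Quotient.inductionOn with | _ b
  have hw : (Set.range fun _ : Unit => a⁻¹ • x).ncard ≤ m := ncard_range_le _ (by simpa using hm)
  have hx : (Set.range fun _ : Unit => x).ncard ≤ m := ncard_range_le _ (by simpa using hm)
  -- Conjugating by a⁻¹ moves the base point from x to a⁻¹ • x, so that one of the two equivalent
  -- cosets becomes the coset of 1, as `tupleRel` requires.
  have hconj : (tupleMember G (fun _ : Unit => a⁻¹ • x) hw).1 =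
      conj a⁻¹ (MulAction.stabilizer G x) := by
    rw [tupleMember_conj (w := fun _ : Unit => x) (hw := hx) (fun _ => rfl)]
    congr 1
    ext g
    rw [mem_tupleMember, MulAction.mem_stabilizer_iff]
    simp
  have h1 := hC.conj_rel (H' := tupleMember G (fun _ : Unit => a⁻¹ • x) hw)
    (H := ⟨MulAction.stabilizer G x, stabilizer_mem G hm x⟩) a⁻¹ hconj huv
  rw [inv_mul_cancel] at h1
  refine ⟨a⁻¹ • x, b⁻¹ • x, ?_, (tupleRel_iff C hw).2 ⟨b⁻¹ * a, ?_, ?_⟩⟩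
  · intro hab
    refine hne (coset_eq_iff.2 ?_)
    rw [MulAction.mem_stabilizer_iff, mul_smul, hab, smul_inv_smul]
  · intro _
    rw [mul_smul, smul_inv_smul]
  · rw [mul_inv_rev, inv_inv]
    exact h1

end OfScheme

end PScheme

/-! ### Classes, definable closure and counting over constants. -/

namespace PScheme

namespace TupleScheme

variable {S V : Type} [AddCommGroup V] {vec : S → V} {m : ℕ} (T : TupleScheme vec m)

theorem rel_of {ι κ : Type} (f : κ → ι) {x y : ι → S} {x' y' : κ → S} (h : T.rel x y)
    (hx : ∀ i, x' i = x (f i)) (hy : ∀ i, y' i = y (f i)) : T.rel x' y' := by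
  have h1 : x' = x ∘ f := funext hx
  have h2 : y' = y ∘ f := funext hy
  rw [h1, h2]
  exact T.pull f h

theorem rel_inl {ι κ : Type} {x y : ι → S} {a b : κ → S}
    (h : T.rel (Sum.elim x a) (Sum.elim y b)) : T.rel x y :=
  T.rel_of Sum.inl h (fun _ => rfl) fun _ => rfl

theorem rel_inr {ι κ : Type} {x y : ι → S} {a b : κ → S}
    (h : T.rel (Sum.elim x a) (Sum.elim y b)) : T.rel a b :=
  T.rel_of Sum.inr h (fun _ => rfl) fun _ => rfl

theorem rel_swap {ι κ : Type} {x y : ι → S} {a b : κ → S}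
    (h : T.rel (Sum.elim x a) (Sum.elim y b)) : T.rel (Sum.elim a x) (Sum.elim b y) :=
  T.rel_of Sum.swap h (by rintro (i | i) <;> rfl) (by rintro (i | i) <;> rfl)

theorem eq_of_rel {ι : Type} {x y : ι → S} (h : T.rel x y) {i j : ι} (hij : x i = x j) :
    y i = y j := by
  obtain ⟨φ, hφ⟩ := T.lin h
  exact T.inj (by rw [← hφ, ← hφ, hij])

/-- Related tuples have matching one-step extensions. -/
theorem exists_matching [Finite S] {ι κ : Type} [Finite ι] [Finite κ] {x y : ι → S}
    (hm : Nat.card ι + Nat.card κ ≤ m) (h : T.rel x y) :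
    ∃ σ : Equiv.Perm (κ → S), ∀ a, T.rel (Sum.elim x a) (Sum.elim y (σ a)) := by
  classical
  let s : Setoid (ι ⊕ κ → S) := ⟨T.rel, ⟨T.refl, T.symm, T.trans⟩⟩
  let f : (κ → S) → Quotient s := fun a => Quotient.mk s (Sum.elim x a)
  let g : (κ → S) → Quotient s := fun a => Quotient.mk s (Sum.elim y a)
  have key : ∀ {x y : ι → S}, T.rel x y → ∀ a : κ → S,
      Nat.card {b // Quotient.mk s (Sum.elim x b) = Quotient.mk s (Sum.elim x a)} =
      Nat.card {b // Quotient.mk s (Sum.elim y b) = Quotient.mk s (Sum.elim x a)} := by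
    intro x y h a
    have h1 : ∀ (z : ι → S) b, Quotient.mk s (Sum.elim z b) = Quotient.mk s (Sum.elim x a) ↔
        T.rel (Sum.elim x a) (Sum.elim z b) := by
      intro z b
      rw [eq_comm, Quotient.eq]
      rfl
    simp_rw [h1]
    exact (T.ext a hm h).symm
  have fib : ∀ q, Nat.card {a // f a = q} = Nat.card {b // g b = q} := by
    intro q
    by_cases h1 : ∃ a, f a = q
    · obtain ⟨a, rfl⟩ := h1
      exact key h a
    · by_cases h2 : ∃ a, g a = q
      · obtain ⟨a, rfl⟩ := h2
        exact (key (T.symm h) a).symm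
      · push Not at h1 h2
        have := Subtype.isEmpty_of_false h1
        have := Subtype.isEmpty_of_false h2
        simp
  let e : ∀ q, {a // f a = q} ≃ {b // g b = q} := fun q => (Finite.card_eq.1 (fib q)).some
  refine ⟨Equiv.ofFiberEquiv e, fun a => ?_⟩
  have := Equiv.ofFiberEquiv_map e a
  exact T.symm (Quotient.exact this)

theorem exists_ext [Finite S] {ι κ : Type} [Finite ι] [Finite κ] {x y : ι → S} (a : κ → S)
    (hm : Nat.card ι + Nat.card κ ≤ m) (h : T.rel x y) :
    ∃ b, T.rel (Sum.elim x a) (Sum.elim y b) := by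
  obtain ⟨σ, hσ⟩ := T.exists_matching (κ := κ) hm h
  exact ⟨σ a, hσ a⟩

/-- The orbit-stabilizer formula for types: restriction to the first part has fibres of constant
size by `ext`. -/
theorem card_rel_elim [Finite S] {ι κ : Type} [Finite ι] [Finite κ] (x : ι → S) (a : κ → S)
    (hm : Nat.card ι + Nat.card κ ≤ m) :
    Nat.card {z // T.rel (Sum.elim x a) z} =
      Nat.card {y // T.rel x y} * Nat.card {b // T.rel (Sum.elim x a) (Sum.elim x b)} := by
  classical
  have := Fintype.ofFinite S
  have := Fintype.ofFinite ι
  have := Fintype.ofFinite κ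
  let e : {z // T.rel (Sum.elim x a) z} ≃
      Σ y : {y // T.rel x y}, {b // T.rel (Sum.elim x a) (Sum.elim y.1 b)} :=
    { toFun := fun z => ⟨⟨z.1 ∘ Sum.inl, T.rel_of Sum.inl z.2 (fun _ => rfl) fun _ => rfl⟩,
        ⟨z.1 ∘ Sum.inr, by simpa using z.2⟩⟩
      invFun := fun y => ⟨Sum.elim y.1.1 y.2.1, y.2.2⟩
      left_inv := fun z => by simp
      right_inv := fun y => rfl }
  rw [Nat.card_congr e, Nat.card_sigma, Finset.sum_congr rfl fun y _ => T.ext a hm y.2,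
    Finset.sum_const, Finset.card_univ, smul_eq_mul, ← Nat.card_eq_fintype_card]

/-- Being related over a set of constants. -/
def relOver (A : Set S) {ι : Type} (x y : ι → S) : Prop :=
  T.rel (Sum.elim (Subtype.val : A → S) x) (Sum.elim Subtype.val y)

theorem relOver_range {ι κ : Type} {x : ι → S} {a b : κ → S} :
    T.relOver (Set.range x) a b ↔ T.rel (Sum.elim x a) (Sum.elim x b) := by
  constructor
  · intro h
    exact T.rel_of (Sum.map (fun i => ⟨x i, i, rfl⟩) id) h (by rintro (i | i) <;> rfl)
      (by rintro (i | i) <;> rfl)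
  · intro h
    refine T.rel_of (Sum.map (fun s => s.2.choose) id) h ?_ ?_ <;> rintro (i | i)
    exacts [i.2.choose_spec.symm, rfl, i.2.choose_spec.symm, rfl]

theorem relOver_mono {A B : Set S} (hAB : A ⊆ B) {ι : Type} {x y : ι → S} (h : T.relOver B x y) :
    T.relOver A x y :=
  T.rel_of (Sum.map (Set.inclusion hAB) id) h (by rintro (i | i) <;> rfl)
    (by rintro (i | i) <;> rfl)

theorem relOver_empty {ι : Type} {x y : ι → S} : T.relOver ∅ x y ↔ T.rel x y := by
  refine ⟨fun h => T.rel_inr h, fun h => T.rel_of (Sum.elim (fun i => i.2.elim) id) h ?_ ?_⟩ <;>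
  · rintro (i | i)
    · exact i.2.elim
    · rfl

/-- The scheme over a set of constants. -/
def relativize [Finite S] (A : Set S) : TupleScheme vec (m - 2 * A.ncard) where
  inj := T.inj
  rel := T.relOver A
  refl _ := T.refl _
  symm := T.symm
  trans := T.trans
  pull := by
    intro ι κ f x y h
    exact T.rel_of (Sum.map id f) h (by rintro (i | i) <;> rfl) (by rintro (i | i) <;> rfl)
  ext := by
    intro ι κ _ _ x y a hm h
    have key : ∀ y' b, T.relOver A (Sum.elim x a) (Sum.elim y' b) ↔
        T.rel (Sum.elim (Sum.elim (Subtype.val : A → S) x) a)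
          (Sum.elim (Sum.elim (Subtype.val : A → S) y') b) := by
      intro y' b
      constructor <;> intro h'
      · refine T.rel_of (Equiv.sumAssoc _ _ _) h' ?_ ?_ <;> rintro ((i | i) | i) <;> rfl
      · refine T.rel_of (Equiv.sumAssoc _ _ _).symm h' ?_ ?_ <;> rintro (i | i | i) <;> rfl
    simp_rw [key]
    -- Subtraction truncates: if A uses up the whole depth, only empty tuples satisfy the bound, and
    -- for them the claim is trivial.
    rcases Nat.eq_zero_or_pos (Nat.card ι + Nat.card κ) with h0 | h0
    · have h1 := Finite.card_eq_zero_iff.1 (Nat.eq_zero_of_add_eq_zero_right h0)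
      rw [Subsingleton.elim x y]
    · refine T.ext a ?_ h
      rw [Nat.card_sum, Nat.card_coe_set_eq]
      omega
  lin h := by
    obtain ⟨φ, hφ⟩ := T.lin h
    exact ⟨φ, fun i => hφ (Sum.inr i)⟩
  antisymm := by
    intro ι _ x y hm h hu
    rcases isEmpty_or_nonempty ι with hι | hι
    · exact Subsingleton.elim _ _
    have hpos : 0 < Nat.card ι := Finite.card_pos
    -- Antisymmetry is applied to the tuple with A adjoined, and its bound doubles the length. This
    -- is why a constant costs 2 in the depth.
    have := T.antisymm (by rw [Nat.card_sum, Nat.card_coe_set_eq]; omega) h ?_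
    · funext i
      exact congrFun this (Sum.inr i)
    · intro y' hy'
      have h1 : ∀ a : A, y' (Sum.inl a) = a := fun a =>
        (T.eq_of_rel hy' (i := Sum.inl (Sum.inl a)) (j := Sum.inr (Sum.inl a)) rfl).symm
      have h2 := hu (y' ∘ Sum.inr) (T.rel_of
        (Sum.elim (Sum.inl ∘ Sum.inl) (Sum.elim (Sum.inl ∘ Sum.inr) (Sum.inr ∘ Sum.inr))) hy'
        (by rintro (i | i | i) <;> rfl) (by rintro (i | i | i) <;> rfl))
      funext i
      rcases i with i | i
      · exact h1 i
      · exact congrFun h2 i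

theorem relOver_union {A : Set S} {ι κ : Type} {u : ι → S} {x y : κ → S} :
    T.relOver (A ∪ Set.range u) x y ↔ T.relOver A (Sum.elim u x) (Sum.elim u y) := by
  constructor
  · intro h
    refine T.rel_of (Sum.elim (fun a => Sum.inl ⟨a, Or.inl a.2⟩)
      (Sum.map (fun i => ⟨u i, Or.inr ⟨i, rfl⟩⟩) id)) h ?_ ?_ <;>
    · rintro (i | i | i) <;> rfl
  · intro h
    classical
    have : ∀ s : ↥(A ∪ Set.range u), ∃ i : A ⊕ ι, s.1 = Sum.elim Subtype.val u i := by
      rintro ⟨s, hs | ⟨i, rfl⟩⟩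
      exacts [⟨Sum.inl ⟨s, hs⟩, rfl⟩, ⟨Sum.inr i, rfl⟩]
    choose f hf using this
    refine T.rel_of (Sum.elim (Sum.elim Sum.inl (Sum.inr ∘ Sum.inl) ∘ f) (Sum.inr ∘ Sum.inr)) h
      ?_ ?_ <;>
    · rintro (s | i)
      · have := hf s
        simp only [Sum.elim_inl, Function.comp_apply, this]
        rcases f s with i | i <;> rfl
      · rfl

/-- The class of an element over a set of constants. -/
def cls (A : Set S) (s : S) : Set S := {s' | T.relOver A (fun _ : Unit => s) fun _ => s'}

/-- The elements that are alone in their class over a set of constants. -/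
def dcl (A : Set S) : Set S := {s | ∀ s' ∈ T.cls A s, s' = s}

theorem mem_cls_self (A : Set S) (s : S) : s ∈ T.cls A s := T.refl _

theorem cls_eq_of_mem {A : Set S} {s s' : S} (h : s' ∈ T.cls A s) : T.cls A s' = T.cls A s := by
  ext t
  exact ⟨fun ht => T.trans h ht, fun ht => T.trans (T.symm h) ht⟩

theorem mem_cls_comm {A : Set S} {s s' : S} : s' ∈ T.cls A s ↔ s ∈ T.cls A s' :=
  ⟨fun h => T.symm h, fun h => T.symm h⟩

theorem cls_anti {A B : Set S} (h : A ⊆ B) (s : S) : T.cls B s ⊆ T.cls A s :=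
  fun _ hs => T.relOver_mono h hs

theorem dcl_mono {A B : Set S} (h : A ⊆ B) : T.dcl A ⊆ T.dcl B :=
  fun s hs s' hs' => hs s' (T.cls_anti h s hs')

theorem mem_dcl_iff {A : Set S} {s : S} : s ∈ T.dcl A ↔ T.cls A s = {s} := by
  constructor
  · intro h
    exact Set.eq_singleton_iff_unique_mem.2 ⟨T.mem_cls_self A s, h⟩
  · intro h s' hs'
    rw [h] at hs'
    exact hs'

theorem mem_dcl_iff_ncard [Finite S] {A : Set S} {s : S} :
    s ∈ T.dcl A ↔ (T.cls A s).ncard = 1 := by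
  rw [mem_dcl_iff, Set.ncard_eq_one]
  constructor
  · exact fun h => ⟨s, h⟩
  · rintro ⟨a, ha⟩
    have := T.mem_cls_self A s
    rw [ha] at this ⊢
    rw [Set.mem_singleton_iff.1 this]

theorem ncard_cls_pos [Finite S] (A : Set S) (s : S) : 0 < (T.cls A s).ncard :=
  (Set.ncard_pos (Set.toFinite _)).2 ⟨s, T.mem_cls_self A s⟩

theorem two_le_ncard_cls [Finite S] {A : Set S} {s : S} (h : s ∉ T.dcl A) :
    2 ≤ (T.cls A s).ncard := by
  rw [mem_dcl_iff_ncard] at h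
  have := T.ncard_cls_pos A s
  omega

theorem apply_eq_of_mem {A : Set S} {ι : Type} {x y : ι → S} (h : T.relOver A x y) {i : ι}
    (hi : x i ∈ A) : y i = x i :=
  (T.eq_of_rel h (i := Sum.inl ⟨x i, hi⟩) (j := Sum.inr i) rfl).symm

theorem apply_mem_cls {A : Set S} {ι : Type} {x y : ι → S} (h : T.relOver A x y) (i : ι) :
    y i ∈ T.cls A (x i) :=
  T.rel_of (Sum.map id fun _ => i) h (by rintro (i | i) <;> rfl) (by rintro (i | i) <;> rfl)

theorem apply_eq_of_mem_dcl {A : Set S} {ι : Type} {x y : ι → S} (h : T.relOver A x y) {i : ι}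
    (hi : x i ∈ T.dcl A) : y i = x i :=
  hi _ (T.apply_mem_cls h i)

theorem subset_dcl (A : Set S) : A ⊆ T.dcl A :=
  fun _ hs _ hs' => T.apply_eq_of_mem (i := ()) hs' hs

/-- An automorphism realizing a relation over `A` fixes the vectors of `A`. -/
theorem exists_aut {A : Set S} {ι : Type} {x y : ι → S} (h : T.relOver A x y) :
    ∃ φ : V ≃+ V, (∀ z ∈ AddSubgroup.closure (vec '' A), φ z = z) ∧
      ∀ i, φ (vec (x i)) = vec (y i) := by
  obtain ⟨φ, hφ⟩ := T.lin h
  refine ⟨φ, fun z hz => ?_, fun i => hφ (Sum.inr i)⟩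
  have : AddSubgroup.closure (vec '' A) ≤ (φ.toAddMonoidHom).eqLocus (AddMonoidHom.id V) := by
    rw [AddSubgroup.closure_le]
    rintro _ ⟨s, hs, rfl⟩
    exact hφ (Sum.inl ⟨s, hs⟩)
  exact this hz

/-- An automorphism realizing a relation over A fixes the generated group pointwise. This is how
linear relations produce definability. -/
theorem mem_dcl_of_vec {A : Set S} {s : S} (h : vec s ∈ AddSubgroup.closure (vec '' A)) :
    s ∈ T.dcl A := by
  intro s' hs'
  obtain ⟨φ, hφ, h2⟩ := T.exists_aut hs'
  exact T.inj ((h2 ()).symm.trans (hφ _ h))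

theorem relOver_over [Finite S] {A B : Set S} {ι : Type} {x y : ι → S} :
    (T.relativize A).relOver B x y ↔ T.relOver (A ∪ B) x y := by
  have := T.relOver_union (A := A) (u := (Subtype.val : B → S)) (x := x) (y := y)
  rw [Subtype.range_coe] at this
  exact this.symm

theorem cls_over [Finite S] (A B : Set S) (s : S) :
    (T.relativize A).cls B s = T.cls (A ∪ B) s := by
  ext t
  exact T.relOver_over

theorem ncard_cls_range [Finite S] {ι : Type} (x : ι → S) (s : S) :
    (T.cls (Set.range x) s).ncard =
      Nat.card {b : Unit → S // T.rel (Sum.elim x fun _ => s) (Sum.elim x b)} := by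
  rw [← Nat.card_coe_set_eq]
  refine Nat.card_congr ((Equiv.subtypeEquiv (Equiv.funUnique Unit S) fun b => ?_).symm)
  rw [← relOver_range]
  rfl

theorem ncard_cls_eq_of_rel [Finite S] {ι : Type} [Finite ι] {x y : ι → S} {s t : S}
    (hm : Nat.card ι + 1 ≤ m) (h : T.rel (Sum.elim x fun _ : Unit => s) (Sum.elim y fun _ => t)) :
    (T.cls (Set.range x) s).ncard = (T.cls (Set.range y) t).ncard := by
  rw [ncard_cls_range, ncard_cls_range, ← T.ext (y := y) _ (by simpa using hm) (T.rel_inl h)]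
  refine Nat.card_congr (Equiv.subtypeEquiv (Equiv.refl _) fun b => ?_)
  exact ⟨fun h' => T.trans (T.symm h) h', fun h' => T.trans h h'⟩

theorem ncard_cls_eq_of_relOver [Finite S] {A : Set S} {ι : Type} [Finite ι] {x y : ι → S}
    {s t : S} (hm : 2 * A.ncard + Nat.card ι + 1 ≤ m)
    (h : T.relOver A (Sum.elim x fun _ : Unit => s) (Sum.elim y fun _ => t)) :
    (T.cls (A ∪ Set.range x) s).ncard = (T.cls (A ∪ Set.range y) t).ncard := by
  rw [← cls_over, ← cls_over]
  exact (T.relativize A).ncard_cls_eq_of_rel (by omega) h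

theorem mem_dcl_iff_of_relOver [Finite S] {A : Set S} {ι : Type} [Finite ι] {x y : ι → S}
    {s t : S} (hm : 2 * A.ncard + Nat.card ι + 1 ≤ m)
    (h : T.relOver A (Sum.elim x fun _ : Unit => s) (Sum.elim y fun _ => t)) :
    s ∈ T.dcl (A ∪ Set.range x) ↔ t ∈ T.dcl (A ∪ Set.range y) := by
  rw [mem_dcl_iff_ncard, mem_dcl_iff_ncard, T.ncard_cls_eq_of_relOver hm h]

theorem exists_ext_over [Finite S] {A : Set S} {ι κ : Type} [Finite ι] [Finite κ] {x y : ι → S}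
    (a : κ → S) (hm : 2 * A.ncard + Nat.card ι + Nat.card κ ≤ m) (h : T.relOver A x y) :
    ∃ b, T.relOver A (Sum.elim x a) (Sum.elim y b) :=
  (T.relativize A).exists_ext a (by omega) h

/-- Transitivity of definable closure. A conjugation of s over A extends to the points of B, which
it must fix, so it is a conjugation over B; the depth has to accommodate this extension. -/
theorem dcl_subset_of_subset [Finite S] {A B : Set S} (hB : B ⊆ T.dcl A)
    (hm : 2 * A.ncard + B.ncard + 1 ≤ m) : T.dcl B ⊆ T.dcl A := by
  intro s hs s' hs'
  obtain ⟨b, hb⟩ := T.exists_ext_over (Subtype.val : B → S)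
    (by rw [Nat.card_coe_set_eq, Nat.card_unique]; omega) hs'
  have hb' : ∀ i, b i = i := fun i => T.apply_eq_of_mem_dcl hb (i := Sum.inr i) (hB i.2)
  refine hs s' (T.rel_of (Sum.elim (Sum.inr ∘ Sum.inr) (Sum.inr ∘ Sum.inl)) hb ?_ ?_)
  · rintro (i | i) <;> rfl
  · rintro (i | i)
    · exact (hb' i).symm
    · rfl

/-- Both sides count the pairs conjugate to (a, b) over A. -/
theorem ncard_cls_mul_comm [Finite S] {A : Set S} (a b : S) (hm : 2 * A.ncard + 2 ≤ m) :
    (T.cls A a).ncard * (T.cls (insert a A) b).ncard =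
      (T.cls A b).ncard * (T.cls (insert b A) a).ncard := by
  have key : ∀ a b : S, (T.cls A a).ncard * (T.cls (insert a A) b).ncard =
      Nat.card {z // (T.relativize A).rel (Sum.elim (fun _ : Unit => a) fun _ : Unit => b) z} := by
    intro a b
    rw [(T.relativize A).card_rel_elim _ _ (by simp; omega)]
    congr 1
    · rw [← Nat.card_coe_set_eq]
      exact Nat.card_congr (Equiv.subtypeEquiv (Equiv.funUnique Unit S) fun b => Iff.rfl).symm
    · rw [← ncard_cls_range, cls_over]
      simp
  rw [key, key]
  refine Nat.card_congr (Equiv.subtypeEquiv (Equiv.arrowCongr (Equiv.sumComm _ _) (Equiv.refl _))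
    fun z => ⟨fun h => ?_, fun h => ?_⟩)
  · exact (T.relativize A).rel_of Sum.swap h (by rintro (i | i) <;> rfl) (by rintro (i | i) <;> rfl)
  · exact (T.relativize A).rel_of Sum.swap h (by rintro (i | i) <;> rfl) (by rintro (i | i) <;> rfl)

/-- Strong antisymmetry for single elements. -/
theorem eq_of_mem_cls_of_mem_dcl [Finite S] {A : Set S} {s t : S} (hm : 2 * A.ncard + 2 ≤ m)
    (h : t ∈ T.cls A s) (ht : t ∈ T.dcl (insert s A)) : t = s := by
  have := (T.relativize A).antisymm (x := fun _ : Unit => s) (y := fun _ => t) (by simp; omega) h ?_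
  · exact congrFun this ()
  · intro y' hy'
    have h1 : y' () ∈ T.cls (insert s A) t := by
      rw [← Set.union_singleton, ← Set.range_const (ι := Unit), cls, Set.mem_ofPred_eq,
        relOver_union]
      exact hy'
    funext i
    exact ht _ h1

/-- The swapped pair is definable from the pair itself, so antisymmetry forbids a nontrivial swap.
-/
theorem rel_pair_ne [Finite S] {A : Set S} {s t : S} (hm : 2 * A.ncard + 4 ≤ m)
    (h : T.relOver A ![s, t] ![t, s]) : t = s := by
  have := (T.relativize A).antisymm (x := ![s, t]) (y := ![t, s]) (by simp; omega) h ?_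
  · exact congrFun this 0
  · intro y' hy'
    have h0 := (T.relativize A).eq_of_rel hy' (i := Sum.inl 0) (j := Sum.inr 1) rfl
    have h1 := (T.relativize A).eq_of_rel hy' (i := Sum.inl 1) (j := Sum.inr 0) rfl
    funext i
    fin_cases i
    · exact h1.symm
    · exact h0.symm

end TupleScheme

end PScheme

/-! ### Localization, growth of classes and homogeneous schemes. -/

namespace PScheme

namespace TupleScheme

variable {S V : Type} [AddCommGroup V] {vec : S → V} {m : ℕ} (T : TupleScheme vec m)

/-- The same scheme with a smaller bound. -/
def weaken {m' : ℕ} (h : m' ≤ m) : TupleScheme vec m' where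
  inj := T.inj
  rel := T.rel
  refl := T.refl
  symm := T.symm
  trans := T.trans
  pull := T.pull
  ext a hm := T.ext a (hm.trans h)
  lin := T.lin
  antisymm hm := T.antisymm (hm.trans h)

/-- The restriction of a scheme to an invariant set. -/
def restrict (D : Set S)
    (hD : ∀ s ∈ D, ∀ s', T.rel (fun _ : Unit => s) (fun _ => s') → s' ∈ D) :
    TupleScheme (fun x : D => vec x) m where
  inj := T.inj.comp Subtype.val_injective
  rel x y := T.rel (Subtype.val ∘ x) (Subtype.val ∘ y)
  refl _ := T.refl _
  symm := T.symm
  trans := T.trans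
  pull f _ _ h := T.pull f h
  ext := by
    intro ι κ _ _ x y a hm h
    have key : ∀ y' : ι → D, Nat.card {b : κ → D // T.rel (Subtype.val ∘ Sum.elim x a)
        (Subtype.val ∘ Sum.elim y' b)} = Nat.card {b : κ → S //
        T.rel (Sum.elim (Subtype.val ∘ x) (Subtype.val ∘ a)) (Sum.elim (Subtype.val ∘ y') b)} := by
      intro y'
      refine Nat.card_congr
        { toFun := fun b => ⟨Subtype.val ∘ b.1, by simpa only [Sum.comp_elim] using b.2⟩
          invFun := fun b => ⟨fun i => ⟨b.1 i, hD (a i) (a i).2 _ (T.rel_of (fun _ => Sum.inr i)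
            b.2 (fun _ => rfl) fun _ => rfl)⟩, by
              have := b.2
              rw [Sum.comp_elim, Sum.comp_elim]
              exact this⟩
          left_inv := fun b => rfl
          right_inv := fun b => rfl }
    rw [key, key]
    exact T.ext _ hm h
  lin h := T.lin h
  antisymm := by
    intro ι _ x y hm h hu
    have := T.antisymm hm h ?_
    · funext i
      exact Subtype.ext (congrFun this i)
    · intro y' hy'
      have hmem : ∀ i, y' i ∈ D := fun i => hD (y i) (y i).2 _
        (T.rel_of (fun _ => Sum.inr i) hy' (fun _ => rfl) fun _ => rfl)
      have := hu (fun i => ⟨y' i, hmem i⟩) (by rw [Sum.comp_elim, Sum.comp_elim]; exact hy')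
      funext i
      exact congrArg Subtype.val (congrFun this i)

theorem cls_restrict (D : Set S)
    (hD : ∀ s ∈ D, ∀ s', T.rel (fun _ : Unit => s) (fun _ => s') → s' ∈ D) (B : Set D) (s : D) :
    Subtype.val '' (T.restrict D hD).cls B s = T.cls (Subtype.val '' B) s := by
  have hB : (Subtype.val '' B : Set S) = Set.range fun b : B => (b.1 : S) := by
    ext
    simp
  have key : ∀ t : D, t ∈ (T.restrict D hD).cls B s ↔ (t : S) ∈ T.cls (Subtype.val '' B) s := by
    intro t
    rw [hB, cls, cls, Set.mem_ofPred_eq, Set.mem_ofPred_eq, relOver_range]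
    change T.rel _ _ ↔ _
    rw [Sum.comp_elim, Sum.comp_elim]
    rfl
  ext t
  constructor
  · rintro ⟨t, ht, rfl⟩
    exact (key t).1 ht
  · intro ht
    have : t ∈ D := hD s s.2 _ (T.rel_inr ht)
    exact ⟨⟨t, this⟩, (key ⟨t, this⟩).2 ht, rfl⟩

theorem insert_eq_union_range (A : Set S) (a : S) :
    insert a A = A ∪ Set.range fun _ : Unit => a := by
  rw [Set.range_const, Set.union_singleton]

theorem not_mem_dcl_empty {s s' : S} (hne : s ≠ s')
    (hrel : T.rel (fun _ : Unit => s) fun _ => s') : s ∉ T.dcl ∅ := fun h =>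
  hne (h s' (T.relOver_empty.2 hrel)).symm

theorem cls_invariant (A : Set S) (a : S) : ∀ s ∈ T.cls A a, ∀ s',
    T.relOver A (fun _ : Unit => s) (fun _ => s') → s' ∈ T.cls A a :=
  fun _ hs _ h => T.trans hs h

variable [Finite S]

/-- The scheme over a set of constants on the class of an element. -/
noncomputable def localize (A : Set S) (a : S) : TupleScheme (fun x : T.cls A a => vec x) (m - 2 * A.ncard) :=
  (T.relativize A).restrict (T.cls A a) (T.cls_invariant A a)

theorem cls_localize (A : Set S) (a : S) (B : Set (T.cls A a)) (s : T.cls A a) :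
    Subtype.val '' (T.localize A a).cls B s = T.cls (A ∪ Subtype.val '' B) s := by
  exact ((T.relativize A).cls_restrict _ (T.cls_invariant A a) B s).trans (T.cls_over A _ _)

theorem ncard_cls_localize (A : Set S) (a : S) (B : Set (T.cls A a)) (s : T.cls A a) :
    ((T.localize A a).cls B s).ncard = (T.cls (A ∪ Subtype.val '' B) s).ncard := by
  rw [← cls_localize, Subtype.val_injective.injOn.ncard_image]

theorem mem_dcl_localize (A : Set S) (a : S) (B : Set (T.cls A a)) (s : T.cls A a) :
    s ∈ (T.localize A a).dcl B ↔ (s : S) ∈ T.dcl (A ∪ Subtype.val '' B) := by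
  rw [mem_dcl_iff_ncard, mem_dcl_iff_ncard, ncard_cls_localize]

/-- All elements are in one class. -/
def Transitive : Prop := ∀ s s', s' ∈ T.cls ∅ s

/-- Nontrivial classes over at most `t` constants are large. -/
def Homogeneous (K t : ℕ) : Prop := ∀ A : Set S, A.ncard ≤ t → ∀ s, s ∉ T.dcl A →
  Nat.card S ≤ K ^ (A.ncard + 1) * (T.cls A s).ncard

theorem localize_transitive (A : Set S) (a : S) : (T.localize A a).Transitive := by
  intro s s'
  have h := T.cls_localize A a ∅ s
  have h2 : (s' : S) ∈ T.cls (A ∪ Subtype.val '' (∅ : Set (T.cls A a))) s := by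
    rw [Set.image_empty, Set.union_empty, T.cls_eq_of_mem s.2]
    exact s'.2
  rw [← h] at h2
  obtain ⟨t, ht, hts⟩ := h2
  rwa [← Subtype.ext hts]

/-- Take a conjugate a' ≠ a over A; antisymmetry keeps it out of the definable closure of a and A.
Inside the class of a lie the class of a' over a and the set Q of those z with (a', a) ~ (a, z).
They have the same size, and they are disjoint because a common element would give (a, a') ~ (a',
a). So the class of a' over a has at most half the size. -/
theorem exists_ncard_cls_insert_le {A : Set S} {a : S} (hm : 2 * A.ncard + 4 ≤ m)
    (ha : a ∉ T.dcl A) :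
    ∃ a', a' ∉ T.dcl (insert a A) ∧ 2 * (T.cls (insert a A) a').ncard ≤ (T.cls A a).ncard := by
  have : ∃ a' ∈ T.cls A a, a' ≠ a := by
    by_contra! h
    exact ha h
  obtain ⟨a', ha', hne⟩ := this
  refine ⟨a', fun h => hne (T.eq_of_mem_cls_of_mem_dcl (by omega) ha' h), ?_⟩
  set Q : Set S := {z | (T.relativize A).rel (Sum.elim (fun _ : Unit => a') fun _ : Unit => a)
    (Sum.elim (fun _ => a) fun _ => z)} with hQ
  -- Regularity identifies |Q| with the size of the class of a over a', and symmetry of pair counts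
  -- identifies that with the class of a' over a, since a and a' have the same class.
  have hcard : Q.ncard = (T.cls (insert a A) a').ncard := by
    have h1 := T.ncard_cls_mul_comm a a' (by omega : 2 * A.ncard + 2 ≤ m)
    rw [T.cls_eq_of_mem ha'] at h1
    rw [Nat.eq_of_mul_eq_mul_left (T.ncard_cls_pos A a) h1]
    have h2 := (T.relativize A).ext (x := fun _ : Unit => a') (y := fun _ => a)
      (fun _ : Unit => a) (by simp; omega) (T.symm ha')
    rw [← ncard_cls_range, cls_over, ← insert_eq_union_range] at h2
    rw [← h2, ← Nat.card_coe_set_eq]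
    exact Nat.card_congr (Equiv.subtypeEquiv (Equiv.funUnique Unit S) fun b => Iff.rfl).symm
  have hdisj : Disjoint (T.cls (insert a A) a') Q := by
    rw [Set.disjoint_left]
    intro z hz hz2
    refine hne (T.rel_pair_ne hm ?_)
    rw [cls, Set.mem_ofPred_eq, insert_eq_union_range, relOver_union] at hz
    have h3 : (T.relativize A).rel (Sum.elim (fun _ : Unit => a) fun _ : Unit => a')
      (Sum.elim (fun _ => a') fun _ => a) :=
      T.trans hz (T.symm hz2)
    refine (T.relativize A).rel_of ![Sum.inl (), Sum.inr ()] h3 ?_ ?_ <;>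
    · intro i
      fin_cases i <;> rfl
  have hsub : T.cls (insert a A) a' ∪ Q ⊆ T.cls A a := by
    rintro z (hz | hz)
    · have := T.cls_anti (Set.subset_insert a A) _ hz
      rwa [T.cls_eq_of_mem ha'] at this
    · exact (T.relativize A).rel_inr hz
  have := Set.ncard_le_ncard hsub (Set.toFinite _)
  rw [Set.ncard_union_eq hdisj (Set.toFinite _) (Set.toFinite _), hcard] at this
  omega

/-- Nontrivial classes are exponentially large in the bound. -/
theorem two_pow_le_ncard_cls {A : Set S} {a : S} (j : ℕ) (hm : 2 * A.ncard + 2 * j + 2 ≤ m)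
    (ha : a ∉ T.dcl A) : 2 ^ (j + 1) ≤ (T.cls A a).ncard := by
  induction j generalizing A a with
  | zero => simpa using T.two_le_ncard_cls ha
  | succ j ih =>
    obtain ⟨a', h1, h2⟩ := T.exists_ncard_cls_insert_le (by omega) ha
    have h3 := Set.ncard_insert_le a A
    have := ih (by omega) h1
    rw [pow_succ]
    omega

/-- Minimize 2^(lam·|A|)·|class of a over A| over sets A of at most 2M constants and points a not
definable over A. The empty set gives a value at most 2^(lam·M), so the minimizer has |A| ≤ M, and M
further constants may be added. Minimality then says that each of them shrinks a nontrivial class by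
at most the factor 2^lam. The class of the minimizer is the new scheme. -/
theorem exists_homogeneous {M lam N : ℕ} (T : TupleScheme vec (16 * M)) (hM : 1 ≤ M)
    (hlam : 1 ≤ lam) (hN : N ≤ lam * M) (hS : Nat.card S ≤ 2 ^ N) {s s' : S} (hne : s ≠ s')
    (hrel : T.rel (fun _ : Unit => s) fun _ => s') :
    ∃ (D : Set S) (T' : TupleScheme (fun x : D => vec x) (14 * M)),
      T'.Transitive ∧ T'.Homogeneous (2 ^ lam) M ∧ 2 ^ (7 * M) ≤ Nat.card D := by
  classical
  let P : ℕ → Prop := fun v => ∃ (A : Set S) (a : S), A.ncard ≤ 2 * M ∧ a ∉ T.dcl A ∧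
    v = 2 ^ (lam * A.ncard) * (T.cls A a).ncard
  have hP0 : P ((T.cls ∅ s).ncard) := ⟨∅, s, by simp, T.not_mem_dcl_empty hne hrel, by simp⟩
  have hP : ∃ v, P v := ⟨_, hP0⟩
  obtain ⟨A, a, hA, ha, hv⟩ := Nat.find_spec hP
  have hle : 2 ^ (lam * A.ncard) * (T.cls A a).ncard ≤ 2 ^ N := by
    rw [← hv]
    refine (Nat.find_min' hP hP0).trans (le_trans ?_ hS)
    rw [← Set.ncard_univ]
    exact Set.ncard_le_ncard (Set.subset_univ _) (Set.toFinite _)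
  have hAM : A.ncard ≤ M := by
    have h1 : 2 ^ (lam * A.ncard) ≤ 2 ^ N :=
      (Nat.le_mul_of_pos_right _ (T.ncard_cls_pos A a)).trans hle
    have h2 := (Nat.pow_le_pow_iff_right (by norm_num)).1 h1
    exact Nat.le_of_mul_le_mul_left (h2.trans hN) (by omega)
  refine ⟨T.cls A a, (T.localize A a).weaken (by omega), T.localize_transitive A a, ?_, ?_⟩
  · intro B hB t ht
    have hB' : (Subtype.val '' B : Set S).ncard = B.ncard :=
      Subtype.val_injective.injOn.ncard_image
    have hAB := Set.ncard_union_le A (Subtype.val '' B)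
    change t ∉ (T.localize A a).dcl B at ht
    rw [mem_dcl_localize] at ht
    have h1 := Nat.find_min' hP ⟨A ∪ Subtype.val '' B, t, by omega, ht, rfl⟩
    rw [hv] at h1
    change _ ≤ _ * ((T.localize A a).cls B t).ncard
    rw [ncard_cls_localize, Nat.card_coe_set_eq]
    have h2 : 2 ^ (lam * A.ncard) * (T.cls A a).ncard ≤ 2 ^ (lam * A.ncard) *
        ((2 ^ lam) ^ (B.ncard + 1) * (T.cls (A ∪ Subtype.val '' B) t).ncard) := by
      refine h1.trans ?_
      rw [← mul_assoc, ← pow_mul, ← pow_add]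
      refine Nat.mul_le_mul_right _ (Nat.pow_le_pow_right (by norm_num) ?_)
      rw [← mul_add]
      exact Nat.mul_le_mul_left _ (by omega)
    exact Nat.le_of_mul_le_mul_left h2 (by positivity)
  · rw [Nat.card_coe_set_eq]
    -- The choice 7M - 1 exhausts the depth: 2M + 2(7M - 1) + 2 = 16M.
    refine le_trans ?_ (T.two_pow_le_ncard_cls (7 * M - 1) (by omega) ha)
    exact Nat.pow_le_pow_right (by norm_num) (by omega)

end TupleScheme

end PScheme

/-! ### Exchange, bounded definable closures and a short dependence. -/

namespace PScheme

namespace TupleScheme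

variable {S V : Type} [AddCommGroup V] {vec : S → V} {m : ℕ}

/-- A transitive homogeneous scheme on a set that is large in terms of the parameters. -/
structure Large (T : TupleScheme vec m) (K t : ℕ) : Prop where
  transitive : T.Transitive
  homogeneous : T.Homogeneous K t
  two_le : 2 ≤ K
  depth : 8 * t + 8 ≤ m
  card : K ^ (8 * t + 8) < Nat.card S

variable {T : TupleScheme vec m} {K t : ℕ}

theorem Large.pow_lt (h : T.Large K t) {k : ℕ} (hk : k ≤ 8 * t + 8) : K ^ k < Nat.card S :=
  (Nat.pow_le_pow_right (by have := h.two_le; omega) hk).trans_lt h.card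

theorem ncard_image_lt_le (y : ℕ → S) (g : ℕ) : (y '' {j | j < g}).ncard ≤ g := by
  refine (Set.ncard_image_le (Set.finite_lt_nat g)).trans ?_
  rw [← Nat.card_coe_set_eq]
  simp

theorem sum_ncard_le_of_pairwise_disjoint [Finite S] {ι : Type} (X : Finset ι) (f : ι → Set S)
    (hf : ∀ x ∈ X, ∀ y ∈ X, x ≠ y → Disjoint (f x) (f y)) :
    ∑ x ∈ X, (f x).ncard ≤ Nat.card S := by
  classical
  have := Fintype.ofFinite S
  have h1 : ∀ x, (f x).ncard = (f x).toFinite.toFinset.card := fun x =>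
    Set.ncard_eq_toFinset_card _ _
  simp_rw [h1]
  rw [← Finset.card_biUnion, Nat.card_eq_fintype_card]
  · exact Finset.card_le_univ _
  · intro x hx y hy hxy
    have := hf x hx y hy hxy
    change Disjoint _ _
    rw [Finset.disjoint_left]
    intro z hz hz'
    exact Set.disjoint_left.1 this (by simpa using hz) (by simpa using hz')

variable [Finite S]

theorem mem_dcl_iff_of_mem_cls {A : Set S} {s s' : S} (h : s' ∈ T.cls A s) :
    s' ∈ T.dcl A ↔ s ∈ T.dcl A := by
  rw [mem_dcl_iff_ncard, mem_dcl_iff_ncard, T.cls_eq_of_mem h]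

/-- Definability between members of a configuration passes to each of its conjugates. -/
theorem mem_dcl_image_iff {A : Set S} {ι : Type} [Finite ι] {x y : ι → S} (h : T.relOver A x y)
    (i : ι) (J : Set ι) (hm : 2 * A.ncard + Nat.card ι + 1 ≤ m) :
    x i ∈ T.dcl (A ∪ x '' J) ↔ y i ∈ T.dcl (A ∪ y '' J) := by
  have h1 : T.relOver A (Sum.elim (fun j : J => x j) fun _ : Unit => x i)
      (Sum.elim (fun j : J => y j) fun _ : Unit => y i) :=
    (T.relativize A).rel_of (Sum.elim Subtype.val fun _ => i) h (by rintro (i | i) <;> rfl)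
      (by rintro (i | i) <;> rfl)
  have hJ := Finite.card_subtype_le (· ∈ J)
  have hJ' : Nat.card J ≤ Nat.card ι := hJ
  have := T.mem_dcl_iff_of_relOver (by omega) h1
  rwa [← Set.image_eq_range, ← Set.image_eq_range] at this

theorem Large.dcl_empty (h : T.Large K t) : T.dcl ∅ = ∅ := by
  rw [Set.eq_empty_iff_forall_notMem]
  intro s hs
  have : Nat.card S ≤ 1 := by
    rw [← Set.ncard_univ, Set.ncard_le_one (Set.toFinite _)]
    intro a _ b _
    rw [hs a (h.transitive s a), hs b (h.transitive s b)]
  have h2 := h.pow_lt (k := 0) (by omega)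
  rw [pow_zero] at h2
  omega

/-- The exchange property. -/
theorem Large.exchange (h : T.Large K t) {A : Set S} (hA : A.ncard + 1 ≤ t) {a b : S}
    (ha : a ∉ T.dcl A) (hb : b ∉ T.dcl (insert a A)) : a ∉ T.dcl (insert b A) := by
  have hd := h.depth
  have h1 := T.ncard_cls_mul_comm (A := A) a b (by omega)
  have hi := Set.ncard_insert_le a A
  have h2 := h.homogeneous A (by omega) a ha
  have h3 := h.homogeneous (insert a A) (by omega) b hb
  intro hcon
  rw [mem_dcl_iff_ncard] at hcon
  rw [hcon, mul_one] at h1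
  have h4 : (T.cls A b).ncard ≤ Nat.card S := by
    rw [← Set.ncard_univ]
    exact Set.ncard_le_ncard (Set.subset_univ _) (Set.toFinite _)
  have hK : 1 ≤ K := by have := h.two_le; omega
  have h5 : K ^ (A.ncard + 1) * K ^ ((insert a A).ncard + 1) < Nat.card S := by
    rw [← pow_add]
    exact h.pow_lt (by omega)
  -- If a were definable over b and A, the conjugates of (a, b) would be as many as those of b, at
  -- most n. But their number is nearly n², both classes in the product being large.
  have h6 : Nat.card S * Nat.card S ≤
      (K ^ (A.ncard + 1) * K ^ ((insert a A).ncard + 1)) * Nat.card S := by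
    calc Nat.card S * Nat.card S ≤ (K ^ (A.ncard + 1) * (T.cls A a).ncard) *
          (K ^ ((insert a A).ncard + 1) * (T.cls (insert a A) b).ncard) := Nat.mul_le_mul h2 h3
      _ = (K ^ (A.ncard + 1) * K ^ ((insert a A).ncard + 1)) *
          ((T.cls A a).ncard * (T.cls (insert a A) b).ncard) := by ring
      _ ≤ _ := Nat.mul_le_mul_left _ (h1.trans_le h4)
  have := Nat.le_of_mul_le_mul_right h6 (by omega)
  omega

theorem Large.mem_dcl_insert_comm (h : T.Large K t) {A : Set S} (hA : A.ncard + 1 ≤ t) {a b : S}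
    (hb : b ∉ T.dcl A) (hb' : b ∈ T.dcl (insert a A)) : a ∈ T.dcl (insert b A) := by
  by_contra hcon
  exact h.exchange hA hb hcon hb'

theorem dcl_insert_subset {A B : Set S} {a : S} (ha : a ∈ T.dcl B) (hAB : A ⊆ T.dcl B)
    (hm : 2 * B.ncard + A.ncard + 2 ≤ m) : T.dcl (insert a A) ⊆ T.dcl B := by
  refine T.dcl_subset_of_subset (Set.insert_subset ha hAB) ?_
  have := Set.ncard_insert_le a A
  omega

/-- By exchange, each newly definable element is interdefinable with a over A, so any two of them
are interdefinable. Antisymmetry then makes them pairwise non-conjugate over A, and their disjoint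
classes are all large, which bounds their number. -/
theorem Large.ncard_dcl_sdiff_le (h : T.Large K t) {A : Set S} (hA : A.ncard + 1 ≤ t) {a : S} :
    (T.dcl (insert a A) \ T.dcl A).ncard ≤ K ^ (A.ncard + 1) := by
  classical
  have hd := h.depth
  by_cases ha : a ∈ T.dcl A
  · have : T.dcl (insert a A) \ T.dcl A = ∅ :=
      Set.sdiff_eq_empty.2 (T.dcl_insert_subset ha (T.subset_dcl A) (by omega))
    simp [this]
  set X := (Set.toFinite (T.dcl (insert a A) \ T.dcl A)).toFinset with hX
  have hmem : ∀ x ∈ X, x ∈ T.dcl (insert a A) ∧ x ∉ T.dcl A := by simp [hX]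
  have h1 := sum_ncard_le_of_pairwise_disjoint X (fun x => T.cls A x) (by
    intro x hx y hy hxy
    rw [Set.disjoint_left]
    intro z hz hz'
    have hyx : y ∈ T.cls A x := by
      rw [← T.cls_eq_of_mem hz, T.cls_eq_of_mem hz']
      exact T.mem_cls_self A y
    refine hxy (T.eq_of_mem_cls_of_mem_dcl (by omega) hyx ?_).symm
    have hax := h.mem_dcl_insert_comm hA (hmem x hx).2 (hmem x hx).1
    refine T.dcl_insert_subset hax ((Set.subset_insert x A).trans (T.subset_dcl _)) ?_
      (hmem y hy).1
    have := Set.ncard_insert_le x A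
    omega)
  have h2 : X.card * Nat.card S ≤ K ^ (A.ncard + 1) * Nat.card S := by
    calc X.card * Nat.card S = ∑ x ∈ X, Nat.card S := by simp
      _ ≤ ∑ x ∈ X, K ^ (A.ncard + 1) * (T.cls A x).ncard :=
        Finset.sum_le_sum fun x hx => h.homogeneous A (by omega) x (hmem x hx).2
      _ = K ^ (A.ncard + 1) * ∑ x ∈ X, (T.cls A x).ncard := by rw [Finset.mul_sum]
      _ ≤ _ := Nat.mul_le_mul_left _ h1
  have hpos : 0 < Nat.card S := lt_of_le_of_lt (Nat.zero_le _) h.card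
  rw [Set.ncard_eq_toFinset_card _ (Set.toFinite _)]
  exact Nat.le_of_mul_le_mul_right h2 hpos

theorem Large.ncard_dcl_le (h : T.Large K t) {A : Set S} (hA : A.ncard ≤ t) :
    (T.dcl A).ncard ≤ K ^ (A.ncard + 1) := by
  have hK := h.two_le
  -- The summand K is there for the induction: adding a constant adds at most K^(k+1) elements, and
  -- 2·K^(k+1) ≤ K^(k+2). At k = 0 it says that the closure is empty.
  suffices ∀ k, ∀ A : Set S, A.ncard = k → k ≤ t → (T.dcl A).ncard + K ≤ K ^ (k + 1) by
    have := this _ A rfl hA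
    omega
  intro k
  induction k with
  | zero =>
    intro A hA _
    rw [Set.ncard_eq_zero (Set.toFinite _)] at hA
    rw [hA, h.dcl_empty]
    simp
  | succ k ih =>
    intro A hA hk
    obtain ⟨a, ha⟩ : A.Nonempty := by
      rw [← Set.ncard_pos (Set.toFinite _)]
      omega
    have h1 : (A \ {a}).ncard = k := by
      rw [Set.ncard_sdiff_singleton_of_mem ha]
      omega
    have h2 := ih _ h1 (by omega)
    have h3 := h.ncard_dcl_sdiff_le (A := A \ {a}) (a := a) (by omega)
    rw [Set.insert_sdiff_singleton, Set.insert_eq_of_mem ha, h1] at h3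
    have h4 := Set.ncard_le_ncard_sdiff_add_ncard (T.dcl A) (T.dcl (A \ {a})) (Set.toFinite _)
    rw [pow_succ K (k + 1)]
    nlinarith

/-- A nontrivial class contains elements outside any small definable closure. -/
theorem Large.exists_mem_cls_notMem_dcl (h : T.Large K t) {B C : Set S} (hB : B.ncard ≤ t)
    (hC : C.ncard ≤ t) {s : S} (hs : s ∉ T.dcl B) : ∃ z ∈ T.cls B s, z ∉ T.dcl C := by
  by_contra! hcon
  have h1 := (Set.ncard_le_ncard hcon (Set.toFinite _)).trans (h.ncard_dcl_le hC)
  have h2 := h.homogeneous B hB s hs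
  have h3 : K ^ (B.ncard + 1) * K ^ (C.ncard + 1) < Nat.card S := by
    rw [← pow_add]
    exact h.pow_lt (by omega)
  have := Nat.mul_le_mul_left (K ^ (B.ncard + 1)) h1
  omega

/-- Conjugates are chosen greedily: the definable closure of those already chosen is too small to
contain a nontrivial class. -/
theorem Large.exists_independent (h : T.Large K t) {B : Set S} {s : S} (hs : s ∉ T.dcl B) (g : ℕ)
    (hg : B.ncard + g ≤ t) : ∃ y : ℕ → S, ∀ i < g,
      y i ∈ T.cls B s ∧ y i ∉ T.dcl (B ∪ y '' {j | j < i}) := by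
  induction g with
  | zero => exact ⟨fun _ => s, by simp⟩
  | succ g ih =>
    obtain ⟨y, hy⟩ := ih (by omega)
    have hc : (B ∪ y '' {j | j < g}).ncard ≤ B.ncard + g := by
      refine (Set.ncard_union_le _ _).trans (Nat.add_le_add_left ?_ _)
      refine (Set.ncard_image_le (Set.finite_lt_nat g)).trans ?_
      rw [← Nat.card_coe_set_eq]
      simp
    obtain ⟨z, hz, hz'⟩ := h.exists_mem_cls_notMem_dcl (B := B) (C := B ∪ y '' {j | j < g})
      (by omega) (by omega) hs
    have him : ∀ i ≤ g, Function.update y g z '' {j | j < i} = y '' {j | j < i} := by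
      intro i hi
      refine Set.image_congr fun j hj => Function.update_of_ne ?_ _ _
      have : j < i := hj
      omega
    refine ⟨Function.update y g z, fun i hi => ?_⟩
    rw [him i (by omega)]
    rcases Nat.lt_succ_iff_lt_or_eq.1 hi with hi | rfl
    · rw [Function.update_of_ne hi.ne]
      exact hy i hi
    · rw [Function.update_self]
      exact ⟨hz, hz'⟩

/-- A short nontrivial dependence. -/
theorem Large.exists_dependence [Finite V] (h : T.Large K t) {s : ℕ}
    (hV : Nat.card V < (Nat.card S).choose s) :
    ∃ (Y : Set S) (b y c : S), Y.ncard ≤ 2 * s ∧ c ∈ T.dcl (insert y (insert b Y)) ∧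
      c ∉ T.dcl (insert b Y) ∧ c ∉ T.dcl (insert y Y) ∧ y ∉ T.dcl (insert b Y) ∧
      b ∉ T.dcl (insert y Y) := by
  classical
  have := Fintype.ofFinite S
  have := Fintype.ofFinite V
  have hd := h.depth
  let P : ℕ → Prop := fun k => ∃ E : Set S, E.ncard = k ∧ ∃ w ∈ T.dcl E, w ∉ E
  have hP : ∃ k, k ≤ 2 * s ∧ P k := by
    -- Two s-element sets with the same vector sum express one of their elements through the others,
    -- so some set of size at most 2s is not definably closed.
    obtain ⟨E1, h1, E2, h2, hne, heq⟩ := Finset.exists_ne_map_eq_of_card_lt_of_maps_to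
      (s := Finset.powersetCard s (Finset.univ : Finset S)) (t := (Finset.univ : Finset V))
      (f := fun E => ∑ x ∈ E, vec x) (by
        rw [Finset.card_powersetCard, Finset.card_univ, Finset.card_univ,
          ← Nat.card_eq_fintype_card, ← Nat.card_eq_fintype_card]
        exact hV) (fun _ _ => Finset.mem_coe.2 (Finset.mem_univ _))
    rw [Finset.mem_powersetCard] at h1 h2
    obtain ⟨w, hw1, hw2⟩ : ∃ w ∈ E1, w ∉ E2 := by
      by_contra! hcon
      exact hne (Finset.eq_of_subset_of_card_le hcon (by omega))
    refine ⟨((E1 ∪ E2).erase w).card, ?_, ((E1 ∪ E2).erase w : Finset S),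
      Set.ncard_coe_finset _, w, ?_, by simp⟩
    · refine (Finset.card_erase_le).trans ((Finset.card_union_le _ _).trans ?_)
      omega
    · refine T.mem_dcl_of_vec ?_
      have : vec w = ∑ x ∈ E2, vec x - ∑ x ∈ E1.erase w, vec x := by
        rw [← heq, ← Finset.add_sum_erase _ _ hw1]
        abel
      rw [this]
      refine AddSubgroup.sub_mem _ ?_ ?_ <;>
      · refine AddSubgroup.sum_mem _ fun x hx => AddSubgroup.subset_closure ⟨x, ?_, rfl⟩
        simp only [Finset.coe_erase, Finset.coe_union, Set.mem_sdiff, Set.mem_union,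
          Finset.mem_coe, Set.mem_singleton_iff]
        first
        | exact ⟨Or.inr hx, fun hxw => hw2 (hxw ▸ hx)⟩
        | exact ⟨Or.inl (Finset.mem_of_mem_erase hx), Finset.ne_of_mem_erase hx⟩
  obtain ⟨k0, hk0, hPk0⟩ := hP
  have hPex : ∃ k, P k := ⟨k0, hPk0⟩
  -- By minimality every set smaller than E is definably closed. All the independence claims below
  -- follow from this.
  obtain ⟨E, hE, c, hc, hcE⟩ := Nat.find_spec hPex
  have hEs : E.ncard ≤ 2 * s := hE.trans_le ((Nat.find_min' hPex hPk0).trans hk0)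
  have hmin : ∀ E' : Set S, E'.ncard < E.ncard → T.dcl E' ⊆ E' := by
    intro E' hE' w hw
    by_contra hw'
    exact Nat.find_min hPex (hE ▸ hE') ⟨E', rfl, w, hw, hw'⟩
  -- The closure of the empty set is empty, and by transitivity and antisymmetry a single point
  -- defines only itself.
  have h2 : 1 < E.ncard := by
    by_contra hcon
    rcases Nat.lt_or_ge E.ncard 1 with h0 | h0
    · have : E = ∅ := (Set.ncard_eq_zero (Set.toFinite _)).1 (by omega)
      rw [this, h.dcl_empty] at hc
      exact hc
    · obtain ⟨b, hb⟩ := Set.ncard_eq_one.1 (by omega : E.ncard = 1)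
      rw [hb] at hc hcE
      refine hcE (T.eq_of_mem_cls_of_mem_dcl (A := ∅) (by simp; omega) (h.transitive b c) ?_)
      rwa [insert_empty_eq]
  obtain ⟨b, y, hb, hy, hby⟩ := (Set.one_lt_ncard_iff (Set.toFinite _)).1 h2
  have hbY : insert b (E \ {b, y}) = E \ {y} := by
    ext z
    by_cases hz : z = b
    · subst hz
      simp [hb, hby]
    · simp [hz]
  have hyY : insert y (E \ {b, y}) = E \ {b} := by
    ext z
    by_cases hz : z = y
    · subst hz
      simp [hy, hby.symm]
    · simp [hz]
  have hcard1 := Set.ncard_sdiff_singleton_lt_of_mem hy (Set.toFinite _)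
  have hcard2 := Set.ncard_sdiff_singleton_lt_of_mem hb (Set.toFinite _)
  refine ⟨E \ {b, y}, b, y, c, (Set.ncard_le_ncard Set.sdiff_subset (Set.toFinite _)).trans hEs,
    ?_, ?_, ?_, ?_, ?_⟩
  · rw [hbY, Set.insert_sdiff_singleton, Set.insert_eq_of_mem hy]
    exact hc
  · rw [hbY]
    exact fun hcon => hcE (hmin _ hcard1 hcon).1
  · rw [hyY]
    exact fun hcon => hcE (hmin _ hcard2 hcon).1
  · rw [hbY]
    exact fun hcon => (hmin _ hcard1 hcon).2 rfl
  · rw [hyY]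
    exact fun hcon => (hmin _ hcard2 hcon).2 rfl

end TupleScheme

end PScheme

/-! ### Families of interdefinable elements and a definable difference. -/

namespace PScheme

namespace TupleScheme

variable {S V : Type} [AddCommGroup V] {vec : S → V} {m : ℕ} {T : TupleScheme vec m} {K t : ℕ}

theorem ncard_union_image_le (B : Set S) (y : ℕ → S) (g : ℕ) :
    (B ∪ y '' {j | j < g}).ncard ≤ B.ncard + g :=
  (Set.ncard_union_le _ _).trans (Nat.add_le_add_left (ncard_image_lt_le y g) _)

variable [Finite S]

/-- Many elements that are interdefinable with one element over a small set. -/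
theorem Large.exists_interdefinable [Finite V] (h : T.Large K t) {s g : ℕ}
    (hs : 2 * s + g + 3 ≤ t) (hV : Nat.card V < (Nat.card S).choose s) :
    ∃ (Y : Set S) (b : S) (c : Fin g → S), Y.ncard ≤ 2 * s + g ∧ Function.Injective c ∧
      b ∉ T.dcl Y ∧ (∀ i, c i ∈ T.dcl (insert b Y)) ∧ ∀ i, b ∈ T.dcl (insert (c i) Y) := by
  have hd := h.depth
  obtain ⟨Y, b, y, c, hY, h1, h2, h3, h4, h5⟩ := h.exists_dependence hV
  have hbY := Set.ncard_insert_le b Y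
  have hyY := Set.ncard_insert_le y Y
  -- Let c depend on b, y and Y. Replacing y by independent conjugates z_i over b and Y gives copies
  -- c_i of c, and once the z_i are constants each c_i is interdefinable with b.
  obtain ⟨z, hz⟩ := h.exists_independent h4 g (by omega)
  have hcopy : ∀ i < g, ∃ c', T.relOver (insert b Y) ![y, c] ![z i, c'] := by
    intro i hi
    obtain ⟨c', hc'⟩ := T.exists_ext_over (fun _ : Unit => c) (by simp; omega) (hz i hi).1
    refine ⟨c' (), (T.relativize _).rel_of ![Sum.inl (), Sum.inr ()] hc' ?_ ?_⟩ <;>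
    · intro i
      fin_cases i <;> rfl
  have : Nonempty S := ⟨b⟩
  choose! c' hc' using hcopy
  have hcb : ∀ i < g, T.relOver Y ![b, y, c] ![b, z i, c' i] := by
    intro i hi
    have := hc' i hi
    rw [insert_eq_union_range, relOver_union] at this
    refine (T.relativize _).rel_of ![Sum.inl (), Sum.inr 0, Sum.inr 1] this ?_ ?_ <;>
    · intro i
      fin_cases i <;> rfl
  have tr : ∀ i < g, ∀ k (J : Set (Fin 3)), ![b, y, c] k ∈ T.dcl (Y ∪ ![b, y, c] '' J) ↔
      ![b, z i, c' i] k ∈ T.dcl (Y ∪ ![b, z i, c' i] '' J) := fun i hi k J =>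
    T.mem_dcl_image_iff (hcb i hi) k J (by simp; omega)
  have hc1 : ∀ i < g, c' i ∈ T.dcl (insert (z i) (insert b Y)) := by
    intro i hi
    have := (tr i hi 2 {0, 1}).1 ?_
    · simpa [Set.image_insert_eq, Set.union_comm Y, Set.insert_union, Set.insert_comm] using this
    · simpa [Set.image_insert_eq, Set.union_comm Y, Set.insert_union, Set.insert_comm] using h1
  have hc2 : ∀ i < g, c' i ∉ T.dcl (insert b Y) := by
    intro i hi hcon
    refine h2 ?_
    have := (tr i hi 2 {0}).2 ?_
    · simpa [Set.image_insert_eq, Set.union_comm Y, Set.insert_union, Set.insert_comm] using this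
    · simpa [Set.image_insert_eq, Set.union_comm Y, Set.insert_union, Set.insert_comm] using hcon
  have hc3 : ∀ i < g, b ∈ T.dcl (insert (c' i) (insert (z i) Y)) := by
    intro i hi
    have := (tr i hi 0 {1, 2}).1 ?_
    · simpa [Set.image_insert_eq, Set.union_comm Y, Set.insert_union, Set.insert_comm] using this
    · have := h.mem_dcl_insert_comm (A := insert y Y) (a := b) (b := c) (by omega) h3
        (by rwa [Set.insert_comm])
      simpa [Set.image_insert_eq, Set.union_comm Y, Set.insert_union, Set.insert_comm] using this
  have hYz : ∀ i < g, insert (z i) Y ⊆ Y ∪ z '' {j | j < g} := by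
    rintro i hi x (rfl | hx)
    · exact Or.inr ⟨i, hi, rfl⟩
    · exact Or.inl hx
  -- By exchange, b stays undefinable as the z_i are added one at a time, because each z_i is
  -- independent of b and the earlier ones.
  have hbz : ∀ i ≤ g, b ∉ T.dcl (Y ∪ z '' {j | j < i}) := by
    intro i
    induction i with
    | zero =>
      intro _ hcon
      refine h5 (T.dcl_mono ?_ hcon)
      simp
    | succ i ih =>
      intro hi
      have hset : Y ∪ z '' {j | j < i + 1} = insert (z i) (Y ∪ z '' {j | j < i}) := by
        have : {j | j < i + 1} = insert i {j | j < i} := by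
          ext j
          simp only [Set.mem_ofPred_eq, Set.mem_insert_iff]
          omega
        rw [this, Set.image_insert_eq, Set.union_insert]
      have hcard := ncard_union_image_le Y z i
      rw [hset]
      refine h.exchange (by omega) (ih (by omega)) ?_
      rw [← Set.insert_union]
      exact (hz i (by omega)).2
  have hcard := ncard_union_image_le Y z g
  refine ⟨Y ∪ z '' {j | j < g}, b, fun i => c' i, hcard.trans (by omega), ?_, hbz g le_rfl, ?_, ?_⟩
  · have hlt : ∀ i < g, ∀ j < i, c' i ≠ c' j := by
      intro i hi j hj hij
      have h6 := T.dcl_mono (B := insert b Y ∪ z '' {k | k < i})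
        (Set.insert_subset (Or.inr ⟨j, hj, rfl⟩) Set.subset_union_left) (hc1 j (hj.trans hi))
      rw [← hij] at h6
      have h7 := h.mem_dcl_insert_comm (by omega) (hc2 i hi) (hc1 i hi)
      have hcard2 := ncard_union_image_le (insert b Y) z i
      exact (hz i hi).2 (T.dcl_insert_subset h6
        (Set.subset_union_left.trans (T.subset_dcl _)) (by omega) h7)
    intro i j hij
    rcases lt_trichotomy i j with hlt' | heq | hlt'
    · exact absurd hij.symm (hlt j j.2 i hlt')
    · exact heq
    · exact absurd hij (hlt i i.2 j hlt')
  · intro i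
    refine T.dcl_mono ?_ (hc1 i i.2)
    rw [Set.insert_comm]
    exact Set.insert_subset_insert (hYz i i.2)
  · intro i
    exact T.dcl_mono (Set.insert_subset_insert (hYz i i.2)) (hc3 i i.2)

/-- A nontrivial definable difference. -/
theorem Large.exists_definable_difference [Finite V] (h : T.Large K t) {s g L : ℕ}
    (hs : 2 * s + g + 2 * L + 3 ≤ t) (hV : Nat.card V < (Nat.card S).choose s)
    (hg : Nat.card V < g ^ L) :
    ∃ (e : Set S) (b b' : S), e.ncard ≤ 2 * L ∧ b ∉ T.dcl e ∧ b' ≠ b ∧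
      vec b' - vec b ∈ AddSubgroup.closure (vec '' e) := by
  classical
  have := Fintype.ofFinite V
  have hd := h.depth
  obtain ⟨Y, b, c, hY, hinj, hb, hc1, hc2⟩ := h.exists_interdefinable (s := s) (g := g)
    (by omega) hV
  obtain ⟨z, hz⟩ := h.exists_independent hb L (by omega)
  have hcopy : ∀ i < L, ∃ c' : Fin g → S,
      T.relOver Y (Sum.elim (fun _ : Unit => b) c) (Sum.elim (fun _ => z i) c') := by
    intro i hi
    exact T.exists_ext_over c (by simp; omega) (hz i hi).1
  have : Nonempty S := ⟨b⟩
  choose! c' hc' using hcopy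
  have hinj' : ∀ i < L, Function.Injective (c' i) := by
    intro i hi j k hjk
    exact hinj (T.eq_of_rel (T.symm (hc' i hi)) (i := Sum.inr (Sum.inr j))
      (j := Sum.inr (Sum.inr k)) hjk)
  have tr : ∀ i < L, ∀ k (J : Set (Unit ⊕ Fin g)),
      (Sum.elim (fun _ : Unit => b) c) k ∈ T.dcl (Y ∪ (Sum.elim (fun _ : Unit => b) c) '' J) ↔
      (Sum.elim (fun _ : Unit => z i) (c' i)) k ∈
        T.dcl (Y ∪ (Sum.elim (fun _ : Unit => z i) (c' i)) '' J) :=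
    fun i hi k J => T.mem_dcl_image_iff (hc' i hi) k J (by simp; omega)
  have hc3 : ∀ i < L, ∀ j, c' i j ∈ T.dcl (insert (z i) Y) := by
    intro i hi j
    have := (tr i hi (Sum.inr j) {Sum.inl ()}).1 (by simpa using hc1 j)
    simpa using this
  have hc4 : ∀ i < L, ∀ j, z i ∈ T.dcl (insert (c' i j) Y) := by
    intro i hi j
    have := (tr i hi (Sum.inl ()) {Sum.inr j}).1 (by simpa using hc2 j)
    simpa using this
  -- Each of L independent conjugates of b carries g interdefinable elements. Choosing one from each
  -- group gives g^L > |V| sums, so two choices have the same sum.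
  obtain ⟨f, f', hne, heq⟩ := Fintype.exists_ne_map_eq_of_card_lt
    (fun f : Fin L → Fin g => ∑ i : Fin L, vec (c' i (f i))) (by
      rw [← Nat.card_eq_fintype_card]
      simpa using hg)
  -- At the last index where the choices differ, the difference of the two chosen points is a
  -- combination of points of earlier groups.
  obtain ⟨i0, hi0, hmax⟩ : ∃ i0, f i0 ≠ f' i0 ∧ ∀ i, i0 < i → f i = f' i := by
    have hnon : (Finset.univ.filter fun i => f i ≠ f' i).Nonempty := by
      obtain ⟨i, hi⟩ := Function.ne_iff.1 hne
      exact ⟨i, by simpa using hi⟩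
    refine ⟨_, (Finset.mem_filter.1 (Finset.max'_mem _ hnon)).2, fun i hi => ?_⟩
    by_contra hcon
    exact absurd (Finset.le_max' _ i (by simpa using hcon)) (not_le.2 hi)
  let E : Set S := (fun i : Fin L => c' i (f i)) '' {i : Fin L | i < i0} ∪
    (fun i : Fin L => c' i (f' i)) '' {i : Fin L | i < i0}
  have hi0L : {i : Fin L | i < i0}.ncard ≤ L := by
    refine (Set.ncard_le_ncard (Set.subset_univ _) (Set.toFinite _)).trans ?_
    simp
  have hE : E.ncard ≤ 2 * L := by
    refine (Set.ncard_union_le _ _).trans ?_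
    have h1 := Set.ncard_image_le (f := fun i : Fin L => c' i (f i))
      (Set.toFinite {i : Fin L | i < i0})
    have h2 := Set.ncard_image_le (f := fun i : Fin L => c' i (f' i))
      (Set.toFinite {i : Fin L | i < i0})
    omega
  refine ⟨E, c' i0 (f i0), c' i0 (f' i0), hE, ?_, fun hcon => hi0 (hinj' i0 i0.2 hcon).symm, ?_⟩
  -- The earlier groups are definable over Y and the earlier z_i. If the chosen point were definable
  -- over them, so would be z_{i0}, against independence.
  · intro hcon
    have hcard := ncard_union_image_le Y z i0
    have hsub : E ⊆ T.dcl (Y ∪ z '' {j | j < (i0 : ℕ)}) := by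
      have hi : ∀ i : Fin L, i < i0 → insert (z i) Y ⊆ Y ∪ z '' {j | j < (i0 : ℕ)} := fun i hi =>
        Set.insert_subset (Or.inr ⟨i, hi, rfl⟩) Set.subset_union_left
      rintro _ (⟨i, hlt, rfl⟩ | ⟨i, hlt, rfl⟩)
      · exact T.dcl_mono (hi i hlt) (hc3 i i.2 _)
      · exact T.dcl_mono (hi i hlt) (hc3 i i.2 _)
    have hlt := i0.2
    have h1 := T.dcl_subset_of_subset hsub (by omega) hcon
    exact (hz i0 i0.2).2 (T.dcl_insert_subset h1
      (Set.subset_union_left.trans (T.subset_dcl _)) (by omega) (hc4 i0 i0.2 _))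
  · have h1 : vec (c' i0 (f' i0)) - vec (c' i0 (f i0)) =
        ∑ i ∈ Finset.univ.erase i0, (vec (c' i (f i)) - vec (c' i (f' i))) := by
      rw [Finset.sum_sub_distrib, Finset.sum_erase_eq_sub (Finset.mem_univ _),
        Finset.sum_erase_eq_sub (Finset.mem_univ _), heq]
      abel
    rw [h1]
    refine AddSubgroup.sum_mem _ fun i hi => ?_
    rcases lt_or_gt_of_ne (Finset.ne_of_mem_erase hi) with hlt | hlt
    · exact AddSubgroup.sub_mem _
        (AddSubgroup.subset_closure ⟨_, Or.inl ⟨i, hlt, rfl⟩, rfl⟩)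
        (AddSubgroup.subset_closure ⟨_, Or.inr ⟨i, hlt, rfl⟩, rfl⟩)
    · rw [hmax i hlt, sub_self]
      exact AddSubgroup.zero_mem _

end TupleScheme

end PScheme

/-! ### From a definable difference to small doubling. -/

namespace PScheme

/-- The set of pairs of elements of `X` with a given difference. -/
def diffPairs {V : Type} [AddCommGroup V] (X : Set V) (z : V) : Set (V × V) :=
  {p | p.1 ∈ X ∧ p.2 ∈ X ∧ p.2 - p.1 = z}

/-- There are few popular differences. -/
theorem ncard_popular_mul_le {V : Type} [AddCommGroup V] [Finite V] (X : Set V) (n Q : ℕ) :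
    {z | n ≤ Q * (diffPairs X z).ncard}.ncard * n ≤ Q * X.ncard ^ 2 := by
  classical
  set P := (Set.toFinite {z | n ≤ Q * (diffPairs X z).ncard}).toFinset with hP
  rw [Set.ncard_eq_toFinset_card _ (Set.toFinite _), ← hP]
  let f : V → Set (X × X) := fun z => {p | (p.2 : V) - p.1 = z}
  have hf : ∀ z, (diffPairs X z).ncard = (f z).ncard := by
    intro z
    refine (Set.ncard_congr (fun p _ => ((p.1 : V), (p.2 : V))) ?_ ?_ ?_).symm
    · intro p hp
      exact ⟨p.1.2, p.2.2, hp⟩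
    · intro p q _ _ hpq
      rw [Prod.mk.injEq] at hpq
      exact Prod.ext (Subtype.ext hpq.1) (Subtype.ext hpq.2)
    · rintro ⟨p, q⟩ ⟨hp, hq, hpq⟩
      exact ⟨(⟨p, hp⟩, ⟨q, hq⟩), hpq, rfl⟩
  calc P.card * n = ∑ z ∈ P, n := by simp
    _ ≤ ∑ z ∈ P, Q * (f z).ncard := by
      refine Finset.sum_le_sum fun z hz => ?_
      rw [← hf]
      simpa [hP] using hz
    _ = Q * ∑ z ∈ P, (f z).ncard := by rw [Finset.mul_sum]
    _ ≤ Q * Nat.card (X × X) := by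
      refine Nat.mul_le_mul_left _ (TupleScheme.sum_ncard_le_of_pairwise_disjoint P f ?_)
      intro x _ y _ hxy
      rw [Set.disjoint_left]
      intro p hp hp'
      exact hxy ((show _ = x from hp).symm.trans hp')
    _ = Q * X.ncard ^ 2 := by rw [Nat.card_prod, Nat.card_coe_set_eq, sq]

theorem ncard_pair_le {S : Type} (x y : S) : ({x, y} : Set S).ncard ≤ 2 := by
  have := Set.ncard_insert_le x {y}
  rwa [Set.ncard_singleton] at this

namespace TupleScheme

variable {S V : Type} [AddCommGroup V] {vec : S → V} {m : ℕ} {T : TupleScheme vec m} {K t : ℕ}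
  [Finite S] [Finite V]

/-- An automorphism fixing y and y' fixes their difference. So every conjugate of w over them starts
a pair with that same difference, and the class of w is large. -/
theorem Large.card_le_mul_diffPairs (h : T.Large K t) (ht : 2 ≤ t) {y y' w w' : S}
    (hw : w ∉ T.dcl {y, y'}) (hd : vec w' - vec w = vec y' - vec y) :
    Nat.card S ≤ K ^ 3 * (diffPairs (Set.range vec) (vec y' - vec y)).ncard := by
  have hdepth := h.depth
  have h2 : ({y, y'} : Set S).ncard ≤ 2 := ncard_pair_le _ _
  refine (h.homogeneous _ (by omega) w hw).trans ?_
  refine Nat.mul_le_mul (Nat.pow_le_pow_right (by have := h.two_le; omega) (by omega)) ?_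
  have key : ∀ x ∈ T.cls {y, y'} w, ∃ x' : S, vec x' - vec x = vec y' - vec y := by
    intro x hx
    obtain ⟨x', hx'⟩ := T.exists_ext_over (fun _ : Unit => w') (by simp; omega) hx
    obtain ⟨φ, hφ, hφ'⟩ := T.exists_aut hx'
    refine ⟨x' (), ?_⟩
    have h3 := hφ' (Sum.inl ())
    have h4 := hφ' (Sum.inr ())
    simp only [Sum.elim_inl, Sum.elim_inr] at h3 h4
    rw [← h3, ← h4, ← map_sub, hd, hφ]
    exact AddSubgroup.sub_mem _ (AddSubgroup.subset_closure ⟨y', by simp, rfl⟩)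
      (AddSubgroup.subset_closure ⟨y, by simp, rfl⟩)
  have : Nonempty S := ⟨w⟩
  choose! g hg using key
  refine Set.ncard_le_ncard_of_injOn (fun x => (vec x, vec (g x))) ?_ ?_ (Set.toFinite _)
  · intro x hx
    exact ⟨⟨x, rfl⟩, ⟨g x, rfl⟩, hg x hx⟩
  · intro x _ y _ hxy
    exact T.inj (Prod.mk.inj hxy).1

/-- Passing to a class of small doubling. -/
theorem Large.exists_small_doubling (h : T.Large K t) {t' : ℕ} (ht : 2 * t' + 4 ≤ t) {e : Set S}
    {b b' : S} (he : e.ncard ≤ t) (hb : b ∉ T.dcl e) (hne : b' ≠ b)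
    (hmem : vec b' - vec b ∈ AddSubgroup.closure (vec '' e)) :
    ∃ (D : Set S) (T' : TupleScheme (fun x : D => vec x) (m - 2)), T'.Large (K ^ 2) t' ∧
      {z | ∃ x y : D, z = vec y - vec x}.ncard ≤ K ^ 12 * Nat.card D ∧
      Nat.card S ≤ K ^ 2 * Nat.card D := by
  classical
  have hdepth := h.depth
  have hK := h.two_le
  set n := Nat.card S with hn
  have hnpos : 0 < n := lt_of_le_of_lt (Nat.zero_le _) h.card
  have hpair : ∀ x y : S, ({x, y} : Set S).ncard ≤ 2 := fun x y => ncard_pair_le _ _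
  have hKle : ∀ {i j : ℕ}, i ≤ j → K ^ i ≤ K ^ j := fun hij => Nat.pow_le_pow_right (by omega) hij
  -- The difference b' - b lies in the group of the constants e, so conjugating b and b' over e
  -- preserves it. A conjugate w that is not definable over b and b' makes the difference popular.
  obtain ⟨w, hwe, hw⟩ := h.exists_mem_cls_notMem_dcl (C := {b, b'}) he
    ((hpair _ _).trans (by omega)) hb
  obtain ⟨w'', hw''⟩ := T.exists_ext_over (fun _ : Unit => b') (by simp; omega) hwe
  set w' := w'' () with hw'
  have hwd : vec w' - vec w = vec b' - vec b := by
    obtain ⟨φ, hφ, hφ'⟩ := T.exists_aut hw''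
    have h3 := hφ' (Sum.inl ())
    have h4 := hφ' (Sum.inr ())
    simp only [Sum.elim_inl, Sum.elim_inr] at h3 h4
    rw [hw', ← h3, ← h4, ← map_sub, hφ _ hmem]
  set Z : Set V := {z | n ≤ K ^ 3 * (diffPairs (Set.range vec) z).ncard} with hZdef
  have hZ : Z.ncard ≤ K ^ 3 * n := by
    have h1 := ncard_popular_mul_le (Set.range vec) n (K ^ 3)
    rw [← Set.image_univ, T.inj.injOn.ncard_image, Set.ncard_univ, ← hn, Set.image_univ, sq,
      ← mul_assoc] at h1
    exact Nat.le_of_mul_le_mul_right h1 hnpos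
  -- Popularity depends only on the type of the pair: carry (w, w') along the relation.
  have hpop : ∀ y y' : S, T.rel ![b, b'] ![y, y'] → vec y' - vec y ∈ Z := by
    intro y y' hy
    obtain ⟨u, hu⟩ := T.exists_ext ![w, w'] (by simp; omega) hy
    refine h.card_le_mul_diffPairs (by omega) (w := u 0) (w' := u 1) ?_ ?_
    · have h5 := (T.mem_dcl_image_iff (T.relOver_empty.2 hu) (Sum.inr 0)
        {Sum.inl 0, Sum.inl 1} (by simp; omega)).2
      simp only [Set.empty_union, Set.image_insert_eq, Set.image_singleton, Sum.elim_inr,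
        Sum.elim_inl, Matrix.cons_val_zero, Matrix.cons_val_one] at h5
      exact fun hcon => hw (h5 hcon)
    · obtain ⟨φ, hφ⟩ := T.lin hu
      have h0 := hφ (Sum.inl 0)
      have h1 := hφ (Sum.inl 1)
      have h2 := hφ (Sum.inr 0)
      have h3 := hφ (Sum.inr 1)
      simp only [Sum.elim_inr, Sum.elim_inl, Matrix.cons_val_zero, Matrix.cons_val_one] at h0 h1 h2 h3
      rw [← h0, ← h1, ← h2, ← h3, ← map_sub, ← map_sub, hwd]
  have hbb : b' ∉ T.dcl {b} := by
    intro hcon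
    refine hne (T.eq_of_mem_cls_of_mem_dcl (A := ∅) (by simp; omega) (h.transitive b b') ?_)
    rwa [insert_empty_eq]
  have hb1 : ({b} : Set S).ncard = 1 := Set.ncard_singleton _
  set B := T.cls {b} b' with hB
  have hBcard : n ≤ K ^ 2 * B.ncard := by
    have := h.homogeneous {b} (by omega) b' hbb
    rwa [hb1] at this
  have hBb : ∀ c ∈ B, c ∉ T.dcl {b} := fun c hc hcon => hbb ((mem_dcl_iff_of_mem_cls hc).1 hcon)
  have hBrel : ∀ c ∈ B, T.rel ![b, b'] ![b, c] := by
    intro c hc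
    refine T.rel_of ![Sum.inl ⟨b, rfl⟩, Sum.inr ()] hc ?_ ?_ <;>
    · intro i
      fin_cases i <;> rfl
  -- For y conjugate to b over c and c', the pairs (y, c) and (y, c') have the type of (b, b').
  -- Hence c' - c = (c' - y) - (c - y) is a difference of elements of Z in many ways.
  have hBB : ∀ c ∈ B, ∀ c' ∈ B, c' ∉ T.dcl {b, c} →
      n ≤ K ^ 3 * (diffPairs Z (vec c' - vec c)).ncard := by
    intro c hc c' hc' hcc
    have hbc : b ∉ T.dcl {c} := by
      have := h.exchange (A := ∅) (a := b) (b := c) (by simp; omega)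
        (by rw [h.dcl_empty]; exact Set.notMem_empty _) (by rw [insert_empty_eq]; exact hBb c hc)
      rwa [insert_empty_eq] at this
    have hbcc := h.exchange (A := {c}) (a := b) (b := c') (by simp; omega) hbc hcc
    have h1 := h.homogeneous {c', c} ((hpair _ _).trans (by omega)) b hbcc
    refine h1.trans (Nat.mul_le_mul (hKle (by have := hpair c' c; omega)) ?_)
    refine Set.ncard_le_ncard_of_injOn (fun y => (vec c - vec y, vec c' - vec y)) ?_ ?_
      (Set.toFinite _)
    · intro y hy
      have hsub : ∀ x ∈ ({c', c} : Set S), x ∈ B → vec x - vec y ∈ Z := by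
        intro x hx hxB
        refine hpop y x (T.trans (hBrel x hxB) ?_)
        refine T.rel_of ![Sum.inr (), Sum.inl ⟨x, hx⟩] hy ?_ ?_ <;>
        · intro i
          fin_cases i <;> rfl
      exact ⟨hsub c (by simp) hc, hsub c' (by simp) hc', by simp⟩
    · intro y _ y' _ hyy
      exact T.inj (sub_right_injective (Prod.mk.inj hyy).1)
  set P : Set V := {z | n ≤ K ^ 3 * (diffPairs Z z).ncard} with hPdef
  have hP : P.ncard ≤ K ^ 9 * n := by
    have h1 := ncard_popular_mul_le Z n (K ^ 3)
    have h2 : K ^ 3 * Z.ncard ^ 2 ≤ (K ^ 9 * n) * n := by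
      calc K ^ 3 * Z.ncard ^ 2 ≤ K ^ 3 * (K ^ 3 * n) ^ 2 := by gcongr
        _ = (K ^ 9 * n) * n := by ring
    exact Nat.le_of_mul_le_mul_right (h1.trans h2) hnpos
  -- The remaining pairs have c' definable over b and c, with at most K^3 choices for each c.
  set Q : Set V := ⋃ c : S, (fun c' => vec c' - vec c) '' T.dcl {b, c} with hQdef
  have hQ : Q.ncard ≤ K ^ 3 * n := by
    have := Fintype.ofFinite S
    have h1 : Q.ncard ≤ ∑ c : S, ((fun c' => vec c' - vec c) '' T.dcl {b, c}).ncard := by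
      have h2 : Q = ⋃ c ∈ (Finset.univ : Finset S), (fun c' => vec c' - vec c) '' T.dcl {b, c} := by
        simp [hQdef]
      rw [h2]
      exact Finset.set_ncard_biUnion_le _ _
    refine h1.trans ?_
    have h3 : ∀ c ∈ (Finset.univ : Finset S),
        ((fun c' => vec c' - vec c) '' T.dcl {b, c}).ncard ≤ K ^ 3 := by
      intro c _
      refine (Set.ncard_image_le (Set.toFinite _)).trans ?_
      refine (h.ncard_dcl_le ((hpair b c).trans (by omega))).trans (hKle ?_)
      have := hpair b c
      omega
    refine (Finset.sum_le_card_nsmul _ _ _ h3).trans ?_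
    rw [Finset.card_univ, smul_eq_mul, mul_comm, ← Nat.card_eq_fintype_card]
  refine ⟨B, (T.localize {b} b').weaken (by omega), ⟨T.localize_transitive _ _, ?_, ?_, ?_, ?_⟩,
    ?_, ?_⟩
  · intro A hA s hs
    have hA' : (Subtype.val '' A : Set S).ncard = A.ncard :=
      Subtype.val_injective.injOn.ncard_image
    have hAB := Set.ncard_union_le {b} (Subtype.val '' A)
    rw [hA', hb1] at hAB
    change s ∉ (T.localize {b} b').dcl A at hs
    rw [mem_dcl_localize] at hs
    change _ ≤ _ * ((T.localize {b} b').cls A s).ncard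
    rw [ncard_cls_localize, Nat.card_coe_set_eq]
    have h1 : B.ncard ≤ n := by
      rw [hn, ← Set.ncard_univ]
      exact Set.ncard_le_ncard (Set.subset_univ _) (Set.toFinite _)
    refine h1.trans ((h.homogeneous _ (by omega) _ hs).trans (Nat.mul_le_mul_right _ ?_))
    rw [← pow_mul]
    exact hKle (by omega)
  · nlinarith
  · omega
  · rw [Nat.card_coe_set_eq]
    have h1 := h.pow_lt (k := 2 + 2 * (8 * t' + 8)) (by omega)
    rw [pow_add] at h1
    rw [← pow_mul]
    exact Nat.lt_of_mul_lt_mul_left (h1.trans_le hBcard)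
  · have hsub : {z | ∃ x y : B, z = vec y - vec x} ⊆ P ∪ Q := by
      rintro _ ⟨⟨c, hc⟩, ⟨c', hc'⟩, rfl⟩
      by_cases hcc : c' ∈ T.dcl {b, c}
      · exact Or.inr (Set.mem_iUnion.2 ⟨c, c', hcc, rfl⟩)
      · exact Or.inl (hBB c hc c' hc' hcc)
    rw [Nat.card_coe_set_eq]
    calc _ ≤ (P ∪ Q).ncard := Set.ncard_le_ncard hsub (Set.toFinite _)
      _ ≤ P.ncard + Q.ncard := Set.ncard_union_le _ _
      _ ≤ K ^ 9 * n + K ^ 9 * n := add_le_add hP (hQ.trans (Nat.mul_le_mul_right _ (hKle (by omega))))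
      _ = 2 * (K ^ 9 * n) := by ring
      -- The factor 2 is absorbed into K, and n ≤ K^2·|B|.
      _ ≤ K * (K ^ 9 * (K ^ 2 * B.ncard)) := by gcongr
      _ = K ^ 12 * B.ncard := by ring
  · rw [Nat.card_coe_set_eq]
    exact hBcard

end TupleScheme

end PScheme

/-! ### Small doubling in groups of bounded exponent. -/

namespace PScheme

open scoped Pointwise

section Additive

variable {S V : Type} [AddCommGroup V]

/-- The sums of `J` differences of vectors indexed by elements of `X`. -/
def diffSum (vec : S → V) (X : Set S) (J : ℕ) : Set V :=
  {z | ∃ a b : Fin J → S, (∀ i, a i ∈ X ∧ b i ∈ X) ∧ z = ∑ i, (vec (a i) - vec (b i))}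

variable {vec : S → V} {X : Set S}

theorem diffSum_add {J J' : ℕ} {z z' : V} (h : z ∈ diffSum vec X J) (h' : z' ∈ diffSum vec X J') :
    z + z' ∈ diffSum vec X (J + J') := by
  obtain ⟨a, b, hab, rfl⟩ := h
  obtain ⟨a', b', hab', rfl⟩ := h'
  refine ⟨Fin.append a a', Fin.append b b', ?_, ?_⟩
  · intro i
    refine Fin.addCases (fun i => ?_) (fun i => ?_) i
    · simpa using hab i
    · simpa using hab' i
  · rw [Fin.sum_univ_add]
    simp

theorem zero_mem_diffSum (hX : X.Nonempty) (J : ℕ) : (0 : V) ∈ diffSum vec X J := by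
  obtain ⟨x, hx⟩ := hX
  exact ⟨fun _ => x, fun _ => x, fun _ => ⟨hx, hx⟩, by simp⟩

theorem diffSum_mono (hX : X.Nonempty) {J J' : ℕ} (h : J ≤ J') :
    diffSum vec X J ⊆ diffSum vec X J' := by
  intro z hz
  obtain ⟨k, rfl⟩ := Nat.exists_eq_add_of_le h
  have := diffSum_add hz (zero_mem_diffSum (vec := vec) hX k)
  rwa [add_zero] at this

theorem neg_mem_diffSum {J : ℕ} {z : V} (h : z ∈ diffSum vec X J) : -z ∈ diffSum vec X J := by
  obtain ⟨a, b, hab, rfl⟩ := h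
  refine ⟨b, a, fun i => (hab i).symm, ?_⟩
  rw [← Finset.sum_neg_distrib]
  exact Finset.sum_congr rfl fun i _ => neg_sub _ _

theorem sub_mem_diffSum {x y : S} (hx : x ∈ X) (hy : y ∈ X) : vec x - vec y ∈ diffSum vec X 1 :=
  ⟨fun _ => x, fun _ => y, fun _ => ⟨hx, hy⟩, by simp⟩

theorem nsmul_mem_diffSum {J : ℕ} {z : V} (h : z ∈ diffSum vec X J) (k : ℕ) :
    k • z ∈ diffSum vec X (k * J) := by
  induction k with
  | zero =>
    rw [zero_smul, zero_mul]
    exact ⟨Fin.elim0, Fin.elim0, fun i => i.elim0, by simp⟩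
  | succ k ih =>
    rw [succ_nsmul, add_mul, one_mul]
    exact diffSum_add ih h

/-- The subgroup generated by the differences of the vectors indexed by elements of `X`. -/
def diffGroup (vec : S → V) (X : Set S) : AddSubgroup V :=
  AddSubgroup.closure {z | ∃ x ∈ X, ∃ y ∈ X, z = vec x - vec y}

theorem sub_mem_diffGroup {x y : S} (hx : x ∈ X) (hy : y ∈ X) :
    vec x - vec y ∈ diffGroup vec X :=
  AddSubgroup.subset_closure ⟨x, hx, y, hy, rfl⟩

theorem diffGroup_mono {Y : Set S} (h : X ⊆ Y) : diffGroup vec X ≤ diffGroup vec Y :=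
  AddSubgroup.closure_mono fun _ ⟨x, hx, y, hy, hz⟩ => ⟨x, h hx, y, h hy, hz⟩

theorem diffSum_subset_diffGroup (J : ℕ) : diffSum vec X J ⊆ diffGroup vec X := by
  rintro z ⟨a, b, hab, rfl⟩
  exact AddSubgroup.sum_mem _ fun i _ => sub_mem_diffGroup (hab i).1 (hab i).2

/-- If `J + 1` differences sum to a sum of `J` differences, then the sums of `J` differences are the
generated subgroup. -/
theorem diffGroup_eq_diffSum (hX : X.Nonempty) {J : ℕ}
    (h : diffSum vec X (J + 1) ⊆ diffSum vec X J) : (diffGroup vec X : Set V) = diffSum vec X J := by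
  refine Set.Subset.antisymm ?_ (diffSum_subset_diffGroup J)
  have hk : ∀ k, diffSum vec X k ⊆ diffSum vec X J := by
    intro k
    induction k with
    | zero => exact diffSum_mono hX (Nat.zero_le _)
    | succ k ih =>
      rintro z ⟨a, b, hab, rfl⟩
      rw [Fin.sum_univ_castSucc]
      refine h (diffSum_add (ih ⟨fun i => a i.castSucc, fun i => b i.castSucc,
        fun i => hab _, rfl⟩) (sub_mem_diffSum (hab _).1 (hab _).2))
  intro z hz
  induction hz using AddSubgroup.closure_induction with
  | mem z hz =>
    obtain ⟨x, hx, y, hy, rfl⟩ := hz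
    exact hk 1 (sub_mem_diffSum hx hy)
  | zero => exact zero_mem_diffSum hX J
  | add x y _ _ hx hy => exact hk _ (diffSum_add hx hy)
  | neg x _ hx => exact neg_mem_diffSum hx

/-- Elements of a finitely generated group of exponent `p`. -/
theorem mem_closure_finset_exponent {p : ℕ} (hp : 0 < p) (hV : ∀ z : V, p • z = 0) (F : Finset V)
    {z : V} (hz : z ∈ AddSubgroup.closure (F : Set V)) :
    ∃ c : V → ℕ, (∀ f, c f < p) ∧ z = ∑ f ∈ F, c f • f := by
  classical
  have hmod : ∀ (k : ℕ) (z : V), (k % p) • z = k • z := by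
    intro k z
    conv_rhs => rw [← Nat.mod_add_div k p, add_smul, mul_comm, mul_smul, hV, smul_zero, add_zero]
  suffices ∃ c : V → ℕ, z = ∑ f ∈ F, c f • f by
    obtain ⟨c, rfl⟩ := this
    exact ⟨fun f => c f % p, fun f => Nat.mod_lt _ hp, Finset.sum_congr rfl fun f _ =>
      (hmod _ _).symm⟩
  induction hz using AddSubgroup.closure_induction with
  | mem z hz =>
    refine ⟨Pi.single z 1, ?_⟩
    rw [Finset.sum_eq_single z]
    · simp
    · intro f _ hf
      simp [Pi.single_eq_of_ne hf]
    · intro h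
      exact absurd hz h
  | zero => exact ⟨0, by simp⟩
  | add x y _ _ hx hy =>
    obtain ⟨c, rfl⟩ := hx
    obtain ⟨c', rfl⟩ := hy
    refine ⟨c + c', ?_⟩
    rw [← Finset.sum_add_distrib]
    exact Finset.sum_congr rfl fun f _ => (add_smul _ _ _).symm
  | neg x _ hx =>
    obtain ⟨c, rfl⟩ := hx
    refine ⟨fun f => (p - 1) * c f, ?_⟩
    rw [← Finset.sum_neg_distrib]
    refine Finset.sum_congr rfl fun f _ => ?_
    rw [neg_eq_iff_add_eq_zero, mul_smul, ← succ_nsmul', Nat.sub_add_cancel hp, hV]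

theorem card_closure_le {p : ℕ} (hp : 0 < p) (hV : ∀ z : V, p • z = 0) (F : Finset V) :
    Nat.card (AddSubgroup.closure (F : Set V)) ≤ p ^ F.card := by
  classical
  let g : (F → Fin p) → V := fun c => ∑ f : F, (c f : ℕ) • (f : V)
  have hsub : (AddSubgroup.closure (F : Set V) : Set V) ⊆ Set.range g := by
    intro z hz
    obtain ⟨c, hc, rfl⟩ := mem_closure_finset_exponent hp hV F hz
    refine ⟨fun f => ⟨c f, hc f⟩, ?_⟩
    exact Finset.sum_coe_sort F fun f => c f • f
  have h1 : Nat.card (Set.range g) ≤ p ^ F.card := by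
    refine (Finite.card_range_le g).trans ?_
    simp
  exact (Nat.card_mono (Set.finite_range g) hsub).trans h1

/-- Ruzsa's theorem in groups of bounded exponent. -/
theorem diffGroup_of_small_doubling [Finite S] (hinj : Function.Injective vec) {p κ : ℕ}
    (hp : 0 < p) (hV : ∀ z : V, p • z = 0) (hX : X.Nonempty)
    (h : {z | ∃ x ∈ X, ∃ y ∈ X, z = vec x - vec y}.ncard ≤ κ * X.ncard) :
    Nat.card (diffGroup vec X) ≤ p ^ κ ^ 5 * (κ * X.ncard) ∧
      (diffGroup vec X : Set V) = diffSum vec X (2 * p * κ ^ 5 + 1) := by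
  classical
  set A : Finset V := (Set.toFinite X).toFinset.image vec with hA
  have hmemA : ∀ {z}, z ∈ A ↔ ∃ x ∈ X, vec x = z := by simp [hA]
  have hAcard : A.card = X.ncard := by
    rw [hA, Finset.card_image_of_injective _ hinj, ← Set.ncard_eq_toFinset_card]
  have hAne : A.Nonempty := by
    obtain ⟨x, hx⟩ := hX
    exact ⟨vec x, hmemA.2 ⟨x, hx, rfl⟩⟩
  have hD : {z | ∃ x ∈ X, ∃ y ∈ X, z = vec x - vec y} = ((A - A : Finset V) : Set V) := by
    ext z
    simp only [Set.mem_ofPred_eq, Finset.coe_sub, Set.mem_sub, Finset.mem_coe, hmemA]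
    constructor
    · rintro ⟨x, hx, y, hy, rfl⟩
      exact ⟨_, ⟨x, hx, rfl⟩, _, ⟨y, hy, rfl⟩, rfl⟩
    · rintro ⟨_, ⟨x, hx, rfl⟩, _, ⟨y, hy, rfl⟩, rfl⟩
      exact ⟨x, hx, y, hy, rfl⟩
  have hDcard : (A - A).card ≤ κ * A.card := by
    rw [hAcard, ← Set.ncard_coe_finset, ← hD]
    exact h
  have hpos : 0 < A.card := hAne.card_pos
  have hPl : ((2 • A - 2 • A) + A).card ≤ κ ^ 5 * A.card := by
    have h1 := Finset.pluennecke_ruzsa_inequality_nsmul_sub_nsmul_sub hAne A 3 2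
    have h2 : 2 • A - 2 • A + A = 3 • A - 2 • A := by
      rw [sub_add_eq_add_sub, ← succ_nsmul]
    rw [h2]
    have h3 : ((A - A).card / A.card : ℚ≥0) ≤ κ := by
      rw [div_le_iff₀ (by exact_mod_cast hpos)]
      exact_mod_cast hDcard
    have h4 : ((3 • A - 2 • A).card : ℚ≥0) ≤ (κ : ℚ≥0) ^ 5 * A.card := by
      refine h1.trans ?_
      gcongr
    exact_mod_cast h4
  -- Write D = A - A. Ruzsa covering gives D + D ⊆ F + D with |F| ≤ κ^5, so the group generated by F
  -- plus D is closed under addition and is all of `diffGroup`.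
  obtain ⟨F, hF, hFcard', hcov⟩ := Finset.ruzsa_covering_add (K := ((κ ^ 5 : ℕ) : ℝ)) hAne
    (by exact_mod_cast hPl)
  have hFcard : F.card ≤ κ ^ 5 := by exact_mod_cast hFcard'
  have hDD : (A - A) + (A - A) = 2 • A - 2 • A := by
    rw [sub_add_sub_comm, two_nsmul]
  have hmemD : ∀ {z}, z ∈ A - A → z ∈ diffSum vec X 1 := by
    intro z hz
    have : z ∈ {z | ∃ x ∈ X, ∃ y ∈ X, z = vec x - vec y} := by
      rw [hD]
      exact hz
    obtain ⟨x, hx, y, hy, rfl⟩ := this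
    exact sub_mem_diffSum hx hy
  have hzero : (0 : V) ∈ A - A := by
    obtain ⟨a, ha⟩ := hAne
    exact Finset.mem_sub.2 ⟨a, ha, a, ha, sub_self a⟩
  have hneg : ∀ {z}, z ∈ A - A → -z ∈ A - A := by
    intro z hz
    obtain ⟨a, ha, b, hb, rfl⟩ := Finset.mem_sub.1 hz
    exact Finset.mem_sub.2 ⟨b, hb, a, ha, (neg_sub _ _).symm⟩
  have hdecomp : ∀ z ∈ diffGroup vec X, ∃ f ∈ AddSubgroup.closure (F : Set V), ∃ d ∈ A - A,
      z = f + d := by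
    intro z hz
    unfold diffGroup at hz
    rw [hD] at hz
    induction hz using AddSubgroup.closure_induction with
    | mem z hz => exact ⟨0, AddSubgroup.zero_mem _, z, hz, (zero_add z).symm⟩
    | zero => exact ⟨0, AddSubgroup.zero_mem _, 0, hzero, (zero_add _).symm⟩
    | add x y _ _ hx hy =>
      obtain ⟨f, hf, d, hd, rfl⟩ := hx
      obtain ⟨f', hf', d', hd', rfl⟩ := hy
      have : d + d' ∈ F + (A - A) := hcov (hDD ▸ Finset.add_mem_add hd hd')
      obtain ⟨f'', hf'', d'', hd'', h5⟩ := Finset.mem_add.1 this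
      refine ⟨f + f' + f'', AddSubgroup.add_mem _ (AddSubgroup.add_mem _ hf hf')
        (AddSubgroup.subset_closure hf''), d'', hd'', ?_⟩
      rw [add_assoc (f + f'), h5]
      abel
    | neg x _ hx =>
      obtain ⟨f, hf, d, hd, rfl⟩ := hx
      exact ⟨-f, AddSubgroup.neg_mem _ hf, -d, hneg hd, neg_add _ _⟩
  refine ⟨?_, ?_⟩
  · have hsub : (diffGroup vec X : Set V) ⊆ (fun q : V × V => q.1 + q.2) ''
        ((AddSubgroup.closure (F : Set V) : Set V) ×ˢ ((A - A : Finset V) : Set V)) := by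
      intro z hz
      obtain ⟨f, hf, d, hd, rfl⟩ := hdecomp z hz
      exact ⟨(f, d), ⟨hf, hd⟩, rfl⟩
    have hfin : (AddSubgroup.closure (F : Set V) : Set V).Finite := by
      classical
      let g : (F → Fin p) → V := fun c => ∑ f : F, (c f : ℕ) • (f : V)
      refine (Set.finite_range g).subset ?_
      intro z hz
      obtain ⟨c, hc, rfl⟩ := mem_closure_finset_exponent hp hV F hz
      exact ⟨fun f => ⟨c f, hc f⟩, Finset.sum_coe_sort F fun f => c f • f⟩
    have hfin2 := hfin.prod (A - A).finite_toSet
    have h6 : (diffGroup vec X : Set V).ncard ≤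
        (AddSubgroup.closure (F : Set V) : Set V).ncard * (A - A).card := by
      refine (Set.ncard_le_ncard hsub (hfin2.image _)).trans ((Set.ncard_image_le hfin2).trans ?_)
      rw [Set.ncard_prod, Set.ncard_coe_finset]
    have h7 := card_closure_le hp hV F
    rw [← hAcard]
    refine le_trans h6 (Nat.mul_le_mul ?_ hDcard)
    rw [← Nat.card_coe_set_eq]
    exact h7.trans (Nat.pow_le_pow_right hp hFcard)
  · refine Set.Subset.antisymm ?_ (diffSum_subset_diffGroup _)
    intro z hz
    obtain ⟨f, hf, d, hd, rfl⟩ := hdecomp z hz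
    refine diffSum_add ?_ (hmemD hd)
    obtain ⟨c, hc, rfl⟩ := mem_closure_finset_exponent hp hV F hf
    -- F lies in D + D, so an element of the group it generates, with coefficients below p, is a sum
    -- of at most 2p|F| differences. One further difference accounts for D.
    have hF2 : ∀ f ∈ F, f ∈ diffSum vec X 2 := by
      intro f hf
      have := hF hf
      rw [← hDD] at this
      obtain ⟨d, hd, d', hd', rfl⟩ := Finset.mem_add.1 this
      exact diffSum_add (hmemD hd) (hmemD hd')
    have h8 : ∀ F' : Finset V, (∀ f ∈ F', f ∈ diffSum vec X 2) →
        ∑ f ∈ F', c f • f ∈ diffSum vec X (2 * p * F'.card) := by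
      intro F'
      induction F' using Finset.induction_on with
      | empty =>
        intro _
        exact zero_mem_diffSum hX _
      | insert f F' hf ih =>
        intro hF'
        rw [Finset.sum_insert hf, Finset.card_insert_of_notMem hf, mul_add, mul_one,
          add_comm (c f • f)]
        refine diffSum_add (ih fun f hf => hF' f (Finset.mem_insert_of_mem hf)) ?_
        refine diffSum_mono hX ?_ (nsmul_mem_diffSum (hF' f (Finset.mem_insert_self _ _)) _)
        have := hc f
        nlinarith
    exact diffSum_mono hX (Nat.mul_le_mul_left _ hFcard) (h8 F hF2)

/-- A set whose differences with most elements of some other set are popular has small doubling. -/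
theorem ncard_sub_le_of_popular [Finite S] (hinj : Function.Injective vec) {Y : Set S} {F : ℕ}
    (hX : X.Nonempty) (hY : Y.Nonempty)
    (h : ∀ x ∈ X, 4 * {y | y ∈ Y ∧
      ¬ (X.ncard ≤ F * {a | a ∈ X ∧ ∃ b ∈ Y, vec b - vec a = vec y - vec x}.ncard ∧
        Y.ncard ≤ F * {a | a ∈ X ∧ ∃ b ∈ Y, vec b - vec a = vec y - vec x}.ncard)}.ncard ≤
      Y.ncard) :
    {z | ∃ x ∈ X, ∃ y ∈ X, z = vec x - vec y}.ncard ≤ 2 * F ^ 2 * X.ncard := by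
  classical
  set pop : V → Prop := fun z => X.ncard ≤ F * {a | a ∈ X ∧ ∃ b ∈ Y, vec b - vec a = z}.ncard ∧
    Y.ncard ≤ F * {a | a ∈ X ∧ ∃ b ∈ Y, vec b - vec a = z}.ncard with hpop
  set P : Set V := {z | pop z ∧ ∃ x ∈ X, ∃ y ∈ Y, z = vec y - vec x} with hP
  set D : Set V := {z | ∃ x ∈ X, ∃ y ∈ X, z = vec x - vec y} with hD
  have hfinP : P.Finite := by
    refine (Set.toFinite ((fun q : S × S => vec q.2 - vec q.1) '' Set.univ)).subset ?_
    rintro z ⟨-, x, -, y, -, rfl⟩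
    exact ⟨(x, y), trivial, rfl⟩
  have hfinD : D.Finite := by
    refine (Set.toFinite ((fun q : S × S => vec q.1 - vec q.2) '' Set.univ)).subset ?_
    rintro z ⟨x, -, y, -, rfl⟩
    exact ⟨(x, y), trivial, rfl⟩
  have hXpos : 0 < X.ncard := (Set.ncard_pos (Set.toFinite _)).2 hX
  have hYpos : 0 < Y.ncard := (Set.ncard_pos (Set.toFinite _)).2 hY
  have hsum : ∑ z ∈ hfinP.toFinset, {a | a ∈ X ∧ ∃ b ∈ Y, vec b - vec a = z}.ncard ≤
      X.ncard * Y.ncard := by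
    have h1 : ∀ z ∈ hfinP.toFinset, {a | a ∈ X ∧ ∃ b ∈ Y, vec b - vec a = z}.ncard ≤
        {q : X × Y | vec q.2 - vec q.1 = z}.ncard := by
      intro z _
      refine Set.ncard_le_ncard_of_injOn (fun a => if h : ∃ q : X × Y, q.1.1 = a ∧
        vec q.2 - vec q.1 = z then h.choose else (⟨hX.some, hX.some_mem⟩, ⟨hY.some, hY.some_mem⟩))
        ?_ ?_ (Set.toFinite _)
      · rintro a ⟨ha, b, hb, hab⟩
        have hex : ∃ q : X × Y, q.1.1 = a ∧ vec q.2 - vec q.1 = z := ⟨(⟨a, ha⟩, ⟨b, hb⟩), rfl, hab⟩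
        simp only [dif_pos hex]
        exact hex.choose_spec.2
      · rintro a ⟨ha, b, hb, hab⟩ a' ⟨ha', b', hb', hab'⟩ haa
        have hex : ∃ q : X × Y, q.1.1 = a ∧ vec q.2 - vec q.1 = z := ⟨(⟨a, ha⟩, ⟨b, hb⟩), rfl, hab⟩
        have hex' : ∃ q : X × Y, q.1.1 = a' ∧ vec q.2 - vec q.1 = z :=
          ⟨(⟨a', ha'⟩, ⟨b', hb'⟩), rfl, hab'⟩
        simp only [dif_pos hex, dif_pos hex'] at haa
        rw [← hex.choose_spec.1, ← hex'.choose_spec.1, haa]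
    refine (Finset.sum_le_sum h1).trans ?_
    refine (TupleScheme.sum_ncard_le_of_pairwise_disjoint _ _ ?_).trans ?_
    · intro z _ z' _ hzz
      rw [Set.disjoint_left]
      intro q hq hq'
      exact hzz ((show _ = z from hq).symm.trans hq')
    · rw [Nat.card_prod, Nat.card_coe_set_eq, Nat.card_coe_set_eq]
  -- The pairs in X × Y are sorted by their difference. A popular difference accounts for at least
  -- |X|/F and at least |Y|/F of them.
  have hPX : P.ncard ≤ F * X.ncard := by
    have h2 : P.ncard * Y.ncard ≤ F * X.ncard * Y.ncard := by
      calc P.ncard * Y.ncard = ∑ z ∈ hfinP.toFinset, Y.ncard := by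
            rw [Finset.sum_const, smul_eq_mul, ← Set.ncard_eq_toFinset_card _ hfinP]
        _ ≤ ∑ z ∈ hfinP.toFinset, F * {a | a ∈ X ∧ ∃ b ∈ Y, vec b - vec a = z}.ncard :=
            Finset.sum_le_sum fun z hz => ((hfinP.mem_toFinset).1 hz).1.2
        _ ≤ F * (X.ncard * Y.ncard) := by
            rw [← Finset.mul_sum]
            exact Nat.mul_le_mul_left _ hsum
        _ = _ := by ring
    exact Nat.le_of_mul_le_mul_right h2 hYpos
  have hPY : P.ncard ≤ F * Y.ncard := by
    have h2 : P.ncard * X.ncard ≤ F * Y.ncard * X.ncard := by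
      calc P.ncard * X.ncard = ∑ z ∈ hfinP.toFinset, X.ncard := by
            rw [Finset.sum_const, smul_eq_mul, ← Set.ncard_eq_toFinset_card _ hfinP]
        _ ≤ ∑ z ∈ hfinP.toFinset, F * {a | a ∈ X ∧ ∃ b ∈ Y, vec b - vec a = z}.ncard :=
            Finset.sum_le_sum fun z hz => ((hfinP.mem_toFinset).1 hz).1.1
        _ ≤ F * (X.ncard * Y.ncard) := by
            rw [← Finset.mul_sum]
            exact Nat.mul_le_mul_left _ hsum
        _ = _ := by ring
    exact Nat.le_of_mul_le_mul_right h2 hXpos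
  -- Write x1 - x2 = (y - x2) - (y - x1). For at least half of the y in Y both terms are popular, so
  -- each difference of X has at least |Y|/2 representations by pairs from P.
  have hrep : ∀ z ∈ hfinD.toFinset, Y.ncard ≤
      2 * {q : P × P | (q.1 : V) - q.2 = z}.ncard := by
    intro z hz
    obtain ⟨x1, hx1, x2, hx2, rfl⟩ := (hfinD.mem_toFinset).1 hz
    have hb1 := h x1 hx1
    have hb2 := h x2 hx2
    set N1 := {y | y ∈ Y ∧ ¬ pop (vec y - vec x1)} with hN1
    set N2 := {y | y ∈ Y ∧ ¬ pop (vec y - vec x2)} with hN2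
    change 4 * N1.ncard ≤ _ at hb1
    change 4 * N2.ncard ≤ _ at hb2
    set G := {y | y ∈ Y ∧ pop (vec y - vec x1) ∧ pop (vec y - vec x2)} with hG
    have hYsub : Y ⊆ G ∪ (N1 ∪ N2) := by
      intro y hy
      by_cases hp1 : pop (vec y - vec x1)
      · by_cases hp2 : pop (vec y - vec x2)
        · exact Or.inl ⟨hy, hp1, hp2⟩
        · exact Or.inr (Or.inr ⟨hy, hp2⟩)
      · exact Or.inr (Or.inl ⟨hy, hp1⟩)
    have h3 := Set.ncard_le_ncard hYsub (Set.toFinite _)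
    have h4 := Set.ncard_union_le G (N1 ∪ N2)
    have h5 := Set.ncard_union_le N1 N2
    have := hfinP.to_subtype
    have hPne : ∀ y : S, y ∈ G → (vec y - vec x2 ∈ P ∧ vec y - vec x1 ∈ P) := fun y hy =>
      ⟨⟨hy.2.2, x2, hx2, y, hy.1, rfl⟩, ⟨hy.2.1, x1, hx1, y, hy.1, rfl⟩⟩
    have h6 : G.ncard ≤ {q : P × P | (q.1 : V) - q.2 = vec x1 - vec x2}.ncard := by
      rw [← Nat.card_coe_set_eq, ← Nat.card_coe_set_eq]
      refine Nat.card_le_card_of_injective (fun y : G => (⟨(⟨vec y - vec x2, (hPne y y.2).1⟩,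
        ⟨vec y - vec x1, (hPne y y.2).2⟩), by
          change vec (y : S) - vec x2 - (vec (y : S) - vec x1) = _
          abel⟩ : {q : P × P | (q.1 : V) - q.2 = vec x1 - vec x2})) ?_
      intro y y' hyy
      have h7 := congrArg (fun q => (q.1.1 : V)) hyy
      exact Subtype.ext (hinj (sub_left_injective h7))
    omega
  have := hfinP.to_subtype
  have h8 : D.ncard * Y.ncard ≤ 2 * (P.ncard * P.ncard) := by
    calc D.ncard * Y.ncard = ∑ z ∈ hfinD.toFinset, Y.ncard := by
          rw [Finset.sum_const, smul_eq_mul, ← Set.ncard_eq_toFinset_card _ hfinD]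
      _ ≤ ∑ z ∈ hfinD.toFinset, 2 * {q : P × P | (q.1 : V) - q.2 = z}.ncard :=
          Finset.sum_le_sum hrep
      _ = 2 * ∑ z ∈ hfinD.toFinset, {q : P × P | (q.1 : V) - q.2 = z}.ncard := by
          rw [Finset.mul_sum]
      _ ≤ 2 * Nat.card (P × P) := by
          refine Nat.mul_le_mul_left _ (TupleScheme.sum_ncard_le_of_pairwise_disjoint _ _ ?_)
          intro z _ z' _ hzz
          rw [Set.disjoint_left]
          intro q hq hq'
          exact hzz ((show _ = z from hq).symm.trans hq')
      _ = _ := by rw [Nat.card_prod, Nat.card_coe_set_eq]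
  have h9 : D.ncard * Y.ncard ≤ 2 * F ^ 2 * X.ncard * Y.ncard := by
    refine h8.trans ?_
    calc 2 * (P.ncard * P.ncard) ≤ 2 * ((F * X.ncard) * (F * Y.ncard)) := by gcongr
      _ = _ := by ring
  exact Nat.le_of_mul_le_mul_right h9 hYpos

end Additive

end PScheme

/-! ### Entropy, characters and generation of finite groups. -/

namespace PScheme

section Counting

variable {S : Type} [Fintype S]

/-- Resampling one coordinate: exchanging x j with u is an involution of the pairs (x, u). -/
theorem card_mul_sum_eq_sum_update {n : ℕ} [DecidableEq (Fin n)] (j : Fin n)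
    (f : (Fin n → S) → ℝ) :
    (Fintype.card S : ℝ) * ∑ x, f x = ∑ x, ∑ u, f (Function.update x j u) := by
  have h1 : ∑ x, ∑ u, f (Function.update x j u) =
      ∑ q : (Fin n → S) × S, f (Function.update q.1 j q.2) := by
    rw [Fintype.sum_prod_type]
  have h2 : ∑ q : (Fin n → S) × S, f (Function.update q.1 j q.2) =
      ∑ q : (Fin n → S) × S, f q.1 := by
    refine Finset.sum_nbij' (fun q => (Function.update q.1 j q.2, q.1 j))
      (fun q => (Function.update q.1 j q.2, q.1 j)) ?_ ?_ ?_ ?_ ?_ <;> simp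
  rw [h1, h2, Fintype.sum_prod_type]
  simp [Finset.mul_sum]

/-- An entropy inequality: the sum over `x ∈ I` of the logarithms of the numbers of elements of `I`
that differ from `x` in one given coordinate only. -/
theorem sum_log_card_line_le [DecidableEq S] {n : ℕ} (I : Finset (Fin n → S)) :
    ∑ x ∈ I, ∑ j, Real.log (I.filter fun y => ∀ i, i ≠ j → y i = x i).card ≤
      I.card * Real.log I.card := by
  classical
  induction n with
  | zero => simpa using mul_nonneg (Nat.cast_nonneg (α := ℝ) I.card) (Real.log_natCast_nonneg _)
  | succ n ih =>
    rcases I.eq_empty_or_nonempty with rfl | hI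
    · simp
    let sl : S → Finset (Fin n → S) := fun c => Finset.univ.filter fun d => Fin.cons c d ∈ I
    have hmem : ∀ c d, d ∈ sl c ↔ Fin.cons c d ∈ I := by simp [sl]
    have hsum : ∀ g : (Fin (n + 1) → S) → ℝ, ∑ x ∈ I, g x =
        ∑ c, ∑ d ∈ sl c, g (Fin.cons c d) := by
      intro g
      rw [← Finset.sum_fiberwise I (fun x => x 0)]
      refine Finset.sum_congr rfl fun c _ => ?_
      refine Finset.sum_nbij' (fun x => Fin.tail x) (fun d => Fin.cons c d) ?_ ?_ ?_ ?_ ?_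
      · intro x hx
        rw [Finset.mem_filter] at hx
        rw [hmem, ← hx.2, Fin.cons_self_tail]
        exact hx.1
      · intro d hd
        rw [Finset.mem_filter]
        exact ⟨(hmem c d).1 hd, by simp⟩
      · intro x hx
        rw [Finset.mem_filter] at hx
        rw [← hx.2, Fin.cons_self_tail]
      · intro d hd
        simp
      · intro x hx
        rw [Finset.mem_filter] at hx
        rw [← hx.2, Fin.cons_self_tail]
    let q0 : (Fin (n + 1) → S) → ℕ := fun x => (I.filter fun y => ∀ i, i ≠ 0 → y i = x i).card
    have hsucc : ∀ c, ∀ d ∈ sl c, ∀ j : Fin n,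
        (I.filter fun y => ∀ i, i ≠ j.succ → y i = (Fin.cons c d : Fin (n + 1) → S) i).card =
          ((sl c).filter fun y => ∀ i, i ≠ j → y i = d i).card := by
      intro c d hd j
      refine (Finset.card_nbij' (fun y => Fin.cons c y) (fun y => Fin.tail y) ?_ ?_ ?_ ?_).symm
      · intro y hy
        simp only [Finset.coe_filter, Set.mem_ofPred_eq] at hy ⊢
        refine ⟨(hmem c y).1 hy.1, fun i hi => ?_⟩
        refine Fin.cases (fun _ => by simp) (fun i hi => ?_) i hi
        simpa using hy.2 i fun h => hi (by rw [h])
      · intro y hy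
        simp only [Finset.coe_filter, Set.mem_ofPred_eq] at hy ⊢
        have h0 : y 0 = c := by simpa using hy.2 0 (Fin.succ_ne_zero j).symm
        refine ⟨?_, fun i hi => ?_⟩
        · rw [hmem, ← h0, Fin.cons_self_tail]
          exact hy.1
        · have := hy.2 i.succ fun h => hi (Fin.succ_injective _ h)
          exact this
      · intro y hy
        simp
      · intro y hy
        simp only [Finset.coe_filter, Set.mem_ofPred_eq] at hy
        have h0 : y 0 = c := by simpa using hy.2 0 (Fin.succ_ne_zero j).symm
        simp only
        rw [← h0, Fin.cons_self_tail]
    -- In entropy terms the lemma says that, for x uniform on I, the conditional entropies of the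
    -- coordinates given all others sum to at most the entropy of x. The induction splits off
    -- coordinate 0: q0 is the size of the line in this direction and `sl` the slice containing x.
    -- The inequality log u ≤ u - 1 reduces the estimate to a count.
    have hmain : ∑ x ∈ I, (Real.log (q0 x) + Real.log (sl (x 0)).card) ≤
        I.card * Real.log I.card := by
      have hIpos : (0 : ℝ) < I.card := by exact_mod_cast hI.card_pos
      have hterm : ∀ x ∈ I, Real.log (q0 x) + Real.log (sl (x 0)).card - Real.log I.card ≤
          (q0 x * (sl (x 0)).card : ℕ) / (I.card : ℝ) - 1 := by
        intro x hx
        have h1 : 0 < q0 x := Finset.card_pos.2 ⟨x, by simp [hx]⟩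
        have h2 : 0 < (sl (x 0)).card := Finset.card_pos.2 ⟨Fin.tail x, by
          rw [hmem, Fin.cons_self_tail]
          exact hx⟩
        have h1' : (0 : ℝ) < q0 x := by exact_mod_cast h1
        have h2' : (0 : ℝ) < (sl (x 0)).card := by exact_mod_cast h2
        rw [← Real.log_mul h1'.ne' h2'.ne', ← Real.log_div (by positivity) hIpos.ne', Nat.cast_mul]
        exact Real.log_le_sub_one_of_pos (by positivity)
      -- Given x, a point y on its 0-line and a point d of its slice, the pair (y, (x 0, d)) in I ×
      -- I recovers everything, since x agrees with y off coordinate 0.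
      have hcount : ∑ x ∈ I, q0 x * (sl (x 0)).card ≤ I.card * I.card := by
        have h3 : ∀ x ∈ I, q0 x * (sl (x 0)).card =
            ((I.filter fun y => ∀ i, i ≠ 0 → y i = x i) ×ˢ sl (x 0)).card := fun x _ => by
          rw [Finset.card_product]
        rw [Finset.sum_congr rfl h3, ← Finset.card_sigma, ← Finset.card_product]
        refine Finset.card_le_card_of_injOn (fun q => (q.2.1, Fin.cons (q.1 0) q.2.2)) ?_ ?_
        · rintro ⟨x, y, d⟩ hq
          simp only [Finset.coe_sigma, Set.mem_sigma_iff, Finset.mem_coe, Finset.mem_filter,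
            Finset.coe_product, Set.mem_prod] at hq ⊢
          exact ⟨hq.2.1.1, (hmem _ _).1 hq.2.2⟩
        · rintro ⟨x, y, d⟩ hq ⟨x', y', d'⟩ hq' heq
          simp only [Finset.coe_sigma, Set.mem_sigma_iff, Finset.mem_coe, Finset.mem_product,
            Finset.mem_filter, Prod.mk.injEq] at hq hq' heq
          obtain ⟨rfl, h5⟩ := heq
          obtain ⟨h6, rfl⟩ := Fin.cons_injective2 h5
          have : x = x' := by
            funext i
            refine Fin.cases h6 (fun i => ?_) i
            rw [← hq.2.1.2 i.succ (Fin.succ_ne_zero i), ← hq'.2.1.2 i.succ (Fin.succ_ne_zero i)]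
          subst this
          rfl
      have h4 := Finset.sum_le_sum hterm
      rw [Finset.sum_sub_distrib, Finset.sum_sub_distrib, ← Finset.sum_div, ← Nat.cast_sum,
        Finset.sum_const, Finset.sum_const, nsmul_eq_mul, nsmul_eq_mul, mul_one] at h4
      have h5 : ((∑ x ∈ I, q0 x * (sl (x 0)).card : ℕ) : ℝ) / I.card ≤ I.card := by
        rw [div_le_iff₀ hIpos]
        exact_mod_cast hcount
      linarith
    refine le_trans ?_ hmain
    rw [hsum, hsum]
    refine Finset.sum_le_sum fun c _ => ?_
    simp_rw [Fin.sum_univ_succ]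
    rw [Finset.sum_add_distrib, Finset.sum_add_distrib]
    refine add_le_add_right ?_ _
    rw [Finset.sum_congr rfl fun d hd => Finset.sum_congr rfl fun j _ => by rw [hsucc c d hd j]]
    refine (ih (sl c)).trans (le_of_eq ?_)
    simp

end Counting

section Dual

variable {V : Type} [AddCommGroup V] (U : AddSubgroup V)

/-- The characters of `U` that are trivial on `W`. -/
def annihilator (W : AddSubgroup V) : AddSubgroup (AddChar U ℂ) where
  carrier := {ψ | ∀ w : U, (w : V) ∈ W → ψ w = 1}
  add_mem' := by
    intro ψ χ hψ hχ w hw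
    rw [AddChar.add_apply, hψ w hw, hχ w hw, one_mul]
  zero_mem' := by
    intro w _
    rw [AddChar.zero_apply]
  neg_mem' := by
    intro ψ hψ w hw
    rw [AddChar.neg_apply, hψ (-w) (W.neg_mem hw)]

variable [Finite V]

/-- Characters trivial on `W` are the characters of the quotient. -/
noncomputable def annihilatorEquiv (W : AddSubgroup V) :
    annihilator U W ≃ AddChar (U ⧸ W.addSubgroupOf U) ℂ where
  toFun ψ := AddChar.toAddMonoidHomEquiv.symm (QuotientAddGroup.lift (W.addSubgroupOf U)
    (AddChar.toAddMonoidHomEquiv ψ.1) fun w hw => by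
      exact congrArg Additive.ofMul (ψ.2 w (AddSubgroup.mem_addSubgroupOf.1 hw)))
  invFun χ := ⟨χ.compAddMonoidHom (QuotientAddGroup.mk' _), fun w hw => by
    rw [AddChar.compAddMonoidHom_apply, QuotientAddGroup.mk'_apply,
      (QuotientAddGroup.eq_zero_iff _).2 (AddSubgroup.mem_addSubgroupOf.2 hw),
      AddChar.map_zero_eq_one]⟩
  left_inv ψ := by
    ext u
    rfl
  right_inv χ := by
    ext u
    induction u using QuotientAddGroup.induction_on with | _ u
    rfl

theorem card_annihilator_mul {W : AddSubgroup V} (hW : W ≤ U) :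
    Nat.card (annihilator U W) * Nat.card W = Nat.card U := by
  classical
  have := Fintype.ofFinite (U ⧸ W.addSubgroupOf U)
  rw [Nat.card_congr (annihilatorEquiv U W), Nat.card_eq_fintype_card,
    AddChar.card_eq, ← Nat.card_eq_fintype_card,
    ← Nat.card_congr (AddSubgroup.addSubgroupOfEquivOfLe hW).toEquiv]
  exact (AddSubgroup.card_eq_card_quotient_mul_card_addSubgroup _).symm

theorem mem_of_annihilator {W : AddSubgroup V} {u : U}
    (h : ∀ ψ ∈ annihilator U W, ψ u = 1) : (u : V) ∈ W := by
  classical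
  by_contra hu
  have h1 : (QuotientAddGroup.mk u : U ⧸ W.addSubgroupOf U) ≠ 0 := by
    rw [Ne, QuotientAddGroup.eq_zero_iff, AddSubgroup.mem_addSubgroupOf]
    exact hu
  obtain ⟨χ, hχ⟩ := AddChar.exists_apply_ne_zero.2 h1
  exact hχ (h _ ((annihilatorEquiv U W).symm χ).2)

theorem annihilator_injOn : Set.InjOn (annihilator U) {W | W ≤ U} := by
  have key : ∀ W W' : AddSubgroup V, W ≤ U → annihilator U W = annihilator U W' → W ≤ W' := by
    intro W W' hW h w hw
    refine mem_of_annihilator U (u := ⟨w, hW hw⟩) fun ψ hψ => ?_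
    rw [← h] at hψ
    exact hψ _ hw
  intro W hW W' hW' h
  exact le_antisymm (key W W' hW h) (key W' W hW' h.symm)

end Dual

section Generation

variable {X : Type} [AddCommGroup X] [Finite X]

theorem two_mul_card_le_of_lt {H H' : AddSubgroup X} (h : H < H') :
    2 * Nat.card H ≤ Nat.card H' := by
  obtain ⟨k, hk⟩ := AddSubgroup.card_dvd_of_le h.le
  have hpos : 0 < Nat.card H := Nat.card_pos
  have hpos' : 0 < Nat.card H' := Nat.card_pos
  have hk2 : 2 ≤ k := by
    by_contra hcon
    have : k = 0 ∨ k = 1 := by omega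
    rcases this with rfl | rfl
    · omega
    · exact h.ne (AddSubgroup.eq_of_le_of_card_ge h.le (by omega))
  rw [hk, mul_comm]
  exact Nat.mul_le_mul_left _ hk2

/-- Every new generator at least doubles the subgroup, so s generators suffice. Padding with 0 makes
the number exactly s. -/
theorem exists_fin_generators (A : Set X) {s : ℕ}
    (hs : Nat.card (AddSubgroup.closure A) ≤ 2 ^ s) :
    ∃ f : Fin s → X, (∀ i, f i ∈ insert 0 A) ∧
      AddSubgroup.closure (Set.range f) = AddSubgroup.closure A := by
  have hle : ∀ {i} (f : Fin i → X), (∀ i, f i ∈ insert 0 A) →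
      AddSubgroup.closure (Set.range f) ≤ AddSubgroup.closure A := by
    intro i f hf
    rw [AddSubgroup.closure_le]
    rintro _ ⟨i, rfl⟩
    rcases hf i with h | h
    · rw [h]
      exact AddSubgroup.zero_mem _
    · exact AddSubgroup.subset_closure h
  suffices ∀ i, ∃ f : Fin i → X, (∀ i, f i ∈ insert 0 A) ∧
      (AddSubgroup.closure (Set.range f) = AddSubgroup.closure A ∨
        2 ^ i ≤ Nat.card (AddSubgroup.closure (Set.range f))) by
    obtain ⟨f, hf, h | h⟩ := this s
    · exact ⟨f, hf, h⟩
    · exact ⟨f, hf, AddSubgroup.eq_of_le_of_card_ge (hle f hf) (hs.trans h)⟩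
  intro i
  induction i with
  | zero => exact ⟨Fin.elim0, fun i => i.elim0, Or.inr Nat.card_pos⟩
  | succ i ih =>
    obtain ⟨f, hf, h⟩ := ih
    by_cases heq : AddSubgroup.closure (Set.range f) = AddSubgroup.closure A
    · refine ⟨Fin.cons 0 f, fun i => Fin.cases (Or.inl rfl) hf i, Or.inl ?_⟩
      rw [Fin.range_cons, AddSubgroup.closure_insert_zero, heq]
    · have : ∃ a ∈ A, a ∉ AddSubgroup.closure (Set.range f) := by
        by_contra! hcon
        exact heq (le_antisymm (hle f hf) ((AddSubgroup.closure_le _).2 hcon))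
      obtain ⟨a, ha, ha'⟩ := this
      refine ⟨Fin.cons a f, fun i => Fin.cases (Or.inr ha) hf i, Or.inr ?_⟩
      have hlt : AddSubgroup.closure (Set.range f) <
          AddSubgroup.closure (Set.range (Fin.cons a f : Fin (i + 1) → X)) := by
        refine lt_of_le_of_ne (AddSubgroup.closure_mono ?_) fun h => ha' ?_
        · rw [Fin.range_cons]
          exact Set.subset_insert _ _
        · rw [h]
          exact AddSubgroup.subset_closure ⟨0, rfl⟩
      have := two_mul_card_le_of_lt hlt
      rw [pow_succ]
      rcases h with h | h
      · exact absurd h heq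
      · omega

/-- Few subgroups have more than half of their elements in a given set. -/
theorem ncard_half_subset_le (T : Set X) (s : ℕ) :
    {N : AddSubgroup X | Nat.card N ≤ 2 ^ s ∧ Nat.card N < 2 * ((N : Set X) ∩ T).ncard}.ncard ≤
      (T.ncard + 1) ^ s := by
  classical
  have := Fintype.ofFinite X
  have hsub : {N : AddSubgroup X | Nat.card N ≤ 2 ^ s ∧
      Nat.card N < 2 * ((N : Set X) ∩ T).ncard} ⊆
      Set.range fun f : Fin s → ↥(insert 0 T) => AddSubgroup.closure (Set.range fun i => (f i : X)) := by
    rintro N ⟨h1, h2⟩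
    have hle : AddSubgroup.closure ((N : Set X) ∩ T) ≤ N :=
      (AddSubgroup.closure_le _).2 Set.inter_subset_left
    -- A proper subgroup has at most half of the elements, so N is generated by its elements in T,
    -- in fact by s of them.
    have hN : AddSubgroup.closure ((N : Set X) ∩ T) = N := by
      by_contra hne
      have h3 := two_mul_card_le_of_lt (lt_of_le_of_ne hle hne)
      have h4 : ((N : Set X) ∩ T).ncard ≤ Nat.card (AddSubgroup.closure ((N : Set X) ∩ T)) := by
        rw [← Nat.card_coe_set_eq]
        exact Nat.card_mono (Set.toFinite _) AddSubgroup.subset_closure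
      omega
    obtain ⟨f, hf, hf'⟩ := exists_fin_generators ((N : Set X) ∩ T) (s := s) (by rw [hN]; exact h1)
    refine ⟨fun i => ⟨f i, ?_⟩, ?_⟩
    · rcases hf i with h | h
      · exact Or.inl h
      · exact Or.inr h.2
    · exact hf'.trans hN
  refine (Set.ncard_le_ncard hsub (Set.toFinite _)).trans ?_
  rw [← Nat.card_coe_set_eq]
  refine (Finite.card_range_le _).trans ?_
  rw [Nat.card_fun, Nat.card_eq_fintype_card (α := Fin s), Fintype.card_fin]
  refine Nat.pow_le_pow_left ?_ _
  rw [Nat.card_coe_set_eq]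
  exact Set.ncard_insert_le _ _

end Generation

end PScheme

/-! ### The groups generated by classes, and complements of them. -/

namespace PScheme

/-- A sum of differences of the two halves of a tuple. -/
def combo {S V : Type} [AddCommGroup V] (vec : S → V) {J : ℕ} (a : Fin J ⊕ Fin J → S) : V :=
  ∑ i, (vec (a (Sum.inl i)) - vec (a (Sum.inr i)))

theorem mem_diffSum_iff {S V : Type} [AddCommGroup V] {vec : S → V} {X : Set S} {J : ℕ} {z : V} :
    z ∈ diffSum vec X J ↔ ∃ a : Fin J ⊕ Fin J → S, (∀ k, a k ∈ X) ∧ z = combo vec a := by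
  constructor
  · rintro ⟨a, b, hab, rfl⟩
    exact ⟨Sum.elim a b, Sum.rec (fun i => (hab i).1) fun i => (hab i).2, rfl⟩
  · rintro ⟨a, ha, rfl⟩
    exact ⟨_, _, fun i => ⟨ha (Sum.inl i), ha (Sum.inr i)⟩, rfl⟩

theorem map_combo {S V : Type} [AddCommGroup V] {vec : S → V} {J : ℕ} {a b : Fin J ⊕ Fin J → S}
    {φ : V ≃+ V} (h : ∀ k, φ (vec (a k)) = vec (b k)) : φ (combo vec a) = combo vec b := by
  simp [combo, map_sum, h]

theorem diffGroup_le_closure {S V : Type} [AddCommGroup V] {vec : S → V} {X : Set S} :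
    diffGroup vec X ≤ AddSubgroup.closure (vec '' X) := by
  rw [diffGroup, AddSubgroup.closure_le]
  rintro _ ⟨x, hx, y, hy, rfl⟩
  exact AddSubgroup.sub_mem _ (AddSubgroup.subset_closure ⟨x, hx, rfl⟩)
    (AddSubgroup.subset_closure ⟨y, hy, rfl⟩)

namespace TupleScheme

variable {S V : Type} [AddCommGroup V] {vec : S → V} {m : ℕ} (T : TupleScheme vec m)

theorem mem_cls_transport {ι : Type} {z z' : ι → S} (h : T.rel z z') {R : ℕ} (f : Fin R → ι)
    {i j : ι} (hij : z j ∈ T.cls (Set.range fun k => z (f k)) (z i)) :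
    z' j ∈ T.cls (Set.range fun k => z' (f k)) (z' i) := by
  rw [cls, Set.mem_ofPred_eq, relOver_range] at hij ⊢
  have hp : ∀ k, T.rel (Sum.elim (fun k => z (f k)) fun _ : Unit => z k)
      (Sum.elim (fun k => z' (f k)) fun _ => z' k) := fun k =>
    T.rel_of (Sum.elim f fun _ => k) h (by rintro (i | i) <;> rfl) (by rintro (i | i) <;> rfl)
  exact T.trans (T.symm (hp i)) (T.trans hij (hp j))

/-- The class of `v` over `x` is nontrivial, and sums of `J + 1` of its differences are sums of `J`
differences. -/
def IsGood (J : ℕ) {R : ℕ} (x : Fin R → S) (v : S) : Prop :=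
  v ∉ T.dcl (Set.range x) ∧ diffSum vec (T.cls (Set.range x) v) (J + 1) ⊆
    diffSum vec (T.cls (Set.range x) v) J

/-- The group generated by the differences of the class of `v` over `x`. -/
def grp {R : ℕ} (x : Fin R → S) (v : S) : AddSubgroup V := diffGroup vec (T.cls (Set.range x) v)

variable {T}

theorem IsGood.mem_grp_iff {J R : ℕ} {x : Fin R → S} {v : S} (h : T.IsGood J x v) {z : V} :
    z ∈ T.grp x v ↔ ∃ a : Fin J ⊕ Fin J → S, (∀ k, a k ∈ T.cls (Set.range x) v) ∧
      z = combo vec a := by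
  have := diffGroup_eq_diffSum (vec := vec) ⟨v, T.mem_cls_self _ v⟩ h.2
  rw [← mem_diffSum_iff, ← this]
  rfl

theorem grp_le {R : ℕ} (x : Fin R → S) (v : S) : T.grp x v ≤ diffGroup vec Set.univ :=
  diffGroup_mono (Set.subset_univ _)

theorem ncard_image_fin_le {R : ℕ} (x : Fin R → S) (J : Set (Fin R)) : (x '' J).ncard ≤ R := by
  refine (Set.ncard_image_le (Set.toFinite _)).trans ?_
  refine (Set.ncard_le_ncard (Set.subset_univ J) (Set.toFinite _)).trans ?_
  simp

theorem ncard_range_fin_le {R : ℕ} (x : Fin R → S) : (Set.range x).ncard ≤ R := by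
  rw [← Set.image_univ]
  exact ncard_image_fin_le x _

theorem diffGroup_le_iff {X : Set S} {v : S} (hv : v ∈ X) {W : AddSubgroup V} :
    diffGroup vec X ≤ W ↔ ∀ b ∈ X, vec b - vec v ∈ W := by
  constructor
  · exact fun h b hb => h (sub_mem_diffGroup hb hv)
  · intro h
    rw [diffGroup, AddSubgroup.closure_le]
    rintro _ ⟨x, hx, y, hy, rfl⟩
    have := W.sub_mem (h x hx) (h y hy)
    rwa [sub_sub_sub_cancel_right] at this

variable [Finite S] {K t : ℕ}

/-- Carry a sum of J + 1 differences back to x and v, rewrite it there with J differences, and carry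
the rewriting forward along an automorphism. -/
theorem IsGood.of_rel {J R : ℕ} {x x' : Fin R → S} {v v' : S} (h : T.IsGood J x v)
    (hm : R + 4 * J + 3 ≤ m)
    (hrel : T.rel (Sum.elim x fun _ : Unit => v) (Sum.elim x' fun _ => v')) :
    T.IsGood J x' v' := by
  refine ⟨?_, ?_⟩
  · have h1 := h.1
    rw [mem_dcl_iff_ncard] at h1 ⊢
    rwa [← T.ncard_cls_eq_of_rel (by simp; omega) hrel]
  · intro z hz
    obtain ⟨a', ha', rfl⟩ := mem_diffSum_iff.1 hz
    obtain ⟨a, ha⟩ := T.exists_ext a' (by simp; omega) (T.symm hrel)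
    have haX : ∀ k, a k ∈ T.cls (Set.range x) v := fun k =>
      T.mem_cls_transport ha (fun k => Sum.inl (Sum.inl k)) (i := Sum.inl (Sum.inr ()))
        (j := Sum.inr k) (ha' k)
    obtain ⟨c, hc, hac⟩ := mem_diffSum_iff.1 (h.2 (mem_diffSum_iff.2 ⟨a, haX, rfl⟩))
    obtain ⟨c', hc'⟩ := T.exists_ext c (by simp; omega) (T.symm ha)
    obtain ⟨φ, hφ⟩ := T.lin hc'
    refine mem_diffSum_iff.2 ⟨c', fun k => ?_, ?_⟩
    · exact T.mem_cls_transport hc' (fun k => Sum.inl (Sum.inl (Sum.inl k)))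
        (i := Sum.inl (Sum.inl (Sum.inr ()))) (j := Sum.inr k) (hc k)
    · have h1 : φ (combo vec a) = combo vec a' := map_combo fun k => hφ (Sum.inl (Sum.inr k))
      rw [← h1, hac]
      exact map_combo fun k => hφ (Sum.inr k)

/-- The coordinates of a tuple with index at least `j` are independent over `A`. -/
def Ind (T : TupleScheme vec m) (A : Set S) {R : ℕ} (x : Fin R → S) (j : ℕ) : Prop :=
  ∀ i : Fin R, j ≤ i → x i ∉ T.dcl (A ∪ x '' {k | k < i})

/-- Conjugates are counted one coordinate at a time. An independent coordinate contributes at least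
n/K^(a+1) choices and any other one at least 1. -/
theorem Large.pow_le_ncard_tuples (h : T.Large K t) {A : Set S} {a : ℕ} {R : ℕ} (x : Fin R → S)
    (ha : A.ncard + R ≤ a) (hat : a ≤ t) {j : ℕ} (hx : T.Ind A x j) :
    Nat.card S ^ (R - j) ≤ (K ^ (a + 1)) ^ R * {y | T.relOver A x y}.ncard := by
  have hd := h.depth
  have hK : 1 ≤ K := by have := h.two_le; omega
  induction R with
  | zero =>
    have : 0 < {y | T.relOver A x y}.ncard :=
      (Set.ncard_pos (Set.toFinite _)).2 ⟨x, T.refl _⟩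
    rw [Nat.zero_sub, pow_zero, pow_zero, one_mul]
    exact this
  | succ R ih =>
    have hinit : T.Ind A (Fin.init x) j := by
      intro i hi
      have := hx i.castSucc hi
      refine fun hcon => this (T.dcl_mono ?_ hcon)
      refine Set.union_subset_union_right _ ?_
      rintro _ ⟨k, hk, rfl⟩
      exact ⟨k.castSucc, hk, rfl⟩
    have h1 := ih (Fin.init x) (by omega) hinit
    have hcard : {y | T.relOver A x y}.ncard = {y | T.relOver A (Fin.init x) y}.ncard *
        (T.cls (A ∪ Set.range (Fin.init x)) (x (Fin.last R))).ncard := by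
      have h2 := (T.relativize A).card_rel_elim (Fin.init x) (fun _ : Unit => x (Fin.last R))
        (by simp; omega)
      rw [← ncard_cls_range, cls_over] at h2
      rw [← Nat.card_coe_set_eq, ← Nat.card_coe_set_eq {y | T.relOver A (Fin.init x) y}]
      refine Eq.trans ?_ h2
      let e : Fin R ⊕ Unit ≃ Fin (R + 1) :=
        { toFun := Sum.elim Fin.castSucc fun _ => Fin.last R
          invFun := Fin.lastCases (Sum.inr ()) Sum.inl
          left_inv := by rintro (i | i) <;> simp
          right_inv := by
            intro i
            refine Fin.lastCases ?_ (fun i => ?_) i <;> simp }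
      have he : Sum.elim (Fin.init x) (fun _ : Unit => x (Fin.last R)) = x ∘ e := by
        funext i
        rcases i with i | i <;> rfl
      rw [he]
      refine Nat.card_congr (Equiv.subtypeEquiv (Equiv.arrowCongr e.symm (Equiv.refl S))
        fun y => ⟨fun hy => (T.relativize A).pull e hy, fun hy => ?_⟩)
      exact (T.relativize A).rel_of e.symm hy (fun i => by simp) fun i => by simp
    rw [hcard, pow_succ (K ^ (a + 1))]
    by_cases hj : j ≤ R
    · have h3 : Nat.card S ≤ K ^ (a + 1) *
          (T.cls (A ∪ Set.range (Fin.init x)) (x (Fin.last R))).ncard := by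
        have hrange : x '' {k | k < Fin.last R} = Set.range (Fin.init x) := by
          ext s
          constructor
          · rintro ⟨k, hk, rfl⟩
            exact ⟨⟨k, hk⟩, rfl⟩
          · rintro ⟨k, rfl⟩
            exact ⟨k.castSucc, Fin.castSucc_lt_last k, rfl⟩
        have h4 := hx (Fin.last R) (by simpa using hj)
        rw [hrange] at h4
        have h5 := Set.ncard_union_le A (Set.range (Fin.init x))
        have h6 := ncard_range_fin_le (Fin.init x)
        refine (h.homogeneous _ (by omega) _ h4).trans (Nat.mul_le_mul_right _ ?_)
        exact Nat.pow_le_pow_right hK (by omega)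
      calc Nat.card S ^ (R + 1 - j) = Nat.card S ^ (R - j) * Nat.card S := by
            rw [← pow_succ]
            congr 1
            omega
        _ ≤ _ := Nat.mul_le_mul h1 h3
        _ = _ := by ring
    · have h3 := T.ncard_cls_pos (A ∪ Set.range (Fin.init x)) (x (Fin.last R))
      have h4 : 1 ≤ K ^ (a + 1) := Nat.one_le_pow _ _ hK
      have h5 : R + 1 - j = R - j := by omega
      rw [h5]
      calc _ ≤ _ := h1
        _ = ((K ^ (a + 1)) ^ R * 1) * ({y | T.relOver A (Fin.init x) y}.ncard * 1) := by ring
        _ ≤ _ := by gcongr; omega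

/-- Enlarging the set of constants by a conjugate of a given element, keeping independence. -/
theorem Large.exists_conj_ind (h : T.Large K t) {A : Set S} {R : ℕ} {x : Fin R → S} {j : ℕ}
    (hA : A.ncard + R + 1 ≤ t) (hx : T.Ind A x j) (b : S) :
    ∃ b' ∈ T.cls A b, T.Ind (insert b' A) x j := by
  have hd := h.depth
  by_cases hb : b ∈ T.dcl A
  · refine ⟨b, T.mem_cls_self _ _, fun i hi hcon => hx i hi ?_⟩
    have h1 := Set.ncard_union_le A (x '' {k | k < i})
    have h2 := ncard_image_fin_le x {k | k < i}
    rw [Set.insert_union] at hcon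
    exact T.dcl_insert_subset (T.dcl_mono Set.subset_union_left hb) (T.subset_dcl _)
      (by omega) hcon
  · have h1 := Set.ncard_union_le A (Set.range x)
    have h2 := ncard_range_fin_le x
    -- A conjugate of b outside the closure of A and x exists because closures are small; by
    -- exchange it does not disturb the independence of x.
    obtain ⟨b', hb', hb2⟩ := h.exists_mem_cls_notMem_dcl (B := A) (C := A ∪ Set.range x)
      (by omega) (by omega) hb
    refine ⟨b', hb', fun i hi => ?_⟩
    rw [Set.insert_union]
    have h3 := Set.ncard_union_le A (x '' {k | k < i})
    have h4 := ncard_image_fin_le x {k | k < i}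
    refine h.exchange (by omega) (hx i hi) fun hcon => hb2 (T.dcl_mono ?_ hcon)
    refine Set.insert_subset (Or.inr ⟨i, rfl⟩) (Set.union_subset_union_right _ ?_)
    exact Set.image_subset_range _ _

/-- The group of `v` over `x` is invariant over constants containing `x` and `v`. -/
theorem IsGood.mem_sup_of_relOver {J R : ℕ} {x : Fin R → S} {v : S} (h : T.IsGood J x v)
    {A : Set S} (hxA : Set.range x ⊆ A) (hv : v ∈ A) (hm : 2 * A.ncard + 2 * J + 1 ≤ m) {b b' : S}
    (hb : b' ∈ T.cls A b) (hmem : vec b - vec v ∈ T.grp x v ⊔ diffGroup vec A) :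
    vec b' - vec v ∈ T.grp x v ⊔ diffGroup vec A := by
  obtain ⟨w, hw, f, hf, hwf⟩ := AddSubgroup.mem_sup.1 hmem
  obtain ⟨a, ha, rfl⟩ := h.mem_grp_iff.1 hw
  obtain ⟨a', ha'⟩ := T.exists_ext_over a (by simp; omega) hb
  obtain ⟨φ, hφ, hφ'⟩ := T.exists_aut ha'
  have h1 : φ (vec b) = vec b' := hφ' (Sum.inl ())
  have h2 : φ (combo vec a) = combo vec a' := map_combo fun k => hφ' (Sum.inr k)
  have h3 : φ (vec v) = vec v := hφ _ (AddSubgroup.subset_closure ⟨v, hv, rfl⟩)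
  have h4 : φ f = f := hφ _ (diffGroup_le_closure hf)
  have h5 : vec b' - vec v = combo vec a' + f := by
    rw [← h1, ← h2, ← h3, ← map_sub, ← hwf, map_add, h4]
  rw [h5]
  refine AddSubgroup.mem_sup.2 ⟨_, h.mem_grp_iff.2 ⟨a', fun k => ?_, rfl⟩, f, hf, rfl⟩
  rw [← T.cls_eq_of_mem (ha k)]
  exact T.cls_anti hxA _ (T.apply_mem_cls ha' (Sum.inr k))

/-- Adding few constants, one gets a complement of the group of `v` over `x`. -/
theorem Large.exists_complement [Finite V] (h : T.Large K t) {J R s : ℕ} {x : Fin R → S} {v : S}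
    (hgood : T.IsGood J x v) {y : Fin R → S} {j : ℕ} {A : Set S} (hxA : Set.range x ⊆ A)
    (hv : v ∈ A) (hA : A.ncard + R + s + J + 1 ≤ t) (hy : T.Ind A y j)
    (hs : Nat.card (diffGroup vec Set.univ) < 2 ^ s * Nat.card (T.grp x v)) :
    ∃ A', A ⊆ A' ∧ A'.ncard ≤ A.ncard + s ∧ T.Ind A' y j ∧
      diffGroup vec Set.univ ≤ T.grp x v ⊔ diffGroup vec A' := by
  have hd := h.depth
  suffices ∀ i ≤ s, ∃ A', A ⊆ A' ∧ A'.ncard ≤ A.ncard + i ∧ T.Ind A' y j ∧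
      (diffGroup vec Set.univ ≤ T.grp x v ⊔ diffGroup vec A' ∨
        2 ^ i * Nat.card (T.grp x v) ≤ Nat.card ↥(T.grp x v ⊔ diffGroup vec A')) by
    obtain ⟨A', h1, h2, h3, h4 | h4⟩ := this s le_rfl
    · exact ⟨A', h1, h2, h3, h4⟩
    · have h5 : T.grp x v ⊔ diffGroup vec A' ≤ diffGroup vec Set.univ :=
        sup_le (grp_le x v) (diffGroup_mono (Set.subset_univ _))
      have h6 := AddSubgroup.card_le_of_le h5
      omega
  intro i
  induction i with
  | zero =>
    intro _
    refine ⟨A, subset_rfl, le_rfl, hy, Or.inr ?_⟩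
    rw [pow_zero, one_mul]
    exact AddSubgroup.card_le_of_le le_sup_left
  | succ i ih =>
    intro hi
    obtain ⟨A', h1, h2, h3, h4⟩ := ih (by omega)
    by_cases hU : diffGroup vec Set.univ ≤ T.grp x v ⊔ diffGroup vec A'
    · exact ⟨A', h1, by omega, h3, Or.inl hU⟩
    · rw [diffGroup_le_iff (Set.mem_univ v)] at hU
      push Not at hU
      obtain ⟨b, -, hb⟩ := hU
      -- Some point b shows that the complement is incomplete. The sum of groups is invariant over
      -- A', so a generic conjugate of b shows it as well, and adding that conjugate at least
      -- doubles the sum.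
      obtain ⟨b', hb', hind⟩ := h.exists_conj_ind (by omega) h3 b
      have hb2 : vec b' - vec v ∉ T.grp x v ⊔ diffGroup vec A' := fun hcon =>
        hb (hgood.mem_sup_of_relOver (hxA.trans h1) (h1 hv) (by omega) (T.mem_cls_comm.1 hb') hcon)
      have hi' := Set.ncard_insert_le b' A'
      refine ⟨insert b' A', h1.trans (Set.subset_insert _ _), by omega, hind, Or.inr ?_⟩
      have hlt : T.grp x v ⊔ diffGroup vec A' < T.grp x v ⊔ diffGroup vec (insert b' A') := by
        refine lt_of_le_of_ne (sup_le_sup_left (diffGroup_mono (Set.subset_insert _ _)) _)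
          fun heq => hb2 ?_
        rw [heq]
        exact AddSubgroup.mem_sup_right (sub_mem_diffGroup (Set.mem_insert _ _)
          (Set.mem_insert_of_mem _ (h1 hv)))
      have h5 := two_mul_card_le_of_lt hlt
      rcases h4 with h4 | h4
      · exact absurd ((diffGroup_le_iff (Set.mem_univ v)).1 h4 b (Set.mem_univ _)) hb
      · rw [pow_succ]
        linarith

/-- Conjugates of `y` over a complement have their group in the sum of the two groups. -/
theorem IsGood.grp_le_sup {J R : ℕ} {x y y' : Fin R → S} {v : S} (hx : T.IsGood J x v)
    (hy : T.IsGood J y v) {A : Set S} (hxA : Set.range x ⊆ A) (hv : v ∈ A)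
    (hm : 2 * A.ncard + R + 4 * J + 3 ≤ m)
    (hU : diffGroup vec Set.univ ≤ T.grp x v ⊔ diffGroup vec A) (hrel : T.relOver A y y') :
    T.IsGood J y' v ∧ T.grp y' v ≤ T.grp x v ⊔ T.grp y v := by
  have hrel' : ∀ {y y' : Fin R → S}, T.relOver A y y' →
      T.rel (Sum.elim y fun _ : Unit => v) (Sum.elim y' fun _ => v) := fun hr =>
    T.rel_of (Sum.elim Sum.inr fun _ => Sum.inl ⟨v, hv⟩) hr (by rintro (i | i) <;> rfl)
      (by rintro (i | i) <;> rfl)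
  have hy' := hy.of_rel (by omega) (hrel' hrel)
  refine ⟨hy', fun w hw => ?_⟩
  obtain ⟨w1, hw1, f, hf, hwf⟩ := AddSubgroup.mem_sup.1 (hU (grp_le y' v hw))
  obtain ⟨a, ha, rfl⟩ := hy'.mem_grp_iff.1 hw
  obtain ⟨c, hc, rfl⟩ := hx.mem_grp_iff.1 hw1
  -- Write w = w1 + f with w1 in the group of x and f in that of A. An automorphism carrying y' to y
  -- and fixing A sends w into the group of y, keeps w1 in that of x, and fixes f. Hence f, and with
  -- it w, lies in the sum of the groups of x and y.
  obtain ⟨e, he⟩ := T.exists_ext_over (Sum.elim a c) (by simp; omega)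
    ((T.relativize A).symm hrel)
  obtain ⟨φ, hφ, hφ'⟩ := T.exists_aut he
  have h1 : φ (combo vec a) = combo vec (e ∘ Sum.inl) :=
    map_combo fun k => hφ' (Sum.inr (Sum.inl k))
  have h2 : φ (combo vec c) = combo vec (e ∘ Sum.inr) :=
    map_combo fun k => hφ' (Sum.inr (Sum.inr k))
  have h3 : φ f = f := hφ _ (diffGroup_le_closure hf)
  have h4 : combo vec (e ∘ Sum.inl) ∈ T.grp y v := by
    refine hy.mem_grp_iff.2 ⟨_, fun k => ?_, rfl⟩
    exact T.mem_cls_transport he (fun k => Sum.inr (Sum.inl k)) (i := Sum.inl ⟨v, hv⟩)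
      (j := Sum.inr (Sum.inr (Sum.inl k))) (ha k)
  have h5 : combo vec (e ∘ Sum.inr) ∈ T.grp x v := by
    refine hx.mem_grp_iff.2 ⟨_, fun k => ?_, rfl⟩
    rw [← T.cls_eq_of_mem (hc k)]
    exact T.cls_anti hxA _ (T.apply_mem_cls he (Sum.inr (Sum.inr k)))
  have h6 : f = combo vec (e ∘ Sum.inl) - combo vec (e ∘ Sum.inr) := by
    rw [← h1, ← h2, ← hwf, map_add, h3]
    abel
  rw [← hwf, h6]
  exact AddSubgroup.add_mem _ (AddSubgroup.mem_sup_left hw1)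
    (AddSubgroup.sub_mem _ (AddSubgroup.mem_sup_right h4) (AddSubgroup.mem_sup_left h5))

end TupleScheme

end PScheme

/-! ### Heavy characters. -/

namespace PScheme

/-- A union bound along lines: P has at most c points on each line in direction j, and only on lines
all of whose points have Q whenever one has P. -/
theorem card_mul_ncard_le_of_update {S : Type} [Finite S] {n : ℕ} (j : Fin n)
    (P Q : (Fin n → S) → Prop) (c : ℕ)
    (h : ∀ x, {u | P (Function.update x j u)}.ncard ≤ c)
    (hPQ : ∀ x u, P (Function.update x j u) → Q x) :
    Nat.card S * {x | P x}.ncard ≤ c * {x | Q x}.ncard := by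
  classical
  have := Fintype.ofFinite S
  have h1 := card_mul_sum_eq_sum_update j fun x : Fin n → S => if P x then (1 : ℝ) else 0
  have hP : ∀ {α : Type} [Fintype α] (P : α → Prop),
      ∑ x, (if P x then (1 : ℝ) else 0) = {x | P x}.ncard := by
    intro α _ P
    rw [Finset.sum_boole, Set.ncard_eq_toFinset_card', Set.toFinset_ofPred]
  have h2 : ∀ x : Fin n → S, ∑ u, (if P (Function.update x j u) then (1 : ℝ) else 0) ≤
      c * if Q x then 1 else 0 := by
    intro x
    rw [hP]
    by_cases hQ : Q x
    · simpa [hQ] using h x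
    · have : {u | P (Function.update x j u)} = ∅ := by
        rw [Set.eq_empty_iff_forall_notMem]
        exact fun u hu => hQ (hPQ x u hu)
      simp [this, hQ]
  have h3 := Finset.sum_le_sum fun x (_ : x ∈ Finset.univ) => h2 x
  rw [← h1, ← Finset.mul_sum, hP, hP] at h3
  rw [Nat.card_eq_fintype_card]
  exact_mod_cast h3

theorem ncard_agree_le {S : Type} [Finite S] {R : ℕ} (x : Fin R → S) (j : ℕ) :
    {y : Fin R → S | ∀ i : Fin R, (i : ℕ) < j → y i = x i}.ncard ≤ Nat.card S ^ (R - j) := by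
  have h1 : Nat.card ({i : Fin R // j ≤ i} → S) = Nat.card S ^ (R - j) := by
    rw [Nat.card_fun]
    congr 1
    have h2 : Nat.card {i : Fin R // j ≤ i} = Nat.card {i : ℕ // j ≤ i ∧ i < R} :=
      Nat.card_congr
        { toFun := fun i => ⟨i.1, i.2, i.1.2⟩
          invFun := fun i => ⟨⟨i.1, i.2.2⟩, i.2.1⟩
          left_inv := fun _ => rfl
          right_inv := fun _ => rfl }
    rw [h2]
    have h3 : Nat.card {i : ℕ // j ≤ i ∧ i < R} = (Finset.Ico j R).card := by
      rw [← Nat.card_eq_finsetCard]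
      exact Nat.card_congr (Equiv.subtypeEquivRight fun i => Finset.mem_Ico.symm)
    rw [h3, Nat.card_Ico]
  rw [← h1, ← Nat.card_coe_set_eq]
  refine Nat.card_le_card_of_injective (fun y i => y.1 i.1) ?_
  intro y y' hyy
  refine Subtype.ext (funext fun i => ?_)
  by_cases hi : (i : ℕ) < j
  · rw [y.2 i hi, y'.2 i hi]
  · exact congrFun hyy ⟨i, by omega⟩

theorem card_addChar (U : Type) [AddCommGroup U] [Finite U] :
    Nat.card (AddChar U ℂ) = Nat.card U := by
  classical
  have := Fintype.ofFinite U
  rw [Nat.card_eq_fintype_card (α := U), ← AddChar.card_eq, Nat.card_eq_fintype_card]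

namespace TupleScheme

variable {S V : Type} [AddCommGroup V] {vec : S → V} {m : ℕ} {T : TupleScheme vec m}
  {K t : ℕ}

/-- The characters that are trivial on the group of `v` over `x'` for many good `x'` that agree with
`x` on the first `j` coordinates. -/
def heavy (T : TupleScheme vec m) (J Q : ℕ) (v : S) {R : ℕ} (j : ℕ) (x : Fin R → S) :
    Set (AddChar (diffGroup vec Set.univ) ℂ) :=
  {ψ | Nat.card S ^ (R - j) ≤ Q * {x' : Fin R → S | (∀ i : Fin R, (i : ℕ) < j → x' i = x i) ∧
    T.IsGood J x' v ∧ ψ ∈ annihilator _ (T.grp x' v)}.ncard}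

theorem heavy_congr {J Q : ℕ} {v : S} {R : ℕ} {j : ℕ} {x y : Fin R → S}
    (h : ∀ i : Fin R, (i : ℕ) < j → x i = y i) : T.heavy J Q v j x = T.heavy J Q v j y := by
  have : ∀ x' : Fin R → S, (∀ i : Fin R, (i : ℕ) < j → x' i = x i) ↔
      ∀ i : Fin R, (i : ℕ) < j → x' i = y i := fun x' =>
    forall_congr' fun i => ⟨fun h1 hi => (h1 hi).trans (h i hi), fun h1 hi => (h1 hi).trans (h i hi).symm⟩
  simp only [heavy, this]

variable [Finite S]

theorem mem_heavy_length {J Q : ℕ} (hQ : 1 ≤ Q) {v : S} {R : ℕ} {x : Fin R → S}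
    (hx : T.IsGood J x v) {ψ : AddChar (diffGroup vec Set.univ) ℂ}
    (hψ : ψ ∈ annihilator _ (T.grp x v)) : ψ ∈ T.heavy J Q v R x := by
  rw [heavy, Set.mem_ofPred_eq, Nat.sub_self, pow_zero]
  refine Nat.mul_pos hQ ((Set.ncard_pos (Set.toFinite _)).2 ⟨x, fun _ _ => rfl, hx, hψ⟩)

/-- Generic completions. -/
theorem Large.exists_ind_of_heavy (h : T.Large K t) {J Q a R j : ℕ} {v : S} {x : Fin R → S}
    {ψ : AddChar (diffGroup vec Set.univ) ℂ} (hψ : ψ ∈ T.heavy J Q v j x) {A : Set S}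
    (hA : A.ncard + R ≤ a) (hat : a ≤ t) (hn : Q * (R * K ^ (a + 1)) < Nat.card S) :
    ∃ x' : Fin R → S, (∀ i : Fin R, (i : ℕ) < j → x' i = x i) ∧ T.IsGood J x' v ∧
      ψ ∈ annihilator _ (T.grp x' v) ∧ T.Ind A x' j := by
  by_contra! hcon
  have hK : 1 ≤ K := by have := h.two_le; omega
  set H := {x' : Fin R → S | (∀ i : Fin R, (i : ℕ) < j → x' i = x i) ∧
    T.IsGood J x' v ∧ ψ ∈ annihilator _ (T.grp x' v)} with hH
  set n := Nat.card S with hn'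
  have hnpos : 0 < n := lt_of_le_of_lt (Nat.zero_le _) hn
  set G := {x' : Fin R → S | ∀ i : Fin R, (i : ℕ) < j → x' i = x i} with hG
  -- B i collects the completions whose coordinate i depends on A and the earlier coordinates. On
  -- each line in direction i these are few, so all the B i together are too small to cover the
  -- heavy set.
  let B : Fin R → Set (Fin R → S) := fun i => {x' | (∀ i : Fin R, (i : ℕ) < j → x' i = x i) ∧
    j ≤ (i : ℕ) ∧ x' i ∈ T.dcl (A ∪ x' '' {k | k < i})}
  have hB : ∀ i, n * (B i).ncard ≤ K ^ (a + 1) * G.ncard := by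
    intro i
    refine card_mul_ncard_le_of_update i _ _ _ (fun y => ?_) (fun y u hy => ?_)
    · have him : ∀ u, Function.update y i u '' {k | k < i} = y '' {k | k < i} := fun u =>
        Set.image_congr fun k hk => Function.update_of_ne (ne_of_lt hk) _ _
      refine (Set.ncard_le_ncard (t := T.dcl (A ∪ y '' {k | k < i})) ?_ (Set.toFinite _)).trans ?_
      · rintro u ⟨-, -, hu⟩
        rwa [him, Function.update_self] at hu
      · have h1 := Set.ncard_union_le A (y '' {k | k < i})
        have h2 := ncard_image_fin_le y {k | k < i}
        exact (h.ncard_dcl_le (by omega)).trans (Nat.pow_le_pow_right hK (by omega))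
    · intro k hk
      have hki : k ≠ i := by
        rintro rfl
        have := hy.2.1
        omega
      have := hy.1 k hk
      rwa [Function.update_of_ne hki] at this
  have hsub : H ⊆ ⋃ i ∈ (Finset.univ : Finset (Fin R)), B i := by
    rintro y ⟨h1, h2, h3⟩
    have h4 := hcon y h1 h2 h3
    rw [Ind] at h4
    push Not at h4
    obtain ⟨i, hi, hi'⟩ := h4
    exact Set.mem_biUnion (Finset.mem_coe.2 (Finset.mem_univ i)) ⟨h1, hi, hi'⟩
  have h5 : n * H.ncard ≤ R * (K ^ (a + 1) * G.ncard) := by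
    calc n * H.ncard ≤ n * ∑ i, (B i).ncard := Nat.mul_le_mul_left _
          ((Set.ncard_le_ncard hsub (Set.toFinite _)).trans (Finset.set_ncard_biUnion_le _ _))
      _ = ∑ i, n * (B i).ncard := Finset.mul_sum _ _ _
      _ ≤ ∑ i : Fin R, K ^ (a + 1) * G.ncard := Finset.sum_le_sum fun i _ => hB i
      _ = _ := by simp
  have h6 : G.ncard ≤ Q * H.ncard := (ncard_agree_le x j).trans hψ
  have h7 : 0 < H.ncard := by
    have : 0 < n ^ (R - j) := Nat.pow_pos hnpos
    have h8 : n ^ (R - j) ≤ Q * H.ncard := hψ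
    exact Nat.pos_of_ne_zero fun h0 => by rw [h0] at h8; omega
  have h8 : n * H.ncard ≤ (Q * (R * K ^ (a + 1))) * H.ncard := by
    calc _ ≤ _ := h5
      _ ≤ R * (K ^ (a + 1) * (Q * H.ncard)) := by gcongr
      _ = _ := by ring
  have := Nat.le_of_mul_le_mul_right h8 h7
  omega

/-- Suppose y j is not definable over v and the first coordinates of x. Complete x and then y to
generic good tuples x1, y1 on whose groups ψ is trivial. Over a complement A of the group of x1, all
conjugates of y1 have their groups inside the sum of the two, so ψ is trivial on them too. These
conjugates agree with x below j and are numerous enough to make ψ heavy at level j. -/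
theorem Large.mem_dcl_of_heavy [Finite V] (h : T.Large K t) {J Q a R s : ℕ} (ha : 2 * R + s + 2 ≤ a)
    (hat : a + J + 1 ≤ t) (hQ : (K ^ (a + 1)) ^ R ≤ Q) (hn : Q * (R * K ^ (a + 1)) < Nat.card S)
    {v : S} (hs : ∀ x : Fin R → S, T.IsGood J x v →
      Nat.card (diffGroup vec Set.univ) < 2 ^ s * Nat.card (T.grp x v))
    {x y : Fin R → S} {j : Fin R} {ψ : AddChar (diffGroup vec Set.univ) ℂ}
    (hxy : ∀ i : Fin R, i < j → x i = y i) (hx : ψ ∈ T.heavy J Q v (j + 1) x)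
    (hy : ψ ∈ T.heavy J Q v (j + 1) y) (hx' : ψ ∉ T.heavy J Q v j x) :
    y j ∈ T.dcl (insert v (x '' {i | i ≤ j})) := by
  by_contra hyj
  have hd := h.depth
  set E0 := insert v (x '' {i | i ≤ j}) with hE0
  have hE0card : E0.ncard ≤ R + 1 :=
    (Set.ncard_insert_le _ _).trans (Nat.add_le_add_right (ncard_image_fin_le _ _) 1)
  have hE0card' := Set.ncard_insert_le (y j) E0
  obtain ⟨x1, hx1, hx1g, hx1ψ, hx1i⟩ := h.exists_ind_of_heavy hx (A := insert (y j) E0) (a := a)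
    (by omega) (by omega) hn
  -- The later coordinates of x1 were chosen independent over y j, so by exchange y j stays
  -- undefinable as they are added.
  have hchain : ∀ k, y j ∉ T.dcl (E0 ∪ x1 '' {i | (i : ℕ) < j + 1 + k}) := by
    intro k
    induction k with
    | zero =>
      refine fun hcon => hyj (T.dcl_mono ?_ hcon)
      refine Set.union_subset subset_rfl ?_
      rintro _ ⟨i, hi, rfl⟩
      rw [hx1 i hi]
      exact Or.inr ⟨i, Nat.lt_succ_iff.1 hi, rfl⟩
    | succ k ih =>
      by_cases hk : j + 1 + k < R
      · have hset : E0 ∪ x1 '' {i | (i : ℕ) < j + 1 + (k + 1)} =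
            insert (x1 ⟨j + 1 + k, hk⟩) (E0 ∪ x1 '' {i | (i : ℕ) < j + 1 + k}) := by
          have : {i : Fin R | (i : ℕ) < j + 1 + (k + 1)} =
              insert ⟨j + 1 + k, hk⟩ {i : Fin R | (i : ℕ) < j + 1 + k} := by
            ext i
            simp only [Set.mem_ofPred_eq, Set.mem_insert_iff, Fin.ext_iff]
            omega
          rw [this, Set.image_insert_eq, Set.union_insert]
        rw [hset]
        have h1 := Set.ncard_union_le E0 (x1 '' {i | (i : ℕ) < j + 1 + k})
        have h2 := ncard_image_fin_le x1 {i | (i : ℕ) < j + 1 + k}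
        refine h.exchange (by omega) ih ?_
        rw [← Set.insert_union]
        exact hx1i ⟨j + 1 + k, hk⟩ (Nat.le_add_right _ _)
      · have : {i : Fin R | (i : ℕ) < j + 1 + (k + 1)} = {i : Fin R | (i : ℕ) < j + 1 + k} := by
          ext i
          simp only [Set.mem_ofPred_eq]
          omega
        rwa [this]
  set E := insert v (Set.range x1) with hE
  have hEcard : E.ncard ≤ R + 1 :=
    (Set.ncard_insert_le _ _).trans (Nat.add_le_add_right (ncard_range_fin_le _) 1)
  have hxE : ∀ i ≤ j, x i ∈ E := by
    intro i hi
    rw [← hx1 i (Nat.lt_succ_iff.2 hi)]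
    exact Or.inr ⟨i, rfl⟩
  have hyE : y j ∉ T.dcl E := by
    refine fun hcon => hchain R (T.dcl_mono ?_ hcon)
    refine Set.insert_subset (Or.inl (Set.mem_insert _ _)) ?_
    rintro _ ⟨i, rfl⟩
    exact Or.inr ⟨i, by simp only [Set.mem_ofPred_eq]; omega, rfl⟩
  obtain ⟨y1, hy1, hy1g, hy1ψ, hy1i⟩ := h.exists_ind_of_heavy hy (A := E) (a := a)
    (by omega) (by omega) hn
  have hylt : ∀ i < j, y1 i = x i := fun i hi =>
    (hy1 i (Nat.lt_succ_of_lt hi)).trans (hxy i hi).symm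
  have hind : T.Ind E y1 j := by
    intro i hi
    rcases Nat.eq_or_lt_of_le hi with hij | hij
    · have hij' : j = i := Fin.ext hij
      subst hij'
      rw [hy1 j (Nat.lt_succ_self _)]
      refine fun hcon => hyE (T.dcl_mono ?_ hcon)
      refine Set.union_subset subset_rfl ?_
      rintro _ ⟨k, hk, rfl⟩
      rw [hylt k hk]
      exact hxE k (le_of_lt hk)
    · exact hy1i i hij
  -- The complement uses at most s further constants and keeps the coordinates of y1 from j on
  -- independent, which makes the conjugates over A numerous.
  obtain ⟨A, hEA, hAcard, hAi, hU⟩ := h.exists_complement (A := E) (s := s) hx1g (Set.subset_insert _ _)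
    (Set.mem_insert _ _) (by omega) hind (hs x1 hx1g)
  have hvA : v ∈ A := hEA (Set.mem_insert _ _)
  have h1 := h.pow_le_ncard_tuples y1 (a := a) (by omega) (by omega) hAi
  refine hx' ?_
  refine h1.trans (Nat.mul_le_mul hQ (Set.ncard_le_ncard ?_ (Set.toFinite _)))
  intro y2 hy2
  obtain ⟨h2, h3⟩ := hx1g.grp_le_sup hy1g ((Set.subset_insert _ _).trans hEA) hvA (by omega) hU hy2
  refine ⟨fun i hi => ?_, h2, fun w hw => ?_⟩
  · rw [← hylt i hi]
    refine T.apply_eq_of_mem hy2 ?_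
    rw [hylt i hi]
    exact hEA (hxE i (le_of_lt hi))
  · obtain ⟨w1, hw1, w2, hw2, hww⟩ := AddSubgroup.mem_sup.1 (h3 hw)
    have h4 : w = (⟨w1, grp_le _ _ hw1⟩ : diffGroup vec Set.univ) + ⟨w2, grp_le _ _ hw2⟩ :=
      Subtype.ext hww.symm
    rw [h4, AddChar.map_add_eq_mul, hx1ψ _ hw1, hy1ψ _ hw2, one_mul]

/-- The number of elements definable over `v` and `x`. -/
noncomputable def dclCard (T : TupleScheme vec m) {R : ℕ} (x : Fin R → S) (v : S) : ℕ :=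
  (T.dcl (insert v (Set.range x))).ncard

theorem dclCard_pos {R : ℕ} (x : Fin R → S) (v : S) : 0 < T.dclCard x v :=
  (Set.ncard_pos (Set.toFinite _)).2 ⟨v, T.subset_dcl _ (Set.mem_insert _ _)⟩

/-- Fix ψ and a line in direction j. By `mem_dcl_of_heavy`, all points of the line where ψ stops
being heavy at level j have coordinates definable from any one of them, so the weights 1/`dclCard`
on the line sum to at most 1. There are |U| characters. -/
theorem Large.card_mul_sum_heavy_le [Finite V] [Fintype S] (h : T.Large K t) {J Q a R s : ℕ}
    (ha : 2 * R + s + 2 ≤ a) (hat : a + J + 1 ≤ t) (hQ : (K ^ (a + 1)) ^ R ≤ Q)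
    (hn : Q * (R * K ^ (a + 1)) < Nat.card S) {v : S} (hs : ∀ x : Fin R → S, T.IsGood J x v →
      Nat.card (diffGroup vec Set.univ) < 2 ^ s * Nat.card (T.grp x v)) (j : Fin R) :
    (Fintype.card S : ℝ) * ∑ x : Fin R → S,
      ((T.heavy J Q v (j + 1) x \ T.heavy J Q v j x).ncard : ℝ) / T.dclCard x v ≤
    (Fintype.card S : ℝ) ^ R * Nat.card (diffGroup vec Set.univ) := by
  classical
  have := Fintype.ofFinite V
  have := Fintype.ofFinite (diffGroup vec Set.univ)
  have : Fintype (AddChar (diffGroup vec Set.univ) ℂ) := Fintype.ofFinite _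
  let P : AddChar (diffGroup vec Set.univ) ℂ → (Fin R → S) → Prop := fun ψ x =>
    ψ ∈ T.heavy J Q v (j + 1) x \ T.heavy J Q v j x
  have h1 : ∀ x : Fin R → S, ((T.heavy J Q v (j + 1) x \ T.heavy J Q v j x).ncard : ℝ) /
      T.dclCard x v = ∑ ψ, if P ψ x then 1 / (T.dclCard x v : ℝ) else 0 := by
    intro x
    rw [← Finset.sum_filter, Finset.sum_const, nsmul_eq_mul, mul_one_div]
    congr 2
    rw [Set.ncard_eq_toFinset_card']
    congr 1
    ext ψ
    simp [P]
  simp_rw [h1]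
  rw [Finset.sum_comm, Finset.mul_sum]
  have h2 : ∀ ψ, (Fintype.card S : ℝ) * ∑ x : Fin R → S,
      (if P ψ x then 1 / (T.dclCard x v : ℝ) else 0) ≤ (Fintype.card S : ℝ) ^ R := by
    intro ψ
    rw [card_mul_sum_eq_sum_update j]
    have h3 : ∀ x : Fin R → S, ∑ u, (if P ψ (Function.update x j u) then
        1 / (T.dclCard (Function.update x j u) v : ℝ) else 0) ≤ 1 := by
      intro x
      set Y := Finset.univ.filter fun u => P ψ (Function.update x j u) with hY
      rw [← Finset.sum_filter, ← hY]
      rcases Y.eq_empty_or_nonempty with hE | hne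
      · rw [hE, Finset.sum_empty]
        exact zero_le_one
      have hYpos : (0 : ℝ) < Y.card := by exact_mod_cast hne.card_pos
      have h4 : ∀ u ∈ Y, 1 / (T.dclCard (Function.update x j u) v : ℝ) ≤ 1 / Y.card := by
        intro u hu
        refine one_div_le_one_div_of_le hYpos ?_
        rw [Nat.cast_le, dclCard, ← Set.ncard_coe_finset]
        refine Set.ncard_le_ncard (fun w hw => ?_) (Set.toFinite _)
        have hu' : P ψ (Function.update x j u) := (Finset.mem_filter.1 hu).2
        have hw' : P ψ (Function.update x j w) := (Finset.mem_filter.1 (Finset.mem_coe.1 hw)).2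
        have h5 := h.mem_dcl_of_heavy ha hat hQ hn hs (j := j)
          (x := Function.update x j u) (y := Function.update x j w) (ψ := ψ) (fun i hi => by
            rw [Function.update_of_ne hi.ne, Function.update_of_ne hi.ne]) hu'.1 hw'.1 hu'.2
        rw [Function.update_self] at h5
        exact T.dcl_mono (Set.insert_subset_insert (Set.image_subset_range _ _)) h5
      refine (Finset.sum_le_sum h4).trans (le_of_eq ?_)
      rw [Finset.sum_const, nsmul_eq_mul, mul_one_div, div_self hYpos.ne']
    refine (Finset.sum_le_sum fun x _ => h3 x).trans (le_of_eq ?_)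
    simp
  refine (Finset.sum_le_sum fun ψ _ => h2 ψ).trans (le_of_eq ?_)
  rw [Finset.sum_const, nsmul_eq_mul, mul_comm, Finset.card_univ,
    ← Nat.card_eq_fintype_card (α := AddChar _ ℂ), card_addChar]

/-- A character trivial on the group of x is heavy at level R, as x itself witnesses. If it is not
heavy at level 0, it is lost between two consecutive levels. -/
theorem Large.sum_annihilator_le [Finite V] [Fintype S] (h : T.Large K t) {J Q a R s : ℕ}
    (ha : 2 * R + s + 2 ≤ a) (hat : a + J + 1 ≤ t) (hQ : (K ^ (a + 1)) ^ R ≤ Q)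
    (hn : Q * (R * K ^ (a + 1)) < Nat.card S) {v : S} (hs : ∀ x : Fin R → S, T.IsGood J x v →
      Nat.card (diffGroup vec Set.univ) < 2 ^ s * Nat.card (T.grp x v)) (X : Finset (Fin R → S))
    (hX : ∀ x ∈ X, T.IsGood J x v) :
    (Fintype.card S : ℝ) * ∑ x ∈ X,
      (((annihilator (diffGroup vec Set.univ) (T.grp x v) : Set (AddChar _ ℂ)) \
        T.heavy J Q v 0 x).ncard : ℝ) / T.dclCard x v ≤
    R * ((Fintype.card S : ℝ) ^ R * Nat.card (diffGroup vec Set.univ)) := by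
  classical
  have := Fintype.ofFinite V
  have := Fintype.ofFinite (diffGroup vec Set.univ)
  have : Fintype (AddChar (diffGroup vec Set.univ) ℂ) := Fintype.ofFinite _
  have hK : 1 ≤ K := by have := h.two_le; omega
  have hQ1 : 1 ≤ Q := (Nat.one_le_pow _ _ (Nat.one_le_pow _ _ hK)).trans hQ
  have h1 : ∀ x ∈ X, (((annihilator (diffGroup vec Set.univ) (T.grp x v) : Set (AddChar _ ℂ)) \
      T.heavy J Q v 0 x).ncard : ℝ) ≤
      ∑ j : Fin R, ((T.heavy J Q v (j + 1) x \ T.heavy J Q v j x).ncard : ℝ) := by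
    intro x hx
    have hsub : (annihilator (diffGroup vec Set.univ) (T.grp x v) : Set (AddChar _ ℂ)) \
        T.heavy J Q v 0 x ⊆ ⋃ j ∈ (Finset.univ : Finset (Fin R)),
          (T.heavy J Q v (j + 1) x \ T.heavy J Q v j x) := by
      rintro ψ ⟨hψ, hψ0⟩
      have hR := mem_heavy_length hQ1 (hX x hx) hψ
      by_contra hcon
      have hall : ∀ k ≤ R, ψ ∉ T.heavy J Q v k x := by
        intro k
        induction k with
        | zero => exact fun _ => hψ0
        | succ k ih =>
          intro hk hmem
          exact hcon (Set.mem_biUnion (Finset.mem_coe.2 (Finset.mem_univ (⟨k, hk⟩ : Fin R)))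
            ⟨hmem, ih (by omega)⟩)
      exact hall R le_rfl hR
    exact_mod_cast (Set.ncard_le_ncard hsub (Set.toFinite _)).trans (Finset.set_ncard_biUnion_le _ _)
  calc _ ≤ (Fintype.card S : ℝ) * ∑ x ∈ X, ∑ j : Fin R,
        ((T.heavy J Q v (j + 1) x \ T.heavy J Q v j x).ncard : ℝ) / T.dclCard x v := by
        refine mul_le_mul_of_nonneg_left (Finset.sum_le_sum fun x hx => ?_) (Nat.cast_nonneg _)
        rw [← Finset.sum_div]
        exact div_le_div_of_nonneg_right (h1 x hx) (Nat.cast_nonneg _)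
    _ ≤ (Fintype.card S : ℝ) * ∑ x : Fin R → S, ∑ j : Fin R,
        ((T.heavy J Q v (j + 1) x \ T.heavy J Q v j x).ncard : ℝ) / T.dclCard x v := by
        refine mul_le_mul_of_nonneg_left ?_ (Nat.cast_nonneg _)
        refine Finset.sum_le_sum_of_subset_of_nonneg (Finset.subset_univ X) fun x _ _ => ?_
        exact Finset.sum_nonneg fun j _ => by positivity
    _ = ∑ j : Fin R, (Fintype.card S : ℝ) * ∑ x : Fin R → S,
        ((T.heavy J Q v (j + 1) x \ T.heavy J Q v j x).ncard : ℝ) / T.dclCard x v := by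
        rw [Finset.sum_comm, Finset.mul_sum]
    _ ≤ ∑ j : Fin R, (Fintype.card S : ℝ) ^ R * Nat.card (diffGroup vec Set.univ) :=
        Finset.sum_le_sum fun j _ => h.card_mul_sum_heavy_le ha hat hQ hn hs j
    _ = _ := by simp

end TupleScheme

end PScheme

/-! ### Stable tuples and the index of their common core. -/

namespace PScheme

namespace TupleScheme

variable {S V : Type} [AddCommGroup V] {vec : S → V} {m : ℕ} {T : TupleScheme vec m}
  {K t : ℕ}

/-- A good tuple that shares its group with many good tuples. -/
def IsStable (T : TupleScheme vec m) (J P : ℕ) {R : ℕ} (x : Fin R → S) (v : S) : Prop :=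
  T.IsGood J x v ∧
    Nat.card S ^ R ≤ P * {y : Fin R → S | T.IsGood J y v ∧ T.grp y v = T.grp x v}.ncard

/-- The intersection of the groups of stable tuples. -/
def core (T : TupleScheme vec m) (J P R : ℕ) (v : S) : AddSubgroup V :=
  diffGroup vec Set.univ ⊓ ⨅ x : {x : Fin R → S // T.IsStable J P x v}, T.grp x.1 v

theorem mem_core_iff {J P R : ℕ} {v : S} {w : V} : w ∈ T.core J P R v ↔
    w ∈ diffGroup vec Set.univ ∧ ∀ x : Fin R → S, T.IsStable J P x v → w ∈ T.grp x v := by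
  simp [core, AddSubgroup.mem_inf, AddSubgroup.mem_iInf]

theorem core_le {J P R : ℕ} {v : S} : T.core J P R v ≤ diffGroup vec Set.univ := inf_le_left

theorem IsStable.core_le {J P R : ℕ} {v : S} {x : Fin R → S} (h : T.IsStable J P x v) :
    T.core J P R v ≤ T.grp x v := fun _ hw => (mem_core_iff.1 hw).2 x h

theorem ncard_le_card_diffGroup [Finite S] [Finite V] (T : TupleScheme vec m) {X : Set S} (hX : X.Nonempty) :
    X.ncard ≤ Nat.card (diffGroup vec X) := by
  obtain ⟨v, hv⟩ := hX
  rw [← Nat.card_coe_set_eq]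
  refine Nat.card_le_card_of_injective
    (fun b : X => (⟨vec b - vec v, sub_mem_diffGroup b.2 hv⟩ : diffGroup vec X)) ?_
  intro b b' hbb
  have h1 : vec b - vec v = vec b' - vec v := congrArg Subtype.val hbb
  exact Subtype.ext (T.inj (sub_left_injective h1))

variable [Finite S]

/-- For a good tuple, membership in its group is witnessed by 2J points of one class, so it is
preserved by relations. -/
theorem IsGood.sub_mem_grp_of_rel {J R : ℕ} {ι : Type} [Finite ι] {z z' : ι → S} (hrel : T.rel z z')
    (f : Fin R → ι) {i b c : ι} (hm : Nat.card ι + 2 * J ≤ m)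
    (h : T.IsGood J (fun k => z (f k)) (z i))
    (hmem : vec (z b) - vec (z c) ∈ T.grp (fun k => z (f k)) (z i)) :
    vec (z' b) - vec (z' c) ∈ T.grp (fun k => z' (f k)) (z' i) := by
  obtain ⟨a, ha, hac⟩ := h.mem_grp_iff.1 hmem
  obtain ⟨a', ha'⟩ := T.exists_ext a (by simp; omega) hrel
  obtain ⟨φ, hφ⟩ := T.lin ha'
  have h1 : vec (z' b) - vec (z' c) = combo vec a' := by
    have h2 : φ (combo vec a) = combo vec a' := map_combo fun k => hφ (Sum.inr k)
    have h3 : φ (vec (z b)) = vec (z' b) := hφ (Sum.inl b)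
    have h4 : φ (vec (z c)) = vec (z' c) := hφ (Sum.inl c)
    rw [← h2, ← hac, map_sub, h3, h4]
  rw [h1]
  refine diffSum_subset_diffGroup J (mem_diffSum_iff.2 ⟨a', fun k => ?_, rfl⟩)
  exact T.mem_cls_transport ha' (fun k => Sum.inl (f k)) (i := Sum.inl i) (j := Sum.inr k) (ha k)

theorem IsGood.grp_le_of_rel {J R : ℕ} {ι : Type} [Finite ι] {z z' : ι → S} (hrel : T.rel z z')
    (f g : Fin R → ι) {i : ι} (hm : Nat.card ι + 2 * J + 1 ≤ m)
    (h : T.IsGood J (fun k => z (f k)) (z i))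
    (hle : T.grp (fun k => z (g k)) (z i) ≤ T.grp (fun k => z (f k)) (z i)) :
    T.grp (fun k => z' (g k)) (z' i) ≤ T.grp (fun k => z' (f k)) (z' i) := by
  rw [grp, diffGroup_le_iff (T.mem_cls_self _ _)] at hle ⊢
  intro b' hb'
  obtain ⟨b, hb⟩ := T.exists_ext (fun _ : Unit => b') (by simp; omega) (T.symm hrel)
  have h1 := hle (b ()) (T.mem_cls_transport hb (fun k => Sum.inl (g k)) (i := Sum.inl i)
    (j := Sum.inr ()) hb')
  exact IsGood.sub_mem_grp_of_rel (T.symm hb) (fun k => Sum.inl (f k)) (i := Sum.inl i)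
    (b := Sum.inr ()) (c := Sum.inl i) (by simp; omega) h h1

theorem IsStable.of_rel {J P R : ℕ} {x x' : Fin R → S} {v v' : S} (h : T.IsStable J P x v)
    (hm : 2 * R + 4 * J + 3 ≤ m)
    (hrel : T.rel (Sum.elim x fun _ : Unit => v) (Sum.elim x' fun _ => v')) :
    T.IsStable J P x' v' := by
  have hx' := h.1.of_rel (by omega) hrel
  refine ⟨hx', h.2.trans (Nat.mul_le_mul_left _ ?_)⟩
  obtain ⟨σ, hσ⟩ := T.exists_matching (κ := Fin R) (by simp; omega) hrel
  refine Set.ncard_le_ncard_of_injOn σ (fun y hy => ?_) σ.injective.injOn (Set.toFinite _)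
  have hy' : T.IsGood J (σ y) v' := by
    refine hy.1.of_rel (by omega) (T.rel_of (Sum.elim Sum.inr fun _ => Sum.inl (Sum.inr ())) (hσ y)
      ?_ ?_) <;> rintro (i | i) <;> rfl
  refine ⟨hy', le_antisymm ?_ ?_⟩
  · exact IsGood.grp_le_of_rel (hσ y) (fun k => Sum.inl (Sum.inl k)) (fun k => Sum.inr k)
      (i := Sum.inl (Sum.inr ())) (by simp; omega) h.1 hy.2.le
  · exact IsGood.grp_le_of_rel (hσ y) (fun k => Sum.inr k) (fun k => Sum.inl (Sum.inl k))
      (i := Sum.inl (Sum.inr ())) (by simp; omega) hy.1 hy.2.ge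

/-- Stability is invariant under relations, so the core depends on v alone in a way that
conjugations respect. -/
theorem sub_mem_core_of_rel {J P R : ℕ} {ι : Type} [Finite ι] {z z' : ι → S} (hrel : T.rel z z')
    {i b c : ι} (hm : Nat.card ι + 2 * R + 4 * J + 3 ≤ m)
    (hmem : vec (z b) - vec (z c) ∈ T.core J P R (z i)) :
    vec (z' b) - vec (z' c) ∈ T.core J P R (z' i) := by
  refine mem_core_iff.2 ⟨sub_mem_diffGroup (Set.mem_univ _) (Set.mem_univ _), fun x' hx' => ?_⟩
  obtain ⟨x, hx⟩ := T.exists_ext x' (by simp; omega) (T.symm hrel)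
  have hstab : T.IsStable J P x (z i) := hx'.of_rel (by omega)
    (T.rel_of (Sum.elim Sum.inr fun _ => Sum.inl i) hx (by rintro (k | k) <;> rfl)
      (by rintro (k | k) <;> rfl))
  exact IsGood.sub_mem_grp_of_rel (T.symm hx) (fun k => Sum.inr k) (i := Sum.inl i)
    (b := Sum.inl b) (c := Sum.inl c) (by simp; omega) hstab.1 ((mem_core_iff.1 hmem).2 x hstab)

theorem Large.card_diffGroup_le [Finite V] (h : T.Large K t) {M R J : ℕ} (hR : R ≤ t)
    (hM : Nat.card (diffGroup vec Set.univ) ≤ M * Nat.card S) {x : Fin R → S} {v : S}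
    (hx : T.IsGood J x v) :
    Nat.card (diffGroup vec Set.univ) ≤ M * K ^ (R + 1) * Nat.card (T.grp x v) := by
  have hK : 1 ≤ K := by have := h.two_le; omega
  have h1 := ncard_range_fin_le x
  have h2 := h.homogeneous _ (by omega) _ hx.1
  have h3 : (T.cls (Set.range x) v).ncard ≤ Nat.card (T.grp x v) :=
    T.ncard_le_card_diffGroup ⟨v, T.mem_cls_self _ _⟩
  have h4 : K ^ ((Set.range x).ncard + 1) ≤ K ^ (R + 1) := Nat.pow_le_pow_right hK (by omega)
  calc _ ≤ _ := hM
    _ ≤ M * (K ^ (R + 1) * Nat.card (T.grp x v)) :=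
      Nat.mul_le_mul_left _ (h2.trans (Nat.mul_le_mul h4 h3))
    _ = _ := by ring

/-- Distinct stable groups belong to disjoint sets of tuples, each a fraction at least 1/P of all
tuples. -/
theorem ncard_stable_grp_le [Finite V] {J P R : ℕ} {v : S} (hn : 0 < Nat.card S) :
    {W : AddSubgroup V | ∃ x : Fin R → S, T.IsStable J P x v ∧ T.grp x v = W}.ncard ≤ P := by
  classical
  have := Fintype.ofFinite S
  set F := {W : AddSubgroup V | ∃ x : Fin R → S, T.IsStable J P x v ∧ T.grp x v = W} with hF
  have hfin : F.Finite := Set.toFinite _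
  have h1 : F.ncard * Nat.card S ^ R ≤ P * Nat.card S ^ R := by
    calc F.ncard * Nat.card S ^ R = ∑ W ∈ hfin.toFinset, Nat.card S ^ R := by
          rw [Finset.sum_const, smul_eq_mul, Set.ncard_eq_toFinset_card _ hfin]
      _ ≤ ∑ W ∈ hfin.toFinset, P * (Finset.univ.filter fun y : Fin R → S => T.grp y v = W).card := by
          refine Finset.sum_le_sum fun W hW => ?_
          obtain ⟨x, hx, rfl⟩ := hfin.mem_toFinset.1 hW
          refine hx.2.trans (Nat.mul_le_mul_left _ ?_)
          rw [← Set.ncard_coe_finset]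
          refine Set.ncard_le_ncard (fun y hy => ?_) (Set.toFinite _)
          simpa using hy.2
      _ = P * ∑ W ∈ hfin.toFinset, (Finset.univ.filter fun y : Fin R → S => T.grp y v = W).card :=
          (Finset.mul_sum _ _ _).symm
      _ ≤ P * Nat.card S ^ R := by
          refine Nat.mul_le_mul_left _ ?_
          have h2 := Finset.card_eq_sum_card_fiberwise (f := fun y : Fin R → S => T.grp y v)
            (s := Finset.univ.filter fun y : Fin R → S => T.grp y v ∈ hfin.toFinset)
            (t := hfin.toFinset) (fun y hy => by simpa using hy)
          have h3 : (Finset.univ.filter fun y : Fin R → S => T.grp y v ∈ hfin.toFinset).card ≤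
              Nat.card S ^ R := by
            refine (Finset.card_le_univ _).trans (le_of_eq ?_)
            rw [Fintype.card_fun, Fintype.card_fin, Nat.card_eq_fintype_card]
          refine le_trans (le_of_eq ?_) (h2.symm.le.trans h3)
          refine Finset.sum_congr rfl fun W hW => congrArg _ ?_
          ext y
          simp only [Finset.mem_filter, Finset.mem_univ, true_and]
          exact ⟨fun hy => ⟨hy ▸ hW, hy⟩, fun hy => hy.2⟩
  exact Nat.le_of_mul_le_mul_right h1 (Nat.pow_pos hn)

theorem card_diffGroup_le_core [Finite V] {J P R τ : ℕ} {v : S} (hn : 0 < Nat.card S) (hτ : 1 ≤ τ)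
    (h : ∀ x : Fin R → S, T.IsGood J x v →
      Nat.card (diffGroup vec Set.univ) ≤ τ * Nat.card (T.grp x v)) :
    Nat.card (diffGroup vec Set.univ) ≤ τ ^ P * Nat.card (T.core J P R v) := by
  classical
  set F := {W : AddSubgroup V | ∃ x : Fin R → S, T.IsStable J P x v ∧ T.grp x v = W} with hF
  have := Fintype.ofFinite F
  set U := diffGroup vec Set.univ with hU
  have hcore : T.core J P R v = U ⊓ ⨅ W : F, W.1 := by
    ext w
    rw [mem_core_iff, AddSubgroup.mem_inf, AddSubgroup.mem_iInf]
    refine and_congr_right fun _ => ⟨?_, fun h x hx => h ⟨_, x, hx, rfl⟩⟩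
    rintro h ⟨_, x, hx, rfl⟩
    exact h x hx
  have h1 := AddSubgroup.relIndex_iInf_le (L := U) fun W : F => W.1
  have h2 : ∏ W : F, W.1.relIndex U ≤ τ ^ P := by
    calc ∏ W : F, W.1.relIndex U ≤ ∏ W : F, τ := by
          refine Finset.prod_le_prod' ?_
          rintro ⟨_, x, hx, rfl⟩ -
          have h3 := AddSubgroup.card_mul_index ((T.grp x v).addSubgroupOf U)
          rw [Nat.card_congr (AddSubgroup.addSubgroupOfEquivOfLe (grp_le x v)).toEquiv] at h3
          have h4 := h x hx.1
          rw [← h3, mul_comm] at h4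
          exact Nat.le_of_mul_le_mul_right h4 Nat.card_pos
      _ = τ ^ Fintype.card F := by simp
      _ ≤ τ ^ P := by
          refine Nat.pow_le_pow_right hτ ?_
          rw [← Nat.card_eq_fintype_card, Nat.card_coe_set_eq]
          exact ncard_stable_grp_le hn
  have h3 := AddSubgroup.card_mul_index ((⨅ W : F, W.1).addSubgroupOf U)
  have h4 : Nat.card ((⨅ W : F, W.1).addSubgroupOf U) = Nat.card (T.core J P R v) := by
    rw [hcore, ← AddSubgroup.inf_addSubgroupOf_left]
    exact Nat.card_congr (AddSubgroup.addSubgroupOfEquivOfLe inf_le_left).toEquiv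
  rw [h4] at h3
  rw [← h3, mul_comm]
  exact Nat.mul_le_mul_right _ (h1.trans h2)

/-- Points whose coset of the core contains few points are definable over `v`. -/
theorem Large.mem_dcl_of_small_piece [Finite V] (h : T.Large K t) {J P R τ : ℕ} {v : S}
    (ht : 3 ≤ t) (hm : 2 * R + 4 * J + 6 ≤ m)
    (hτ : Nat.card (diffGroup vec Set.univ) ≤ τ * Nat.card (T.core J P R v))
    (hn : K ^ 5 * τ < Nat.card S) {b : S}
    (hb : K ^ 3 * {c | vec c - vec b ∈ T.core J P R v}.ncard < Nat.card S) : b ∈ T.dcl {v} := by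
  classical
  by_contra hbv
  have hd := h.depth
  have := Fintype.ofFinite S
  have := Fintype.ofFinite V
  have hK : 1 ≤ K := by have := h.two_le; omega
  set C := T.core J P R v with hC
  have hpair := ncard_pair_le v b
  -- The points in the coset of b form a set invariant over v and b. A nontrivial class inside it
  -- would be larger than the whole set, so all its points are definable over v and b, and there are
  -- at most K^3 of them.
  have hpiece : {c | vec c - vec b ∈ C} ⊆ T.dcl {v, b} := by
    intro c hc
    by_contra hcd
    have h1 := h.homogeneous {v, b} (by omega) _ hcd
    have h2 : T.cls {v, b} c ⊆ {c | vec c - vec b ∈ C} := by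
      intro c' hc'
      exact sub_mem_core_of_rel (i := Sum.inl ⟨v, Or.inl rfl⟩) (c := Sum.inl ⟨b, Or.inr rfl⟩)
        (b := Sum.inr ()) hc' (by
          rw [Nat.card_sum, Nat.card_coe_set_eq, Nat.card_unique]
          omega) hc
    have h3 := Set.ncard_le_ncard h2 (Set.toFinite _)
    have h4 : K ^ (({v, b} : Set S).ncard + 1) ≤ K ^ 3 := Nat.pow_le_pow_right hK (by omega)
    have h5 := Nat.mul_le_mul h4 h3
    omega
  have hsmall : {c | vec c - vec b ∈ C}.ncard ≤ K ^ 3 :=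
    (Set.ncard_le_ncard hpiece (Set.toFinite _)).trans
      ((h.ncard_dcl_le (by omega)).trans (Nat.pow_le_pow_right hK (by omega)))
  have hsmall' : ∀ b' ∈ T.cls {v} b, {c | vec c - vec b' ∈ C}.ncard ≤ K ^ 3 := by
    intro b' hb'
    refine le_trans ?_ hsmall
    obtain ⟨σ, hσ⟩ := T.exists_matching (κ := Unit) (by
      rw [Nat.card_sum, Nat.card_coe_set_eq, Set.ncard_singleton, Nat.card_unique]
      omega) (T.symm hb')
    refine Set.ncard_le_ncard_of_injOn (fun c => σ (fun _ => c) ()) (fun c hc => ?_) ?_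
      (Set.toFinite _)
    · exact sub_mem_core_of_rel (i := Sum.inl (Sum.inl ⟨v, rfl⟩)) (c := Sum.inl (Sum.inr ()))
        (b := Sum.inr ()) (hσ fun _ => c) (by
          rw [Nat.card_sum, Nat.card_sum, Nat.card_coe_set_eq, Set.ncard_singleton, Nat.card_unique]
          omega) hc
    · intro c _ c' _ hcc
      exact congrFun (σ.injective (funext fun _ => hcc)) ()
  have h1 := h.homogeneous {v} (by rw [Set.ncard_singleton]; omega) _ hbv
  rw [Set.ncard_singleton] at h1
  -- The same bound holds in the coset of each conjugate of b over v. The conjugates are therefore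
  -- spread over many cosets of the core, more than its index τ permits.
  have h2 : (T.cls {v} b).ncard * Nat.card C ≤ K ^ 3 * Nat.card (diffGroup vec Set.univ) := by
    have h3 := Finset.card_le_mul_card_image_of_maps_to
      (f := fun y : S × V => vec y.1 - vec v + y.2)
      (s := (T.cls {v} b).toFinset ×ˢ (C : Set V).toFinset)
      (t := (diffGroup vec Set.univ : Set V).toFinset) (fun y hy => by
        rw [Set.mem_toFinset]
        have hy' := Finset.mem_product.1 hy
        exact (diffGroup vec Set.univ).add_mem (sub_mem_diffGroup (Set.mem_univ _) (Set.mem_univ _))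
          (core_le (Set.mem_toFinset.1 hy'.2))) (K ^ 3) (fun z _ => ?_)
    · rw [Finset.card_product, ← Set.ncard_eq_toFinset_card', ← Set.ncard_eq_toFinset_card',
        ← Set.ncard_eq_toFinset_card', ← Nat.card_coe_set_eq (C : Set V),
        ← Nat.card_coe_set_eq (diffGroup vec Set.univ : Set V)] at h3
      exact h3
    · rcases Finset.eq_empty_or_nonempty (Finset.filter (fun y : S × V => vec y.1 - vec v + y.2 = z)
        ((T.cls {v} b).toFinset ×ˢ (C : Set V).toFinset)) with hE | ⟨⟨b', w⟩, hbw⟩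
      · rw [hE, Finset.card_empty]
        exact Nat.zero_le _
      · rw [Finset.mem_filter, Finset.mem_product, Set.mem_toFinset, Set.mem_toFinset] at hbw
        refine le_trans ?_ (hsmall' b' hbw.1.1)
        rw [← Set.ncard_coe_finset]
        refine Set.ncard_le_ncard_of_injOn Prod.fst (fun y hy => ?_) ?_ (Set.toFinite _)
        · rw [Finset.coe_filter, Set.mem_ofPred_eq, Finset.mem_product, Set.mem_toFinset,
            Set.mem_toFinset] at hy
          have h4 : vec y.1 - vec b' = w - y.2 := by
            have h5 := hy.2.trans hbw.2.symm
            rw [sub_eq_sub_iff_add_eq_add]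
            have h6 : vec y.1 + y.2 = vec b' + w := by
              have := congrArg (· + vec v) h5
              simpa [sub_add_eq_add_sub] using this
            rw [h6, add_comm]
          rw [Set.mem_ofPred_eq, h4]
          exact C.sub_mem hbw.1.2 hy.1.2
        · intro y hy y' hy' hyy
          rw [Finset.coe_filter, Set.mem_ofPred_eq] at hy hy'
          refine Prod.ext hyy ?_
          have h5 := hy.2.trans hy'.2.symm
          rw [hyy] at h5
          exact add_left_cancel h5
  have h3 : (T.cls {v} b).ncard ≤ K ^ 3 * τ := by
    refine Nat.le_of_mul_le_mul_right ?_ (Nat.card_pos (α := C))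
    calc _ ≤ _ := h2
      _ ≤ K ^ 3 * (τ * Nat.card C) := Nat.mul_le_mul_left _ hτ
      _ = _ := by ring
  have h4 := Nat.mul_le_mul_left (K ^ (1 + 1)) h3
  have h5 : K ^ (1 + 1) * (K ^ 3 * τ) = K ^ 5 * τ := by ring
  omega

theorem card_sup_le {V : Type} [AddCommGroup V] [Finite V] (A B : AddSubgroup V) :
    Nat.card ↥(A ⊔ B) ≤ Nat.card A * Nat.card B := by
  rw [← Nat.card_prod]
  refine Nat.card_le_card_of_surjective
    (fun y : A × B => (⟨y.1 + y.2, AddSubgroup.mem_sup.2 ⟨_, y.1.2, _, y.2.2, rfl⟩⟩ : ↥(A ⊔ B))) ?_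
  rintro ⟨z, hz⟩
  obtain ⟨a, ha, b, hb, rfl⟩ := AddSubgroup.mem_sup.1 hz
  exact ⟨(⟨a, ha⟩, ⟨b, hb⟩), rfl⟩

/-- The core has small index. -/
theorem Large.card_diffGroup_le_mul_card_core [Finite V] (h : T.Large K t) {p : ℕ} (hp : 0 < p)
    (hV : ∀ z : V, p • z = 0) {J P R τ : ℕ} {v : S} (ht : 3 ≤ t) (hm : 2 * R + 4 * J + 6 ≤ m)
    (hτ : Nat.card (diffGroup vec Set.univ) ≤ τ * Nat.card (T.core J P R v))
    (hn : K ^ 5 * τ < Nat.card S) :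
    Nat.card (diffGroup vec Set.univ) ≤ p ^ (K ^ 3 + K ^ 2) * Nat.card (T.core J P R v) := by
  classical
  have := Fintype.ofFinite S
  have := Fintype.ofFinite V
  have hd := h.depth
  have hnpos : 0 < Nat.card S := by omega
  set C := T.core J P R v with hC
  let r : S → V ⧸ C := fun b => QuotientAddGroup.mk (vec b)
  have hr : ∀ b c, r c = r b ↔ vec c - vec b ∈ C := by
    intro b c
    rw [eq_comm]
    simp only [r]
    rw [QuotientAddGroup.eq, neg_add_eq_sub]
  -- The preliminary index bound is exponential in P, the new one is not. At most K^3 cosets contain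
  -- many points, and the points in other cosets are among the at most K^2 elements definable over
  -- v. So U is generated by the core and at most K^3 + K^2 elements of order dividing p.
  set Big := (Finset.univ.image r).filter fun c =>
    Nat.card S ≤ K ^ 3 * (Finset.univ.filter fun b => r b = c).card with hBig
  have hBigcard : Big.card ≤ K ^ 3 := by
    refine Nat.le_of_mul_le_mul_right ?_ hnpos
    calc Big.card * Nat.card S = ∑ c ∈ Big, Nat.card S := by rw [Finset.sum_const, smul_eq_mul]
      _ ≤ ∑ c ∈ Big, K ^ 3 * (Finset.univ.filter fun b => r b = c).card :=
          Finset.sum_le_sum fun c hc => (Finset.mem_filter.1 hc).2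
      _ ≤ ∑ c ∈ Finset.univ.image r, K ^ 3 * (Finset.univ.filter fun b => r b = c).card :=
          Finset.sum_le_sum_of_subset (Finset.filter_subset _ _)
      _ = K ^ 3 * Nat.card S := by
          rw [← Finset.mul_sum, Nat.card_eq_fintype_card, ← Finset.card_univ]
          congr 1
          exact (Finset.card_eq_sum_card_image r Finset.univ).symm
  have hsub : Finset.univ.image r ⊆ Big ∪ (T.dcl {v}).toFinset.image r := by
    intro c hc
    obtain ⟨b, -, rfl⟩ := Finset.mem_image.1 hc
    rw [Finset.mem_union]
    by_cases hb : Nat.card S ≤ K ^ 3 * (Finset.univ.filter fun b' => r b' = r b).card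
    · exact Or.inl (Finset.mem_filter.2 ⟨hc, hb⟩)
    · refine Or.inr (Finset.mem_image_of_mem _ (Set.mem_toFinset.2 ?_))
      refine h.mem_dcl_of_small_piece ht hm hτ hn ?_
      rw [not_le] at hb
      have : (Finset.univ.filter fun b' => r b' = r b).card =
          {c | vec c - vec b ∈ T.core J P R v}.ncard := by
        rw [← Set.ncard_coe_finset]
        congr 1
        ext c
        simp [hr, hC]
      rwa [this] at hb
  have hcard : (Finset.univ.image r).card ≤ K ^ 3 + K ^ 2 := by
    refine (Finset.card_le_card hsub).trans ((Finset.card_union_le _ _).trans ?_)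
    refine Nat.add_le_add hBigcard (Finset.card_image_le.trans ?_)
    rw [← Set.ncard_eq_toFinset_card']
    have := h.ncard_dcl_le (A := {v}) (by rw [Set.ncard_singleton]; omega)
    rwa [Set.ncard_singleton] at this
  have hex : ∀ c : V ⧸ C, ∃ b, c ∈ Finset.univ.image r → r b = c := by
    intro c
    by_cases hc : c ∈ Finset.univ.image r
    · obtain ⟨b, -, hb⟩ := Finset.mem_image.1 hc
      exact ⟨b, fun _ => hb⟩
    · exact ⟨v, fun h => absurd h hc⟩
  choose g hg using hex
  set F : Finset V := (Finset.univ.image r).image fun c => vec (g c) - vec v with hF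
  have hle : diffGroup vec Set.univ ≤ C ⊔ AddSubgroup.closure (F : Set V) := by
    rw [diffGroup_le_iff (Set.mem_univ v)]
    intro b _
    have hb : r b ∈ Finset.univ.image r := Finset.mem_image_of_mem _ (Finset.mem_univ _)
    have h1 := (hr _ _).1 (hg _ hb).symm
    rw [← sub_add_sub_cancel (vec b) (vec (g (r b))) (vec v)]
    refine AddSubgroup.add_mem _ (AddSubgroup.mem_sup_left h1) (AddSubgroup.mem_sup_right ?_)
    exact AddSubgroup.subset_closure (Finset.mem_coe.2 (Finset.mem_image_of_mem _ hb))
  calc _ ≤ _ := AddSubgroup.card_le_of_le hle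
    _ ≤ _ := card_sup_le _ _
    _ ≤ Nat.card C * p ^ (K ^ 3 + K ^ 2) := by
        refine Nat.mul_le_mul_left _ ((card_closure_le hp hV F).trans ?_)
        exact Nat.pow_le_pow_right hp (Finset.card_image_le.trans hcard)
    _ = _ := mul_comm _ _

end TupleScheme

end PScheme

/-! ### Tuples with too few definable elements are rare. -/

namespace PScheme

namespace TupleScheme

variable {S V : Type} [AddCommGroup V] {vec : S → V} {m : ℕ} {T : TupleScheme vec m}
  {K t : ℕ}

variable [Finite S]

/-- Double counting: a character heavy at level 0 is trivial on the groups of at least n^R/Q tuples,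
and each good tuple admits at most τ characters. -/
theorem ncard_heavy_zero_le [Finite V] (hn : 0 < Nat.card S) {J Q R τ : ℕ} {v : S}
    (hτ : ∀ x : Fin R → S, T.IsGood J x v →
      Nat.card (annihilator (diffGroup vec Set.univ) (T.grp x v)) ≤ τ) (x : Fin R → S) :
    (T.heavy J Q v 0 x).ncard ≤ Q * τ := by
  classical
  have := Fintype.ofFinite S
  have : Fintype (AddChar (diffGroup vec Set.univ) ℂ) := by
    have := Fintype.ofFinite (diffGroup vec Set.univ)
    exact Fintype.ofFinite _
  set H := (T.heavy J Q v 0 x).toFinset with hH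
  let B : AddChar (diffGroup vec Set.univ) ℂ → (Fin R → S) → Prop := fun ψ y =>
    T.IsGood J y v ∧ ψ ∈ annihilator (diffGroup vec Set.univ) (T.grp y v)
  have h1 : H.card * Nat.card S ^ R ≤ (Q * τ) * Nat.card S ^ R := by
    calc H.card * Nat.card S ^ R = ∑ ψ ∈ H, Nat.card S ^ R := by rw [Finset.sum_const, smul_eq_mul]
      _ ≤ ∑ ψ ∈ H, Q * (Finset.univ.filter fun y => B ψ y).card := by
          refine Finset.sum_le_sum fun ψ hψ => ?_
          have h2 := Set.mem_toFinset.1 hψ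
          rw [heavy, Set.mem_ofPred_eq, Nat.sub_zero] at h2
          refine h2.trans (Nat.mul_le_mul_left _ ?_)
          rw [← Set.ncard_coe_finset]
          refine Set.ncard_le_ncard (fun y hy => ?_) (Set.toFinite _)
          simpa [B] using hy.2
      _ ≤ ∑ ψ, Q * (Finset.univ.filter fun y => B ψ y).card :=
          Finset.sum_le_sum_of_subset (Finset.subset_univ _)
      _ = Q * ∑ y, (Finset.univ.filter fun ψ => B ψ y).card := by
          rw [← Finset.mul_sum]
          congr 1
          exact Finset.sum_card_bipartiteAbove_eq_sum_card_bipartiteBelow _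
      _ ≤ Q * ∑ y : Fin R → S, τ := by
          refine Nat.mul_le_mul_left _ (Finset.sum_le_sum fun y _ => ?_)
          by_cases hy : T.IsGood J y v
          · refine le_trans ?_ (hτ y hy)
            rw [← Set.ncard_coe_finset]
            refine le_trans (Set.ncard_le_ncard (t := (annihilator (diffGroup vec Set.univ)
              (T.grp y v) : Set (AddChar _ ℂ))) (fun ψ hψ => ?_) (Set.toFinite _))
              (Nat.card_coe_set_eq _).symm.le
            simp only [Finset.coe_filter, Finset.mem_univ, true_and, Set.mem_ofPred_eq] at hψ
            exact hψ.2
          · have : (Finset.univ.filter fun ψ => B ψ y) = ∅ :=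
              Finset.filter_eq_empty_iff.2 fun ψ _ hB => hy hB.1
            rw [this, Finset.card_empty]
            exact Nat.zero_le _
      _ = (Q * τ) * Nat.card S ^ R := by
          rw [Finset.sum_const, smul_eq_mul, Finset.card_univ, Fintype.card_fun, Fintype.card_fin,
            ← Nat.card_eq_fintype_card]
          ring
  rw [Set.ncard_eq_toFinset_card']
  exact Nat.le_of_mul_le_mul_right h1 (Nat.pow_pos hn)

/-- For most good tuples with a small group, the class is not much smaller than forced by the number
of definable elements. -/
theorem Large.ncard_exceptional_le [Finite V] (h : T.Large K t) {p : ℕ} (hp : 0 < p)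
    (hV : ∀ z : V, p • z = 0) {J Q a R s M D P C : ℕ} (ha : 2 * R + s + 2 ≤ a) (hat : a + J + 1 ≤ t)
    (ht : 3 ≤ t) (hQ : (K ^ (a + 1)) ^ R ≤ Q) (hn : Q * (R * K ^ (a + 1)) < Nat.card S)
    (hM : Nat.card (diffGroup vec Set.univ) ≤ M * Nat.card S) (hs : M * K ^ (R + 1) < 2 ^ s)
    (hP : D * (Q * (M * K ^ (R + 1)) + 1) ^ s ≤ P)
    (hn' : K ^ 5 * (M * K ^ (R + 1)) ^ P < Nat.card S) (hR : 1 ≤ R) (hM1 : 1 ≤ M) (v : S) :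
    D * {x : Fin R → S | T.IsGood J x v ∧
      Nat.card (T.grp x v) ≤ C * (T.cls (Set.range x) v).ncard ∧
      C * (2 * R * M * D + p ^ (K ^ 3 + K ^ 2)) * T.dclCard x v *
        (T.cls (Set.range x) v).ncard < Nat.card S}.ncard ≤ 2 * Nat.card S ^ R := by
  classical
  have := Fintype.ofFinite S
  have hd := h.depth
  have hK : 1 ≤ K := by have := h.two_le; omega
  have hnpos : 0 < Nat.card S := by omega
  set U := diffGroup vec Set.univ with hU
  have : Fintype (AddChar U ℂ) := by
    have := Fintype.ofFinite U
    exact Fintype.ofFinite _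
  set τ := M * K ^ (R + 1) with hτ
  have hτ1 : 1 ≤ τ := Nat.mul_pos hM1 (Nat.pow_pos hK)
  have hUn : Nat.card S ≤ Nat.card U := by
    have := T.ncard_le_card_diffGroup (X := Set.univ) ⟨v, Set.mem_univ _⟩
    rwa [Set.ncard_univ] at this
  have hgrp : ∀ x : Fin R → S, T.IsGood J x v → Nat.card U ≤ τ * Nat.card (T.grp x v) :=
    fun x hx => h.card_diffGroup_le (by omega) hM hx
  have hann : ∀ x : Fin R → S, Nat.card (annihilator U (T.grp x v)) * Nat.card (T.grp x v) =
      Nat.card U := fun x => card_annihilator_mul U (grp_le x v)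
  have hannτ : ∀ x : Fin R → S, T.IsGood J x v → Nat.card (annihilator U (T.grp x v)) ≤ τ := by
    intro x hx
    have h1 := hgrp x hx
    rw [← hann x] at h1
    exact Nat.le_of_mul_le_mul_right h1 Nat.card_pos
  have hs' : ∀ x : Fin R → S, T.IsGood J x v → Nat.card U < 2 ^ s * Nat.card (T.grp x v) :=
    fun x hx => (hgrp x hx).trans_lt (Nat.mul_lt_mul_of_pos_right hs Nat.card_pos)
  have hcore := card_diffGroup_le_core (T := T) (J := J) (P := P) hnpos hτ1 hgrp
  have hindex := h.card_diffGroup_le_mul_card_core hp hV (J := J) (P := P) (R := R) (v := v) ht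
    (by omega) hcore hn'
  set G0 := p ^ (K ^ 3 + K ^ 2) with hG0
  set E := {x : Fin R → S | T.IsGood J x v ∧
      Nat.card (T.grp x v) ≤ C * (T.cls (Set.range x) v).ncard ∧
      C * (2 * R * M * D + G0) * T.dclCard x v *
        (T.cls (Set.range x) v).ncard < Nat.card S} with hE
  -- The group of a stable tuple contains the core, whose index is at most G0, so n ≤ G0·C·|class|.
  -- The exceptional inequality excludes this.
  have hunst : ∀ x ∈ E, ¬ T.IsStable J P x v := by
    rintro x ⟨-, h2, h3⟩ hst
    have h4 := T.dclCard_pos x v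
    have h5 := AddSubgroup.card_le_of_le hst.core_le
    refine absurd ?_ (not_le.2 h3)
    calc Nat.card S ≤ G0 * Nat.card (T.core J P R v) := hUn.trans hindex
      _ ≤ G0 * (C * (T.cls (Set.range x) v).ncard) := Nat.mul_le_mul_left _ (h5.trans h2)
      _ = C * G0 * 1 * (T.cls (Set.range x) v).ncard := by ring
      _ ≤ _ := by
          gcongr
          · exact Nat.le_add_left _ _
          · exact h4
  set T0 := T.heavy J Q v 0 (fun _ : Fin R => v) with hT0
  have hT0eq : ∀ x : Fin R → S, T.heavy J Q v 0 x = T0 := fun x =>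
    heavy_congr fun i hi => absurd hi (Nat.not_lt_zero _)
  have hT0card : T0.ncard ≤ Q * τ := ncard_heavy_zero_le hnpos hannτ _
  -- In the first case most of the annihilator is heavy at level 0. Such an annihilator is generated
  -- by its elements in the small set T0, so there are few candidates, and instability bounds the
  -- number of tuples for each. In the second case `sum_annihilator_le` applies.
  set E1 : Finset (Fin R → S) := Finset.univ.filter fun x => x ∈ E ∧
    Nat.card (annihilator U (T.grp x v)) < 2 * ((annihilator U (T.grp x v) : Set _) ∩ T0).ncard
    with hE1
  set E2 : Finset (Fin R → S) := Finset.univ.filter fun x => x ∈ E ∧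
    2 * ((annihilator U (T.grp x v) : Set _) ∩ T0).ncard ≤ Nat.card (annihilator U (T.grp x v))
    with hE2
  have hEsub : E ⊆ ((E1 ∪ E2 : Finset _) : Set (Fin R → S)) := by
    intro x hx
    rw [Finset.mem_coe, Finset.mem_union, Finset.mem_filter, Finset.mem_filter]
    rcases lt_or_ge (Nat.card (annihilator U (T.grp x v)))
      (2 * ((annihilator U (T.grp x v) : Set _) ∩ T0).ncard) with hlt | hle
    · exact Or.inl ⟨Finset.mem_univ _, hx, hlt⟩
    · exact Or.inr ⟨Finset.mem_univ _, hx, hle⟩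
  have hE1card : D * E1.card ≤ Nat.card S ^ R := by
    set A := (Q * τ + 1) ^ s with hA
    have hApos : 0 < A := Nat.pow_pos (Nat.succ_pos _)
    set 𝒩 := E1.image fun x => annihilator U (T.grp x v) with h𝒩
    have h𝒩card : 𝒩.card ≤ A := by
      rw [← Set.ncard_coe_finset]
      refine le_trans (Set.ncard_le_ncard ?_ (Set.toFinite _))
        ((ncard_half_subset_le T0 s).trans (Nat.pow_le_pow_left (by omega) s))
      intro N hN
      obtain ⟨x, hx, rfl⟩ := Finset.mem_image.1 (Finset.mem_coe.1 hN)
      have hx' := (Finset.mem_filter.1 hx).2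
      exact ⟨(hannτ x hx'.1.1).trans hs.le, hx'.2⟩
    have h1 : P * E1.card ≤ A * Nat.card S ^ R := by
      calc P * E1.card = ∑ N ∈ 𝒩, P * (E1.filter fun x => annihilator U (T.grp x v) = N).card := by
            rw [← Finset.mul_sum, Finset.card_eq_sum_card_image fun x => annihilator U (T.grp x v)]
        _ ≤ ∑ N ∈ 𝒩, Nat.card S ^ R := by
            refine Finset.sum_le_sum fun N hN => ?_
            obtain ⟨x, hx, rfl⟩ := Finset.mem_image.1 hN
            have hx' := (Finset.mem_filter.1 hx).2
            have hun := hunst x hx'.1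
            rw [IsStable, not_and, not_le] at hun
            refine le_trans (Nat.mul_le_mul_left _ ?_) (hun hx'.1.1).le
            rw [← Set.ncard_coe_finset]
            refine Set.ncard_le_ncard (fun y hy => ?_) (Set.toFinite _)
            have hy' := Finset.mem_filter.1 (Finset.mem_coe.1 hy)
            refine ⟨((Finset.mem_filter.1 hy'.1).2).1.1, ?_⟩
            exact annihilator_injOn U (grp_le y v) (grp_le x v) hy'.2
        _ = 𝒩.card * Nat.card S ^ R := by rw [Finset.sum_const, smul_eq_mul]
        _ ≤ _ := Nat.mul_le_mul_right _ h𝒩card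
    refine Nat.le_of_mul_le_mul_left ?_ hApos
    calc A * (D * E1.card) = D * A * E1.card := by ring
      _ ≤ P * E1.card := Nat.mul_le_mul_right _ hP
      _ ≤ _ := h1
  have hE2card : D * E2.card ≤ Nat.card S ^ R := by
    have h1 := h.sum_annihilator_le ha hat hQ hn hs' E2
      (fun x hx => (Finset.mem_filter.1 hx).2.1.1)
    have h2 : ∀ x ∈ E2, (R * M * D : ℝ) ≤
        (((annihilator U (T.grp x v) : Set (AddChar _ ℂ)) \ T.heavy J Q v 0 x).ncard : ℝ) /
          T.dclCard x v := by
      intro x hx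
      obtain ⟨-, ⟨hx1, hx2, hx3⟩, hx4⟩ := Finset.mem_filter.1 hx
      have hpos := T.dclCard_pos x v
      rw [hT0eq, le_div_iff₀ (by exact_mod_cast hpos)]
      have h3 := Set.ncard_inter_add_ncard_sdiff_eq_ncard
        (annihilator U (T.grp x v) : Set (AddChar U ℂ)) T0 (Set.toFinite _)
      have h4 : (annihilator U (T.grp x v) : Set (AddChar U ℂ)).ncard =
          Nat.card (annihilator U (T.grp x v)) :=
        (Nat.card_coe_set_eq (annihilator U (T.grp x v) : Set (AddChar U ℂ))).symm
      rw [h4] at h3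
      set c := (T.cls (Set.range x) v).ncard with hc
      have hcpos : 0 < c := T.ncard_cls_pos _ _
      have hCpos : 0 < C := by
        refine Nat.pos_of_ne_zero fun hC => ?_
        have h5 : 0 < Nat.card (T.grp x v) := Nat.card_pos
        rw [hC, zero_mul] at hx2
        omega
      have h5 : (2 * R * M * D + G0) * T.dclCard x v < Nat.card (annihilator U (T.grp x v)) := by
        refine Nat.lt_of_mul_lt_mul_left (a := C * c) ?_
        calc C * c * ((2 * R * M * D + G0) * T.dclCard x v)
            = C * (2 * R * M * D + G0) * T.dclCard x v * c := by ring
          _ < Nat.card S := hx3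
          _ ≤ Nat.card U := hUn
          _ = Nat.card (annihilator U (T.grp x v)) * Nat.card (T.grp x v) := (hann x).symm
          _ ≤ Nat.card (annihilator U (T.grp x v)) * (C * c) := Nat.mul_le_mul_left _ hx2
          _ = _ := mul_comm _ _
      -- At least half of the annihilator is not heavy, and its size |U|/|grp| exceeds (2RMD +
      -- G0)·`dclCard`. Each such tuple thus contributes at least RMD to a sum that is at most
      -- R·M·n^R.
      have h6 : 2 * R * M * D * T.dclCard x v ≤ (2 * R * M * D + G0) * T.dclCard x v :=
        Nat.mul_le_mul_right _ (Nat.le_add_right _ _)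
      have h7 : R * M * D * T.dclCard x v ≤
          ((annihilator U (T.grp x v) : Set (AddChar _ ℂ)) \ T0).ncard := by
        have : 2 * R * M * D * T.dclCard x v = 2 * (R * M * D * T.dclCard x v) := by ring
        omega
      exact_mod_cast h7
    have h3 : (Nat.card S : ℝ) * (E2.card * (R * M * D)) ≤
        R * ((Nat.card S : ℝ) ^ R * (M * Nat.card S)) := by
      rw [Nat.card_eq_fintype_card]
      calc (Fintype.card S : ℝ) * (E2.card * (R * M * D))
          = (Fintype.card S : ℝ) * ∑ x ∈ E2, (R * M * D : ℝ) := by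
            rw [Finset.sum_const, nsmul_eq_mul]
        _ ≤ _ := mul_le_mul_of_nonneg_left (Finset.sum_le_sum h2) (Nat.cast_nonneg _)
        _ ≤ _ := h1
        _ ≤ _ := by
            rw [Nat.card_eq_fintype_card (α := S)] at hM
            gcongr
            exact_mod_cast hM
    have h4 : Nat.card S * (E2.card * (R * M * D)) ≤ R * (Nat.card S ^ R * (M * Nat.card S)) := by
      exact_mod_cast h3
    refine le_of_mul_le_mul_left (a := Nat.card S * (R * M)) ?_
      (Nat.mul_pos hnpos (Nat.mul_pos hR hM1))
    calc Nat.card S * (R * M) * (D * E2.card) = Nat.card S * (E2.card * (R * M * D)) := by ring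
      _ ≤ _ := h4
      _ = _ := by ring
  calc D * E.ncard ≤ D * (E1.card + E2.card) := by
        refine Nat.mul_le_mul_left _ ((Set.ncard_le_ncard hEsub (Set.toFinite _)).trans ?_)
        rw [Set.ncard_coe_finset]
        exact Finset.card_union_le _ _
    _ ≤ _ := by linarith

end TupleScheme

end PScheme

/-! ### Heights and translations between classes. -/

namespace PScheme

theorem sum_snoc {S : Type} [Fintype S] {k : ℕ} (f : (Fin (k + 1) → S) → ℝ) :
    ∑ z, f z = ∑ x : Fin k → S, ∑ y, f (Fin.snoc (α := fun _ => S) x y) := by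
  rw [← Fintype.sum_prod_type' fun (x : Fin k → S) y => f (Fin.snoc (α := fun _ => S) x y)]
  refine Fintype.sum_equiv ((Fin.snocEquiv fun _ : Fin (k + 1) => S).symm.trans
    (Equiv.prodComm _ _)) _ _ fun z => ?_
  simp

theorem range_snoc {S : Type} {k : ℕ} (x : Fin k → S) (y : S) :
    Set.range (Fin.snoc (α := fun _ => S) x y : Fin (k + 1) → S) = insert y (Set.range x) := by
  ext s
  constructor
  · rintro ⟨i, rfl⟩
    refine Fin.lastCases ?_ (fun i => ?_) i
    · simp
    · simp
  · rintro (rfl | ⟨i, rfl⟩)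
    · exact ⟨Fin.last k, by simp⟩
    · exact ⟨i.castSucc, by simp⟩

namespace TupleScheme

variable {S V : Type} [AddCommGroup V] {vec : S → V} {m : ℕ} (T : TupleScheme vec m)

/-- The logarithm of the number of elements over the size of the class of `v` over `x`. -/
noncomputable def defect {k : ℕ} (x : Fin k → S) (v : S) : ℝ :=
  Real.log (Nat.card S / (T.cls (Set.range x) v).ncard)

/-- The mean defect over tuples of length `k`. -/
noncomputable def height [Fintype S] (k : ℕ) : ℝ :=
  (∑ x : Fin k → S, ∑ v, T.defect x v) / (Nat.card S : ℝ) ^ (k + 1)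

/-- The translation from `v` to `v'` is a difference of elements over which the class of `v` over `x`
does not shrink by more than the factor `F`. -/
def IsNear (F : ℕ) {R : ℕ} (x : Fin R → S) (v v' : S) : Prop :=
  ∃ y y', vec y' - vec y = vec v' - vec v ∧
    (T.cls (Set.range x) v).ncard ≤ F * (T.cls (insert y' (insert y (Set.range x))) v).ncard

variable {T}

/-- Markov's inequality: the height increment is the mean of the logarithm of the factor by which a
class shrinks when two random constants are added, and this logarithm is never negative. -/
theorem log_mul_ncard_le [Fintype S] [Nonempty S] {F R : ℕ} (hF : 1 ≤ F) :
    Real.log F * {q : (Fin R → S) × S × S × S | ¬ (T.cls (Set.range q.1) q.2.1).ncard ≤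
      F * (T.cls (insert q.2.2.2 (insert q.2.2.1 (Set.range q.1))) q.2.1).ncard}.ncard ≤
      (Nat.card S : ℝ) ^ (R + 3) * (T.height (R + 2) - T.height R) := by
  classical
  set n : ℝ := (Nat.card S : ℝ) with hn
  have hnpos : 0 < n := by
    rw [hn]
    exact_mod_cast Nat.card_pos
  have h1 : n ^ (R + 3) * T.height (R + 2) = ∑ q : (Fin R → S) × S × S × S,
      Real.log (n / (T.cls (insert q.2.2.2 (insert q.2.2.1 (Set.range q.1))) q.2.1).ncard) := by
    rw [height, mul_div_cancel₀ _ (by positivity), sum_snoc, sum_snoc, Fintype.sum_prod_type]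
    refine Finset.sum_congr rfl fun x _ => ?_
    simp_rw [Fintype.sum_prod_type]
    rw [Finset.sum_comm' (s := Finset.univ) (t := fun _ => Finset.univ) (t' := Finset.univ)
      (s' := fun _ => Finset.univ) (by simp)]
    rw [Finset.sum_comm]
    rw [Finset.sum_comm]
    refine Eq.trans (b := ∑ y : S, ∑ v : S, ∑ y' : S, Real.log (n / (T.cls (insert y'
      (insert y (Set.range x))) v).ncard)) ?_ Finset.sum_comm
    rw [Finset.sum_comm]
    refine Finset.sum_congr rfl fun y _ => ?_
    rw [Finset.sum_comm]
    simp only [defect, range_snoc, hn]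
  have h2 : n ^ (R + 3) * T.height R = ∑ q : (Fin R → S) × S × S × S,
      Real.log (n / (T.cls (Set.range q.1) q.2.1).ncard) := by
    have : n ^ (R + 3) = n ^ 2 * n ^ (R + 1) := by ring
    rw [this, mul_assoc, height, mul_div_cancel₀ _ (by positivity)]
    simp_rw [Fintype.sum_prod_type]
    simp only [Finset.sum_const, Finset.card_univ, nsmul_eq_mul, ← Finset.mul_sum]
    simp only [hn, Nat.card_eq_fintype_card, defect]
    ring
  rw [mul_sub, h1, h2, ← Finset.sum_sub_distrib, Set.ncard_eq_toFinset_card', mul_comm,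
    ← nsmul_eq_mul, ← Finset.sum_const]
  have hpos : ∀ (A : Set S) v, (0 : ℝ) < (T.cls A v).ncard := fun A v => by
    exact_mod_cast T.ncard_cls_pos A v
  have hlog : ∀ q : (Fin R → S) × S × S × S,
      Real.log (n / (T.cls (insert q.2.2.2 (insert q.2.2.1 (Set.range q.1))) q.2.1).ncard) -
        Real.log (n / (T.cls (Set.range q.1) q.2.1).ncard) =
      Real.log (T.cls (Set.range q.1) q.2.1).ncard -
        Real.log (T.cls (insert q.2.2.2 (insert q.2.2.1 (Set.range q.1))) q.2.1).ncard := by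
    intro q
    rw [Real.log_div hnpos.ne' (hpos _ _).ne', Real.log_div hnpos.ne' (hpos _ _).ne']
    ring
  simp_rw [hlog]
  refine (Finset.sum_le_sum fun q hq => ?_).trans
    (Finset.sum_le_sum_of_subset_of_nonneg (Finset.subset_univ _) fun q _ _ => ?_)
  · have hq' := Set.mem_toFinset.1 hq
    rw [Set.mem_ofPred_eq, not_le] at hq'
    rw [le_sub_iff_add_le, ← Real.log_mul (by positivity) (hpos _ _).ne']
    refine Real.log_le_log (mul_pos (by exact_mod_cast hF) (hpos _ _)) ?_
    exact_mod_cast hq'.le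
  · rw [sub_nonneg]
    refine Real.log_le_log (hpos _ _) ?_
    exact_mod_cast Set.ncard_le_ncard (T.cls_anti
      ((Set.subset_insert _ _).trans (Set.subset_insert _ _)) _) (Set.toFinite _)

/-- There are at most κn differences, and the unpopular ones have fewer than n/(Dκ) representations
each. -/
theorem mul_ncard_unpopular_le [Finite S] {κ D : ℕ} (hκ : 1 ≤ κ)
    (h : {z | ∃ x y : S, z = vec y - vec x}.ncard ≤ κ * Nat.card S) :
    D * {q : S × S | D * κ * {p : S × S | vec p.2 - vec p.1 = vec q.2 - vec q.1}.ncard <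
      Nat.card S}.ncard ≤ Nat.card S ^ 2 := by
  classical
  have := Fintype.ofFinite S
  let d : S × S → V := fun q => vec q.2 - vec q.1
  set B : Finset (S × S) := Finset.univ.filter fun q => D * κ * {p : S × S | d p = d q}.ncard <
    Nat.card S with hB
  have hBeq : {q : S × S | D * κ * {p : S × S | vec p.2 - vec p.1 = vec q.2 - vec q.1}.ncard <
      Nat.card S}.ncard = B.card := by
    rw [← Set.ncard_coe_finset]
    congr 1
    ext q
    simp [hB, d]
  rw [hBeq]
  have h1 : (B.image d).card ≤ κ * Nat.card S := by
    rw [← Set.ncard_coe_finset]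
    refine le_trans (Set.ncard_le_ncard ?_ ?_) h
    · rintro z hz
      obtain ⟨q, -, rfl⟩ := Finset.mem_image.1 (Finset.mem_coe.1 hz)
      exact ⟨q.1, q.2, rfl⟩
    · refine (Set.finite_range d).subset ?_
      rintro z ⟨x, y, rfl⟩
      exact ⟨(x, y), rfl⟩
  have h2 : D * κ * B.card ≤ κ * Nat.card S * Nat.card S := by
    calc D * κ * B.card = ∑ z ∈ B.image d, D * κ * (B.filter fun q => d q = z).card := by
          rw [← Finset.mul_sum, Finset.card_eq_sum_card_image d]
      _ ≤ ∑ z ∈ B.image d, Nat.card S := by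
          refine Finset.sum_le_sum fun z hz => ?_
          obtain ⟨q, hq, rfl⟩ := Finset.mem_image.1 hz
          refine le_trans (Nat.mul_le_mul_left _ ?_) (Finset.mem_filter.1 hq).2.le
          rw [← Set.ncard_coe_finset]
          refine Set.ncard_le_ncard (fun p hp => ?_) (Set.toFinite _)
          exact (Finset.mem_filter.1 (Finset.mem_coe.1 hp)).2
      _ = (B.image d).card * Nat.card S := by rw [Finset.sum_const, smul_eq_mul]
      _ ≤ _ := Nat.mul_le_mul_right _ h1
  refine le_of_mul_le_mul_left (a := κ) ?_ hκ
  calc κ * (D * B.card) = D * κ * B.card := by ring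
    _ ≤ _ := h2
    _ = _ := by ring

theorem mul_ncard_not_isNear_le [Fintype S] [Nonempty S] {κ D F R : ℕ} (hκ : 1 ≤ κ)
    (h : {z | ∃ x y : S, z = vec y - vec x}.ncard ≤ κ * Nat.card S) (hF : 2 ≤ F)
    (hD : D ^ 2 * κ * (T.height (R + 2) - T.height R) ≤ Real.log F) :
    D * {q : (Fin R → S) × S × S | ¬ T.IsNear F q.1 q.2.1 q.2.2}.ncard ≤
      2 * Nat.card S ^ (R + 2) := by
  classical
  set n := Nat.card S with hn
  have hnpos : 0 < n := Nat.card_pos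
  set B := {q : (Fin R → S) × S × S × S | ¬ (T.cls (Set.range q.1) q.2.1).ncard ≤
      F * (T.cls (insert q.2.2.2 (insert q.2.2.1 (Set.range q.1))) q.2.1).ncard} with hB
  have hlogF : 0 < Real.log F := Real.log_pos (by exact_mod_cast hF)
  have h1 : D ^ 2 * κ * B.ncard ≤ n ^ (R + 3) := by
    have h2 := log_mul_ncard_le (T := T) (F := F) (R := R) (by omega)
    have h3 : Real.log F * ((D : ℝ) ^ 2 * κ * B.ncard) ≤ Real.log F * (n : ℝ) ^ (R + 3) := by
      calc Real.log F * ((D : ℝ) ^ 2 * κ * B.ncard) = (D : ℝ) ^ 2 * κ * (Real.log F * B.ncard) := by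
            ring
        _ ≤ (D : ℝ) ^ 2 * κ * ((n : ℝ) ^ (R + 3) * (T.height (R + 2) - T.height R)) :=
            mul_le_mul_of_nonneg_left h2 (by positivity)
        _ = (n : ℝ) ^ (R + 3) * ((D : ℝ) ^ 2 * κ * (T.height (R + 2) - T.height R)) := by ring
        _ ≤ (n : ℝ) ^ (R + 3) * Real.log F := mul_le_mul_of_nonneg_left hD (by positivity)
        _ = _ := mul_comm _ _
    exact_mod_cast le_of_mul_le_mul_left h3 hlogF
  set un : Finset (S × S) := Finset.univ.filter fun q =>
    D * κ * {p : S × S | vec p.2 - vec p.1 = vec q.2 - vec q.1}.ncard < n with hun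
  have hun1 : D * un.card ≤ n ^ 2 := by
    have := mul_ncard_unpopular_le (D := D) hκ h
    rwa [Set.ncard_eq_toFinset_card', Set.toFinset_ofPred] at this
  set bad : Finset ((Fin R → S) × S × S) := Finset.univ.filter fun q =>
    ¬ T.IsNear F q.1 q.2.1 q.2.2 with hbad
  rw [Set.ncard_eq_toFinset_card', Set.toFinset_ofPred, ← hbad]
  set bad1 := bad.filter fun q => q.2 ∉ un with hbad1
  have hsub : bad ⊆ (Finset.univ ×ˢ un) ∪ bad1 := by
    intro q hq
    rw [Finset.mem_union, Finset.mem_product]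
    by_cases hqu : q.2 ∈ un
    · exact Or.inl ⟨Finset.mem_univ _, hqu⟩
    · exact Or.inr (Finset.mem_filter.2 ⟨hq, hqu⟩)
  -- If v' - v is popular and v, v' are not near, then each of the n/(Dκ) pairs with this difference
  -- shrinks the class of v by more than F. The quadruple (x, v, y, y') determines v', so
  -- `log_mul_ncard_le` bounds the number of such triples.
  have hbad1n : n * bad1.card ≤ D * κ * B.ncard := by
    have h2 : (bad1.sigma fun q => Finset.univ.filter fun p : S × S =>
        vec p.2 - vec p.1 = vec q.2.2 - vec q.2.1).card ≤ B.ncard := by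
      rw [← Set.ncard_coe_finset]
      refine Set.ncard_le_ncard_of_injOn (fun y => (y.1.1, y.1.2.1, y.2.1, y.2.2)) ?_ ?_
        (Set.toFinite _)
      · rintro ⟨⟨x, v, v'⟩, ⟨y, y'⟩⟩ hy
        rw [Finset.mem_coe, Finset.mem_sigma] at hy
        have hy1 := (Finset.mem_filter.1 (Finset.mem_filter.1 hy.1).1).2
        exact fun hle => hy1 ⟨y, y', (Finset.mem_filter.1 hy.2).2, hle⟩
      · rintro ⟨⟨x, v, v'⟩, ⟨y, y'⟩⟩ hy ⟨⟨x2, v2, v2'⟩, ⟨y2, y2'⟩⟩ hy2 heq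
        rw [Finset.mem_coe, Finset.mem_sigma] at hy hy2
        simp only [Prod.mk.injEq] at heq
        obtain ⟨rfl, rfl, rfl, rfl⟩ := heq
        have : v' = v2' := T.inj (sub_left_injective ((Finset.mem_filter.1 hy.2).2.symm.trans
          (Finset.mem_filter.1 hy2.2).2))
        subst this
        rfl
    rw [Finset.card_sigma] at h2
    calc n * bad1.card = ∑ q ∈ bad1, n := by rw [Finset.sum_const, smul_eq_mul, mul_comm]
      _ ≤ ∑ q ∈ bad1, D * κ * (Finset.univ.filter fun p : S × S =>
          vec p.2 - vec p.1 = vec q.2.2 - vec q.2.1).card := by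
          refine Finset.sum_le_sum fun q hq => ?_
          have hq' := (Finset.mem_filter.1 hq).2
          rw [Finset.mem_filter, not_and, not_lt] at hq'
          have := hq' (Finset.mem_univ _)
          rwa [Set.ncard_eq_toFinset_card', Set.toFinset_ofPred] at this
      _ ≤ _ := by
          rw [← Finset.mul_sum]
          exact Nat.mul_le_mul_left _ h2
  have hbad1c : D * bad1.card ≤ n ^ (R + 2) := by
    refine le_of_mul_le_mul_left (a := n) ?_ hnpos
    calc n * (D * bad1.card) = D * (n * bad1.card) := by ring
      _ ≤ D * (D * κ * B.ncard) := Nat.mul_le_mul_left _ hbad1n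
      _ = D ^ 2 * κ * B.ncard := by ring
      _ ≤ _ := h1
      _ = _ := by ring
  have huniv : D * (Finset.univ ×ˢ un : Finset ((Fin R → S) × S × S)).card ≤ n ^ (R + 2) := by
    rw [Finset.card_product, Finset.card_univ, Fintype.card_fun, Fintype.card_fin,
      ← Nat.card_eq_fintype_card]
    calc D * (n ^ R * un.card) = n ^ R * (D * un.card) := by ring
      _ ≤ n ^ R * n ^ 2 := Nat.mul_le_mul_left _ hun1
      _ = _ := by ring
  calc D * bad.card ≤ D * ((Finset.univ ×ˢ un : Finset ((Fin R → S) × S × S)).card + bad1.card) :=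
        Nat.mul_le_mul_left _ ((Finset.card_le_card hsub).trans (Finset.card_union_le _ _))
    _ ≤ _ := by linarith

theorem IsNear.of_rel [Finite S] {F R : ℕ} {x : Fin R → S} {v v' w w' : S}
    (h : T.IsNear F x v v') (hm : R + 6 ≤ m)
    (hrel : T.rel (Sum.elim x ![v, v']) (Sum.elim x ![w, w'])) : T.IsNear F x w w' := by
  obtain ⟨y, y', hy, hc⟩ := h
  obtain ⟨u, hu⟩ := T.exists_ext ![y, y'] (by simp; omega) hrel
  refine ⟨u 0, u 1, ?_, ?_⟩
  · obtain ⟨φ, hφ⟩ := T.lin hu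
    have h1 := hφ (Sum.inl (Sum.inr 0))
    have h2 := hφ (Sum.inl (Sum.inr 1))
    have h3 := hφ (Sum.inr 0)
    have h4 := hφ (Sum.inr 1)
    simp only [Sum.elim_inl, Sum.elim_inr, Matrix.cons_val_zero, Matrix.cons_val_one] at h1 h2 h3 h4
    rw [← h1, ← h2, ← h3, ← h4, ← map_sub, hy, map_sub]
  · have e1 : (T.cls (Set.range x) v).ncard = (T.cls (Set.range x) w).ncard :=
      T.ncard_cls_eq_of_rel (by simp; omega) (T.rel_of (Sum.elim Sum.inl fun _ => Sum.inr 0) hrel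
        (by rintro (i | i) <;> rfl) (by rintro (i | i) <;> rfl))
    have hr : ∀ a b : S, insert b (insert a (Set.range x)) = Set.range (Sum.elim x ![a, b]) := by
      intro a b
      rw [Set.Sum.elim_range, Matrix.range_cons_cons_empty, Set.union_comm]
      ext s
      simp only [Set.mem_insert_iff, Set.mem_union, Set.mem_singleton_iff]
      tauto
    have e2 : (T.cls (insert y' (insert y (Set.range x))) v).ncard =
        (T.cls (insert (u 1) (insert (u 0) (Set.range x))) w).ncard := by
      rw [hr, hr]
      refine T.ncard_cls_eq_of_rel (by simp; omega) (T.rel_of (Sum.elim (Sum.elim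
        (fun i => Sum.inl (Sum.inl i)) Sum.inr) fun _ => Sum.inl (Sum.inr 0)) hu ?_ ?_)
      · rintro ((i | i) | i) <;> rfl
      · rintro ((i | i) | i)
        · rfl
        · fin_cases i <;> rfl
        · rfl
    rwa [← e1, ← e2]

/-- Conjugations over x, y and y' fix y' - y = v' - v. Translation by it therefore carries the class
of v over these constants into the class of v' over x. -/
theorem IsNear.ncard_cls_le [Finite S] {F R : ℕ} {x : Fin R → S} {v v' : S}
    (h : T.IsNear F x v v') (hm : 2 * R + 6 ≤ m) :
    (T.cls (Set.range x) v).ncard ≤ F * {a | a ∈ T.cls (Set.range x) v ∧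
      ∃ b ∈ T.cls (Set.range x) v', vec b - vec a = vec v' - vec v}.ncard := by
  obtain ⟨y, y', hy, hc⟩ := h
  refine hc.trans (Nat.mul_le_mul_left _ (Set.ncard_le_ncard ?_ (Set.toFinite _)))
  intro a ha
  set A := insert y' (insert y (Set.range x)) with hA
  have hsub : Set.range x ⊆ A := (Set.subset_insert _ _).trans (Set.subset_insert _ _)
  have hAcard : A.ncard ≤ R + 2 := by
    have h1 := Set.ncard_insert_le y' (insert y (Set.range x))
    have h2 := Set.ncard_insert_le y (Set.range x)
    have h3 := ncard_range_fin_le x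
    rw [hA]
    omega
  refine ⟨T.cls_anti hsub _ ha, ?_⟩
  obtain ⟨b, hb⟩ := T.exists_ext_over (fun _ : Unit => v') (by simp; omega) ha
  refine ⟨b (), T.cls_anti hsub _ (T.apply_mem_cls hb (Sum.inr ())), ?_⟩
  obtain ⟨φ, hφ, hφ'⟩ := T.exists_aut hb
  have h1 : φ (vec v) = vec a := hφ' (Sum.inl ())
  have h2 : φ (vec v') = vec (b ()) := hφ' (Sum.inr ())
  have h3 : φ (vec y) = vec y := hφ _ (AddSubgroup.subset_closure
    ⟨y, Or.inr (Set.mem_insert _ _), rfl⟩)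
  have h4 : φ (vec y') = vec y' := hφ _ (AddSubgroup.subset_closure ⟨y', Or.inl rfl, rfl⟩)
  rw [← h1, ← h2, ← map_sub, ← hy, map_sub, h3, h4]

end TupleScheme

end PScheme

/-! ### Most classes have small doubling and many definable elements. -/

namespace PScheme

theorem mul_ncard_le_of_fibre {α β : Type} [Finite α] [Finite β] {B : Set (α × β)} {D c : ℕ}
    (h : ∀ b, D * {a | (a, b) ∈ B}.ncard ≤ c) : D * B.ncard ≤ Nat.card β * c := by
  classical
  have := Fintype.ofFinite α
  have := Fintype.ofFinite β
  rw [Set.ncard_eq_toFinset_card']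
  calc D * B.toFinset.card = ∑ b : β, D * (B.toFinset.filter fun q => q.2 = b).card := by
        rw [← Finset.mul_sum, ← Finset.card_eq_sum_card_fiberwise (f := Prod.snd) (s := B.toFinset)
          fun _ _ => Finset.mem_coe.2 (Finset.mem_univ _)]
    _ ≤ ∑ b : β, c := by
        refine Finset.sum_le_sum fun b _ => le_trans (Nat.mul_le_mul_left _ ?_) (h b)
        rw [← Set.ncard_coe_finset]
        refine Set.ncard_le_ncard_of_injOn Prod.fst (fun q hq => ?_) (fun q hq q' hq' hqq => ?_)
          (Set.toFinite _)
        · have hq' := Finset.mem_filter.1 (Finset.mem_coe.1 hq)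
          rw [Set.mem_ofPred_eq, ← hq'.2]
          exact Set.mem_toFinset.1 hq'.1
        · have h1 := (Finset.mem_filter.1 (Finset.mem_coe.1 hq)).2
          have h2 := (Finset.mem_filter.1 (Finset.mem_coe.1 hq')).2
          exact Prod.ext hqq (h1.trans h2.symm)
    _ = _ := by rw [Finset.sum_const, smul_eq_mul, Finset.card_univ, Nat.card_eq_fintype_card]

theorem mul_ncard_le_of_fibre' {α β : Type} [Finite α] [Finite β] {B : Set (α × β)} {D c : ℕ}
    (h : ∀ a, D * {b | (a, b) ∈ B}.ncard ≤ c) : D * B.ncard ≤ Nat.card α * c := by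
  have h1 := mul_ncard_le_of_fibre (B := Prod.swap ⁻¹' B) (D := D) (c := c) h
  refine le_trans (Nat.mul_le_mul_left _ ?_) h1
  refine Set.ncard_le_ncard_of_injOn Prod.swap (fun q hq => ?_) Prod.swap_injective.injOn
    (Set.toFinite _)
  simpa using hq

namespace TupleScheme

variable {S V : Type} [AddCommGroup V] {vec : S → V} {m : ℕ} {T : TupleScheme vec m} {K t : ℕ}

/-- If v is near to most points in both directions, averaging over classes gives a class Y in which
at most a quarter of the points are bad for v. By homogeneity of types the same holds for each w in
the class of v, and `ncard_sub_le_of_popular` applies. -/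
theorem ncard_sub_cls_le [Finite S] {F R : ℕ} {x : Fin R → S} {v : S} (hm : 2 * R + 6 ≤ m)
    (h : 4 * {v' | ¬ T.IsNear F x v v' ∨ ¬ T.IsNear F x v' v}.ncard ≤ Nat.card S) :
    {z | ∃ a ∈ T.cls (Set.range x) v, ∃ b ∈ T.cls (Set.range x) v, z = vec a - vec b}.ncard ≤
      2 * F ^ 2 * (T.cls (Set.range x) v).ncard := by
  classical
  have := Fintype.ofFinite S
  set bad : S → S → Prop := fun w v' => ¬ T.IsNear F x w v' ∨ ¬ T.IsNear F x v' w with hbad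
  have hbad_rel : ∀ {w w' a a'}, T.rel (Sum.elim x ![w, a]) (Sum.elim x ![w', a']) →
      bad w a → bad w' a' := by
    intro w w' a a' hr hwa
    rcases hwa with hwa | hwa
    · exact Or.inl fun hn => hwa (hn.of_rel (by omega) (T.symm hr))
    · refine Or.inr fun hn => hwa (hn.of_rel (by omega) (T.rel_of (Sum.elim Sum.inl
        ![Sum.inr 1, Sum.inr 0]) (T.symm hr) ?_ ?_)) <;>
      · rintro (i | i)
        · rfl
        · fin_cases i <;> rfl
  obtain ⟨y0, hy0⟩ : ∃ y0, 4 * {y | y ∈ T.cls (Set.range x) y0 ∧ bad v y}.ncard ≤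
      (T.cls (Set.range x) y0).ncard := by
    let cl : S → Set S := fun y => T.cls (Set.range x) y
    have h1 : ∑ Y ∈ Finset.univ.image cl,
        4 * ((Finset.univ.filter fun y => bad v y).filter fun y => cl y = Y).card ≤
        ∑ Y ∈ Finset.univ.image cl, (Finset.univ.filter fun y => cl y = Y).card := by
      rw [← Finset.mul_sum, ← Finset.card_eq_sum_card_image,
        ← Finset.card_eq_sum_card_fiberwise fun y _ =>
          Finset.mem_coe.2 (Finset.mem_image_of_mem _ (Finset.mem_univ y)), Finset.card_univ,
        ← Nat.card_eq_fintype_card, ← Set.ncard_coe_finset]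
      refine le_trans (le_of_eq ?_) h
      congr 2
      ext y
      simp [hbad]
    obtain ⟨Y, hY, hY'⟩ := Finset.exists_le_of_sum_le
      ⟨cl v, Finset.mem_image_of_mem _ (Finset.mem_univ v)⟩ h1
    obtain ⟨y0, -, rfl⟩ := Finset.mem_image.1 hY
    have hcl : ∀ y, cl y = cl y0 ↔ y ∈ T.cls (Set.range x) y0 := fun y =>
      ⟨fun hy => by
        rw [← show cl y = T.cls (Set.range x) y0 from hy]
        exact T.mem_cls_self _ _, fun hy => T.cls_eq_of_mem hy⟩
    refine ⟨y0, ?_⟩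
    rw [← Set.ncard_coe_finset, ← Set.ncard_coe_finset] at hY'
    have e1 : {y | y ∈ T.cls (Set.range x) y0 ∧ bad v y} =
        ((Finset.univ.filter fun y => bad v y).filter fun y => cl y = cl y0 : Finset S) := by
      ext y
      rw [Finset.mem_coe, Finset.mem_filter, Finset.mem_filter, hcl]
      exact ⟨fun hy => ⟨⟨Finset.mem_univ _, hy.2⟩, hy.1⟩, fun hy => ⟨hy.2, hy.1.2⟩⟩
    have e2 : T.cls (Set.range x) y0 = (Finset.univ.filter fun y => cl y = cl y0 : Finset S) := by
      ext y
      rw [Finset.mem_coe, Finset.mem_filter, hcl]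
      exact ⟨fun hy => ⟨Finset.mem_univ _, hy⟩, fun hy => hy.2⟩
    rw [e1]
    exact hY'.trans (le_of_eq (congrArg Set.ncard e2.symm))
  refine ncard_sub_le_of_popular T.inj ⟨v, T.mem_cls_self _ _⟩ ⟨y0, T.mem_cls_self _ y0⟩
    fun w hw => le_trans (Nat.mul_le_mul_left _ ?_) hy0
  -- A matching of extensions over the relation w ~ v injects the bad points of w into the bad
  -- points of v within the same class.
  obtain ⟨σ, hσ⟩ := T.exists_matching (κ := Unit) (by simp; omega) (T.symm (T.relOver_range.1 hw))
  have hσ2 : ∀ a, T.rel (Sum.elim x ![w, a]) (Sum.elim x ![v, σ (fun _ => a) ()]) := by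
    intro a
    refine T.rel_of (Sum.elim (fun i => Sum.inl (Sum.inl i)) ![Sum.inl (Sum.inr ()), Sum.inr ()])
      (hσ fun _ => a) ?_ ?_ <;>
    · rintro (i | i)
      · rfl
      · fin_cases i <;> rfl
  refine Set.ncard_le_ncard_of_injOn (fun a => σ (fun _ => a) ()) (fun a ha => ?_) ?_ (Set.toFinite _)
  · obtain ⟨haY, ha⟩ := ha
    refine ⟨?_, ?_⟩
    · have h1 : σ (fun _ => a) () ∈ T.cls (Set.range x) a := by
        refine T.relOver_range.2 (T.rel_of (Sum.elim (fun i => Sum.inl (Sum.inl i)) Sum.inr)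
          (hσ fun _ => a) ?_ ?_) <;> rintro (i | i) <;> rfl
      rw [← T.cls_eq_of_mem haY]
      exact h1
    · refine hbad_rel (hσ2 a) ?_
      by_contra hnb
      simp only [hbad, not_or, not_not] at hnb
      refine ha ⟨?_, ?_⟩
      · have h1 := hnb.1.ncard_cls_le hm
        rwa [T.cls_eq_of_mem hw, T.cls_eq_of_mem haY] at h1
      · have h1 := hnb.2.ncard_cls_le hm
        rw [T.cls_eq_of_mem hw, T.cls_eq_of_mem haY] at h1
        refine h1.trans (Nat.mul_le_mul_left _ ?_)
        have : Nonempty S := ⟨v⟩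
        have key : ∀ b ∈ {b | b ∈ T.cls (Set.range x) y0 ∧ ∃ c ∈ T.cls (Set.range x) v,
            vec c - vec b = vec w - vec a}, ∃ c ∈ T.cls (Set.range x) v,
            vec c - vec b = vec w - vec a := fun b hb => hb.2
        choose! g hg hg' using key
        refine Set.ncard_le_ncard_of_injOn g (fun b hb => ⟨hg b hb, b, hb.1, ?_⟩)
          (fun b hb b' hb' hbb => ?_) (Set.toFinite _)
        · rw [← neg_sub, hg' b hb, neg_sub]
        · have h2 := (hg' b hb).trans (hg' b' hb').symm
          rw [hbb] at h2
          exact T.inj (sub_right_injective h2)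
  · intro a _ a' _ haa
    exact congrFun (σ.injective (funext fun _ => haa)) ()

/-- Markov's inequality again: the threshold n/4 and the two directions of nearness give 8, and the
hypothesis supplies the remaining 2. -/
theorem mul_ncard_many_not_isNear_le [Finite S] [Nonempty S] {D F R : ℕ}
    (h : D * {q : (Fin R → S) × S × S | ¬ T.IsNear F q.1 q.2.1 q.2.2}.ncard ≤
      2 * Nat.card S ^ (R + 2)) :
    D * {q : (Fin R → S) × S | Nat.card S <
      4 * {v' | ¬ T.IsNear F q.1 q.2 v' ∨ ¬ T.IsNear F q.1 v' q.2}.ncard}.ncard ≤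
      16 * Nat.card S ^ (R + 1) := by
  classical
  have := Fintype.ofFinite S
  set n := Nat.card S with hn
  have hnpos : 0 < n := Nat.card_pos
  set N := {q : (Fin R → S) × S × S | ¬ T.IsNear F q.1 q.2.1 q.2.2} with hN
  set E : Finset ((Fin R → S) × S) := Finset.univ.filter fun q => n <
      4 * {v' | ¬ T.IsNear F q.1 q.2 v' ∨ ¬ T.IsNear F q.1 v' q.2}.ncard with hE
  rw [Set.ncard_eq_toFinset_card', Set.toFinset_ofPred, ← hE]
  have h1 : ∑ q ∈ E, {v' | ¬ T.IsNear F q.1 q.2 v'}.ncard ≤ N.ncard := by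
    have h2 : (E.sigma fun q => Finset.univ.filter fun v' => ¬ T.IsNear F q.1 q.2 v').card ≤
        N.ncard := by
      rw [← Set.ncard_coe_finset]
      refine Set.ncard_le_ncard_of_injOn (fun y => (y.1.1, y.1.2, y.2)) ?_ ?_ (Set.toFinite _)
      · rintro ⟨q, v'⟩ hy
        exact (Finset.mem_filter.1 (Finset.mem_sigma.1 (Finset.mem_coe.1 hy)).2).2
      · rintro ⟨⟨x, v⟩, v'⟩ _ ⟨⟨x2, v2⟩, v2'⟩ _ heq
        simp only [Prod.mk.injEq] at heq
        obtain ⟨rfl, rfl, rfl⟩ := heq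
        rfl
    rw [Finset.card_sigma] at h2
    refine le_trans (le_of_eq (Finset.sum_congr rfl fun q _ => ?_)) h2
    rw [Set.ncard_eq_toFinset_card', Set.toFinset_ofPred]
  have h1' : ∑ q ∈ E, {v' | ¬ T.IsNear F q.1 v' q.2}.ncard ≤ N.ncard := by
    have h2 : (E.sigma fun q => Finset.univ.filter fun v' => ¬ T.IsNear F q.1 v' q.2).card ≤
        N.ncard := by
      rw [← Set.ncard_coe_finset]
      refine Set.ncard_le_ncard_of_injOn (fun y => (y.1.1, y.2, y.1.2)) ?_ ?_ (Set.toFinite _)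
      · rintro ⟨q, v'⟩ hy
        exact (Finset.mem_filter.1 (Finset.mem_sigma.1 (Finset.mem_coe.1 hy)).2).2
      · rintro ⟨⟨x, v⟩, v'⟩ _ ⟨⟨x2, v2⟩, v2'⟩ _ heq
        simp only [Prod.mk.injEq] at heq
        obtain ⟨rfl, rfl, rfl⟩ := heq
        rfl
    rw [Finset.card_sigma] at h2
    refine le_trans (le_of_eq (Finset.sum_congr rfl fun q _ => ?_)) h2
    rw [Set.ncard_eq_toFinset_card', Set.toFinset_ofPred]
  have h3 : n * E.card ≤ 8 * N.ncard := by
    calc n * E.card = ∑ q ∈ E, n := by rw [Finset.sum_const, smul_eq_mul, mul_comm]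
      _ ≤ ∑ q ∈ E, (4 * {v' | ¬ T.IsNear F q.1 q.2 v'}.ncard +
          4 * {v' | ¬ T.IsNear F q.1 v' q.2}.ncard) := by
          refine Finset.sum_le_sum fun q hq => ?_
          have h4 := (Finset.mem_filter.1 hq).2
          have h5 := Set.ncard_union_le {v' | ¬ T.IsNear F q.1 q.2 v'}
            {v' | ¬ T.IsNear F q.1 v' q.2}
          rw [Set.union_def] at h5
          simp only [Set.mem_ofPred_eq] at h5
          omega
      _ ≤ _ := by
          rw [Finset.sum_add_distrib, ← Finset.mul_sum, ← Finset.mul_sum]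
          omega
  refine le_of_mul_le_mul_left (a := n) ?_ hnpos
  calc n * (D * E.card) = D * (n * E.card) := by ring
    _ ≤ D * (8 * N.ncard) := Nat.mul_le_mul_left _ h3
    _ = 8 * (D * N.ncard) := by ring
    _ ≤ 8 * (2 * n ^ (R + 2)) := Nat.mul_le_mul_left _ h
    _ = _ := by ring

/-- For most tuples and points, the number of definable elements is at least the index of the class,
up to a constant. -/
theorem Large.mul_ncard_lt_le [Fintype S] [Finite V] (h : T.Large K t) {p : ℕ} (hp : 0 < p)
    (hV : ∀ z : V, p • z = 0) {κ F Q a R s M D P : ℕ} (hκ : 1 ≤ κ)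
    (hdoub : {z | ∃ x y : S, z = vec y - vec x}.ncard ≤ κ * Nat.card S) (hF : 2 ≤ F)
    (hFD : D ^ 2 * κ * (T.height (R + 2) - T.height R) ≤ Real.log F)
    (ha : 2 * R + s + 2 ≤ a) (hat : a + (2 * p * (2 * F ^ 2) ^ 5 + 1) + 1 ≤ t)
    (ht : 3 ≤ t) (hQ : (K ^ (a + 1)) ^ R ≤ Q) (hn : Q * (R * K ^ (a + 1)) < Nat.card S)
    (hM : Nat.card (diffGroup vec Set.univ) ≤ M * Nat.card S) (hs : M * K ^ (R + 1) < 2 ^ s)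
    (hP : D * (Q * (M * K ^ (R + 1)) + 1) ^ s ≤ P)
    (hn' : K ^ 5 * (M * K ^ (R + 1)) ^ P < Nat.card S) (hR : 1 ≤ R) (hM1 : 1 ≤ M)
    (hDn : D * K ^ (R + 1) ≤ Nat.card S) :
    D * {q : (Fin R → S) × S | p ^ (2 * F ^ 2) ^ 5 * (2 * F ^ 2) *
      (2 * R * M * D + p ^ (K ^ 3 + K ^ 2)) * T.dclCard q.1 q.2 *
        (T.cls (Set.range q.1) q.2).ncard < Nat.card S}.ncard ≤ 19 * Nat.card S ^ (R + 1) := by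
  classical
  have hd := h.depth
  have hK : 1 ≤ K := by have := h.two_le; omega
  have hnpos : 0 < Nat.card S := by omega
  have hne : Nonempty S := (Nat.card_pos_iff.1 hnpos).1
  set κ' := 2 * F ^ 2 with hκ'
  set C := p ^ κ' ^ 5 * κ' with hC
  set J := 2 * p * κ' ^ 5 + 1 with hJ
  set n := Nat.card S with hnS
  set C1 := C * (2 * R * M * D + p ^ (K ^ 3 + K ^ 2)) with hC1
  set E1 := {q : (Fin R → S) × S | n <
      4 * {v' | ¬ T.IsNear F q.1 q.2 v' ∨ ¬ T.IsNear F q.1 v' q.2}.ncard} with hE1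
  set E2 := {q : (Fin R → S) × S | q.2 ∈ T.dcl (Set.range q.1)} with hE2
  set E3 := {q : (Fin R → S) × S | T.IsGood J q.1 q.2 ∧
      Nat.card (T.grp q.1 q.2) ≤ C * (T.cls (Set.range q.1) q.2).ncard ∧
      C1 * T.dclCard q.1 q.2 * (T.cls (Set.range q.1) q.2).ncard < n} with hE3
  have hc1 : D * E1.ncard ≤ 16 * n ^ (R + 1) :=
    mul_ncard_many_not_isNear_le (mul_ncard_not_isNear_le hκ hdoub hF hFD)
  have hc2 : D * E2.ncard ≤ n ^ (R + 1) := by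
    have h1 : D * E2.ncard ≤ Nat.card (Fin R → S) * n := by
      refine mul_ncard_le_of_fibre' fun x => ?_
      have h2 := ncard_range_fin_le x
      have h3 := h.ncard_dcl_le (A := Set.range x) (by omega)
      have h4 : K ^ ((Set.range x).ncard + 1) ≤ K ^ (R + 1) := Nat.pow_le_pow_right hK (by omega)
      exact (Nat.mul_le_mul_left _ (h3.trans h4)).trans hDn
    rw [Nat.card_fun, Nat.card_fin] at h1
    rwa [pow_succ]
  have hc3 : D * E3.ncard ≤ 2 * n ^ (R + 1) := by
    have h1 : D * E3.ncard ≤ Nat.card S * (2 * n ^ R) := mul_ncard_le_of_fibre fun v =>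
      h.ncard_exceptional_le hp hV ha hat ht hQ hn hM hs hP hn' hR hM1 v
    refine h1.trans (le_of_eq ?_)
    rw [← hnS]
    ring
  -- Outside E1 the class has small doubling, outside E2 it is nontrivial. Ruzsa's theorem then
  -- makes the tuple good with a group not much larger than the class, so a remaining failure is
  -- exceptional. The bounds add up as 16 + 1 + 2 = 19.
  have hsub : {q : (Fin R → S) × S | C1 * T.dclCard q.1 q.2 *
      (T.cls (Set.range q.1) q.2).ncard < n} ⊆ E1 ∪ (E2 ∪ E3) := by
    intro q hq
    by_cases hq1 : q ∈ E1
    · exact Or.inl hq1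
    · by_cases hq2 : q ∈ E2
      · exact Or.inr (Or.inl hq2)
      · have h1 := ncard_sub_cls_le (T := T) (F := F) (x := q.1) (v := q.2) (by omega) (not_lt.1 hq1)
        obtain ⟨h2, h3⟩ := diffGroup_of_small_doubling T.inj hp hV ⟨q.2, T.mem_cls_self _ _⟩ h1
        refine Or.inr (Or.inr ⟨⟨hq2, ?_⟩, ?_, hq⟩)
        · rw [hJ, ← h3]
          exact diffSum_subset_diffGroup _
        · refine h2.trans (le_of_eq ?_)
          rw [hC]
          ring
  have hle := Set.ncard_le_ncard hsub (Set.toFinite _)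
  have hu1 := Set.ncard_union_le E1 (E2 ∪ E3)
  have hu2 := Set.ncard_union_le E2 E3
  calc _ ≤ D * (E1.ncard + (E2.ncard + E3.ncard)) := Nat.mul_le_mul_left _ (by omega)
    _ ≤ _ := by linarith

end TupleScheme

end PScheme

/-! ### Interdefinable tuples and the chain rule. -/

namespace PScheme

namespace TupleScheme

variable {S V : Type} [AddCommGroup V] {vec : S → V} {m : ℕ} (T : TupleScheme vec m)

/-- The tuples that are interdefinable with `x`. -/
def interdef {r : ℕ} (x : Fin r → S) : Set (Fin r → S) :=
  {y | Set.range y ⊆ T.dcl (Set.range x) ∧ Set.range x ⊆ T.dcl (Set.range y)}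

variable {T} {K t : ℕ}

theorem mem_interdef_self {r : ℕ} (x : Fin r → S) : x ∈ T.interdef x :=
  ⟨T.subset_dcl _, T.subset_dcl _⟩

variable [Finite S]

theorem dcl_range_subset {r : ℕ} (hm : 3 * r + 1 ≤ m) {x y : Fin r → S}
    (h : Set.range y ⊆ T.dcl (Set.range x)) : T.dcl (Set.range y) ⊆ T.dcl (Set.range x) := by
  have h1 := ncard_range_fin_le x
  have h2 := ncard_range_fin_le y
  exact T.dcl_subset_of_subset h (by omega)

theorem interdef_eq_of_mem {r : ℕ} (hm : 3 * r + 1 ≤ m) {x y : Fin r → S} (h : y ∈ T.interdef x) :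
    T.interdef y = T.interdef x := by
  have key : ∀ {x y : Fin r → S}, y ∈ T.interdef x → T.interdef y ⊆ T.interdef x := by
    intro x y h z hz
    exact ⟨hz.1.trans (dcl_range_subset hm h.1), h.2.trans (dcl_range_subset hm hz.2)⟩
  exact Set.Subset.antisymm (key h) (key ⟨h.2, h.1⟩)

/-- For e interdefinable with x and d conjugate to x, choose f with (x, e) ~ (d, f). Then f
determines e: two candidates are conjugate and interdefinable, hence equal by antisymmetry. It also
determines d, which is definable from f as x is from e. -/
theorem ncard_interdef_mul_le {r : ℕ} (hm : 3 * r + 1 ≤ m) (x : Fin r → S) :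
    (T.interdef x).ncard * {y | T.rel x y}.ncard ≤ Nat.card S ^ r := by
  have hex : ∀ q : T.interdef x × {y | T.rel x y}, ∃ e : Fin r → S,
      T.rel (Sum.elim x q.1.1) (Sum.elim q.2.1 e) := fun q =>
    T.exists_ext _ (by simp; omega) q.2.2
  choose f hf using hex
  rw [← Nat.card_coe_set_eq, ← Nat.card_coe_set_eq, ← Nat.card_prod]
  refine (Nat.card_le_card_of_injective f ?_).trans (by rw [Nat.card_fun, Nat.card_fin])
  rintro ⟨⟨e1, he1⟩, ⟨d1, hd1⟩⟩ ⟨⟨e2, he2⟩, ⟨d2, hd2⟩⟩ heq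
  have h1 := hf (⟨e1, he1⟩, ⟨d1, hd1⟩)
  have h2 := hf (⟨e2, he2⟩, ⟨d2, hd2⟩)
  rw [← heq] at h2
  set e' := f (⟨e1, he1⟩, ⟨d1, hd1⟩)
  simp only at h1 h2
  have he : e2 = e1 := by
    refine T.antisymm (by simp; omega) (T.trans (T.rel_inr h1) (T.symm (T.rel_inr h2)))
      fun y hy => ?_
    have h3 := T.relOver_range.2 hy
    funext i
    exact T.apply_eq_of_mem_dcl h3 (dcl_range_subset hm he1.2 (he2.1 ⟨i, rfl⟩))
  subst he
  obtain ⟨d, hd⟩ := T.exists_ext d2 (by simp; omega) (T.symm h1)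
  have h3 : T.rel (Sum.elim e2 x) (Sum.elim e2 d) := by
    have h4 : T.rel (Sum.elim e' d2) (Sum.elim e2 d) :=
      T.rel_of (Sum.elim (fun i => Sum.inl (Sum.inr i)) Sum.inr) hd
        (by rintro (i | i) <;> rfl) (by rintro (i | i) <;> rfl)
    exact T.trans (T.rel_swap h2) h4
  have h5 : d = x := by
    funext i
    exact T.apply_eq_of_mem_dcl (T.relOver_range.2 h3) (he1.2 ⟨i, rfl⟩)
  have h6 : d1 = d2 := by
    funext i
    exact T.eq_of_rel (T.symm hd) (i := Sum.inl (Sum.inl i)) (j := Sum.inr i)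
      (congrFun h5 i).symm
  subst h6
  rfl

theorem ncard_rel_snoc {r : ℕ} (hm : r + 1 ≤ m) (x : Fin r → S) (v : S) :
    {y | T.rel (Fin.snoc (α := fun _ => S) x v : Fin (r + 1) → S) y}.ncard =
      {y | T.rel x y}.ncard * (T.cls (Set.range x) v).ncard := by
  have h2 := T.card_rel_elim x (fun _ : Unit => v) (by simp; omega)
  rw [← ncard_cls_range] at h2
  rw [← Nat.card_coe_set_eq, ← Nat.card_coe_set_eq {y | T.rel x y}]
  refine Eq.trans ?_ h2
  let e : Fin r ⊕ Unit ≃ Fin (r + 1) :=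
    { toFun := Sum.elim Fin.castSucc fun _ => Fin.last r
      invFun := Fin.lastCases (Sum.inr ()) Sum.inl
      left_inv := by rintro (i | i) <;> simp
      right_inv := by
        intro i
        refine Fin.lastCases ?_ (fun i => ?_) i <;> simp }
  have he : Sum.elim x (fun _ : Unit => v) =
      (Fin.snoc (α := fun _ => S) x v : Fin (r + 1) → S) ∘ e := by
    funext i
    rcases i with i | i <;> simp [e]
  rw [he]
  refine Nat.card_congr (Equiv.subtypeEquiv (Equiv.arrowCongr e.symm (Equiv.refl S))
    fun y => ⟨fun hy => T.pull e hy, fun hy => ?_⟩)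
  exact T.rel_of e.symm hy (fun i => by simp) fun i => by simp

/-- The chain rule. -/
theorem sum_log_ncard_rel [Fintype S] [Nonempty S] {r : ℕ} (hm : r ≤ m) :
    ∑ x : Fin r → S, Real.log ((Nat.card S : ℝ) ^ r / {y | T.rel x y}.ncard) =
      (Nat.card S : ℝ) ^ r * ∑ k ∈ Finset.range r, T.height k := by
  have hnpos : (0 : ℝ) < Nat.card S := by exact_mod_cast Nat.card_pos
  induction r with
  | zero =>
    have : ∀ x : Fin 0 → S, {y | T.rel x y}.ncard = 1 := by
      intro x
      rw [Set.ncard_eq_one]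
      refine ⟨x, Set.eq_singleton_iff_unique_mem.2 ⟨T.refl x, fun y _ => Subsingleton.elim _ _⟩⟩
    simp [this]
  | succ r ih =>
    rw [sum_snoc, Finset.sum_range_succ, mul_add, pow_succ, mul_right_comm, ← ih (by omega), height,
      ← pow_succ, mul_div_cancel₀ _ (by positivity), Finset.sum_mul, ← Finset.sum_add_distrib]
    refine Finset.sum_congr rfl fun x _ => ?_
    have h1 : (0 : ℝ) < {y | T.rel x y}.ncard := by
      exact_mod_cast (Set.ncard_pos (Set.toFinite _)).2 ⟨x, T.refl x⟩
    have h2 : ∀ v, Real.log ((Nat.card S : ℝ) ^ (r + 1) /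
        {y | T.rel (Fin.snoc (α := fun _ => S) x v : Fin (r + 1) → S) y}.ncard) =
        Real.log ((Nat.card S : ℝ) ^ r / {y | T.rel x y}.ncard) + T.defect x v := by
      intro v
      have h3 : (0 : ℝ) < (T.cls (Set.range x) v).ncard := by
        exact_mod_cast T.ncard_cls_pos _ _
      rw [ncard_rel_snoc hm, defect, ← Real.log_mul (by positivity) (by positivity), Nat.cast_mul,
        pow_succ, div_mul_div_comm]
    simp_rw [h2]
    rw [Finset.sum_add_distrib, Finset.sum_const, Finset.card_univ, nsmul_eq_mul, mul_comm,
      Nat.card_eq_fintype_card]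

/-- Over the other coordinates and everything definable from them, b and x j differ by an element of
the fixed group, so each defines the other. The whole closure enters as constants, hence the term
K^(r+1) in the depth. -/
theorem Large.update_mem_interdef (h : T.Large K t) {r : ℕ} (hr : r ≤ t)
    (hm : 2 * r + K ^ (r + 1) + 2 ≤ m) {x : Fin r → S} {j : Fin r} {b : S}
    (hb : vec b - vec (x j) ∈ diffGroup vec (T.dcl (x '' {i | i ≠ j}))) :
    Function.update x j b ∈ T.interdef x := by
  have hK : 1 ≤ K := by have := h.two_le; omega
  set A := x '' {i | i ≠ j} with hA
  have hAcard : A.ncard ≤ r := ncard_image_fin_le _ _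
  have hdcl : (T.dcl A).ncard ≤ K ^ (r + 1) :=
    (h.ncard_dcl_le (hAcard.trans hr)).trans (Nat.pow_le_pow_right hK (by omega))
  have key : ∀ {c c' : S}, vec c - vec c' ∈ diffGroup vec (T.dcl A) →
      c ∈ T.dcl (insert c' (T.dcl A)) := by
    intro c c' hc
    refine T.mem_dcl_of_vec ?_
    rw [← sub_add_cancel (vec c) (vec c')]
    refine AddSubgroup.add_mem _ ?_ (AddSubgroup.subset_closure ⟨c', Set.mem_insert _ _, rfl⟩)
    exact AddSubgroup.closure_mono (Set.image_mono (Set.subset_insert _ _)) (diffGroup_le_closure hc)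
  have key2 : ∀ {c c' : S} {y : Fin r → S}, A ⊆ Set.range y → c' ∈ Set.range y →
      vec c - vec c' ∈ diffGroup vec (T.dcl A) → c ∈ T.dcl (Set.range y) := by
    intro c c' y hAy hc'y hc
    have h1 := Set.ncard_insert_le c' (T.dcl A)
    have h2 := ncard_range_fin_le y
    refine T.dcl_subset_of_subset (B := insert c' (T.dcl A)) ?_ (by omega) (key hc)
    exact Set.insert_subset (T.subset_dcl _ hc'y) (T.dcl_mono hAy)
  have hAx : A ⊆ Set.range x := Set.image_subset_range _ _
  have hAu : A ⊆ Set.range (Function.update x j b) := by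
    rintro _ ⟨i, hi, rfl⟩
    exact ⟨i, Function.update_of_ne hi _ _⟩
  have hbu : b ∈ Set.range (Function.update x j b) := ⟨j, Function.update_self _ _ _⟩
  constructor
  · rintro _ ⟨i, rfl⟩
    by_cases hi : i = j
    · subst hi
      rw [Function.update_self]
      exact key2 hAx ⟨i, rfl⟩ hb
    · rw [Function.update_of_ne hi]
      exact T.subset_dcl _ ⟨i, rfl⟩
  · rintro _ ⟨i, rfl⟩
    by_cases hi : i = j
    · subst hi
      refine key2 hAu hbu ?_
      rw [← neg_sub]
      exact AddSubgroup.neg_mem _ hb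
    · exact T.subset_dcl _ (hAu ⟨i, hi, rfl⟩)

/-- Most cosets of a subgroup contain many elements. -/
theorem mul_ncard_small_coset_le [Finite V] {M D : ℕ} (hM1 : 1 ≤ M) {W : AddSubgroup V}
    (hW : W ≤ diffGroup vec Set.univ)
    (hM : Nat.card (diffGroup vec Set.univ) ≤ M * Nat.card S) :
    D * {b : S | D * M * {b' | vec b' - vec b ∈ W}.ncard < Nat.card W}.ncard ≤ Nat.card S := by
  classical
  have := Fintype.ofFinite S
  let r : S → V ⧸ W := fun b => QuotientAddGroup.mk (vec b)
  have hr : ∀ b c, r c = r b ↔ vec c - vec b ∈ W := by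
    intro b c
    rw [eq_comm]
    simp only [r]
    rw [QuotientAddGroup.eq, neg_add_eq_sub]
  set B : Finset S := Finset.univ.filter fun b =>
    D * M * {b' | vec b' - vec b ∈ W}.ncard < Nat.card W with hB
  rw [Set.ncard_eq_toFinset_card', Set.toFinset_ofPred, ← hB]
  rcases B.eq_empty_or_nonempty with hE | ⟨v, hv⟩
  · rw [hE, Finset.card_empty, mul_zero]
    exact Nat.zero_le _
  have h1 : (B.image r).card * Nat.card W ≤ Nat.card (diffGroup vec Set.univ) := by
    have hex : ∀ c : B.image r, ∃ b, r b = c := fun c => by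
      obtain ⟨b, -, hb⟩ := Finset.mem_image.1 c.2
      exact ⟨b, hb⟩
    choose g hg using hex
    rw [← Nat.card_eq_finsetCard, ← Nat.card_prod]
    refine Nat.card_le_card_of_injective (fun q => (⟨vec (g q.1) - vec v + q.2,
      AddSubgroup.add_mem _ (sub_mem_diffGroup (Set.mem_univ _) (Set.mem_univ _)) (hW q.2.2)⟩ :
      diffGroup vec Set.univ)) ?_
    rintro ⟨c, w⟩ ⟨c', w'⟩ heq
    have h2 : vec (g c) - vec v + w = vec (g c') - vec v + w' := congrArg Subtype.val heq
    have h3 : vec (g c) - vec (g c') = w' - w := by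
      rw [sub_eq_sub_iff_add_eq_add]
      have h2' := h2
      rw [sub_add_eq_add_sub, sub_add_eq_add_sub] at h2'
      rw [sub_left_injective h2', add_comm]
    have h4 : c = c' := by
      refine Subtype.ext ?_
      rw [← hg c, ← hg c', hr, h3]
      exact W.sub_mem w'.2 w.2
    subst h4
    rw [Prod.mk.injEq]
    exact ⟨rfl, Subtype.ext (add_left_cancel h2)⟩
  -- Cosets with fewer than |W|/(DM) points are at most |U|/|W| in number, so together they hold at
  -- most n/D points.
  have h2 : D * M * B.card ≤ (B.image r).card * Nat.card W := by
    calc D * M * B.card = ∑ c ∈ B.image r, D * M * (B.filter fun b => r b = c).card := by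
          rw [← Finset.mul_sum, ← Finset.card_eq_sum_card_image r]
      _ ≤ ∑ c ∈ B.image r, Nat.card W := by
          refine Finset.sum_le_sum fun c hc => ?_
          obtain ⟨b, hb, rfl⟩ := Finset.mem_image.1 hc
          refine le_trans (Nat.mul_le_mul_left _ ?_) (Finset.mem_filter.1 hb).2.le
          rw [← Set.ncard_coe_finset]
          refine Set.ncard_le_ncard (fun b' hb' => ?_) (Set.toFinite _)
          exact (hr _ _).1 (Finset.mem_filter.1 (Finset.mem_coe.1 hb')).2
      _ = _ := by rw [Finset.sum_const, smul_eq_mul]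
  refine le_of_mul_le_mul_left (a := M) ?_ hM1
  calc M * (D * B.card) = D * M * B.card := by ring
    _ ≤ _ := h2.trans h1
    _ ≤ _ := hM

end TupleScheme

end PScheme

/-! ### The inequality between the heights. -/

namespace PScheme

theorem sum_insertNth {S : Type} [Fintype S] {k : ℕ} (j : Fin (k + 1)) (f : (Fin (k + 1) → S) → ℝ) :
    ∑ z, f z = ∑ x : Fin k → S, ∑ y, f (j.insertNth (α := fun _ => S) y x) := by
  rw [← Fintype.sum_prod_type' fun (x : Fin k → S) y => f (j.insertNth (α := fun _ => S) y x)]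
  refine Fintype.sum_equiv ((Fin.insertNthEquiv (fun _ : Fin (k + 1) => S) j).symm.trans
    (Equiv.prodComm _ _)) _ _ fun z => ?_
  simp

theorem insertNth_image_ne {S : Type} {k : ℕ} (j : Fin (k + 1)) (x : Fin k → S) (y : S) :
    (j.insertNth (α := fun _ => S) y x : Fin (k + 1) → S) '' {i | i ≠ j} = Set.range x := by
  have : {i | i ≠ j} = Set.range j.succAbove := by
    rw [Fin.range_succAbove]
    rfl
  rw [this, ← Set.range_comp]
  congr 1
  funext i
  simp

namespace TupleScheme

variable {S V : Type} [AddCommGroup V] {vec : S → V} {m : ℕ} {T : TupleScheme vec m} {K t : ℕ}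

theorem defect_nonneg [Finite S] {k : ℕ} (x : Fin k → S) (v : S) : 0 ≤ T.defect x v := by
  refine Real.log_nonneg ?_
  have h1 : (0 : ℝ) < (T.cls (Set.range x) v).ncard := by
    exact_mod_cast T.ncard_cls_pos _ _
  rw [le_div_iff₀ h1, one_mul]
  have h2 := Set.ncard_le_ncard (Set.subset_univ (T.cls (Set.range x) v)) (Set.toFinite _)
  rw [Set.ncard_univ] at h2
  exact_mod_cast h2

open Classical in
theorem Large.defect_le [Finite S] (h : T.Large K t) {k : ℕ} (hk : k ≤ t) (x : Fin k → S) (v : S) :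
    T.defect x v ≤ (k + 1) * Real.log K +
      if v ∈ T.dcl (Set.range x) then Real.log (Nat.card S) else 0 := by
  have hK := h.two_le
  have hnpos : 0 < Nat.card S := lt_of_le_of_lt (Nat.zero_le _) h.card
  have hlogK : 0 ≤ Real.log K := Real.log_natCast_nonneg _
  have h1 : 0 < (T.cls (Set.range x) v).ncard := T.ncard_cls_pos _ _
  split_ifs with hv
  · rw [mem_dcl_iff_ncard] at hv
    rw [defect, hv, Nat.cast_one, div_one]
    have : 0 ≤ ((k : ℝ) + 1) * Real.log K := by positivity
    linarith
  · have h2 := ncard_range_fin_le x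
    have h3 := h.homogeneous _ (h2.trans hk) _ hv
    have h4 : K ^ ((Set.range x).ncard + 1) ≤ K ^ (k + 1) :=
      Nat.pow_le_pow_right (by omega) (by omega)
    rw [defect, add_zero]
    have h5 : (Nat.card S : ℝ) / (T.cls (Set.range x) v).ncard ≤ (K : ℝ) ^ (k + 1) := by
      rw [div_le_iff₀ (by exact_mod_cast h1)]
      exact_mod_cast h3.trans (Nat.mul_le_mul_right _ h4)
    refine (Real.log_le_log (by positivity) h5).trans (le_of_eq ?_)
    rw [Real.log_pow]
    push_cast
    ring

/-- From log n ≤ 2√n. It makes the rare event that v is definable over x, with defect log n,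
contribute at most 1 to a height. -/
theorem mul_log_le_of_four_mul_sq_le {n k : ℕ} (h : 4 * k ^ 2 ≤ n) : (k : ℝ) * Real.log n ≤ n := by
  have h1 : (0 : ℝ) ≤ n := Nat.cast_nonneg n
  have h2 : Real.log n ≤ 2 * √n := by
    have h3 := Real.log_le_self (Real.sqrt_nonneg n)
    rw [Real.log_sqrt h1] at h3
    linarith
  have h4 : 2 * (k : ℝ) ≤ √n := by
    refine Real.le_sqrt_of_sq_le ?_
    have : ((4 * k ^ 2 : ℕ) : ℝ) ≤ n := by exact_mod_cast h
    push_cast at this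
    linarith
  calc (k : ℝ) * Real.log n ≤ k * (2 * √n) := mul_le_mul_of_nonneg_left h2 (Nat.cast_nonneg _)
    _ = 2 * k * √n := by ring
    _ ≤ √n * √n := mul_le_mul_of_nonneg_right h4 (Real.sqrt_nonneg _)
    _ = n := Real.mul_self_sqrt h1

open Classical in
theorem Large.sum_mem_dcl_le [Fintype S] (h : T.Large K t) {k : ℕ} (hk : k ≤ t)
    (hn : 4 * (K ^ (k + 1)) ^ 2 ≤ Nat.card S) :
    ∑ x : Fin k → S, ∑ v, (if v ∈ T.dcl (Set.range x) then Real.log (Nat.card S) else 0) ≤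
      (Nat.card S : ℝ) ^ (k + 1) := by
  have hK := h.two_le
  calc _ ≤ ∑ x : Fin k → S, (Nat.card S : ℝ) := by
        refine Finset.sum_le_sum fun x _ => ?_
        rw [← Finset.sum_filter, Finset.sum_const, nsmul_eq_mul]
        refine le_trans ?_ (mul_log_le_of_four_mul_sq_le hn)
        refine mul_le_mul_of_nonneg_right ?_ (Real.log_natCast_nonneg _)
        rw [Nat.cast_le, ← Set.ncard_coe_finset]
        have h2 := ncard_range_fin_le x
        have h3 := h.ncard_dcl_le (A := Set.range x) (by omega)
        refine le_trans (le_of_eq ?_) (h3.trans (Nat.pow_le_pow_right (by omega)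
          (Nat.add_le_add_right h2 1)))
        congr 1
        ext v
        simp
    _ = _ := by
        rw [Finset.sum_const, Finset.card_univ, Fintype.card_fun, Fintype.card_fin, nsmul_eq_mul,
          Nat.card_eq_fintype_card, pow_succ]
        push_cast
        ring

theorem height_nonneg [Fintype S] (k : ℕ) : 0 ≤ T.height k :=
  div_nonneg (Finset.sum_nonneg fun x _ => Finset.sum_nonneg fun v _ => defect_nonneg x v)
    (by positivity)

theorem pow_mul_height [Fintype S] [Nonempty S] (k : ℕ) :
    (Nat.card S : ℝ) ^ (k + 1) * T.height k = ∑ x : Fin k → S, ∑ v, T.defect x v := by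
  have hnpos : (0 : ℝ) < Nat.card S := by exact_mod_cast Nat.card_pos
  rw [height, mul_div_cancel₀ _ (by positivity)]

theorem sum_sum_const {S : Type} [Fintype S] (k : ℕ) (c : ℝ) :
    ∑ _x : Fin k → S, ∑ _v : S, c = (Nat.card S : ℝ) ^ (k + 1) * c := by
  simp only [Finset.sum_const, Finset.card_univ, Fintype.card_fun, Fintype.card_fin, nsmul_eq_mul,
    Nat.card_eq_fintype_card, pow_succ]
  push_cast
  ring

theorem Large.height_le [Fintype S] [Nonempty S] (h : T.Large K t) {k : ℕ} (hk : k ≤ t)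
    (hn : 4 * (K ^ (k + 1)) ^ 2 ≤ Nat.card S) : T.height k ≤ (k + 1) * Real.log K + 1 := by
  classical
  have hnpos : (0 : ℝ) < Nat.card S := by exact_mod_cast Nat.card_pos
  have h1 : (0 : ℝ) < (Nat.card S : ℝ) ^ (k + 1) := by positivity
  refine le_of_mul_le_mul_left ?_ h1
  rw [pow_mul_height]
  refine (Finset.sum_le_sum fun x _ => Finset.sum_le_sum fun v _ => h.defect_le hk x v).trans ?_
  simp_rw [Finset.sum_add_distrib]
  have := h.sum_mem_dcl_le hk hn
  rw [sum_sum_const]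
  linarith

/-- The mean of the logarithm of the number of definable elements. -/
theorem Large.le_sum_log_dclCard [Fintype S] [Nonempty S] (h : T.Large K t) {R D C : ℕ} (hR : R ≤ t)
    (hD : 1 ≤ D) (hC : 1 ≤ C) (hn : 4 * (K ^ (R + 1)) ^ 2 ≤ Nat.card S)
    (hexc : D * {q : (Fin R → S) × S | C * T.dclCard q.1 q.2 *
      (T.cls (Set.range q.1) q.2).ncard < Nat.card S}.ncard ≤ 19 * Nat.card S ^ (R + 1)) :
    (Nat.card S : ℝ) ^ (R + 1) * (T.height R - (Real.log C + 1 + 19 * (R + 1) * Real.log K / D)) ≤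
      ∑ x : Fin R → S, ∑ v, Real.log (T.dclCard x v) := by
  classical
  set n := Nat.card S with hnS
  have hnpos : (0 : ℝ) < n := by
    rw [hnS]
    exact_mod_cast Nat.card_pos
  have hDpos : (0 : ℝ) < D := by exact_mod_cast hD
  have hlogK : 0 ≤ Real.log K := Real.log_natCast_nonneg _
  set E := {q : (Fin R → S) × S | C * T.dclCard q.1 q.2 *
      (T.cls (Set.range q.1) q.2).ncard < n} with hE
  -- Off the exceptional set the defect is at most log C + log `dclCard`. On it the defect is
  -- bounded by (R + 1) log K, apart from the term for v definable over x.
  have hpt : ∀ x : Fin R → S, ∀ v, T.defect x v - Real.log C -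
      (if (x, v) ∈ E then (R + 1) * Real.log K else 0) -
      (if v ∈ T.dcl (Set.range x) then Real.log n else 0) ≤ Real.log (T.dclCard x v) := by
    intro x v
    have hc : 0 < (T.cls (Set.range x) v).ncard := T.ncard_cls_pos _ _
    have hd := T.dclCard_pos x v
    have hif : 0 ≤ if v ∈ T.dcl (Set.range x) then Real.log n else 0 := by
      split_ifs
      · exact Real.log_natCast_nonneg _
      · exact le_rfl
    by_cases hq : (x, v) ∈ E
    · rw [if_pos hq]
      have h1 := h.defect_le hR x v
      have h2 : 0 ≤ Real.log C := Real.log_natCast_nonneg _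
      have h3 : 0 ≤ Real.log (T.dclCard x v) := Real.log_natCast_nonneg _
      linarith
    · rw [if_neg hq]
      have h1 : n ≤ C * T.dclCard x v * (T.cls (Set.range x) v).ncard := not_lt.1 hq
      have h2 : T.defect x v ≤ Real.log C + Real.log (T.dclCard x v) := by
        have hC0 : (0 : ℝ) < C := by exact_mod_cast hC
        have hd0 : (0 : ℝ) < T.dclCard x v := by exact_mod_cast hd
        rw [defect, ← Real.log_mul hC0.ne' hd0.ne']
        refine Real.log_le_log (div_pos hnpos (by exact_mod_cast hc)) ?_
        rw [div_le_iff₀ (by exact_mod_cast hc)]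
        exact_mod_cast h1
      linarith
  have hEsum : ∑ x : Fin R → S, ∑ v, (if (x, v) ∈ E then (R + 1) * Real.log K else 0) ≤
      (n : ℝ) ^ (R + 1) * (19 * (R + 1) * Real.log K / D) := by
    rw [← Fintype.sum_prod_type' fun (x : Fin R → S) v =>
      if (x, v) ∈ E then ((R : ℝ) + 1) * Real.log K else 0, ← Finset.sum_filter, Finset.sum_const,
      nsmul_eq_mul]
    have h1 : ((Finset.univ.filter fun q : (Fin R → S) × S => (q.1, q.2) ∈ E).card : ℝ) =
        E.ncard := by
      rw [Set.ncard_eq_toFinset_card']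
      congr 2
      ext q
      simp
    rw [h1]
    have h2 : (D : ℝ) * E.ncard ≤ 19 * (n : ℝ) ^ (R + 1) := by exact_mod_cast hexc
    have h3 : (E.ncard : ℝ) ≤ 19 * (n : ℝ) ^ (R + 1) / D := by
      rw [le_div_iff₀ hDpos, mul_comm]
      exact h2
    calc _ ≤ 19 * (n : ℝ) ^ (R + 1) / D * ((R + 1) * Real.log K) :=
          mul_le_mul_of_nonneg_right h3 (by positivity)
      _ = _ := by ring
  have h1 := Finset.sum_le_sum fun x (_ : x ∈ Finset.univ) =>
    Finset.sum_le_sum fun v (_ : v ∈ Finset.univ) => hpt x v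
  simp_rw [Finset.sum_sub_distrib] at h1
  rw [sum_sum_const, ← pow_mul_height] at h1
  have h2 := h.sum_mem_dcl_le hR hn
  rw [← hnS] at h1 h2
  linarith

/-- With W generated by the differences of the closure of the other coordinates, |W| is at least the
size of the closure, and most points lie in a coset of W with at least |W|/(DM) points. -/
theorem Large.le_sum_log_coset [Fintype S] [Nonempty S] [Finite V] (h : T.Large K t) {k M D : ℕ}
    (hk : k ≤ t) (hM1 : 1 ≤ M) (hD : 1 ≤ D)
    (hM : Nat.card (diffGroup vec Set.univ) ≤ M * Nat.card S) (j : Fin (k + 1)) :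
    (Nat.card S : ℝ) * ∑ x : Fin k → S, Real.log (T.dcl (Set.range x)).ncard -
      (Nat.card S : ℝ) ^ (k + 1) * (Real.log (D * M) + (k + 1) * Real.log K / D) ≤
    ∑ x : Fin (k + 1) → S, Real.log
      {b | vec b - vec (x j) ∈ diffGroup vec (T.dcl (x '' {i | i ≠ j}))}.ncard := by
  classical
  have hK := h.two_le
  set n := Nat.card S with hnS
  have hDpos : (0 : ℝ) < D := by exact_mod_cast hD
  have hMpos : (0 : ℝ) < M := by exact_mod_cast hM1
  rw [sum_insertNth j]
  simp_rw [insertNth_image_ne, Fin.insertNth_apply_same]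
  have hx : ∀ x : Fin k → S, (n : ℝ) * Real.log (T.dcl (Set.range x)).ncard -
      n * (Real.log (D * M) + (k + 1) * Real.log K / D) ≤
      ∑ y, Real.log {b | vec b - vec y ∈ diffGroup vec (T.dcl (Set.range x))}.ncard := by
    intro x
    set W := diffGroup vec (T.dcl (Set.range x)) with hW
    set q := (T.dcl (Set.range x)).ncard with hq
    have hqW : q ≤ Nat.card W := by
      rcases Set.eq_empty_or_nonempty (T.dcl (Set.range x)) with hE | hne
      · rw [hq, hE, Set.ncard_empty]
        exact Nat.zero_le _
      · exact T.ncard_le_card_diffGroup hne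
    have hqK : Real.log q ≤ (k + 1) * Real.log K := by
      have h2 := ncard_range_fin_le x
      have h3 := (h.ncard_dcl_le (A := Set.range x) (by omega)).trans
        (Nat.pow_le_pow_right (by omega) (Nat.add_le_add_right h2 1))
      rcases Nat.eq_zero_or_pos q with h0 | hpos
      · rw [h0, Nat.cast_zero, Real.log_zero]
        have := Real.log_natCast_nonneg K
        positivity
      · refine (Real.log_le_log (by exact_mod_cast hpos)
          (show (q : ℝ) ≤ (K : ℝ) ^ (k + 1) by exact_mod_cast h3)).trans (le_of_eq ?_)
        rw [Real.log_pow]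
        push_cast
        ring
    have hq0 : 0 ≤ Real.log q := Real.log_natCast_nonneg _
    have hDM : 0 ≤ Real.log (D * M) := by
      rw [← Nat.cast_mul]
      exact Real.log_natCast_nonneg _
    set B : Set S := {b : S | D * M * {b' | vec b' - vec b ∈ W}.ncard < Nat.card W} with hB
    have hBn : (B.ncard : ℝ) ≤ n / D := by
      have := mul_ncard_small_coset_le (D := D) (vec := vec) hM1 (diffGroup_mono (Set.subset_univ _)) hM (W := W)
      rw [le_div_iff₀ hDpos, mul_comm]
      exact_mod_cast this
    have hpt : ∀ y, Real.log q - Real.log (D * M) - (if y ∈ B then Real.log q else 0) ≤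
        Real.log {b | vec b - vec y ∈ W}.ncard := by
      intro y
      split_ifs with hy
      · have : 0 ≤ Real.log {b | vec b - vec y ∈ W}.ncard := Real.log_natCast_nonneg _
        linarith
      · have h1 : Nat.card W ≤ D * M * {b' | vec b' - vec y ∈ W}.ncard := not_lt.1 hy
        have h2 : 0 < {b' | vec b' - vec y ∈ W}.ncard :=
          (Set.ncard_pos (Set.toFinite _)).2 ⟨y, by simp⟩
        have h2' : (0 : ℝ) < {b' | vec b' - vec y ∈ W}.ncard := by exact_mod_cast h2
        rw [sub_zero, sub_le_iff_le_add, add_comm, ← Real.log_mul (by positivity) h2'.ne']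
        rcases Nat.eq_zero_or_pos q with h0 | hpos
        · rw [h0, Nat.cast_zero, Real.log_zero]
          have := Real.log_natCast_nonneg (D * M * {b' | vec b' - vec y ∈ W}.ncard)
          push_cast at this
          exact this
        · refine Real.log_le_log (by exact_mod_cast hpos) ?_
          exact_mod_cast hqW.trans h1
    refine le_trans ?_ (Finset.sum_le_sum fun y _ => hpt y)
    rw [Finset.sum_sub_distrib, Finset.sum_const, ← Finset.sum_filter, Finset.sum_const,
      Finset.card_univ, nsmul_eq_mul, nsmul_eq_mul, ← Nat.card_eq_fintype_card, ← hnS]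
    have hcard : ((Finset.univ.filter fun y => y ∈ B).card : ℝ) = B.ncard := by
      rw [Set.ncard_eq_toFinset_card']
      congr 2
      ext y
      simp
    rw [hcard]
    have h3 : (B.ncard : ℝ) * Real.log q ≤ n / D * ((k + 1) * Real.log K) :=
      mul_le_mul hBn hqK hq0 (by positivity)
    have h4 : (n : ℝ) / D * ((k + 1) * Real.log K) = n * ((k + 1) * Real.log K / D) := by ring
    rw [h4] at h3
    linarith
  refine le_trans (le_of_eq ?_) (Finset.sum_le_sum fun x _ => hx x)
  rw [Finset.sum_sub_distrib, ← Finset.mul_sum, Finset.sum_const, Finset.card_univ, Fintype.card_fun,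
    Fintype.card_fin, nsmul_eq_mul, ← Nat.card_eq_fintype_card, ← hnS, pow_succ]
  push_cast
  ring

/-- The set counted in coordinate j injects, by changing that coordinate, into the line through x
inside its class of interdefinable tuples. The entropy inequality on each class, the bound
`ncard_interdef_mul_le` and the chain rule give the right side. -/
theorem Large.sum_log_coset_le [Fintype S] [Nonempty S] (h : T.Large K t) {r : ℕ} (hr : r ≤ t)
    (hm : 2 * r + K ^ (r + 1) + 2 ≤ m) :
    ∑ x : Fin r → S, ∑ j, Real.log
      {b | vec b - vec (x j) ∈ diffGroup vec (T.dcl (x '' {i | i ≠ j}))}.ncard ≤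
    (Nat.card S : ℝ) ^ r * ∑ k ∈ Finset.range r, T.height k := by
  classical
  have hd := h.depth
  have hm' : 3 * r + 1 ≤ m := by omega
  rw [← sum_log_ncard_rel (by omega)]
  let cl : (Fin r → S) → Finset (Fin r → S) := fun x => (T.interdef x).toFinset
  have hcl : ∀ x y, cl y = cl x ↔ y ∈ T.interdef x := by
    intro x y
    simp only [cl, Set.toFinset_inj]
    exact ⟨fun hxy => hxy ▸ mem_interdef_self (T := T) y, fun hxy => interdef_eq_of_mem hm' hxy⟩
  have hfib : ∀ f : (Fin r → S) → ℝ, ∑ x, f x = ∑ I ∈ Finset.univ.image cl, ∑ x ∈ I, f x := by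
    intro f
    rw [← Finset.sum_fiberwise_of_maps_to (g := cl) (t := Finset.univ.image cl)
      fun x _ => Finset.mem_image_of_mem _ (Finset.mem_univ x)]
    refine Finset.sum_congr rfl fun I hI => Finset.sum_congr ?_ fun _ _ => rfl
    obtain ⟨x, -, rfl⟩ := Finset.mem_image.1 hI
    ext y
    rw [Finset.mem_filter, hcl]
    simp [cl]
  have h1 : ∀ x : Fin r → S, Real.log (cl x).card ≤
      Real.log ((Nat.card S : ℝ) ^ r / {y | T.rel x y}.ncard) := by
    intro x
    have h2 : 0 < {y | T.rel x y}.ncard := (Set.ncard_pos (Set.toFinite _)).2 ⟨x, T.refl x⟩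
    have h3 : 0 < (cl x).card := Finset.card_pos.2 ⟨x, Set.mem_toFinset.2 (mem_interdef_self x)⟩
    refine Real.log_le_log (by exact_mod_cast h3) ?_
    rw [le_div_iff₀ (by exact_mod_cast h2)]
    have h4 := ncard_interdef_mul_le (T := T) hm' x
    rw [Set.ncard_eq_toFinset_card' (T.interdef x)] at h4
    exact_mod_cast h4
  refine le_trans ?_ (Finset.sum_le_sum fun x _ => h1 x)
  rw [hfib, hfib fun x => Real.log (cl x).card]
  refine Finset.sum_le_sum fun I hI => ?_
  obtain ⟨x, -, rfl⟩ := Finset.mem_image.1 hI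
  have h2 : ∑ y ∈ cl x, Real.log (cl y).card = (cl x).card * Real.log (cl x).card := by
    rw [← nsmul_eq_mul, ← Finset.sum_const]
    refine Finset.sum_congr rfl fun y hy => ?_
    rw [(hcl x y).2 (Set.mem_toFinset.1 hy)]
  rw [h2]
  refine le_trans (Finset.sum_le_sum fun y hy => Finset.sum_le_sum fun j _ => ?_)
    (sum_log_card_line_le (cl x))
  have hy' := Set.mem_toFinset.1 hy
  have h3 : 0 < {b | vec b - vec (y j) ∈ diffGroup vec (T.dcl (y '' {i | i ≠ j}))}.ncard :=
    (Set.ncard_pos (Set.toFinite _)).2 ⟨y j, by simp⟩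
  refine Real.log_le_log (by exact_mod_cast h3) ?_
  rw [Nat.cast_le, ← Set.ncard_coe_finset]
  refine Set.ncard_le_ncard_of_injOn (fun b => Function.update y j b) (fun b hb => ?_) ?_
    (Set.toFinite _)
  · rw [Finset.mem_coe, Finset.mem_filter]
    refine ⟨Set.mem_toFinset.2 ?_, fun i hi => Function.update_of_ne hi _ _⟩
    rw [← interdef_eq_of_mem hm' hy']
    exact h.update_mem_interdef hr hm hb
  · intro b _ b' _ hbb
    have := congrFun hbb j
    simpa using this

/-- The key inequality between the heights. -/
theorem Large.mul_height_le [Fintype S] [Nonempty S] [Finite V] (h : T.Large K t) {R M D C : ℕ}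
    (hR : R + 2 ≤ t) (hm : 2 * (R + 2) + K ^ (R + 3) + 2 ≤ m) (hM1 : 1 ≤ M) (hD : 1 ≤ D)
    (hC : 1 ≤ C) (hM : Nat.card (diffGroup vec Set.univ) ≤ M * Nat.card S)
    (hn : 4 * (K ^ (R + 1)) ^ 2 ≤ Nat.card S)
    (hexc : D * {q : (Fin R → S) × S | C * T.dclCard q.1 q.2 *
      (T.cls (Set.range q.1) q.2).ncard < Nat.card S}.ncard ≤ 19 * Nat.card S ^ (R + 1)) :
    (R + 2) * (T.height R - (Real.log C + Real.log (D * M) + 1 + 20 * (R + 2) * Real.log K / D)) ≤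
      ∑ k ∈ Finset.range (R + 2), T.height k := by
  have hnpos : (0 : ℝ) < Nat.card S := by exact_mod_cast Nat.card_pos
  have hlogK : 0 ≤ Real.log K := Real.log_natCast_nonneg _
  have hDpos : (0 : ℝ) < D := by exact_mod_cast hD
  set n := Nat.card S with hnS
  have h1 := h.sum_log_coset_le hR hm
  have h2 := h.le_sum_log_dclCard (by omega) hD hC hn hexc
  -- The closure of R + 1 coordinates is the closure of an R-tuple x and a point v, so the estimate
  -- for `dclCard` applies to each of the R + 2 ways of omitting a coordinate.
  have h3 : ∑ x : Fin (R + 1) → S, Real.log (T.dcl (Set.range x)).ncard =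
      ∑ x : Fin R → S, ∑ v, Real.log (T.dclCard x v) := by
    rw [sum_snoc]
    simp_rw [range_snoc]
    rfl
  have h4 : ∀ j : Fin (R + 2), _ := fun j =>
    h.le_sum_log_coset (k := R + 1) (by omega) hM1 hD hM j
  rw [Finset.sum_comm] at h1
  have h5 := (Finset.sum_le_sum fun j (_ : j ∈ Finset.univ) => h4 j).trans h1
  rw [Finset.sum_const, Finset.card_univ, Fintype.card_fin, nsmul_eq_mul, h3, ← hnS] at h5
  have h6 : (n : ℝ) ^ (R + 2) * (T.height R - (Real.log C + 1 + 19 * (R + 1) * Real.log K / D)) ≤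
      n * ∑ x : Fin R → S, ∑ v, Real.log (T.dclCard x v) := by
    calc _ = n * ((n : ℝ) ^ (R + 1) *
          (T.height R - (Real.log C + 1 + 19 * (R + 1) * Real.log K / D))) := by ring
      _ ≤ _ := mul_le_mul_of_nonneg_left h2 hnpos.le
  have hpow : (0 : ℝ) < (n : ℝ) ^ (R + 2) := by positivity
  have h7 : (19 : ℝ) * (R + 1) * Real.log K / D + (R + 2) * Real.log K / D ≤
      20 * (R + 2) * Real.log K / D := by
    rw [← add_div]
    refine div_le_div_of_nonneg_right ?_ hDpos.le
    nlinarith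
  refine le_of_mul_le_mul_left ?_ hpow
  refine le_trans ?_ h5
  have h8 : ((R + 2 : ℕ) : ℝ) = R + 2 := by push_cast; ring
  have h9 : (((R + 1 : ℕ) : ℝ) + 1) = R + 2 := by push_cast; ring
  rw [h8, h9]
  have h10 : (n : ℝ) ^ (R + 2) * ((R + 2) * (T.height R -
      (Real.log C + Real.log (D * M) + 1 + 20 * (R + 2) * Real.log K / D))) =
      (R + 2) * ((n : ℝ) ^ (R + 2) * (T.height R -
      (Real.log C + Real.log (D * M) + 1 + 20 * (R + 2) * Real.log K / D))) := by ring
  rw [h10]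
  refine mul_le_mul_of_nonneg_left ?_ (by positivity)
  have h11 := mul_le_mul_of_nonneg_left h7 hpow.le
  have h12 : (n : ℝ) ^ (R + 1 + 1) = (n : ℝ) ^ (R + 2) := rfl
  rw [h12]
  nlinarith

end TupleScheme

end PScheme

/-! ### Linear growth of the heights and the contradiction. -/

namespace PScheme

namespace TupleScheme

variable {S V : Type} [AddCommGroup V] {vec : S → V} {m : ℕ} {T : TupleScheme vec m} {K t : ℕ}

/-- The translates of the class of v by the group of A are disjoint: two conjugates over A whose
difference lies in that group are interdefinable over A, hence equal. -/
theorem ncard_cls_mul_card_diffGroup_le [Finite S] [Finite V] {A : Set S}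
    (hm : 2 * A.ncard + 2 ≤ m) (v : S) :
    (T.cls A v).ncard * Nat.card (diffGroup vec A) ≤ Nat.card (diffGroup vec Set.univ) := by
  rw [← Nat.card_coe_set_eq, ← Nat.card_prod]
  refine Nat.card_le_card_of_injective (fun q : T.cls A v × diffGroup vec A =>
    (⟨vec q.1 - vec v + q.2, AddSubgroup.add_mem _ (sub_mem_diffGroup (Set.mem_univ _)
      (Set.mem_univ _)) (diffGroup_mono (Set.subset_univ _) q.2.2)⟩ : diffGroup vec Set.univ)) ?_
  rintro ⟨⟨x, hx⟩, d⟩ ⟨⟨y, hy⟩, e⟩ heq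
  have h1 : vec x - vec v + d = vec y - vec v + e := congrArg Subtype.val heq
  have h2 : vec y - vec x ∈ diffGroup vec A := by
    have h3 : vec y - vec x = d - e := by
      rw [sub_eq_sub_iff_add_eq_add]
      rw [sub_add_eq_add_sub, sub_add_eq_add_sub] at h1
      rw [← sub_left_injective h1, add_comm]
    rw [h3]
    exact AddSubgroup.sub_mem _ d.2 e.2
  have h4 : y = x := by
    refine T.eq_of_mem_cls_of_mem_dcl hm (by rw [T.cls_eq_of_mem hx]; exact hy) (T.mem_dcl_of_vec ?_)
    rw [← sub_add_cancel (vec y) (vec x)]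
    refine AddSubgroup.add_mem _ ?_ (AddSubgroup.subset_closure ⟨x, Set.mem_insert _ _, rfl⟩)
    exact AddSubgroup.closure_mono (Set.image_mono (Set.subset_insert _ _)) (diffGroup_le_closure h2)
  subst h4
  rw [Prod.mk.injEq]
  exact ⟨rfl, Subtype.ext (add_left_cancel h1)⟩

/-- Each new independent coordinate enlarges the group of differences, hence at least doubles it;
the first one serves as origin. -/
theorem pow_le_card_diffGroup_of_ind [Finite S] [Finite V] {k : ℕ} {x : Fin (k + 1) → S}
    (hx : T.Ind ∅ x 0) : 2 ^ k ≤ Nat.card (diffGroup vec (Set.range x)) := by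
  induction k with
  | zero => exact Nat.card_pos
  | succ k ih =>
    have hinit : T.Ind ∅ (Fin.init x) 0 := by
      intro i hi hcon
      refine hx i.castSucc hi (T.dcl_mono ?_ hcon)
      refine Set.union_subset_union_right _ ?_
      rintro _ ⟨k, hk, rfl⟩
      exact ⟨k.castSucc, hk, rfl⟩
    have h1 := ih hinit
    have hsub : Set.range (Fin.init x) ⊆ Set.range x := by
      rintro _ ⟨i, rfl⟩
      exact ⟨i.castSucc, rfl⟩
    have hlast := hx (Fin.last (k + 1)) (Nat.zero_le _)
    have hrange : x '' {k' | k' < Fin.last (k + 1)} = Set.range (Fin.init x) := by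
      ext s
      constructor
      · rintro ⟨i, hi, rfl⟩
        exact ⟨⟨i, hi⟩, rfl⟩
      · rintro ⟨i, rfl⟩
        exact ⟨i.castSucc, Fin.castSucc_lt_last i, rfl⟩
    rw [Set.empty_union, hrange] at hlast
    have hlt : diffGroup vec (Set.range (Fin.init x)) < diffGroup vec (Set.range x) := by
      refine lt_of_le_of_ne (diffGroup_mono hsub) fun heq => hlast (T.mem_dcl_of_vec ?_)
      have h2 : vec (x (Fin.last (k + 1))) - vec (x 0) ∈ diffGroup vec (Set.range (Fin.init x)) := by
        rw [heq]
        exact sub_mem_diffGroup ⟨_, rfl⟩ ⟨_, rfl⟩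
      rw [← sub_add_cancel (vec (x (Fin.last (k + 1)))) (vec (x 0))]
      exact AddSubgroup.add_mem _ (diffGroup_le_closure h2)
        (AddSubgroup.subset_closure ⟨x 0, ⟨0, rfl⟩, rfl⟩)
    have h3 := two_mul_card_le_of_lt hlt
    rw [pow_succ]
    omega

theorem Large.mul_ncard_not_ind_le [Finite S] (h : T.Large K t) {k : ℕ} (hk : k ≤ t) :
    Nat.card S * {x : Fin k → S | ¬ T.Ind ∅ x 0}.ncard ≤ k * K ^ (k + 1) * Nat.card S ^ k := by
  classical
  have hK := h.two_le
  set n := Nat.card S with hn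
  let B : Fin k → Set (Fin k → S) := fun i => {x | x i ∈ T.dcl (x '' {k | k < i})}
  have hB : ∀ i, n * (B i).ncard ≤ K ^ (k + 1) * n ^ k := by
    intro i
    refine (card_mul_ncard_le_of_update i _ (fun _ => True) (K ^ (k + 1)) (fun y => ?_)
      (fun _ _ _ => trivial)).trans (le_of_eq ?_)
    · have him : ∀ u, Function.update y i u '' {k | k < i} = y '' {k | k < i} := fun u =>
        Set.image_congr fun k hk => Function.update_of_ne (ne_of_lt hk) _ _
      refine (Set.ncard_le_ncard (t := T.dcl (y '' {k | k < i})) ?_ (Set.toFinite _)).trans ?_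
      · intro u hu
        rwa [Set.mem_ofPred_eq, him, Function.update_self] at hu
      · have h2 := ncard_image_fin_le y {k | k < i}
        exact (h.ncard_dcl_le (by omega)).trans (Nat.pow_le_pow_right (by omega) (by omega))
    · rw [Set.ofPred_true, Set.ncard_univ, Nat.card_fun, Nat.card_fin]
  have hsub : {x : Fin k → S | ¬ T.Ind ∅ x 0} ⊆ ⋃ i ∈ (Finset.univ : Finset (Fin k)), B i := by
    intro x hx
    rw [Set.mem_ofPred_eq, Ind] at hx
    push Not at hx
    obtain ⟨i, -, hi⟩ := hx
    rw [Set.empty_union] at hi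
    exact Set.mem_biUnion (Finset.mem_coe.2 (Finset.mem_univ i)) hi
  calc _ ≤ n * ∑ i, (B i).ncard := Nat.mul_le_mul_left _
        ((Set.ncard_le_ncard hsub (Set.toFinite _)).trans (Finset.set_ncard_biUnion_le _ _))
    _ = ∑ i, n * (B i).ncard := Finset.mul_sum _ _ _
    _ ≤ ∑ i : Fin k, K ^ (k + 1) * n ^ k := Finset.sum_le_sum fun i _ => hB i
    _ = _ := by
      rw [Finset.sum_const, Finset.card_univ, Fintype.card_fin, smul_eq_mul]
      ring

/-- At least half of the (k+1)-tuples are independent. Over such a tuple each class has at most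
Mn/2^k elements, and the remaining tuples contribute at least 0. -/
theorem Large.le_height [Fintype S] [Nonempty S] [Finite V] (h : T.Large K t) {k M : ℕ}
    (hk : k + 1 ≤ t) (hM1 : 1 ≤ M) (hM : Nat.card (diffGroup vec Set.univ) ≤ M * Nat.card S)
    (hn : 2 * ((k + 1) * K ^ (k + 2)) ≤ Nat.card S) :
    (k * Real.log 2 - Real.log M) / 2 ≤ T.height (k + 1) := by
  classical
  have hd := h.depth
  set n := Nat.card S with hnS
  have hnpos' : 0 < n := Nat.card_pos
  have hnpos : (0 : ℝ) < n := by exact_mod_cast hnpos'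
  rcases le_total ((k : ℝ) * Real.log 2 - Real.log M) 0 with hneg | hpos
  · exact le_trans (by linarith) (height_nonneg _)
  set c := (k : ℝ) * Real.log 2 - Real.log M with hc
  have hMpos : (0 : ℝ) < M := by exact_mod_cast hM1
  have hpt : ∀ x : Fin (k + 1) → S, T.Ind ∅ x 0 → ∀ v, c ≤ T.defect x v := by
    intro x hx v
    have h1 := pow_le_card_diffGroup_of_ind hx
    have h2 := ncard_range_fin_le x
    have h3 := T.ncard_cls_mul_card_diffGroup_le (A := Set.range x) (by omega) v
    have h4 : (T.cls (Set.range x) v).ncard * 2 ^ k ≤ M * n :=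
      (Nat.mul_le_mul_left _ h1).trans (h3.trans hM)
    have h5 : (0 : ℝ) < (T.cls (Set.range x) v).ncard := by exact_mod_cast T.ncard_cls_pos _ _
    have h6 : (2 : ℝ) ^ k / M ≤ n / (T.cls (Set.range x) v).ncard := by
      rw [div_le_div_iff₀ hMpos h5, mul_comm, mul_comm (n : ℝ)]
      exact_mod_cast h4
    have h7 := Real.log_le_log (by positivity) h6
    rw [Real.log_div (by positivity) hMpos.ne', Real.log_pow] at h7
    exact h7
  have hbad : 2 * {x : Fin (k + 1) → S | ¬ T.Ind ∅ x 0}.ncard ≤ n ^ (k + 1) := by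
    have h1 := h.mul_ncard_not_ind_le hk
    refine le_of_mul_le_mul_left (a := n) ?_ hnpos'
    calc n * (2 * {x : Fin (k + 1) → S | ¬ T.Ind ∅ x 0}.ncard) =
        2 * (n * {x : Fin (k + 1) → S | ¬ T.Ind ∅ x 0}.ncard) := by ring
      _ ≤ 2 * ((k + 1) * K ^ (k + 1 + 1) * n ^ (k + 1)) := Nat.mul_le_mul_left _ h1
      _ = 2 * ((k + 1) * K ^ (k + 2)) * n ^ (k + 1) := by ring
      _ ≤ _ := Nat.mul_le_mul_right _ hn
  have h1 : (0 : ℝ) < (n : ℝ) ^ (k + 1 + 1) := by positivity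
  refine le_of_mul_le_mul_left ?_ h1
  rw [pow_mul_height]
  have h2 : ∀ x : Fin (k + 1) → S, n * (c - if ¬ T.Ind ∅ x 0 then c else 0) ≤
      ∑ v, T.defect x v := by
    intro x
    have h3 : ∀ v : S, (c - if ¬ T.Ind ∅ x 0 then c else 0) ≤ T.defect x v := by
      intro v
      by_cases hx : T.Ind ∅ x 0
      · rw [if_neg (not_not.2 hx), sub_zero]
        exact hpt x hx v
      · rw [if_pos hx, sub_self]
        exact defect_nonneg x v
    refine le_trans (le_of_eq ?_) (Finset.sum_le_sum fun v _ => h3 v)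
    rw [Finset.sum_const, Finset.card_univ, nsmul_eq_mul, hnS, Nat.card_eq_fintype_card]
  refine le_trans ?_ (Finset.sum_le_sum fun x _ => h2 x)
  rw [← Finset.mul_sum, Finset.sum_sub_distrib, Finset.sum_const, ← Finset.sum_filter,
    Finset.sum_const, Finset.card_univ, Fintype.card_fun, Fintype.card_fin, nsmul_eq_mul,
    nsmul_eq_mul, ← Nat.card_eq_fintype_card, ← hnS, ← Set.ncard_coe_finset]
  have h4 : ((Finset.univ.filter fun x : Fin (k + 1) → S => ¬ T.Ind ∅ x 0 : Finset _) : Set _) =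
      {x : Fin (k + 1) → S | ¬ T.Ind ∅ x 0} := by
    ext x
    simp
  rw [h4]
  have h5 : 2 * ({x : Fin (k + 1) → S | ¬ T.Ind ∅ x 0}.ncard : ℝ) ≤ (n : ℝ) ^ (k + 1) := by
    exact_mod_cast hbad
  have h6 := mul_le_mul_of_nonneg_right h5 hpos
  push_cast
  rw [pow_succ (n : ℝ) (k + 1), mul_comm ((n : ℝ) ^ (k + 1)) (n : ℝ), mul_assoc]
  refine mul_le_mul_of_nonneg_left ?_ hnpos.le
  linarith

theorem sum_range_sq (r : ℕ) :
    ∑ k ∈ Finset.range (r + 2), (k : ℝ) ^ 2 = (r + 1) * (r + 2) * (2 * r + 3) / 6 := by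
  induction r with
  | zero => norm_num [Finset.sum_range_succ]
  | succ r ih =>
    rw [Finset.sum_range_succ, ih]
    push_cast
    ring

/-- A sequence of controlled growth has an index with a small increment and a small initial mean. -/
theorem exists_index_of_growth {f : ℕ → ℝ} {ℓ k B : ℕ} (hk : 8192 * ((ℓ : ℝ) + 1) ^ 2 < k)
    (hB : 16 * k * (ℓ + 1) + 2 ≤ B) (hupper : ∀ i ≤ B, f i ≤ (i + 1) * (ℓ + 1))
    (hlower : (k : ℝ) / 4 ≤ f (k + 1)) :
    ∃ R, 1 ≤ R ∧ R + 2 ≤ B ∧ f (R + 2) - f R ≤ 16 * (ℓ + 1) ∧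
      ∀ L loss D : ℝ, 0 ≤ L → L ≤ ℓ + 1 → 20480 * ((ℓ : ℝ) + 1) ^ 2 ≤ D →
        (R + 2) * (f R - (loss + 20 * (R + 2) * L / D)) ≤ ∑ i ∈ Finset.range (R + 2), f i →
        (k : ℝ) ≤ 8192 * (ℓ + 1) ^ 2 * loss := by
  set l : ℝ := (ℓ : ℝ) + 1 with hl
  have hl1 : 1 ≤ l := by
    have : (0 : ℝ) ≤ ℓ := Nat.cast_nonneg _
    linarith
  set q : ℝ := (k : ℝ) with hq
  have hq8192 : 8192 < q := by nlinarith
  have hqpos : 0 < q := by linarith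
  have hkB : k + 1 ≤ B := by
    refine le_trans ?_ hB
    have : 16 * k * 1 ≤ 16 * k * (ℓ + 1) := Nat.mul_le_mul_left _ (Nat.le_add_left _ _)
    omega
  -- R maximizes f(i) - i²/(8q). The lower bound at k + 1 keeps R away from 0, and the linear upper
  -- bound keeps R + 2 inside the range. Maximality bounds the next increment and keeps the earlier
  -- values below f(R).
  obtain ⟨R, hRB, hR⟩ := Finset.exists_max_image (Finset.range (B + 1))
    (fun i => f i - (i : ℝ) ^ 2 / (8 * q)) ⟨0, by simp⟩
  have hRB' : R ≤ B := Nat.lt_succ_iff.1 (Finset.mem_range.1 hRB)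
  set x : ℝ := (R : ℝ) with hx
  have hx0 : 0 ≤ x := Nat.cast_nonneg _
  have hmax : ∀ i ≤ B, f i ≤ f R - x ^ 2 / (8 * q) + (i : ℝ) ^ 2 / (8 * q) := by
    intro i hi
    have := hR i (Finset.mem_range.2 (Nat.lt_succ_of_le hi))
    linarith
  have hRk : q / 9 ≤ f R - x ^ 2 / (8 * q) := by
    have h1 := hmax (k + 1) hkB
    have h2 : ((k + 1 : ℕ) : ℝ) ^ 2 / (8 * q) ≤ q / 4 - q / 9 := by
      rw [div_le_iff₀ (by positivity)]
      push_cast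
      nlinarith
    linarith
  have hRup : f R ≤ (x + 1) * l := hupper R hRB'
  have hsq : 0 ≤ x ^ 2 / (8 * q) := by positivity
  have h9 : q ≤ 9 * ((x + 1) * l) := by linarith
  have hx910 : 910 * l ≤ x + 1 := by
    have h1 : (910 * l) * (9 * l) ≤ (x + 1) * (9 * l) := by nlinarith
    exact le_of_mul_le_mul_right h1 (by linarith)
  have hx512 : 512 * l ≤ x := by linarith
  have hqx : q ≤ 16 * l * x := by
    have : 9 * ((x + 1) * l) ≤ 9 * ((x + x / 512) * l) := by
      gcongr
      linarith
    have h2 : 0 ≤ x * l := by positivity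
    linarith
  have hxhigh : x ≤ 16 * q * l := by
    have h1 : x ^ 2 / (8 * q) ≤ (x + 1) * l := by linarith
    rw [div_le_iff₀ (by positivity)] at h1
    have h3 : (x + 1) * l * (8 * q) ≤ 2 * x * l * (8 * q) := by
      gcongr
      linarith
    have h2 : x * x ≤ (16 * q * l) * x := by
      calc x * x = x ^ 2 := by ring
        _ ≤ _ := h1.trans h3
        _ = _ := by ring
    exact le_of_mul_le_mul_right h2 (by linarith)
  have hR2B : R + 2 ≤ B := by
    have : R ≤ 16 * k * (ℓ + 1) := by
      rw [hx, hq, hl] at hxhigh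
      exact_mod_cast hxhigh
    omega
  have hR1 : 1 ≤ R := by
    have : (1 : ℝ) ≤ R := by linarith
    exact_mod_cast this
  refine ⟨R, hR1, hR2B, ?_, ?_⟩
  · have h1 := hmax (R + 2) hR2B
    have h2 : ((R + 2 : ℕ) : ℝ) ^ 2 / (8 * q) - x ^ 2 / (8 * q) ≤ 16 * l := by
      rw [← sub_div, div_le_iff₀ (by positivity)]
      push_cast
      have h3 : 1 ≤ q * l := by nlinarith
      calc (x + 2) ^ 2 - x ^ 2 = 4 * x + 4 := by ring
        _ ≤ 4 * (16 * q * l) + 4 * (q * l) := by linarith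
        _ ≤ _ := by nlinarith
    linarith
  · intro L loss D hL0 hL hD hmain
    have hDpos : 0 < D := by nlinarith
    have hsum : ∑ i ∈ Finset.range (R + 2), f i ≤
        (x + 2) * (f R - x ^ 2 / (8 * q)) + (x + 1) * (x + 2) * (2 * x + 3) / 6 / (8 * q) := by
      refine (Finset.sum_le_sum fun i hi => hmax i (by
        have := Finset.mem_range.1 hi
        omega)).trans (le_of_eq ?_)
      rw [Finset.sum_add_distrib, Finset.sum_const, Finset.card_range, nsmul_eq_mul,
        ← Finset.sum_div, sum_range_sq]
      push_cast
      ring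
    have h1 : x ^ 2 / (16 * q) ≤ loss + 20 * (x + 2) * L / D := by
      have h2 := hmain.trans hsum
      have h3 : (x + 1) * (x + 2) * (2 * x + 3) / 6 / (8 * q) =
          (x + 2) * ((x + 1) * (2 * x + 3) / 6 / (8 * q)) := by ring
      rw [h3, ← mul_add] at h2
      have h4 := le_of_mul_le_mul_left h2 (by linarith)
      -- Averaged over i < R + 2, the penalty i²/(8q) is about a third of its value at R, so the
      -- mean of f falls below f(R) by at least R²/(16q).
      have h5 : x ^ 2 / (16 * q) ≤ x ^ 2 / (8 * q) - (x + 1) * (2 * x + 3) / 6 / (8 * q) := by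
        have h6 : x ^ 2 / (16 * q) = x ^ 2 / 2 / (8 * q) := by
          rw [div_div]
          congr 1
          ring
        rw [h6, ← sub_div]
        refine div_le_div_of_nonneg_right ?_ (by positivity)
        nlinarith
      linarith
    -- D was chosen so that this part of the loss eats at most half of the gain. The rest gives R² ≤
    -- 32·q·loss, and q ≤ 16·l·R turns this into a bound on q.
    have h2 : 20 * (x + 2) * L / D ≤ x ^ 2 / (32 * q) := by
      rw [div_le_div_iff₀ hDpos (by positivity)]
      have h3 : 20 * (x + 2) * L ≤ 40 * x * l := mul_le_mul (by linarith) hL hL0 (by linarith)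
      calc 20 * (x + 2) * L * (32 * q) ≤ 40 * x * l * (32 * (16 * l * x)) :=
            mul_le_mul h3 (by linarith) (by positivity) (by positivity)
        _ = x ^ 2 * (20480 * l ^ 2) := by ring
        _ ≤ _ := mul_le_mul_of_nonneg_left hD (by positivity)
    have h4 : x ^ 2 / (32 * q) ≤ loss := by
      have h5 : x ^ 2 / (16 * q) = x ^ 2 / (32 * q) + x ^ 2 / (32 * q) := by
        field_simp
        ring
      linarith
    rw [div_le_iff₀ (by positivity)] at h4
    have h6 : q * q ≤ (8192 * l ^ 2 * loss) * q := by
      calc q * q ≤ (16 * l * x) * (16 * l * x) :=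
            mul_le_mul hqx hqx hqpos.le (by positivity)
        _ = 256 * l ^ 2 * x ^ 2 := by ring
        _ ≤ 256 * l ^ 2 * (loss * (32 * q)) := mul_le_mul_of_nonneg_left h4 (by positivity)
        _ = _ := by ring
    exact le_of_mul_le_mul_right h6 hqpos

/-- There are no large schemes of small doubling. -/
theorem Large.false_of_small_doubling [Finite S] [Finite V] (h : T.Large K t) {p : ℕ} (hp : 0 < p)
    (hV : ∀ z : V, p • z = 0) {κ F Q a s M D P ℓ k B : ℕ} (hκ : 1 ≤ κ)
    (hdoub : {z | ∃ x y : S, z = vec y - vec x}.ncard ≤ κ * Nat.card S) (hF : 2 ≤ F)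
    (hℓ : Real.log K ≤ ℓ) (hD : 20480 * (ℓ + 1) ^ 2 ≤ D)
    (hFD : 16 * (D : ℝ) ^ 2 * κ * (ℓ + 1) ≤ Real.log F) (hB : 16 * k * (ℓ + 1) + 2 ≤ B)
    (ha : 2 * B + s + 2 ≤ a) (hat : a + (2 * p * (2 * F ^ 2) ^ 5 + 1) + 1 ≤ t)
    (hQ : (K ^ (a + 1)) ^ B ≤ Q) (hn : Q * (B * K ^ (a + 1)) < Nat.card S)
    (hM : Nat.card (diffGroup vec Set.univ) ≤ M * Nat.card S) (hs : M * K ^ (B + 1) < 2 ^ s)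
    (hP : D * (Q * (M * K ^ (B + 1)) + 1) ^ s ≤ P)
    (hn' : K ^ 5 * (M * K ^ (B + 1)) ^ P < Nat.card S) (hM1 : 1 ≤ M)
    (hDn : D * K ^ (B + 1) ≤ Nat.card S) (hm : 2 * (B + 2) + K ^ (B + 3) + 2 ≤ m)
    (hKn : 4 * (K ^ (B + 1)) ^ 2 ≤ Nat.card S) (hkn : 2 * ((k + 1) * K ^ (k + 2)) ≤ Nat.card S)
    (hkM : 8 + 8 * Real.log M ≤ k)
    (hk : 8192 * (ℓ + 1) ^ 2 * (Real.log (p ^ (2 * F ^ 2) ^ 5 * (2 * F ^ 2) *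
      (2 * B * M * D + p ^ (K ^ 3 + K ^ 2)) : ℕ) + Real.log (D * M) + 1) < k) : False := by
  classical
  have := Fintype.ofFinite S
  have hd := h.depth
  have hK := h.two_le
  have hnpos' : 0 < Nat.card S := by omega
  have hne : Nonempty S := (Nat.card_pos_iff.1 hnpos').1
  have hD1 : 1 ≤ D := le_trans (Nat.mul_pos (by norm_num) (by positivity)) hD
  have hBt : B + 2 ≤ t := by omega
  set C1 := p ^ (2 * F ^ 2) ^ 5 * (2 * F ^ 2) * (2 * B * M * D + p ^ (K ^ 3 + K ^ 2)) with hC1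
  have hlogK : 0 ≤ Real.log K := Real.log_natCast_nonneg _
  have hℓ0 : (0 : ℝ) ≤ ℓ := Nat.cast_nonneg _
  have hlogM : 0 ≤ Real.log M := Real.log_natCast_nonneg _
  have hlogC : 0 ≤ Real.log C1 := Real.log_natCast_nonneg _
  have hlogDM : 0 ≤ Real.log (D * M) := by
    rw [← Nat.cast_mul]
    exact Real.log_natCast_nonneg _
  have hkpos : (0 : ℝ) < k := by linarith
  have hk8192 : 8192 * ((ℓ : ℝ) + 1) ^ 2 < k := by
    refine lt_of_le_of_lt ?_ hk
    have : (1 : ℝ) ≤ Real.log C1 + Real.log (D * M) + 1 := by linarith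
    nlinarith [sq_nonneg ((ℓ : ℝ) + 1)]
  have hupper : ∀ i ≤ B, T.height i ≤ (i + 1) * (ℓ + 1) := by
    intro i hi
    have h1 := h.height_le (k := i) (by omega) (le_trans (by gcongr; omega) hKn)
    have : ((i : ℝ) + 1) * Real.log K ≤ (i + 1) * ℓ :=
      mul_le_mul_of_nonneg_left hℓ (by positivity)
    have hi0 : (0 : ℝ) ≤ i := Nat.cast_nonneg _
    linarith
  have hkB : k + 1 ≤ B := by
    refine le_trans ?_ hB
    have : 16 * k * 1 ≤ 16 * k * (ℓ + 1) := Nat.mul_le_mul_left _ (Nat.le_add_left _ _)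
    omega
  have hlower : (k : ℝ) / 4 ≤ T.height (k + 1) := by
    refine le_trans ?_ (h.le_height (by omega) hM1 hM hkn)
    have := mul_le_mul_of_nonneg_left Real.log_two_gt_d9.le hkpos.le
    linarith
  obtain ⟨R, hR1, hR2B, hΔ, hfin⟩ := exists_index_of_growth hk8192 hB hupper hlower
  have hRB' : R ≤ B := by omega
  -- The increment bound 16(ℓ + 1) does not depend on R, so F can be fixed in advance.
  have hFD' : (D : ℝ) ^ 2 * κ * (T.height (R + 2) - T.height R) ≤ Real.log F := by
    refine le_trans (mul_le_mul_of_nonneg_left hΔ (by positivity)) (le_trans (le_of_eq ?_) hFD)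
    ring
  have hKR : ∀ {i j : ℕ}, i ≤ j → K ^ i ≤ K ^ j := fun hij => Nat.pow_le_pow_right (by omega) hij
  have hQ' : (K ^ (a + 1)) ^ R ≤ Q := (Nat.pow_le_pow_right (Nat.pow_pos (by omega)) hRB').trans hQ
  have hMK : M * K ^ (R + 1) ≤ M * K ^ (B + 1) := Nat.mul_le_mul_left _ (hKR (by omega))
  -- All conditions are monotone in R, so the hypotheses for B imply them for R ≤ B.
  have hexc := h.mul_ncard_lt_le hp hV hκ hdoub hF hFD' (ha := by omega) (s := s) (Q := Q) (a := a)
    (M := M) (P := P) hat (by omega) hQ'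
    (lt_of_le_of_lt (Nat.mul_le_mul_left _ (Nat.mul_le_mul_right _ hRB')) hn) hM
    (lt_of_le_of_lt hMK hs)
    (le_trans (Nat.mul_le_mul_left _ (Nat.pow_le_pow_left (Nat.add_le_add_right
      (Nat.mul_le_mul_left _ hMK) 1) s)) hP)
    (lt_of_le_of_lt (Nat.mul_le_mul_left _ (Nat.pow_le_pow_left hMK P)) hn') hR1 hM1
    (le_trans (Nat.mul_le_mul_left _ (hKR (by omega))) hDn)
  set C := p ^ (2 * F ^ 2) ^ 5 * (2 * F ^ 2) * (2 * R * M * D + p ^ (K ^ 3 + K ^ 2)) with hC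
  have hF0 : 0 < 2 * F ^ 2 := Nat.mul_pos two_pos (Nat.pow_pos (by omega))
  have hCpos : 1 ≤ C := Nat.mul_pos (Nat.mul_pos (Nat.pow_pos hp) hF0)
    (Nat.add_pos_right _ (Nat.pow_pos hp))
  have hCC : C ≤ C1 := by
    refine Nat.mul_le_mul_left _ (Nat.add_le_add_right ?_ _)
    gcongr
  have hlogCC : Real.log C ≤ Real.log C1 :=
    Real.log_le_log (by exact_mod_cast hCpos) (by exact_mod_cast hCC)
  have hmain := h.mul_height_le (by omega) (le_trans (by
    have := hKR (show R + 3 ≤ B + 3 by omega)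
    omega) hm) hM1 hD1 hCpos hM (le_trans (by gcongr; omega) hKn) hexc
  have h3 := hfin (Real.log K) (Real.log C + Real.log (D * M) + 1) D hlogK (by linarith)
    (by exact_mod_cast hD) hmain
  refine absurd (lt_of_le_of_lt ?_ hk) (not_lt.2 h3)
  refine mul_le_mul_of_nonneg_left ?_ (by positivity)
  linarith

end TupleScheme

end PScheme

/-! ### Choice of the parameters. -/

namespace PScheme

theorem log_le_of_le_two_pow {c e : ℕ} (h : c ≤ 2 ^ e) : Real.log c ≤ e := by
  rcases Nat.eq_zero_or_pos c with rfl | hc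
  · simp
  · have h1 : Real.log c ≤ Real.log ((2 : ℝ) ^ e) :=
      Real.log_le_log (by exact_mod_cast hc) (by exact_mod_cast h)
    rw [Real.log_pow] at h1
    have h2 := Real.log_two_lt_d9
    have h3 : (0 : ℝ) ≤ e := Nat.cast_nonneg _
    nlinarith

namespace TupleScheme

variable {S V : Type} [AddCommGroup V] {vec : S → V} {m : ℕ} {T : TupleScheme vec m} {t : ℕ}

set_option maxHeartbeats 2000000 in
/-- There are no large schemes of small doubling and of depth an iterated exponential. -/
theorem Large.false_of_two_pow_le [Finite S] [Finite V] {Λ : ℕ} (h : T.Large ((2 ^ Λ) ^ 2) t)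
    (hΛ : 1 ≤ Λ) {p : ℕ} (hp : 0 < p) (hpΛ : p ≤ 2 ^ Λ) (hV : ∀ z : V, p • z = 0)
    (hdoub : {z | ∃ x y : S, z = vec y - vec x}.ncard ≤ (2 ^ Λ) ^ 12 * Nat.card S)
    (ht : 2 ^ 2 ^ (15 * 2 ^ (70 * Λ)) ≤ t) : False := by
  have pow_le : ∀ {i j : ℕ}, i ≤ j → 2 ^ i ≤ 2 ^ j := fun hij =>
    Nat.pow_le_pow_right two_pos hij
  rw [← pow_mul, mul_comm Λ 2] at h
  have hd := h.depth
  have hcard := h.card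
  rw [← pow_mul, mul_comm Λ 12] at hdoub
  have hone : ∀ i : ℕ, 1 ≤ 2 ^ i := fun i => Nat.one_le_two_pow
  have h2Λ : 2 * Λ + 1 ≤ 2 ^ (2 * Λ) := Nat.lt_two_pow_self
  have hΛ2 : Λ ≤ 2 ^ Λ := Nat.lt_two_pow_self.le
  obtain ⟨D, hD⟩ : ∃ z, z = 20480 * (2 * Λ + 1) ^ 2 := ⟨_, rfl⟩
  have hDle : D ≤ 2 ^ (19 * Λ) := by
    calc D ≤ 2 ^ 15 * (2 ^ (2 * Λ)) ^ 2 := by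
          rw [hD]
          gcongr
          norm_num
      _ = 2 ^ (15 + 4 * Λ) := by
          rw [← pow_mul, ← pow_add]
          congr 1
          ring
      _ ≤ _ := pow_le (by omega)
  -- F = 2^f. The factor 32 is twice the required 16, since log 2 > 1/2.
  obtain ⟨f, hf⟩ : ∃ z, z = 32 * D ^ 2 * 2 ^ (12 * Λ) * (2 * Λ + 1) := ⟨_, rfl⟩
  have hfle : f ≤ 2 ^ (57 * Λ) := by
    calc f ≤ 2 ^ 5 * (2 ^ (19 * Λ)) ^ 2 * 2 ^ (12 * Λ) * 2 ^ (2 * Λ) := by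
          rw [hf]
          gcongr
          norm_num
      _ = 2 ^ (5 + 52 * Λ) := by
          rw [← pow_mul, ← pow_add, ← pow_add, ← pow_add]
          congr 1
          ring
      _ ≤ _ := pow_le (by omega)
  have hf1 : 1 ≤ f := by
    rw [hf, hD]
    exact Nat.succ_le_of_lt (by positivity)
  obtain ⟨e, he⟩ : ∃ z, z = 10 * f + 5 := ⟨_, rfl⟩
  have hele : e ≤ 2 ^ (61 * Λ) := by
    calc e ≤ 2 ^ 4 * 2 ^ (57 * Λ) := by omega
      _ = 2 ^ (4 + 57 * Λ) := by rw [← pow_add]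
      _ ≤ _ := pow_le (by omega)
  have hFe : (2 * (2 ^ f) ^ 2) ^ 5 = 2 ^ e := by
    rw [← pow_mul, ← pow_succ', ← pow_mul]
    congr 1
    omega
  -- The exponent y exceeds e = log₂ (2F²)^5 with room to spare, so that Y = 2^y exceeds the
  -- logarithms of all group sizes produced by Ruzsa's theorem.
  obtain ⟨y, hy⟩ : ∃ z, z = 2 ^ (70 * Λ) := ⟨_, rfl⟩
  have hy61 : 2 ^ 8 * 2 ^ (61 * Λ) ≤ y := by
    rw [hy, ← pow_add]
    exact pow_le (by omega)
  have h61Λ : Λ ≤ 2 ^ (61 * Λ) := hΛ2.trans (pow_le (by omega))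
  have hy19 : 2 ^ (19 * Λ) ≤ 2 ^ (61 * Λ) := pow_le (by omega)
  have h61 := hone (61 * Λ)
  have hΛy : 256 * Λ ≤ y := (Nat.mul_le_mul_left _ h61Λ).trans hy61
  obtain ⟨Y, hY⟩ : ∃ z, z = 2 ^ y := ⟨_, rfl⟩
  have hyY : y < Y := hY ▸ Nat.lt_two_pow_self
  have hyY2 : 64 * y ≤ Y := by
    obtain ⟨z, hz⟩ : ∃ z, y = z + 14 := ⟨y - 14, by omega⟩
    have := Nat.lt_two_pow_self (n := z)
    rw [hY, hz, pow_add]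
    omega
  have hYpos : 0 < Y := hY ▸ Nat.two_pow_pos y
  obtain ⟨μ, hμ⟩ : ∃ z, z = Λ * 2 ^ (60 * Λ) + 12 * Λ := ⟨_, rfl⟩
  have hμle : μ ≤ 13 * 2 ^ (61 * Λ) := by
    have : Λ * 2 ^ (60 * Λ) ≤ 2 ^ (61 * Λ) := by
      calc Λ * 2 ^ (60 * Λ) ≤ 2 ^ Λ * 2 ^ (60 * Λ) := Nat.mul_le_mul_right _ hΛ2
        _ = 2 ^ (61 * Λ) := by
          rw [← pow_add]
          congr 1
          ring
    omega
  obtain ⟨M, hM⟩ : ∃ z, z = p ^ (2 ^ (12 * Λ)) ^ 5 * 2 ^ (12 * Λ) := ⟨_, rfl⟩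
  have hM1 : 1 ≤ M := hM ▸ Nat.mul_pos (Nat.pow_pos hp) (Nat.two_pow_pos _)
  have hMle : M ≤ 2 ^ μ := by
    calc M ≤ (2 ^ Λ) ^ (2 ^ (12 * Λ)) ^ 5 * 2 ^ (12 * Λ) := by
          rw [hM]
          gcongr
      _ = 2 ^ μ := by
          rw [← pow_mul, ← pow_mul, ← pow_add, hμ]
          congr 4
          ring
  have hMy : M ≤ 2 ^ y := hMle.trans (pow_le (by omega))
  have hDy : D ≤ 2 ^ y := hDle.trans (pow_le (by omega))
  have hYY : ∀ {i j : ℕ}, i ≤ j → Y ^ i ≤ Y ^ j := fun hij => Nat.pow_le_pow_right hYpos hij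
  have hYtwo : 2 ^ 21 ≤ Y := hY ▸ pow_le (by
    have := pow_le (show 5 ≤ 70 * Λ by omega)
    omega)
  have hYmul : ∀ {i j c d : ℕ}, c ≤ 2 ^ 21 * d → d ≤ Y ^ i → i < j → c ≤ Y ^ j := by
    intro i j c d hc hd hij
    calc c ≤ 2 ^ 21 * d := hc
      _ ≤ Y * Y ^ i := Nat.mul_le_mul hYtwo hd
      _ = Y ^ (i + 1) := (pow_succ' _ _).symm
      _ ≤ _ := hYY hij
  have hexp : y + 2 * Λ * (Y ^ 3 + 1) < Y ^ 4 := by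
    have h2 : 1 ≤ Y ^ 3 := Nat.pow_pos hYpos
    have h5 : 4 * Λ + y < Y := by omega
    calc y + 2 * Λ * (Y ^ 3 + 1) ≤ (4 * Λ + y) * Y ^ 3 := by
          linarith [Nat.le_mul_of_pos_right (2 * Λ) h2, Nat.le_mul_of_pos_right y h2]
      _ < Y * Y ^ 3 := Nat.mul_lt_mul_of_pos_right h5 h2
      _ = Y ^ 4 := by ring
  have hKB : M * (2 ^ (2 * Λ)) ^ (Y ^ 3 + 1) < 2 ^ Y ^ 4 := by
    have hK1 : (2 ^ (2 * Λ)) ^ (Y ^ 3 + 1) = 2 ^ (2 * Λ * (Y ^ 3 + 1)) := (pow_mul _ _ _).symm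
    rw [hK1]
    refine lt_of_le_of_lt (Nat.mul_le_mul_right _ hMy) ?_
    rw [← pow_add]
    exact Nat.pow_lt_pow_right one_lt_two hexp
  have hK1 : ∀ j, (2 ^ (2 * Λ)) ^ j = 2 ^ (2 * Λ * j) := fun j => (pow_mul _ _ _).symm
  have hY1 : ∀ i, 1 ≤ Y ^ i := fun i => Nat.pow_pos hYpos
  have hYlt : ∀ {i j : ℕ}, i < j → 2 ^ 21 * Y ^ i ≤ Y ^ j := fun hij => hYmul le_rfl le_rfl hij
  have hYlt1 : ∀ {j : ℕ}, 1 < j → 2 ^ 21 * Y ≤ Y ^ j := fun hj => by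
    simpa only [pow_one] using hYlt hj
  have hKB' : (2 ^ (2 * Λ)) ^ (Y ^ 3 + 3) ≤ 2 ^ Y ^ 4 := by
    rw [hK1]
    refine pow_le ?_
    calc 2 * Λ * (Y ^ 3 + 3) ≤ 8 * Λ * Y ^ 3 := by
          linarith [Nat.le_mul_of_pos_right (2 * Λ) (hY1 3)]
      _ ≤ Y * Y ^ 3 := Nat.mul_le_mul_right _ (by omega)
      _ = Y ^ 4 := by ring
  have ht' : 2 ^ Y ^ 15 ≤ t := by
    refine le_trans (le_of_eq ?_) ht
    rw [hY, ← pow_mul, hy]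
    congr 2
    ring
  have hYt : Y ^ 15 < t := Nat.lt_two_pow_self.trans_le ht'
  have hS : ∀ c, c ≤ 2 ^ t → c < Nat.card S := by
    intro c hc
    refine (hc.trans ?_).trans_lt hcard
    rw [hK1]
    refine pow_le ?_
    linarith [Nat.le_mul_of_pos_left (8 * t + 8) (show 0 < 2 * Λ by omega)]
  have hS' : ∀ {c e : ℕ}, c ≤ 2 ^ e → e ≤ Y ^ 15 → c < Nat.card S := fun hc he =>
    hS _ (hc.trans (pow_le (he.trans hYt.le)))
  have he1 : Λ + e + 1 ≤ y := by omega
  have hpe : 2 * p * 2 ^ e ≤ Y := by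
    calc 2 * p * 2 ^ e ≤ 2 * 2 ^ Λ * 2 ^ e := by gcongr
      _ = 2 ^ (Λ + e + 1) := by ring
      _ ≤ Y := hY ▸ pow_le he1
  have h34 := hYlt (show 3 < 4 by norm_num)
  have h45 := hYlt (show 4 < 5 by norm_num)
  have h515 := hYlt (show 5 < 15 by norm_num)
  have h415 := hYlt (show 4 < 15 by norm_num)
  have hY3 := hY1 3
  have hKle : (2 ^ (2 * Λ)) ^ (Y ^ 3 + 1) ≤ 2 ^ Y ^ 4 :=
    (Nat.pow_le_pow_right (Nat.two_pow_pos _) (by omega)).trans hKB'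
  have hKa : (2 ^ (2 * Λ)) ^ (Y ^ 5 + 1) ≤ 2 ^ Y ^ 6 := by
    rw [hK1]
    refine pow_le ?_
    calc 2 * Λ * (Y ^ 5 + 1) ≤ 4 * Λ * Y ^ 5 := by
          linarith [Nat.le_mul_of_pos_right (2 * Λ) (hY1 5)]
      _ ≤ Y * Y ^ 5 := Nat.mul_le_mul_right _ (by omega)
      _ = Y ^ 6 := by ring
  -- All parameters are powers of Y or powers of 2 with such exponents. The loss is O(Y) up to
  -- factors bounded in terms of Λ, so k = Y² beats it, and B = Y³ covers the range. P must exceed a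
  -- power (Q·τ)^s, hence the exponent Y^14, and n must exceed τ^P, hence t ≥ 2^(Y^15). This last
  -- requirement is the source of the third exponential.
  refine h.false_of_small_doubling hp hV (κ := 2 ^ (12 * Λ)) (F := 2 ^ f) (Q := 2 ^ Y ^ 9)
    (a := Y ^ 5) (s := Y ^ 4) (M := M) (D := D) (P := 2 ^ Y ^ 14) (ℓ := 2 * Λ) (k := Y ^ 2)
    (B := Y ^ 3) (hone _) hdoub ?_ ?_ ?_ ?_ ?_ ?_ ?_ ?_ ?_ ?_ hKB ?_ ?_ hM1 ?_ ?_ ?_ ?_ ?_ ?_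
  · exact Nat.le_self_pow (by omega) 2
  · exact_mod_cast log_le_of_le_two_pow (le_refl (2 ^ (2 * Λ)))
  · exact_mod_cast hD.ge
  · have h1 : Real.log ((2 ^ f : ℕ) : ℝ) = f * Real.log 2 := by
      push_cast
      exact Real.log_pow _ _
    rw [h1]
    have h2 := Real.log_two_gt_d9
    have h3 : (f : ℝ) = 2 * (16 * (D : ℝ) ^ 2 * ((2 ^ (12 * Λ) : ℕ) : ℝ) * (((2 * Λ : ℕ) : ℝ) + 1)) := by
      rw [hf]
      push_cast
      ring
    have h4 : (0 : ℝ) ≤ f := Nat.cast_nonneg _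
    push_cast at h3 ⊢
    linarith [mul_le_mul_of_nonneg_left h2.le h4]
  · calc 16 * Y ^ 2 * (2 * Λ + 1) + 2 ≤ (16 * (2 * Λ + 1) + 2) * Y ^ 2 := by
          linarith [Nat.le_mul_of_pos_right 2 (hY1 2)]
      _ ≤ Y * Y ^ 2 := Nat.mul_le_mul_right _ (by omega)
      _ = Y ^ 3 := by ring
  · omega
  · rw [hFe]
    have h1 := hYlt1 (show 1 < 15 by norm_num)
    omega
  · calc ((2 ^ (2 * Λ)) ^ (Y ^ 5 + 1)) ^ Y ^ 3 ≤ (2 ^ Y ^ 6) ^ Y ^ 3 := Nat.pow_le_pow_left hKa _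
      _ = 2 ^ Y ^ 9 := by
        rw [← pow_mul]
        congr 1
        ring
  · refine hS' (e := Y ^ 9 + (Y ^ 3 + Y ^ 6)) ?_ ?_
    · rw [pow_add 2 (Y ^ 9), pow_add 2 (Y ^ 3)]
      exact Nat.mul_le_mul_left _ (Nat.mul_le_mul Nat.lt_two_pow_self.le hKa)
    · have h1 := hYlt (show 3 < 15 by norm_num)
      have h2 := hYlt (show 6 < 15 by norm_num)
      have h3 := hYlt (show 9 < 15 by norm_num)
      omega
  · have hX : (Set.univ : Set S).Nonempty := by
      have : Nonempty S := (Nat.card_pos_iff.1 (Nat.zero_lt_of_lt hcard)).1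
      exact Set.univ_nonempty
    have h1 := (diffGroup_of_small_doubling T.inj hp hV (κ := 2 ^ (12 * Λ)) hX (by
      rw [Set.ncard_univ]
      refine le_trans (le_of_eq ?_) hdoub
      congr 1
      ext z
      constructor
      · rintro ⟨x, -, y, -, rfl⟩
        exact ⟨y, x, rfl⟩
      · rintro ⟨x, y, rfl⟩
        exact ⟨y, trivial, x, trivial, rfl⟩)).1
    rw [Set.ncard_univ, ← mul_assoc, ← hM] at h1
    exact h1
  · calc D * (2 ^ Y ^ 9 * (M * (2 ^ (2 * Λ)) ^ (Y ^ 3 + 1)) + 1) ^ Y ^ 4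
        ≤ 2 ^ Y * (2 ^ (Y ^ 9 + Y ^ 4 + 1)) ^ Y ^ 4 := by
          refine Nat.mul_le_mul (hDy.trans (pow_le hyY.le)) (Nat.pow_le_pow_left ?_ _)
          have h1 := Nat.mul_le_mul_left (2 ^ Y ^ 9) hKB.le
          have h2 := hone (Y ^ 9 + Y ^ 4)
          rw [← pow_add] at h1
          rw [pow_succ 2 (Y ^ 9 + Y ^ 4)]
          omega
      _ = 2 ^ (Y + (Y ^ 9 + Y ^ 4 + 1) * Y ^ 4) := by rw [← pow_mul, ← pow_add]
      _ ≤ 2 ^ Y ^ 14 := by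
          refine pow_le ?_
          have h1 := hYlt1 (show 1 < 14 by norm_num)
          have h2 := hYlt (show 4 < 14 by norm_num)
          have h3 := hYlt (show 8 < 14 by norm_num)
          have h4 := hYlt (show 13 < 14 by norm_num)
          have h5 : (Y ^ 9 + Y ^ 4 + 1) * Y ^ 4 = Y ^ 13 + Y ^ 8 + Y ^ 4 := by ring
          rw [h5]
          omega
  · refine hS _ ?_
    calc (2 ^ (2 * Λ)) ^ 5 * (M * (2 ^ (2 * Λ)) ^ (Y ^ 3 + 1)) ^ 2 ^ Y ^ 14
        ≤ 2 ^ (2 * Λ * 5) * (2 ^ Y ^ 4) ^ 2 ^ Y ^ 14 := by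
          rw [hK1]
          exact Nat.mul_le_mul_left _ (Nat.pow_le_pow_left hKB.le _)
      _ = 2 ^ (2 * Λ * 5 + Y ^ 4 * 2 ^ Y ^ 14) := by rw [← pow_mul, ← pow_add]
      _ ≤ 2 ^ t := by
          refine pow_le (le_trans ?_ ht')
          have h1 : Y ^ 4 * 2 ^ Y ^ 14 ≤ 2 ^ (Y ^ 4 + Y ^ 14) := by
            rw [pow_add]
            exact Nat.mul_le_mul_right _ Nat.lt_two_pow_self.le
          have h2 : 2 * Λ * 5 ≤ 2 ^ (Y ^ 4 + Y ^ 14) := by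
            have h3 := hYlt1 (show 1 < 4 by norm_num)
            have h4 : Y ^ 4 + Y ^ 14 < _ := Nat.lt_two_pow_self
            omega
          have h5 : 2 ^ (Y ^ 4 + Y ^ 14 + 1) ≤ 2 ^ Y ^ 15 := by
            refine pow_le ?_
            have h6 := hYlt (show 4 < 15 by norm_num)
            have h7 := hYlt (show 14 < 15 by norm_num)
            have h8 := hY1 4
            omega
          rw [pow_succ] at h5
          omega
  · refine (hS' (e := Y + Y ^ 4) ?_ ?_).le
    · rw [pow_add 2 Y]
      exact Nat.mul_le_mul (hDy.trans (pow_le hyY.le)) hKle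
    · have h3 := hYlt1 (show 1 < 15 by norm_num)
      omega
  · have h1 : 2 ^ (Y ^ 4) ≤ 2 ^ Y ^ 15 := pow_le (by omega)
    have h2 := hYlt (show 3 < 15 by norm_num)
    omega
  · refine (hS' (e := 2 + Y ^ 4 * 2) ?_ ?_).le
    · rw [pow_add 2 2, pow_mul 2 (Y ^ 4)]
      exact Nat.mul_le_mul_left _ (Nat.pow_le_pow_left hKle _)
    · have := hY1 4
      omega
  · refine (hS' (e := 1 + (Y ^ 2 + 1 + Y ^ 4)) ?_ ?_).le
    · rw [pow_add 2 1, pow_add 2 (Y ^ 2 + 1), pow_one]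
      refine Nat.mul_le_mul_left _ (Nat.mul_le_mul Nat.lt_two_pow_self.le (le_trans ?_ hKle))
      refine Nat.pow_le_pow_right (Nat.two_pow_pos _) ?_
      have := hYlt (show 2 < 3 by norm_num)
      omega
    · have := hYlt (show 2 < 15 by norm_num)
      have := hY1 4
      omega
  · have h1 := log_le_of_le_two_pow hMle
    have h2 : 8 + 8 * μ ≤ Y ^ 2 := by
      have h3 := hYlt1 (show 1 < 2 by norm_num)
      omega
    have h4 : (8 : ℝ) + 8 * μ ≤ ((Y ^ 2 : ℕ) : ℝ) := by exact_mod_cast h2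
    linarith
  · have hp1 : p ^ 2 ^ e ≤ 2 ^ Y := by
      calc p ^ 2 ^ e ≤ (2 ^ Λ) ^ 2 ^ e := Nat.pow_le_pow_left hpΛ _
        _ = 2 ^ (Λ * 2 ^ e) := by rw [← pow_mul]
        _ ≤ 2 ^ Y := by
          refine pow_le ?_
          calc Λ * 2 ^ e ≤ 2 ^ Λ * 2 ^ e := Nat.mul_le_mul_right _ hΛ2
            _ = 2 ^ (Λ + e) := by rw [← pow_add]
            _ ≤ Y := hY ▸ pow_le (by omega)
    have hF2 : 2 * (2 ^ f) ^ 2 ≤ 2 ^ y := by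
      rw [← pow_mul, ← pow_succ']
      exact pow_le (by omega)
    have hpK : p ^ ((2 ^ (2 * Λ)) ^ 3 + (2 ^ (2 * Λ)) ^ 2) ≤ 2 ^ y := by
      calc p ^ ((2 ^ (2 * Λ)) ^ 3 + (2 ^ (2 * Λ)) ^ 2)
          ≤ (2 ^ Λ) ^ ((2 ^ (2 * Λ)) ^ 3 + (2 ^ (2 * Λ)) ^ 2) := Nat.pow_le_pow_left hpΛ _
        _ = 2 ^ (Λ * ((2 ^ (2 * Λ)) ^ 3 + (2 ^ (2 * Λ)) ^ 2)) := by rw [← pow_mul]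
        _ ≤ 2 ^ y := by
          refine pow_le ?_
          rw [hK1, hK1]
          have h1 := pow_le (show 2 * Λ * 3 ≤ 60 * Λ by omega)
          have h2 := pow_le (show 2 * Λ * 2 ≤ 60 * Λ by omega)
          have h3 : Λ * (2 ^ (2 * Λ * 3) + 2 ^ (2 * Λ * 2)) ≤
              Λ * (2 ^ (60 * Λ) + 2 ^ (60 * Λ)) := by gcongr
          have h4 : Λ * (2 ^ (60 * Λ) + 2 ^ (60 * Λ)) = 2 * (Λ * 2 ^ (60 * Λ)) := by ring
          omega
    have hC : p ^ (2 * (2 ^ f) ^ 2) ^ 5 * (2 * (2 ^ f) ^ 2) *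
        (2 * Y ^ 3 * M * D + p ^ ((2 ^ (2 * Λ)) ^ 3 + (2 ^ (2 * Λ)) ^ 2)) ≤ 2 ^ (Y + 7 * y) := by
      rw [hFe]
      calc _ ≤ 2 ^ Y * 2 ^ y * (2 ^ (5 * y + 1) + 2 ^ (5 * y + 1)) := by
            refine Nat.mul_le_mul (Nat.mul_le_mul hp1 hF2) (Nat.add_le_add ?_ ?_)
            · calc 2 * Y ^ 3 * M * D ≤ 2 * (2 ^ y) ^ 3 * 2 ^ y * 2 ^ y := by
                    rw [← hY] at hMy hDy ⊢
                    gcongr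
                _ = 2 ^ (5 * y + 1) := by ring
            · exact hpK.trans (pow_le (by omega))
        _ = 2 ^ (Y + y + (5 * y + 2)) := by
            rw [pow_add, pow_add, pow_succ 2 (5 * y + 1)]
            ring
        _ ≤ _ := pow_le (by omega)
    have hDM : D * M ≤ 2 ^ (2 * y) := by
      rw [two_mul, pow_add]
      exact Nat.mul_le_mul hDy hMy
    have h1 := log_le_of_le_two_pow hC
    have h2 := log_le_of_le_two_pow hDM
    have h3 : 8192 * (2 * Λ + 1) ^ 2 * (11 * Y) < Y ^ 2 := by
      have h4 : 8192 * (2 * Λ + 1) ^ 2 * 11 < Y := by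
        calc 8192 * (2 * Λ + 1) ^ 2 * 11 < 20480 * (2 * Λ + 1) ^ 2 * 8 := by
              have : 0 < (2 * Λ + 1) ^ 2 := by positivity
              omega
          _ ≤ 2 ^ (19 * Λ) * 8 := Nat.mul_le_mul_right _ (hD ▸ hDle)
          _ ≤ Y := by omega
      calc _ = 8192 * (2 * Λ + 1) ^ 2 * 11 * Y := by ring
        _ < Y * Y := Nat.mul_lt_mul_of_pos_right h4 hYpos
        _ = _ := by ring
    have h5 : Y + 7 * y + 2 * y + 1 ≤ 11 * Y := by omega
    have h3' : (8192 : ℝ) * (2 * Λ + 1) ^ 2 * (11 * Y) < ((Y ^ 2 : ℕ) : ℝ) := by exact_mod_cast h3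
    have h5' : (Y : ℝ) + 7 * y + 2 * y + 1 ≤ 11 * Y := by exact_mod_cast h5
    push_cast at h1 h2 h3' ⊢
    refine lt_of_le_of_lt (mul_le_mul_of_nonneg_left ?_ (by positivity)) h3'
    linarith

end TupleScheme

end PScheme

/-! ### Bounds for groups acting linearly. -/

namespace PScheme

theorem two_pow_lt_choose {n M Λ : ℕ} (hΛ : 1 ≤ Λ) (hΛM : Λ ≤ M) (hn : 2 ^ (7 * M) ≤ n) :
    2 ^ (Λ * M) < n.choose Λ := by
  have h1 : (n + 1 - Λ) ^ Λ ≤ Λ.factorial * n.choose Λ := by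
    rw [← Nat.descFactorial_eq_factorial_mul_choose]
    exact Nat.pow_sub_le_descFactorial n Λ
  have h2 : 2 ^ (6 * M) ≤ n + 1 - Λ := by
    have h3 : 2 ^ (6 * M) + 2 ^ (6 * M) ≤ 2 ^ (7 * M) := by
      rw [← two_mul, ← pow_succ']
      exact Nat.pow_le_pow_right two_pos (by omega)
    have h4 : 6 * M < 2 ^ (6 * M) := Nat.lt_two_pow_self
    omega
  have h3 : Λ.factorial ≤ 2 ^ (M * Λ) := by
    calc Λ.factorial ≤ Λ ^ Λ := Nat.factorial_le_pow _
      _ ≤ (2 ^ M) ^ Λ := Nat.pow_le_pow_left (hΛM.trans Nat.lt_two_pow_self.le) _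
      _ = _ := (pow_mul _ _ _).symm
  have h4 : 2 ^ (M * Λ) * 2 ^ (5 * (M * Λ)) ≤ 2 ^ (M * Λ) * n.choose Λ := by
    calc 2 ^ (M * Λ) * 2 ^ (5 * (M * Λ)) = (2 ^ (6 * M)) ^ Λ := by
          rw [← pow_mul, ← pow_add]
          congr 1
          ring
      _ ≤ (n + 1 - Λ) ^ Λ := Nat.pow_le_pow_left h2 _
      _ ≤ _ := h1
      _ ≤ _ := Nat.mul_le_mul_right _ h3
  have h5 := Nat.le_of_mul_le_mul_left h4 (Nat.two_pow_pos _)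
  refine lt_of_lt_of_le (Nat.pow_lt_pow_right one_lt_two ?_) h5
  have : 0 < M * Λ := Nat.mul_pos (by omega) hΛ
  rw [mul_comm Λ M]
  omega

theorem two_mul_add_two_pow_le (Λ : ℕ) (hΛ : 1 ≤ Λ) :
    2 * Λ + 2 ^ (16 * Λ ^ 2) + 3 ≤ 2 ^ 2 ^ (15 * 2 ^ (70 * Λ)) := by
  have h1 : Λ < 2 ^ Λ := Nat.lt_two_pow_self
  have h2 : 16 * Λ ^ 2 + 2 ≤ 2 ^ (15 * 2 ^ (70 * Λ)) := by
    have h3 : 70 * Λ < 2 ^ (70 * Λ) := Nat.lt_two_pow_self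
    calc 16 * Λ ^ 2 + 2 ≤ 32 * (2 ^ Λ) ^ 2 := by
          have := Nat.pow_le_pow_left h1.le 2
          have := Nat.one_le_two_pow (n := Λ)
          have : 1 ≤ (2 ^ Λ) ^ 2 := Nat.one_le_pow _ _ (by omega)
          omega
      _ = 2 ^ (2 * Λ + 5) := by ring
      _ ≤ _ := Nat.pow_le_pow_right two_pos (by omega)
  have h4 : 2 ^ (16 * Λ ^ 2) * 4 ≤ 2 ^ 2 ^ (15 * 2 ^ (70 * Λ)) := by
    refine le_trans (le_of_eq ?_) (Nat.pow_le_pow_right two_pos h2)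
    ring
  have h5 : 16 * Λ ^ 2 < 2 ^ (16 * Λ ^ 2) := Nat.lt_two_pow_self
  have h6 : Λ ≤ Λ ^ 2 := Nat.le_self_pow (by norm_num) _
  omega

namespace TupleScheme

variable {S V : Type} [AddCommGroup V] {vec : S → V}

/-- Over a group of small exponent there are no schemes of large depth with nontrivial classes. -/
theorem false_of_rel [Finite V] {Λ M p : ℕ} (T : TupleScheme vec (16 * M)) (hΛ : 1 ≤ Λ)
    (hVM : Nat.card V ≤ 2 ^ (Λ * M)) (hp : 0 < p) (hpΛ : p ≤ 2 ^ Λ) (hV : ∀ z : V, p • z = 0)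
    (hM : 16 * Λ * 2 ^ 2 ^ (15 * 2 ^ (70 * Λ)) ≤ M) {s s' : S} (hne : s ≠ s')
    (hrel : T.rel (fun _ : Unit => s) fun _ => s') : False := by
  have : Finite S := Finite.of_injective vec T.inj
  obtain ⟨E, hE⟩ : ∃ E, E = 2 ^ 2 ^ (15 * 2 ^ (70 * Λ)) := ⟨_, rfl⟩
  have hE1 := two_mul_add_two_pow_le Λ hΛ
  rw [← hE] at hM hE1
  -- About M/Λ constants are needed for the definable difference. The divisor 8Λ makes K^(24u+8)
  -- smaller than the number 2^(7M) of points.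
  obtain ⟨u, hu⟩ : ∃ u, u = M / (8 * Λ) := ⟨_, rfl⟩
  have hu1 : 8 * Λ * u ≤ M := hu ▸ Nat.mul_div_le _ _
  have hu2 : M < 8 * Λ * (u + 1) := hu ▸ Nat.lt_mul_div_succ M (by omega)
  have huE : 2 * E ≤ u := by
    rw [hu, Nat.le_div_iff_mul_le (by omega)]
    linarith
  have hE4 : 4 ≤ E := by
    have := Nat.zero_le (2 ^ (16 * Λ ^ 2))
    omega
  have hΛM : Λ ≤ M := by
    refine le_trans ?_ hM
    rw [mul_comm 16, mul_assoc]
    exact Nat.le_mul_of_pos_right _ (by linarith)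
  obtain ⟨D, T', htrans, hhom, hcard⟩ := T.exists_homogeneous (hΛ.trans hΛM) hΛ le_rfl
    ((Nat.card_le_card_of_injective vec T.inj).trans hVM) hne hrel
  have hΛu : Λ ≤ Λ * u := Nat.le_mul_of_pos_right _ (by omega)
  have hlarge : T'.Large (2 ^ Λ) (3 * u) :=
    { transitive := htrans
      homogeneous := fun A hA => hhom A (hA.trans (by nlinarith))
      two_le := Nat.le_self_pow (by omega) 2
      depth := by nlinarith
      card := by
        refine lt_of_lt_of_le ?_ hcard
        rw [← pow_mul]
        refine Nat.pow_lt_pow_right one_lt_two ?_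
        nlinarith }
  -- Here g = 2^(16Λ²) and L = u, since M < 8Λ(u + 1) ≤ 16Λu gives g^u > 2^(ΛM) ≥ |V|. The Λ-element
  -- sets are numerous enough by `two_pow_lt_choose`.
  obtain ⟨e, b, b', he, hb, hbb', hmem⟩ := hlarge.exists_definable_difference
    (s := Λ) (g := 2 ^ (16 * Λ ^ 2)) (L := u) (by omega)
    (hVM.trans_lt (two_pow_lt_choose hΛ hΛM hcard)) (by
      refine hVM.trans_lt ?_
      rw [← pow_mul]
      refine Nat.pow_lt_pow_right one_lt_two ?_
      calc Λ * M < Λ * (8 * Λ * (u + 1)) := Nat.mul_lt_mul_of_pos_left hu2 hΛ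
        _ ≤ 16 * Λ ^ 2 * u := by nlinarith)
  obtain ⟨D', T'', hlarge', hdoub, -⟩ := hlarge.exists_small_doubling (t' := E) (by linarith)
    (he.trans (by omega)) hb hbb' hmem
  exact hlarge'.false_of_two_pow_le hΛ hp hpΛ hV hdoub hE.ge

/-- A scheme whose depth is twice the logarithm of the size has only trivial classes. -/
theorem false_of_rel_of_card_lt [Finite S] {m j : ℕ} (T : TupleScheme vec m) (hj : 2 * j + 2 ≤ m)
    (hS : Nat.card S < 2 ^ (j + 1)) {s s' : S} (hne : s ≠ s')
    (hrel : T.rel (fun _ : Unit => s) fun _ => s') : False := by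
  have h1 := T.two_pow_le_ncard_cls (A := ∅) j (by simpa using hj) (T.not_mem_dcl_empty hne hrel)
  have h2 := Set.ncard_le_ncard (Set.subset_univ (T.cls ∅ s)) (Set.toFinite _)
  rw [Set.ncard_univ] at h2
  omega

end TupleScheme

variable {S : Type} {G : Subgroup (Equiv.Perm S)} {m : ℕ}

theorem d_le_of_tupleRel [Finite S] (hm : 1 ≤ m)
    (h : ∀ C : Collection (stabilizerSystem G m), IsScheme C → StronglyAntisymmetric C →
      ∀ s s' : S, s ≠ s' → ¬ tupleRel C (fun _ : Unit => s) fun _ => s') : d G ≤ m := by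
  refine (d_isLeast G).2 ⟨hm, fun C hC hA x => ?_⟩
  by_contra hx
  obtain ⟨s, s', hne, hrel⟩ := exists_tupleRel_of_not_discrete hC hm x hx
  exact h C hC hA s s' hne hrel

/-- If the pointwise stabilizer of some tuple is trivial, then `d(G)` is at most twice its length,
up to a constant. -/
theorem d_le_of_base [Finite S] {κ : Type} [Finite κ] (b : κ → S)
    (hb : ∀ g : G, (∀ i, g • b i = b i) → g = 1) : d G ≤ 2 * Nat.card κ + 2 := by
  refine d_le_of_tupleRel (by omega) fun C hC hA s s' hne hrel => hne ?_
  -- Adjoin the base b to s: the relation s ~ s' extends to (s, b) ~ (s', a). Only the identity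
  -- fixes b, so nothing else is conjugate to (s', a) over (s, b), and antisymmetry gives s' = s.
  have hne' : Nat.card {a // tupleRel C (Sum.elim (fun _ : Unit => s) b)
      (Sum.elim (fun _ => s') a)} ≠ 0 := by
    rw [tupleRel_ext hC b (by rw [Nat.card_unique]; omega) hrel]
    exact (Nat.card_pos_iff.2 ⟨⟨b, Or.inl rfl⟩, inferInstance⟩).ne'
  obtain ⟨⟨⟨a, ha⟩⟩, -⟩ := Nat.card_ne_zero.1 hne'
  have h1 := tupleRel_antisymm hC hA (by rw [Nat.card_sum, Nat.card_unique]; omega) ha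
    (fun y' hy' => by
      rcases hy' with hy' | ⟨-, -, g, hg, -⟩
      · funext i
        exact (congrFun hy' (Sum.inr i)).symm
      · obtain rfl := hb g fun i => (hg (Sum.inl (Sum.inr i))).symm
        funext i
        simpa using hg (Sum.inr i))
  exact (congrFun h1 (Sum.inl ())).symm

section Linear

variable {F W : Type} [Field F] [AddCommGroup W] [Module F W] {S : Set W}
  {G : Subgroup (Equiv.Perm S)}

theorem ActsLinearly.exists_addEquiv (h : ActsLinearly F S G) (g : G) :
    ∃ φ : W ≃+ W, ∀ s : S, φ (s : W) = ((g • s : S) : W) := by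
  obtain ⟨φ, -, hφ⟩ := h
  exact ⟨(φ g).toAddEquiv, fun s => hφ g s⟩

/-- A basis of the span of S chosen inside S is a base of the permutation group. -/
theorem ActsLinearly.d_le_two_mul_finrank [Finite W] (h : ActsLinearly F S G) :
    d G ≤ 2 * Module.finrank F W + 2 := by
  have : Module.Finite F W := Module.Finite.of_finite
  obtain ⟨b, hbS, hspan, hli⟩ := exists_linearIndependent F S
  obtain ⟨φ, -, hφ⟩ := h
  have := Fintype.ofFinite b
  have hcard : Nat.card b ≤ Module.finrank F W := by
    rw [Nat.card_eq_fintype_card]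
    exact hli.fintype_card_le_finrank
  refine (d_le_of_base (fun i : b => (⟨i, hbS i.2⟩ : S)) fun g hg => ?_).trans (by omega)
  have hfix : ∀ v ∈ Submodule.span F b, φ g v = v := by
    intro v hv
    induction hv using Submodule.span_induction with
    | mem v hv =>
      rw [hφ g ⟨v, hbS hv⟩]
      exact congrArg Subtype.val (hg ⟨v, hv⟩)
    | zero => exact map_zero _
    | add v w _ _ hv hw => rw [map_add, hv, hw]
    | smul a v _ hv => rw [map_smul, hv]
  ext s
  have h1 := hfix s (hspan ▸ Submodule.subset_span s.2)
  rw [hφ] at h1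
  exact h1

theorem ActsLinearly.d_le_of_card_lt [Finite W] (h : ActsLinearly F S G) {j : ℕ}
    (hW : Nat.card W < 2 ^ (j + 1)) : d G ≤ 2 * j + 2 :=
  d_le_of_tupleRel (by omega) fun _ hC hA _ _ hne hrel =>
    (TupleScheme.ofScheme Subtype.val_injective h.exists_addEquiv hC hA).false_of_rel_of_card_lt
      le_rfl ((Finite.card_subtype_le _).trans_lt hW) hne hrel

theorem ActsLinearly.d_le_of_char [Finite W] (h : ActsLinearly F S G) {Λ M p : ℕ} (hΛ : 1 ≤ Λ)
    (hW : Nat.card W ≤ 2 ^ (Λ * M)) (hp : 0 < p) (hpΛ : p ≤ 2 ^ Λ) [CharP F p]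
    (hM : 16 * Λ * 2 ^ 2 ^ (15 * 2 ^ (70 * Λ)) ≤ M) : d G ≤ 16 * M := by
  refine d_le_of_tupleRel ?_ fun _ hC hA _ _ hne hrel =>
    (TupleScheme.ofScheme Subtype.val_injective h.exists_addEquiv hC hA).false_of_rel hΛ hW hp hpΛ
      (fun z => ?_) hM hne hrel
  · have : 0 < 16 * Λ * 2 ^ 2 ^ (15 * 2 ^ (70 * Λ)) :=
      Nat.mul_pos (by omega) (Nat.two_pow_pos _)
    omega
  · rw [← Nat.cast_smul_eq_nsmul F, CharP.cast_eq_zero, zero_smul]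

end Linear

end PScheme

/-! ### The final estimate. -/

namespace PScheme

theorem sixteen_mul_sq_mul_le (Λ : ℕ) (hΛ : 1 ≤ Λ) :
    Λ * (16 * Λ * 2 ^ 2 ^ (15 * 2 ^ (70 * Λ))) ≤ 2 ^ 2 ^ 2 ^ (74 * Λ) := by
  obtain ⟨E, hE⟩ : ∃ E, E = 2 ^ 2 ^ (15 * 2 ^ (70 * Λ)) := ⟨_, rfl⟩
  have h1 := two_mul_add_two_pow_le Λ hΛ
  have h2 : 16 * Λ ^ 2 < 2 ^ (16 * Λ ^ 2) := Nat.lt_two_pow_self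
  rw [← hE] at h1 ⊢
  calc Λ * (16 * Λ * E) = 16 * Λ ^ 2 * E := by ring
    _ ≤ E * E := Nat.mul_le_mul_right _ (by omega)
    _ = 2 ^ 2 ^ (15 * 2 ^ (70 * Λ) + 1) := by
      rw [hE, ← pow_add, ← two_mul, ← pow_succ']
    _ ≤ 2 ^ 2 ^ 2 ^ (74 * Λ) := by
      refine Nat.pow_le_pow_right two_pos (Nat.pow_le_pow_right two_pos ?_)
      have h3 := Nat.one_le_two_pow (n := 70 * Λ)
      calc 15 * 2 ^ (70 * Λ) + 1 ≤ 2 ^ 4 * 2 ^ (70 * Λ) := by omega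
        _ = 2 ^ (4 + 70 * Λ) := by rw [pow_add]
        _ ≤ _ := Nat.pow_le_pow_right two_pos (by omega)

/-- If |F| ≤ 2^Λ, the characteristic is small and the bound 16⌈N/Λ⌉ applies. Otherwise |W| ≤ 2^N
forces the dimension to be at most N/Λ, and a base suffices. -/
theorem ActsLinearly.d_mul_le {F W : Type} [Field F] [AddCommGroup W] [Module F W] [Finite F]
    [Finite W] {S : Set W} {G : Subgroup (Equiv.Perm S)} (h : ActsLinearly F S G) {N : ℝ} {Λ : ℕ}
    (hΛ : 1 ≤ Λ) (hW : (Nat.card W : ℝ) ≤ (2 : ℝ) ^ N)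
    (hN : ((2 ^ 2 ^ 2 ^ (74 * Λ) : ℕ) : ℝ) ≤ N) : (d G : ℝ) * Λ ≤ 32 * N := by
  have hΛ0 : (0 : ℝ) < Λ := by exact_mod_cast hΛ
  have hΛN : (Λ : ℝ) * (16 * Λ * 2 ^ 2 ^ (15 * 2 ^ (70 * Λ)) : ℕ) ≤ N :=
    le_trans (by exact_mod_cast sixteen_mul_sq_mul_le Λ hΛ) hN
  obtain ⟨E, hE⟩ : ∃ E, E = 16 * Λ * 2 ^ 2 ^ (15 * 2 ^ (70 * Λ)) := ⟨_, rfl⟩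
  have hE1 : 1 ≤ E := hE ▸ Nat.mul_pos (by omega) (Nat.two_pow_pos _)
  rw [← hE] at hΛN
  have hΛN' : (Λ : ℝ) ≤ N := by
    refine le_trans ?_ hΛN
    exact le_mul_of_one_le_right hΛ0.le (by exact_mod_cast hE1)
  rcases le_or_gt (Nat.card F) (2 ^ Λ) with hF | hF
  · obtain ⟨p, hp⟩ := CharP.exists F
    have := Fintype.ofFinite F
    have hprime := (CharP.char_is_prime_or_zero F p).resolve_right (CharP.char_ne_zero_of_finite F p)
    have hpF : p ≤ Nat.card F := by
      rw [Nat.card_eq_fintype_card]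
      exact Nat.le_of_dvd Fintype.card_pos
        ((CharP.cast_eq_zero_iff F p _).1 (Nat.cast_card_eq_zero F))
    have hM := Nat.le_ceil (N / Λ)
    rw [div_le_iff₀ hΛ0] at hM
    have hM' := Nat.ceil_lt_add_one (div_nonneg (hΛ0.le.trans hΛN') hΛ0.le)
    have h1 := h.d_le_of_char (M := ⌈N / Λ⌉₊) hΛ (by
      have h2 := hW.trans (Real.rpow_le_rpow_of_exponent_le one_le_two hM)
      rw [mul_comm] at h2
      exact_mod_cast h2) hprime.pos (hpF.trans hF) (by
      rw [← hE]
      have h2 : (E : ℝ) * Λ ≤ ⌈N / Λ⌉₊ * Λ := by linarith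
      exact_mod_cast le_of_mul_le_mul_right h2 hΛ0)
    have h3 : (d G : ℝ) ≤ 16 * ⌈N / Λ⌉₊ := by exact_mod_cast h1
    have h4 : (⌈N / Λ⌉₊ : ℝ) * Λ ≤ N + Λ := by
      have h5 := mul_le_mul_of_nonneg_right hM'.le hΛ0.le
      rwa [add_mul, div_mul_cancel₀ _ hΛ0.ne', one_mul] at h5
    have h6 := mul_le_mul_of_nonneg_right h3 hΛ0.le
    linarith
  · have hfin : Module.Finite F W := Module.Finite.of_finite
    have h1 : (d G : ℝ) ≤ 2 * Module.finrank F W + 2 := by exact_mod_cast h.d_le_two_mul_finrank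
    have hcard : 2 ^ (Λ * Module.finrank F W) ≤ Nat.card W := by
      rw [Module.natCard_eq_pow_finrank (K := F) (V := W), pow_mul]
      exact Nat.pow_le_pow_left hF.le _
    have h2 : (2 : ℝ) ^ ((Λ * Module.finrank F W : ℕ) : ℝ) ≤ (2 : ℝ) ^ N := by
      rw [Real.rpow_natCast]
      exact le_trans (by exact_mod_cast hcard) hW
    rw [Real.rpow_le_rpow_left_iff one_lt_two] at h2
    push_cast at h2
    have h3 := mul_le_mul_of_nonneg_right h1 hΛ0.le
    linarith

theorem ActsLinearly.d_le_three_mul {F W : Type} [Field F] [AddCommGroup W] [Module F W]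
    [Finite W] {S : Set W} {G : Subgroup (Equiv.Perm S)} (h : ActsLinearly F S G) {N : ℝ}
    (hW : (Nat.card W : ℝ) ≤ (2 : ℝ) ^ N) (hN : 4 < N) : (d G : ℝ) ≤ 3 * N := by
  have h1 := h.d_le_of_card_lt (j := ⌊N⌋₊) (by
    have h2 : (2 : ℝ) ^ N < (2 : ℝ) ^ ((⌊N⌋₊ : ℝ) + 1) :=
      Real.rpow_lt_rpow_of_exponent_lt one_lt_two (Nat.lt_floor_add_one N)
    have h3 := hW.trans_lt h2
    exact_mod_cast h3)
  have h2 : (d G : ℝ) ≤ 2 * ⌊N⌋₊ + 2 := by exact_mod_cast h1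
  have h3 := Nat.floor_le (show 0 ≤ N by linarith)
  linarith

end PScheme

theorem theorem3 :
    ∃ c : ℝ, 0 < c ∧ ∀ m q : ℕ, 1 ≤ m → IsPrimePow q → 4 < (m : ℝ) * Real.logb 2 (q : ℝ) →
      (PScheme.dLin m q : ℝ) ≤
        c * ((m : ℝ) * Real.logb 2 (q : ℝ) /
          (Real.logb 2 (Real.logb 2 (Real.logb 2 ((m : ℝ) * Real.logb 2 (q : ℝ))))) ^
            ((1 : ℝ) / 3)) := by
  -- 4736 = 2·74·32: the factor 32 comes from `d_mul_le`, 74 from the size of the triple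
  -- exponential, and 2 from Λ + 1 ≤ 2Λ.
  refine ⟨4736, by norm_num, fun m q hm hq hN => ?_⟩
  obtain ⟨⟨m', F, _, _, -, -, hcard, -, S, G, hG, hd⟩, -⟩ := PScheme.dLin_isGreatest hm hq
  rw [hd]
  have hq0 : (0 : ℝ) < q := by exact_mod_cast hq.pos
  have hW : (Nat.card (Fin m' → F) : ℝ) ≤ (2 : ℝ) ^ ((m : ℝ) * Real.logb 2 (q : ℝ)) := by
    rw [mul_comm, Real.rpow_mul zero_le_two, Real.rpow_logb two_pos (by norm_num) hq0,
      Real.rpow_natCast]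
    have h1 : Nat.card (Fin m' → F) = Nat.card F ^ m' := by simp [Nat.card_fun]
    rw [h1]
    exact_mod_cast hcard
  obtain ⟨N, hN'⟩ : ∃ N, N = (m : ℝ) * Real.logb 2 (q : ℝ) := ⟨_, rfl⟩
  rw [← hN'] at hN hW ⊢
  have hN1 : 2 < Real.logb 2 N := by
    rw [Real.lt_logb_iff_rpow_lt one_lt_two (by linarith)]
    norm_num
    exact hN
  have hN2 : 1 < Real.logb 2 (Real.logb 2 N) := by
    rw [Real.lt_logb_iff_rpow_lt one_lt_two (by linarith)]
    norm_num
    exact hN1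
  obtain ⟨w, hw⟩ : ∃ w, w = Real.logb 2 (Real.logb 2 (Real.logb 2 N)) := ⟨_, rfl⟩
  have hw0 : 0 < w := hw ▸ Real.logb_pos one_lt_two hN2
  rw [← hw]
  have hr : 0 < w ^ ((1 : ℝ) / 3) := Real.rpow_pos_of_pos hw0 _
  rw [← mul_div_assoc, le_div_iff₀ hr]
  have h74 : (74 : ℝ) ^ ((1 : ℝ) / 3) ≤ 74 := by
    calc (74 : ℝ) ^ ((1 : ℝ) / 3) ≤ (74 : ℝ) ^ (1 : ℝ) :=
          Real.rpow_le_rpow_of_exponent_le (by norm_num) (by norm_num)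
      _ = 74 := Real.rpow_one _
  have h74' : 0 < (74 : ℝ) ^ ((1 : ℝ) / 3) := by positivity
  -- Any Λ with 74Λ ≤ w is admissible. The cube root is smaller than necessary, but it is all that
  -- the stated bound asks for.
  obtain ⟨Λ, hΛ⟩ : ∃ Λ, Λ = ⌊(w / 74) ^ ((1 : ℝ) / 3)⌋₊ := ⟨_, rfl⟩
  have hpos : 0 ≤ (w / 74) ^ ((1 : ℝ) / 3) := by positivity
  have hlt : w ^ ((1 : ℝ) / 3) ≤ (Λ + 1) * 74 := by
    have h1 := (Nat.lt_floor_add_one ((w / 74) ^ ((1 : ℝ) / 3))).le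
    rw [← hΛ, Real.div_rpow hw0.le (by norm_num), div_le_iff₀ h74'] at h1
    exact h1.trans (mul_le_mul_of_nonneg_left h74 (by positivity))
  have hd0 : (0 : ℝ) ≤ PScheme.d G := Nat.cast_nonneg _
  have hdr := mul_le_mul_of_nonneg_left hlt hd0
  rcases Nat.eq_zero_or_pos Λ with h0 | h0
  -- If Λ = 0, then w is bounded, and the bound O(N) coming from the doubling of classes suffices.
  · have h1 := hG.d_le_three_mul hW hN
    rw [h0, Nat.cast_zero] at hdr
    linarith
  · have hfl : (Λ : ℝ) ≤ (w / 74) ^ ((1 : ℝ) / 3) := hΛ ▸ Nat.floor_le hpos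
    have hcube : (Λ : ℝ) ^ 3 ≤ w / 74 := by
      refine (pow_le_pow_left₀ (Nat.cast_nonneg _) hfl 3).trans (le_of_eq ?_)
      rw [← Real.rpow_natCast, ← Real.rpow_mul (by positivity)]
      norm_num
    have hΛ1 : (1 : ℝ) ≤ Λ := by exact_mod_cast h0
    have h74w : 74 * (Λ : ℝ) ≤ w := by
      have : (Λ : ℝ) ≤ (Λ : ℝ) ^ 3 := le_self_pow₀ hΛ1 (by norm_num)
      linarith
    have hbig : ((2 ^ 2 ^ 2 ^ (74 * Λ) : ℕ) : ℝ) ≤ N := by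
      rw [hw, Real.le_logb_iff_rpow_le one_lt_two (by linarith),
        Real.le_logb_iff_rpow_le one_lt_two (by linarith),
        Real.le_logb_iff_rpow_le one_lt_two (by linarith)] at h74w
      exact_mod_cast h74w
    have h1 := hG.d_mul_le h0 hW hbig
    have h2 : ((PScheme.d G : ℝ)) ≤ PScheme.d G * Λ := le_mul_of_one_le_right hd0 hΛ1
    linarith
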